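/- Let $b\in\mathbb R$, $\kappa>0$, $k>0$, $c_0=\kappa/(1+k^2)$. Consider the $b$-KP-I equation $$\big[(1-\partial_x^2)u_t+(b+1)uu_x+\kappa u_x-bu_xu_{xx}-uu_{xxx}\big]_x-u_{yy}=0$$ and its small $2\pi/k$-periodic line travelling waves $u=w(k(x-ct))$ with zero integration constants: $w$ is a smooth, real, even, $2\pi$-periodic function of $z$ with $$(\kappa-c)w+ck^2w''+\tfrac{b+1}{2}w^2-k^2ww''-\tfrac{b-1}{2}k^2(w')^2=0 .$$ The amplitude $a=\frac1\pi\int_0^{2\pi}w(z)\cos z\,dz$ is the coefficient of $\cos z$ in $w$. For $\ell\in\mathbb R$ let $$\mathcal A_a(\ell)=\partial_z\Big[c-(1-k^2\partial_z^2)^{-1}\big(\kappa+(b+1)w-k^2w_{zz}-k^2(b-1)w_z\partial_z-k^2w\,\partial_z^2+\ell^2\partial_z^{-2}\big)\Big],$$ the operator of the linearization at $w$ for co-periodic perturbations with transverse wave number $\ell$, as an unbounded operator in $L^2_0(\mathbb T)$ (complex $2\pi$-periodic $L^2$ functions of mean zero) with domain $H^1(\mathbb T)\cap L^2_0(\mathbb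 T)$. Put $$\ell_a^2=\big[(b+1)+(7-2b)k^2\big]\frac{(b+1)(1+k^2)^2}{12\,\kappa k^2}\,a^2,$$ a real number of either sign. **Theorem.** There are $\varepsilon>0$ and $C>0$, depending only on $b,\kappa,k$, such that the following holds for every such wave $(w,c)$ with $|c-c_0|<\varepsilon$, $|w|,|w'|,|w''|<\varepsilon$ on $\mathbb R$, and $|a|<\varepsilon$. 1. If $\ell_a^2>0$, there is a number $\ell_*^2>0$, independent of $\ell$, with $|\ell_*^2-\ell_a^2|\le Ca^4$, such that for all $|\ell|<\varepsilon$: (i) if $\ell^2>\ell_*^2$, the spectrum of $\mathcal A_a(\ell)$ is purely imaginary; (ii) if $0<\ell^2<\ell_*^2$, the spectrum of $\mathcal A_a(\ell)$ is purely imaginary except for a pair of simple real eigenvalues $\pm\mu$, $\mu>0$. 2. If $\ell_a^2<0$, the spectrum of $\mathcal A_a(\ell)$ is purely imaginary for all $|\ell|<\varepsilon$. -/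

import Mathlib

open MeasureTheory AddCircle

namespace BKP

noncomputable section

instance factTwoPiPos : Fact (0 < 2 * Real.pi) := ⟨Real.two_pi_pos⟩

/-- The circle `ℝ / 2πℤ`. -/
abbrev Torus : Type := AddCircle (2 * Real.pi)

/-- `L²(𝕋)`, complex valued, with the normalised measure `dz / 2π`. -/
abbrev L2 : Type := Lp ℂ 2 (haarAddCircle : Measure Torus)

/-- The `n`-th Fourier coefficient `(2π)⁻¹ ∫ f(z) e^{-inz} dz`, as a linear functional. -/
def coeff (n : ℤ) : L2 →ₗ[ℂ] ℂ where
  toFun f := fourierCoeff f n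
  map_add' f g := by
    rw [← fourierBasis_repr, ← fourierBasis_repr, ← fourierBasis_repr, map_add]; rfl
  map_smul' t f := by
    rw [← fourierBasis_repr, ← fourierBasis_repr, map_smul]; rfl

theorem memlp_coeff (f : L2) : Memℓp (fun n => coeff n f) 2 := by
  have h : (fun n => coeff n f) = fourierBasis.repr f := by
    funext n
    exact (fourierBasis_repr f n).symm
  rw [h]
  exact lp.memℓp _

theorem ext_coeff {f g : L2} (h : ∀ n, coeff n f = coeff n g) : f = g := by
  apply fourierBasis.repr.injective
  ext n
  rw [fourierBasis_repr, fourierBasis_repr]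
  exact h n

/-- The element of `L²(𝕋)` with a prescribed square summable sequence of Fourier coefficients. -/
def ofCoeff (u : ℤ → ℂ) (hu : Memℓp u 2) : L2 := fourierBasis.repr.symm ⟨u, hu⟩

theorem coeff_ofCoeff (u : ℤ → ℂ) (hu : Memℓp u 2) (n : ℤ) : coeff n (ofCoeff u hu) = u n := by
  change fourierCoeff (ofCoeff u hu) n = u n
  rw [← fourierBasis_repr]
  simp [ofCoeff]

/-- The subspace `L²₀(𝕋)` of functions of mean zero. -/
def L20 : Submodule ℂ L2 where
  carrier := {f | ∫ z : Torus, f z ∂haarAddCircle = 0}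
  zero_mem' := by
    have h : (fun z : Torus => (0 : L2) z) =ᵐ[haarAddCircle] fun _ => (0 : ℂ) := Lp.coeFn_zero _ _ _
    exact (integral_congr_ae h).trans (by simp)
  add_mem' := by
    intro f g hf hg
    have hf' : Integrable f haarAddCircle := (Lp.memLp f).integrable (by norm_num)
    have hg' : Integrable g haarAddCircle := (Lp.memLp g).integrable (by norm_num)
    have h : ∫ z : Torus, (f + g) z ∂haarAddCircle
        = ∫ z : Torus, f z ∂haarAddCircle + ∫ z : Torus, g z ∂haarAddCircle := by
      rw [← integral_add hf' hg']
      exact integral_congr_ae (Lp.coeFn_add f g)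
    simp only [Set.mem_ofPred_eq] at hf hg ⊢
    rw [h, hf, hg, add_zero]
  smul_mem' := by
    intro t f hf
    have h : ∫ z : Torus, (t • f) z ∂haarAddCircle = t * ∫ z : Torus, f z ∂haarAddCircle := by
      rw [← integral_const_mul]
      exact integral_congr_ae (Lp.coeFn_smul t f)
    simp only [Set.mem_ofPred_eq] at hf ⊢
    rw [h, hf, mul_zero]

theorem mem_L20_iff (f : L2) : f ∈ L20 ↔ coeff 0 f = 0 := by
  change (∫ z : Torus, f z ∂haarAddCircle = 0) ↔ fourierCoeff f 0 = 0
  simp [fourierCoeff]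

theorem memlp_mul {m u : ℤ → ℂ} (hm : Memℓp m ⊤) (hu : Memℓp u 2) :
    Memℓp (fun n => m n * u n) 2 := by
  obtain ⟨C, hC⟩ := memℓp_infty_iff.1 hm
  have hC' : ∀ n, ‖m n‖ ≤ C := fun n => hC ⟨n, rfl⟩
  have h2 : (0 : ℝ) < (2 : ENNReal).toReal := by norm_num
  refine (memℓp_gen_iff h2).2 ?_
  refine Summable.of_nonneg_of_le (fun n => by positivity) (fun n => ?_)
    (((memℓp_gen_iff h2).1 hu).mul_left (C ^ (2 : ENNReal).toReal))
  rw [norm_mul, Real.mul_rpow (norm_nonneg _) (norm_nonneg _)]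
  gcongr
  exact hC' n

/-- The Fourier multiplier with bounded symbol `m`. -/
def multiplier (m : ℤ → ℂ) (hm : Memℓp m ⊤) : L2 →ₗ[ℂ] L2 where
  toFun f := ofCoeff (fun n => m n * coeff n f) (memlp_mul hm (memlp_coeff f))
  map_add' f g := ext_coeff fun n => by
    simp only [map_add, coeff_ofCoeff]; ring
  map_smul' t f := ext_coeff fun n => by
    simp only [map_smul, coeff_ofCoeff, smul_eq_mul, RingHom.id_apply]; ring

theorem coeff_multiplier (m : ℤ → ℂ) (hm : Memℓp m ⊤) (f : L2) (n : ℤ) :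
    coeff n (multiplier m hm f) = m n * coeff n f := coeff_ofCoeff _ _ n

/-- The Sobolev space `H¹(𝕋)`: the sequence `n f̂(n)` is square summable. -/
def H1 : Submodule ℂ L2 where
  carrier := {f | Memℓp (fun n : ℤ => (Complex.I * n) * coeff n f) 2}
  zero_mem' := by
    simpa using (zero_mem_ℓp' : Memℓp (fun _ : ℤ => (0 : ℂ)) 2)
  add_mem' := by
    intro f g hf hg
    have h := hf.add hg
    refine (congrArg (fun u => Memℓp u 2) ?_).mp h
    funext n
    simp only [Pi.add_apply, map_add, mul_add]
  smul_mem' := by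
    intro t f hf
    have h := hf.const_mul t
    refine (congrArg (fun u => Memℓp u 2) ?_).mp h
    funext n
    simp only [map_smul, smul_eq_mul]
    ring

theorem memlp_of_H1 (f : H1) : Memℓp (fun n : ℤ => (Complex.I * n) * coeff n f.1) 2 := f.2

/-- The weak derivative `∂_z : H¹(𝕋) → L²(𝕋)`. -/
def weakDeriv : H1 →ₗ[ℂ] L2 where
  toFun f := ofCoeff (fun n => (Complex.I * n) * coeff n f.1) (memlp_of_H1 f)
  map_add' f g := ext_coeff fun n => by
    rw [map_add, coeff_ofCoeff, coeff_ofCoeff, coeff_ofCoeff, Submodule.coe_add, map_add]; ring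
  map_smul' t f := ext_coeff fun n => by
    rw [map_smul, coeff_ofCoeff, coeff_ofCoeff, Submodule.coe_smul, map_smul, smul_eq_mul,
      RingHom.id_apply, smul_eq_mul]
    ring

theorem coeff_weakDeriv (f : H1) (n : ℤ) :
    coeff n (weakDeriv f) = (Complex.I * n) * coeff n f.1 := coeff_ofCoeff _ _ n

theorem memLp_mul (φ : C(Torus, ℂ)) (f : L2) :
    MemLp (fun z => φ z * f z) 2 (haarAddCircle : Measure Torus) := by
  have hφ : MemLp φ ⊤ (haarAddCircle : Measure Torus) :=
    memLp_top_of_bound φ.continuous.aestronglyMeasurable ‖φ‖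
      (Filter.Eventually.of_forall fun z => φ.norm_coe_le_norm z)
  exact (Lp.memLp f).mul hφ

/-- Multiplication by a continuous function, as an operator on `L²(𝕋)`. -/
def mulOp (φ : C(Torus, ℂ)) : L2 →ₗ[ℂ] L2 where
  toFun f := (memLp_mul φ f).toLp (fun z => φ z * f z)
  map_add' f g := by
    rw [← MemLp.toLp_add, MemLp.toLp_eq_toLp_iff]
    filter_upwards [Lp.coeFn_add f g] with z hz
    simp only [hz, Pi.add_apply, mul_add]
  map_smul' t f := by
    rw [RingHom.id_apply, ← MemLp.toLp_const_smul, MemLp.toLp_eq_toLp_iff]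
    filter_upwards [Lp.coeFn_smul t f] with z hz
    simp only [hz, Pi.smul_apply, smul_eq_mul]
    ring

/-- A smooth, real, `2π`-periodic function of `z`. -/
structure Profile where
  toFun : ℝ → ℝ
  smooth : ContDiff ℝ (⊤ : ℕ∞) toFun
  periodic : Function.Periodic toFun (2 * Real.pi)

instance : CoeFun Profile fun _ => ℝ → ℝ := ⟨Profile.toFun⟩

/-- The derivative `w_z`. -/
def Profile.dz (w : Profile) : Profile where
  toFun := deriv w
  smooth := (contDiff_infty_iff_deriv.1 w.smooth).2
  periodic := fun z => by
    have h : (fun x => w (x + 2 * Real.pi)) = w := funext w.periodic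
    rw [← deriv_comp_add_const, h]

/-- A profile as a continuous complex valued function on the circle. -/
def Profile.onTorus (w : Profile) : C(Torus, ℂ) where
  toFun x := ((w.periodic.lift x : ℝ) : ℂ)
  continuous_toFun := Complex.continuous_ofReal.comp
    (w.smooth.continuous.quotient_liftOn' _)

/-- `(w, c)` is a travelling wave profile with wave number `k` and zero integration constants: `w` is
even and solves
`(κ - c) w + c k² w'' + (b+1)/2 w² - k² w w'' - (b-1)/2 k² (w')² = 0`. -/
structure IsWave (b κ k c : ℝ) (w : Profile) : Prop where
  even : Function.Even w
  profile_eq : ∀ z, (κ - c) * w z + c * k ^ 2 * w.dz.dz z + (b + 1) / 2 * w z ^ 2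
    - k ^ 2 * w z * w.dz.dz z - (b - 1) / 2 * k ^ 2 * w.dz z ^ 2 = 0

/-- The amplitude of a profile: its first cosine coefficient, `w = a cos z + (other harmonics)`. -/
def Profile.amplitude (w : Profile) : ℝ :=
  1 / Real.pi * ∫ z in (0 : ℝ)..(2 * Real.pi), w z * Real.cos z

/-- `(w, c)` lies in the `ε`-neighbourhood of the bifurcation point `(0, c₀)`, `c₀ = κ / (1 + k²)`,
with respect to the `C²` norm of `w`. -/
def NearBifurcation (ε κ k c : ℝ) (w : Profile) : Prop :=
  |c - κ / (1 + k ^ 2)| < ε ∧ ∀ z, |w z| < ε ∧ |w.dz z| < ε ∧ |w.dz.dz z| < ε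

theorem memlp_symbol {k : ℝ} (hk : 0 < k) {m : ℤ → ℂ} (hm : ∀ n, ‖m n‖ ≤ (n : ℝ) ^ 2) :
    Memℓp (fun n : ℤ => m n / (1 + (k : ℂ) ^ 2 * (n : ℂ) ^ 2)) ⊤ := by
  refine memℓp_infty ⟨1 / k ^ 2, ?_⟩
  rintro _ ⟨n, rfl⟩
  have h : (1 + (k : ℂ) ^ 2 * (n : ℂ) ^ 2) = ((1 + k ^ 2 * (n : ℝ) ^ 2 : ℝ) : ℂ) := by
    push_cast; ring
  have hp : (0 : ℝ) < 1 + k ^ 2 * (n : ℝ) ^ 2 := by positivity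
  change ‖m n / (1 + (k : ℂ) ^ 2 * (n : ℂ) ^ 2)‖ ≤ 1 / k ^ 2
  rw [h, norm_div, Complex.norm_real, Real.norm_of_nonneg hp.le, div_le_div_iff₀ hp (by positivity)]
  nlinarith [hm n, mul_le_mul_of_nonneg_right (hm n) (sq_nonneg k)]

/-- `∂_z (1 - k² ∂_z²)⁻¹` on `L²(𝕋)`. -/
def opJ {k : ℝ} (hk : 0 < k) : L2 →ₗ[ℂ] L2 :=
  multiplier (fun n => (Complex.I * n) / (1 + (k : ℂ) ^ 2 * (n : ℂ) ^ 2)) (memlp_symbol hk fun n => by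
    rw [norm_mul, Complex.norm_I, one_mul, Complex.norm_intCast]
    have h : |n| ≤ n ^ 2 := by
      rw [← sq_abs]
      nlinarith [abs_nonneg n, Int.le_self_sq |n|]
    exact_mod_cast h)

/-- `∂_z (1 - k² ∂_z²)⁻¹ ∂_z` on `L²(𝕋)`, the bounded extension of `V ↦ opJ (∂_z V)`. -/
def opJd {k : ℝ} (hk : 0 < k) : L2 →ₗ[ℂ] L2 :=
  multiplier (fun n => (Complex.I * n) ^ 2 / (1 + (k : ℂ) ^ 2 * (n : ℂ) ^ 2)) (memlp_symbol hk fun n => by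
    rw [norm_pow, norm_mul, Complex.norm_I, one_mul, Complex.norm_intCast, sq_abs])

/-- `∂_z⁻²` on functions of mean zero: the symbol is `(in)⁻²` for `n ≠ 0` (and `0` for `n = 0`). -/
def opInvD2 : L2 →ₗ[ℂ] L2 :=
  multiplier (fun n => ((Complex.I * n) ^ 2)⁻¹) (memℓp_infty ⟨1, by
    rintro _ ⟨n, rfl⟩
    change ‖((Complex.I * (n : ℂ)) ^ 2)⁻¹‖ ≤ 1
    rw [norm_inv, norm_pow, norm_mul, Complex.norm_I, one_mul, Complex.norm_intCast, sq_abs]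
    rcases eq_or_ne n 0 with rfl | hn
    · simp
    · have h : (1 : ℤ) ≤ n ^ 2 := Int.add_one_le_iff.2 (sq_pos_of_ne_zero hn)
      exact inv_le_one_of_one_le₀ (by exact_mod_cast h)⟩)

/-- The value of
`𝒜 V = ∂_z [c V - (1-k²∂_z²)⁻¹ (κ + (b+1) w - k² w_zz - k² (b-1) w_z ∂_z - k² w ∂_z² - σℓ² ∂_z⁻²) V]`
for `V ∈ H¹(𝕋)`. There `w V_zz` is an element of `H⁻¹(𝕋)`, namely `w V_zz = (w V_z)_z - w_z V_z`, so that
`- k² (b-1) w_z V_z - k² w V_zz = - k² (b-2) w_z V_z - k² (w V_z)_z`. -/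
def opFun {k : ℝ} (hk : 0 < k) (b κ σ ℓ c : ℝ) (w : Profile) : H1 →ₗ[ℂ] L2 :=
  (c : ℂ) • weakDeriv
    - opJ hk ∘ₗ
      ((κ : ℂ) • H1.subtype
        + ((b + 1 : ℝ) : ℂ) • (mulOp w.onTorus ∘ₗ H1.subtype)
        - ((k ^ 2 : ℝ) : ℂ) • (mulOp w.dz.dz.onTorus ∘ₗ H1.subtype)
        - ((k ^ 2 * (b - 2) : ℝ) : ℂ) • (mulOp w.dz.onTorus ∘ₗ weakDeriv)
        - ((σ * ℓ ^ 2 : ℝ) : ℂ) • (opInvD2 ∘ₗ H1.subtype))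
    + ((k ^ 2 : ℝ) : ℂ) • (opJd hk ∘ₗ mulOp w.onTorus ∘ₗ weakDeriv)

theorem opFun_mem {k : ℝ} (hk : 0 < k) (b κ σ ℓ c : ℝ) (w : Profile) (V : H1) :
    opFun hk b κ σ ℓ c w V ∈ L20 := by
  rw [mem_L20_iff]
  simp only [opFun, opJ, opJd, LinearMap.add_apply, LinearMap.sub_apply, LinearMap.smul_apply,
    LinearMap.comp_apply, map_add, map_sub, map_smul, coeff_multiplier, coeff_weakDeriv]
  simp

/-- The linearised operator `𝒜(ℓ)` as an unbounded operator in `L²₀(𝕋)` with domain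
`H¹(𝕋) ∩ L²₀(𝕋)`. -/
def opA {k : ℝ} (hk : 0 < k) (b κ σ ℓ c : ℝ) (w : Profile) : L20 →ₗ.[ℂ] L20 where
  domain := H1.comap L20.subtype
  toFun :=
    { toFun := fun V => ⟨opFun hk b κ σ ℓ c w ⟨V.1.1, V.2⟩, opFun_mem hk b κ σ ℓ c w _⟩
      map_add' := fun U V => Subtype.ext
        ((opFun hk b κ σ ℓ c w).map_add ⟨U.1.1, U.2⟩ ⟨V.1.1, V.2⟩)
      map_smul' := fun t V => Subtype.ext
        ((opFun hk b κ σ ℓ c w).map_smul t ⟨V.1.1, V.2⟩) }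

/-- `μ` is in the resolvent set of the unbounded operator `A`: `A - μ` maps the domain of `A`
bijectively onto the space, with bounded inverse `R`. -/
def InResolventSet {E : Type*} [NormedAddCommGroup E] [NormedSpace ℂ E] (A : E →ₗ.[ℂ] E)
    (μ : ℂ) : Prop :=
  ∃ R : E →L[ℂ] E, (∀ f : E, ∃ u : A.domain, (u : E) = R f ∧ A u - μ • (u : E) = f) ∧
    ∀ u : A.domain, R (A u - μ • (u : E)) = u

/-- The spectrum of an unbounded operator. -/
def unboundedSpectrum {E : Type*} [NormedAddCommGroup E] [NormedSpace ℂ E] (A : E →ₗ.[ℂ] E) :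
    Set ℂ := {μ | ¬ InResolventSet A μ}

/-- `μ` is a simple eigenvalue of `A`: the eigenspace is spanned by one nonzero vector `v`, and `v` is
not in the range of `A - μ` (there is no generalised eigenvector). -/
def IsSimpleEigenvalue {E : Type*} [NormedAddCommGroup E] [NormedSpace ℂ E] (A : E →ₗ.[ℂ] E)
    (μ : ℂ) : Prop :=
  ∃ v : A.domain, v ≠ 0 ∧ (∀ u : A.domain, A u = μ • (u : E) ↔ ∃ t : ℂ, u = t • v) ∧
    ∀ u : A.domain, A u - μ • (u : E) ≠ v

/-- `ℓ_a² = [(b+1) + (7-2b) k²] (b+1) (1+k²)² a² / (12 κ k²)` (a real number of either sign). -/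
def ellASq (b κ k a : ℝ) : ℝ :=
  ((b + 1) + (7 - 2 * b) * k ^ 2) * ((b + 1) * (1 + k ^ 2) ^ 2 / (12 * κ * k ^ 2)) * a ^ 2

end

end BKP

namespace BKP

noncomputable section

/-! ### `L²(𝕋)` through Fourier coefficients -/

/-! Writing V = ∂_z⁻¹f turns the eigenvalue problem 𝒜V = zV on mean-zero functions into a pencil A f
= z ∂_z⁻¹f with A bounded (`opFun_eq_opHat`). Modulo compact terms the pencil is multiplication by c
− w, which has no zeros for a small wave, so every point of the spectrum is an eigenvalue
(`inResolventSet_of_injective`).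

At the bifurcation point and ℓ = 0 the pencil is diagonal. Its eigenvalues are i n θ_n with θ_n =
κ/(1+k²) − κ/(1+k²n²); they are separated by θ_2, except that n = 1 and n = −1 share the eigenvalue
0. Since w is real and even, conjugating Fourier coefficients carries an eigenvector for z to one
for −z̄. An eigenvalue that stays simple and isolated is therefore imaginary. The complex plane is
covered by three regions.

Bounded z away from 0 (`re_eq_zero_of_bounded`): at most one mode is nearly resonant, and comparing
the eigenvector with its conjugate forces z + z̄ = 0.

Large z (`re_eq_zero_of_large`): the term w∂_z moves the n-th frequency by an amount growing with n,
so the spectral gap alone is of no use. The transport part is conjugated by exp(−inφ), where φ' is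
proportional to 1/(c − w). The other terms are smoothing and small for large |z|, and the
conjugation argument applies again (`re_eq_zero_of_transport`).

Small z: this is where instability can arise. Translation invariance gives an even kernel vector ψ =
−w_zz/a at ℓ = 0. The operator A preserves parity and ∂_z⁻¹ reverses it, so an eigenvector can be
written f = F + (z/λ)(ψ + λρ) with F odd, ρ even, λ = ℓ² and z² = νλ. The pair (F, ρ) and the number
ν solve a rescaled system (`ScaledSol`) that is regular as λ → 0. It has exactly one solution
(`exists_scaledSol`, `ScaledSol.unique`), and by the conjugation symmetry ν is real
(`ScaledSol.conj_eq`). Hence z² is real, and the small eigenvalues form an imaginary pair or a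
simple real pair according to the sign of ν. That sign changes at the value λ* of λ at which A also
has an odd kernel vector (`exists_threshold`): ν is close to −n₁x(λ − λ*), with n₁ = 1/(1+k²) and x
close to n₁ (`ScaledSol.compare`, `ScaledSol.sign`).

To locate λ*, the even kernel vector at ℓ = 0 is combined with i times the odd one at λ*. The result
is a perturbation of e^{−iz}, and its equation in mode 1 contains neither the speed correction c −
c₀ nor a contribution linear in a. What is left couples mode −1 to mode 1 through the second
harmonic of w, which is itself read off from mode 2 of the equation for ψ. Two matrix elements then
give λ* = ℓ_a² + O(a⁴) (`WaveExpansion.threshold_location`, `threshold_sub_ellASq`). All of this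
needs only w = a cos z + O(a²) in C² and c − c₀ = O(a²) (`wave_estimates`). For small a the number
λ* has the sign of ℓ_a², whence the two cases. -/

theorem hasSum_norm_sq (f : L2) : HasSum (fun n : ℤ => ‖coeff n f‖ ^ 2) (‖f‖ ^ 2) := by
  have h := lp.hasSum_norm (p := 2) (by norm_num) (fourierBasis.repr f)
  simp only [LinearIsometryEquiv.norm_map] at h
  have h2 : ((2 : ENNReal).toReal) = ((2 : ℕ) : ℝ) := by norm_num
  simp only [h2, Real.rpow_natCast] at h
  refine h.congr_fun ?_ |> fun h => h
  intro n
  rw [fourierBasis_repr]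
  rfl

/-- By Parseval, a modewise bound is an operator bound. The estimates for multipliers and for their
inverses off resonance all pass through here. -/
theorem norm_le_of_coeff {f g : L2} {C : ℝ} (hC : 0 ≤ C)
    (h : ∀ n, ‖coeff n g‖ ≤ C * ‖coeff n f‖) : ‖g‖ ≤ C * ‖f‖ := by
  have h1 := hasSum_norm_sq g
  have h2 := (hasSum_norm_sq f).mul_left (C ^ 2)
  have h3 : ‖g‖ ^ 2 ≤ C ^ 2 * ‖f‖ ^ 2 := by
    refine hasSum_le (fun n => ?_) h1 h2
    rw [← mul_pow]
    exact pow_le_pow_left₀ (norm_nonneg _) (h n) 2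
  rw [← mul_pow] at h3
  exact le_of_sq_le_sq h3 (by positivity)

theorem norm_coeff_le (n : ℤ) (f : L2) : ‖coeff n f‖ ≤ ‖f‖ := by
  have h := le_hasSum (hasSum_norm_sq f) n (fun m _ => by positivity)
  exact le_of_sq_le_sq h (norm_nonneg _)

/-- The Fourier coefficient as a continuous functional. -/
def coeffL (n : ℤ) : L2 →L[ℂ] ℂ :=
  (coeff n).mkContinuous 1 fun f => by simpa using norm_coeff_le n f

@[simp] theorem coeffL_apply (n : ℤ) (f : L2) : coeffL n f = coeff n f := rfl

/-- The Fourier multiplier with symbol `m`, `‖m n‖ ≤ C`, as a bounded operator. -/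
def mult (m : ℤ → ℂ) (C : ℝ) (h : ∀ n, ‖m n‖ ≤ C) : L2 →L[ℂ] L2 :=
  (multiplier m (memℓp_infty ⟨C, by rintro _ ⟨n, rfl⟩; exact h n⟩)).mkContinuous C fun f =>
    norm_le_of_coeff ((norm_nonneg _).trans (h 0)) fun n => by
      rw [coeff_multiplier, norm_mul]
      exact mul_le_mul_of_nonneg_right (h n) (norm_nonneg _)

theorem coeff_mult (m : ℤ → ℂ) (C : ℝ) (h : ∀ n, ‖m n‖ ≤ C) (f : L2) (n : ℤ) :
    coeff n (mult m C h f) = m n * coeff n f :=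
  coeff_multiplier m (memℓp_infty ⟨C, by rintro _ ⟨n, rfl⟩; exact h n⟩) f n

theorem norm_mult_le (m : ℤ → ℂ) (C : ℝ) (h : ∀ n, ‖m n‖ ≤ C) (f : L2) :
    ‖mult m C h f‖ ≤ C * ‖f‖ :=
  norm_le_of_coeff ((norm_nonneg _).trans (h 0)) fun n => by
    rw [coeff_mult, norm_mul]
    exact mul_le_mul_of_nonneg_right (h n) (norm_nonneg _)

/-- The exponential `e^{imz}` in `L²(𝕋)`. -/
def expL2 (m : ℤ) : L2 := fourierLp 2 m

theorem coeff_expL2 (n m : ℤ) : coeff n (expL2 m) = if n = m then 1 else 0 := by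
  change fourierCoeff (fourierLp (T := 2 * Real.pi) 2 m) n = _
  rw [fourierCoeff_congr_ae (coeFn_fourierLp 2 m), fourierCoeff_fourier, Pi.single_apply]

theorem norm_expL2 (m : ℤ) : ‖expL2 m‖ = 1 := orthonormal_fourier.1 m

/-- Exponentials span a dense subspace, so identities between bounded operators reduce to their
matrix elements. -/
theorem clm_ext_exp {F : Type*} [NormedAddCommGroup F] [NormedSpace ℂ F] {A B : L2 →L[ℂ] F}
    (h : ∀ m, A (expL2 m) = B (expL2 m)) : A = B := by
  have hd : Dense (Submodule.span ℂ (Set.range (fourierLp (T := 2 * Real.pi) 2)) : Set L2) := by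
    rw [Submodule.dense_iff_topologicalClosure_eq_top]
    exact span_fourierLp_closure_eq_top (by norm_num)
  refine ContinuousLinearMap.ext_on hd ?_
  rintro _ ⟨m, rfl⟩
  exact h m

/-! ### Multiplication by continuous functions -/

theorem norm_mulOp_le (φ : C(Torus, ℂ)) (f : L2) : ‖mulOp φ f‖ ≤ ‖φ‖ * ‖f‖ := by
  refine Lp.norm_le_mul_norm_of_ae_le_mul ?_
  have h : mulOp φ f =ᵐ[haarAddCircle] fun z => φ z * f z := (memLp_mul φ f).coeFn_toLp
  filter_upwards [h] with z hz
  rw [hz, norm_mul]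
  exact mul_le_mul_of_nonneg_right (φ.norm_coe_le_norm z) (norm_nonneg _)

theorem coeFn_mulOp (φ : C(Torus, ℂ)) (f : L2) :
    mulOp φ f =ᵐ[haarAddCircle] fun z => φ z * f z := (memLp_mul φ f).coeFn_toLp

/-- Multiplication by a continuous function, as a bounded operator. -/
def mulC (φ : C(Torus, ℂ)) : L2 →L[ℂ] L2 :=
  (mulOp φ).mkContinuous ‖φ‖ (norm_mulOp_le φ)

theorem mulC_apply (φ : C(Torus, ℂ)) (f : L2) : mulC φ f = mulOp φ f := rfl

theorem norm_mulC_le (φ : C(Torus, ℂ)) (f : L2) : ‖mulC φ f‖ ≤ ‖φ‖ * ‖f‖ := norm_mulOp_le φ f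

theorem coeFn_mulC (φ : C(Torus, ℂ)) (f : L2) :
    mulC φ f =ᵐ[haarAddCircle] fun z => φ z * f z := coeFn_mulOp φ f

theorem mulC_add (φ χ : C(Torus, ℂ)) (f : L2) : mulC (φ + χ) f = mulC φ f + mulC χ f := by
  apply Lp.ext
  filter_upwards [coeFn_mulC (φ + χ) f, coeFn_mulC φ f, coeFn_mulC χ f,
    Lp.coeFn_add (mulC φ f) (mulC χ f)] with z h1 h2 h3 h4
  rw [h1, h4, Pi.add_apply, h2, h3, ContinuousMap.add_apply, add_mul]

theorem mulC_smul (t : ℂ) (φ : C(Torus, ℂ)) (f : L2) : mulC (t • φ) f = t • mulC φ f := by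
  apply Lp.ext
  filter_upwards [coeFn_mulC (t • φ) f, coeFn_mulC φ f, Lp.coeFn_smul t (mulC φ f)] with z h1 h2 h3
  rw [h1, h3, Pi.smul_apply, h2, ContinuousMap.smul_apply, smul_eq_mul, smul_eq_mul, mul_assoc]

theorem mulC_sub (φ χ : C(Torus, ℂ)) (f : L2) : mulC (φ - χ) f = mulC φ f - mulC χ f := by
  have h : φ - χ = φ + (-1 : ℂ) • χ := by ext z; simp [sub_eq_add_neg]
  rw [h, mulC_add, mulC_smul]
  simp [sub_eq_add_neg]

theorem mulC_mul (φ χ : C(Torus, ℂ)) (f : L2) : mulC (φ * χ) f = mulC φ (mulC χ f) := by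
  apply Lp.ext
  filter_upwards [coeFn_mulC (φ * χ) f, coeFn_mulC χ f, coeFn_mulC φ (mulC χ f)] with z h1 h2 h3
  rw [h1, h3, h2, ContinuousMap.mul_apply, mul_assoc]

theorem mulC_one (f : L2) : mulC 1 f = f := by
  apply Lp.ext
  filter_upwards [coeFn_mulC 1 f] with z h1
  rw [h1, ContinuousMap.one_apply, one_mul]

/-- The Fourier coefficients of a continuous function. -/
def fc (φ : C(Torus, ℂ)) (n : ℤ) : ℂ := fourierCoeff φ n

theorem coeff_mulC_exp (φ : C(Torus, ℂ)) (n m : ℤ) :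
    coeff n (mulC φ (expL2 m)) = fc φ (n - m) := by
  change fourierCoeff (mulC φ (expL2 m)) n = fourierCoeff φ (n - m)
  rw [fourierCoeff, fourierCoeff]
  apply integral_congr_ae
  filter_upwards [coeFn_mulC φ (expL2 m), coeFn_fourierLp (T := 2 * Real.pi) 2 m] with z h1 h2
  have h3 : (expL2 m : Torus → ℂ) z = fourier m z := h2
  rw [h1, h3, show -(n - m) = -n + m by ring, fourier_add]
  simp only [smul_eq_mul]
  ring

/-- A continuous function as an element of `L²(𝕋)`. -/
def toL2 (φ : C(Torus, ℂ)) : L2 := mulC φ (expL2 0)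

theorem coeff_toL2 (φ : C(Torus, ℂ)) (n : ℤ) : coeff n (toL2 φ) = fc φ n := by
  rw [toL2, coeff_mulC_exp, sub_zero]

theorem norm_toL2_le (φ : C(Torus, ℂ)) : ‖toL2 φ‖ ≤ ‖φ‖ := by
  simpa [toL2, norm_expL2] using norm_mulC_le φ (expL2 0)

theorem mulC_toL2 (φ χ : C(Torus, ℂ)) : mulC φ (toL2 χ) = toL2 (φ * χ) := (mulC_mul _ _ _).symm

theorem toL2_add (φ χ : C(Torus, ℂ)) : toL2 (φ + χ) = toL2 φ + toL2 χ := mulC_add _ _ _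
theorem toL2_sub (φ χ : C(Torus, ℂ)) : toL2 (φ - χ) = toL2 φ - toL2 χ := mulC_sub _ _ _
theorem toL2_smul (t : ℂ) (φ : C(Torus, ℂ)) : toL2 (t • φ) = t • toL2 φ := mulC_smul _ _ _

theorem fc_add (φ χ : C(Torus, ℂ)) (n : ℤ) : fc (φ + χ) n = fc φ n + fc χ n := by
  rw [← coeff_toL2, toL2_add, map_add, coeff_toL2, coeff_toL2]

theorem fc_sub (φ χ : C(Torus, ℂ)) (n : ℤ) : fc (φ - χ) n = fc φ n - fc χ n := by
  rw [← coeff_toL2, toL2_sub, map_sub, coeff_toL2, coeff_toL2]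

theorem fc_smul (t : ℂ) (φ : C(Torus, ℂ)) (n : ℤ) : fc (t • φ) n = t * fc φ n := by
  rw [← coeff_toL2, toL2_smul, map_smul, coeff_toL2, smul_eq_mul]

/-- `u'` is the derivative of `u` along the circle. -/
def HasTorusDeriv (u u' : C(Torus, ℂ)) : Prop :=
  ∀ x : ℝ, HasDerivAt (fun y : ℝ => u (y : Torus)) (u' (x : Torus)) x

theorem HasTorusDeriv.mul {u u' v v' : C(Torus, ℂ)} (hu : HasTorusDeriv u u')
    (hv : HasTorusDeriv v v') : HasTorusDeriv (u * v) (u' * v + u * v') :=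
  fun x => (hu x).mul (hv x)

/-- Integration by parts over one period; the boundary terms cancel by periodicity. -/
theorem HasTorusDeriv.fc_eq {u u' : C(Torus, ℂ)} (h : HasTorusDeriv u u') (n : ℤ) :
    fc u' n = Complex.I * n * fc u n := by
  have key : ∀ φ : C(Torus, ℂ), fc φ n = 1 / (2 * Real.pi) *
      ∫ x in (0 : ℝ)..(2 * Real.pi), fourier (-n) (x : Torus) * φ (x : Torus) := by
    intro φ
    rw [fc, fourierCoeff_eq_intervalIntegral _ _ 0, zero_add]
    simp [Complex.real_smul]
  have hE : ∀ x : ℝ, HasDerivAt (fun y : ℝ => fourier (-n) (y : Torus))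
      (-(Complex.I * n) * fourier (-n) (x : Torus)) x := by
    intro x
    refine (hasDerivAt_fourier_neg (2 * Real.pi) n x).congr_deriv ?_
    have : (Real.pi : ℂ) ≠ 0 := by exact_mod_cast Real.pi_ne_zero
    congr 1
    push_cast
    field_simp
  have hcont : ∀ φ : C(Torus, ℂ), Continuous fun x : ℝ => φ (x : Torus) := fun φ =>
    φ.continuous.comp (AddCircle.continuous_mk' _)
  have hint := intervalIntegral.integral_mul_deriv_eq_deriv_mul (a := 0) (b := 2 * Real.pi)
    (fun x _ => hE x) (fun x _ => h x)
    ((continuous_const.mul (hcont _)).intervalIntegrable _ _)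
    ((hcont _).intervalIntegrable _ _)
  have hb : ((2 * Real.pi : ℝ) : Torus) = ((0 : ℝ) : Torus) := by
    rw [AddCircle.coe_period]; simp
  have hmul : ∫ x in (0 : ℝ)..(2 * Real.pi),
        -(Complex.I * n) * fourier (-n) (x : Torus) * u (x : Torus)
      = -(Complex.I * n) * ∫ x in (0 : ℝ)..(2 * Real.pi), fourier (-n) (x : Torus) * u (x : Torus) := by
    rw [← intervalIntegral.integral_const_mul]
    simp only [mul_assoc]
  rw [key, key, hint, hb, sub_self, zero_sub, hmul]
  ring

/-! ### The basic multipliers -/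

/-- `∂_z⁻¹` on functions of mean zero. -/
def opS : L2 →L[ℂ] L2 := mult (fun n => (Complex.I * n)⁻¹) 1 fun n => by
  rw [norm_inv, norm_mul, Complex.norm_I, one_mul, Complex.norm_intCast]
  -- At n = 0 the symbol is 0⁻¹ = 0, so the operator annihilates constants and its range has mean
  -- zero.
  rcases eq_or_ne n 0 with rfl | hn
  · simp
  · exact inv_le_one_of_one_le₀ (by exact_mod_cast Int.one_le_abs hn)

theorem coeff_opS (f : L2) (n : ℤ) : coeff n (opS f) = (Complex.I * n)⁻¹ * coeff n f :=
  coeff_mult _ _ _ _ _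

theorem norm_opS_le (f : L2) : ‖opS f‖ ≤ ‖f‖ := by
  rw [opS]
  exact (norm_mult_le _ _ _ f).trans_eq (one_mul _)

theorem I_mul_coeff_opS {f : L2} (hf : coeff 0 f = 0) (n : ℤ) :
    Complex.I * n * coeff n (opS f) = coeff n f := by
  rw [coeff_opS]
  rcases eq_or_ne n 0 with rfl | hn
  · simp [hf]
  · have : (n : ℂ) ≠ 0 := by exact_mod_cast hn
    field_simp

/-- The product rule for a multiplier function and `V = ∂_z⁻¹ f`. -/
theorem coeff_deriv_mulC {u u' : C(Torus, ℂ)} (h : HasTorusDeriv u u') {f : L2}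
    (hf : coeff 0 f = 0) (n : ℤ) :
    Complex.I * n * coeff n (mulC u (opS f)) = coeff n (mulC u' (opS f)) + coeff n (mulC u f) := by
  -- The identity is extended to all of L² so that it can be tested on exponentials. On the constant
  -- function `opS` vanishes, and the rank-one term removes what remains there.
  have key : (Complex.I * n) • (coeffL n ∘L mulC u ∘L opS)
      = coeffL n ∘L mulC u' ∘L opS + coeffL n ∘L mulC u
        - (coeffL 0).smulRight (fc u n) := by
    apply clm_ext_exp
    intro m
    have hS : opS (expL2 m) = (Complex.I * m)⁻¹ • expL2 m := by
      apply ext_coeff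
      intro j
      rw [coeff_opS, map_smul, coeff_expL2, smul_eq_mul]
      split_ifs with hj
      · rw [hj]
      · simp
    simp only [sub_apply, add_apply,
      smul_apply, ContinuousLinearMap.comp_apply, hS, map_smul, coeffL_apply,
      coeff_mulC_exp, ContinuousLinearMap.smulRight_apply, coeff_expL2, smul_eq_mul, h.fc_eq]
    rcases eq_or_ne m 0 with rfl | hm
    · simp
    · have hm' : (m : ℂ) ≠ 0 := by exact_mod_cast hm
      rw [if_neg hm.symm]
      push_cast
      field_simp
      ring
  have := congrArg (fun A : L2 →L[ℂ] ℂ => A f) key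
  simpa [hf] using this

theorem isCompactOperator_rankOne (n : ℤ) (v : L2) :
    IsCompactOperator ((coeffL n).smulRight v : L2 →L[ℂ] L2) := by
  have h : IsCompactOperator ((ContinuousLinearMap.id ℂ ℂ).smulRight v : ℂ →L[ℂ] L2) :=
    isCompactOperator_of_locallyCompactSpace_rng _
  exact h.comp_clm (coeffL n)

/-- The symbol tends to 0: truncation to |n| ≤ N has finite rank and differs from the operator by at
most 1/(N+1) in norm. -/
theorem isCompactOperator_opS : IsCompactOperator opS := by
  let A : ℕ → L2 →L[ℂ] L2 := fun N =>
    ∑ n ∈ Finset.Icc (-(N : ℤ)) N, (coeffL n).smulRight ((Complex.I * n)⁻¹ • expL2 n)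
  have hA : ∀ N, IsCompactOperator (A N) := by
    intro N
    have : A N ∈ compactOperator (RingHom.id ℂ) L2 L2 := 
      Submodule.sum_mem _ fun n _ => isCompactOperator_rankOne n _
    exact this
  have hlim : Filter.Tendsto A Filter.atTop (nhds opS) := by
    rw [tendsto_iff_norm_sub_tendsto_zero]
    refine squeeze_zero (fun _ => norm_nonneg _) (fun N => ?_) tendsto_one_div_add_atTop_nhds_zero_nat
    refine ContinuousLinearMap.opNorm_le_bound _ (by positivity) fun f => ?_
    refine norm_le_of_coeff (by positivity) fun n => ?_
    have h1 : coeff n (A N f) = if n ∈ Finset.Icc (-(N : ℤ)) N then coeff n (opS f) else 0 := by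
      simp only [A, sum_apply, map_sum, ContinuousLinearMap.smulRight_apply,
        map_smul, coeff_expL2, coeffL_apply, smul_eq_mul, coeff_opS]
      simp only [mul_ite, mul_one, mul_zero, Finset.sum_ite_eq]
      split_ifs <;> ring
    rw [sub_apply, map_sub, h1]
    split_ifs with h
    · simp; positivity
    · rw [zero_sub, norm_neg, coeff_opS, norm_mul, norm_inv, norm_mul, Complex.norm_I, one_mul,
        Complex.norm_intCast]
      gcongr
      rw [one_div]
      apply inv_anti₀ (by positivity)
      have : (N : ℤ) + 1 ≤ |n| := by
        rw [Finset.mem_Icc, ← abs_le] at h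
        omega
      exact_mod_cast this
  exact isCompactOperator_of_tendsto hlim (Filter.Eventually.of_forall hA)

/-! ### Symmetries -/

theorem memlp_conj (f : L2) : Memℓp (fun n => (starRingEnd ℂ) (coeff n f)) 2 := by
  have h2 : (0 : ℝ) < (2 : ENNReal).toReal := by norm_num
  refine (memℓp_gen_iff h2).2 ?_
  simpa using (memℓp_gen_iff h2).1 (memlp_coeff f)

theorem memlp_neg_index (f : L2) : Memℓp (fun n => coeff (-n) f) 2 := by
  have h2 : (0 : ℝ) < (2 : ENNReal).toReal := by norm_num
  refine (memℓp_gen_iff h2).2 ?_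
  exact ((memℓp_gen_iff h2).1 (memlp_coeff f)).comp_injective neg_injective

/-- `f ↦ f*`, complex conjugation of the Fourier coefficients. -/
def conjL : L2 →L⋆[ℂ] L2 :=
  LinearMap.mkContinuous
    { toFun := fun f => ofCoeff (fun n => (starRingEnd ℂ) (coeff n f)) (memlp_conj f)
      map_add' := fun f g => ext_coeff fun n => by simp [coeff_ofCoeff]
      map_smul' := fun t f => ext_coeff fun n => by simp [coeff_ofCoeff] } 1 fun f => by
    refine norm_le_of_coeff (f := f) zero_le_one fun n => ?_
    simp [coeff_ofCoeff]

theorem coeff_conjL (f : L2) (n : ℤ) : coeff n (conjL f) = (starRingEnd ℂ) (coeff n f) :=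
  coeff_ofCoeff _ _ _

/-- The reflection `z ↦ -z`. -/
def reflL : L2 →L[ℂ] L2 :=
  LinearMap.mkContinuous
    { toFun := fun f => ofCoeff (fun n => coeff (-n) f) (memlp_neg_index f)
      map_add' := fun f g => ext_coeff fun n => by simp [coeff_ofCoeff]
      map_smul' := fun t f => ext_coeff fun n => by simp [coeff_ofCoeff] } 1 fun f => by
    have h1 := hasSum_norm_sq (ofCoeff (fun n => coeff (-n) f) (memlp_neg_index f))
    have h2 := (Equiv.neg ℤ).hasSum_iff.2 (hasSum_norm_sq f)
    simp only [coeff_ofCoeff] at h1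
    have h3 := h1.unique h2
    rw [one_mul]
    exact le_of_sq_le_sq h3.le (norm_nonneg _)

theorem coeff_reflL (f : L2) (n : ℤ) : coeff n (reflL f) = coeff (-n) f :=
  coeff_ofCoeff _ _ _

theorem norm_conjL_le (f : L2) : ‖conjL f‖ ≤ ‖f‖ := by
  refine (norm_le_of_coeff (f := f) zero_le_one fun n => ?_).trans_eq (one_mul _)
  simp [coeff_conjL]

theorem conjL_conjL (f : L2) : conjL (conjL f) = f := ext_coeff fun n => by simp [coeff_conjL]

theorem reflL_reflL (f : L2) : reflL (reflL f) = f := ext_coeff fun n => by simp [coeff_reflL]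

/-- The symbol 1/(in) is imaginary and odd, hence the sign. For operators commuting with both
symmetries, this sign makes conjugation send z to −z̄ and reflection send z to −z in the pencil. -/
theorem conjL_opS (f : L2) : conjL (opS f) = -opS (conjL f) := ext_coeff fun n => by
  simp [coeff_conjL, coeff_opS]

theorem reflL_opS (f : L2) : reflL (opS f) = -opS (reflL f) := ext_coeff fun n => by
  simp [coeff_reflL, coeff_opS]

/-- Multiplication by a function with real Fourier coefficients commutes with `*`. -/
theorem conjL_mulC {φ : C(Torus, ℂ)} {s : ℂ} (h : ∀ n, (starRingEnd ℂ) (fc φ n) = s * fc φ n)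
    (f : L2) : conjL (mulC φ f) = s • mulC φ (conjL f) := by
  have key : conjL.comp ((mulC φ).comp conjL) = s • mulC φ := by
    apply clm_ext_exp
    intro m
    apply ext_coeff
    intro n
    have h1 : conjL (expL2 m) = expL2 m := by
      apply ext_coeff
      intro j
      rw [coeff_conjL, coeff_expL2]
      split_ifs <;> simp
    rw [ContinuousLinearMap.comp_apply, ContinuousLinearMap.comp_apply, h1, coeff_conjL,
      coeff_mulC_exp, h, smul_apply, map_smul, coeff_mulC_exp, smul_eq_mul]
  have := congrArg (fun A : L2 →L[ℂ] L2 => A (conjL f)) key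
  simpa [conjL_conjL] using this

theorem reflL_mulC {φ : C(Torus, ℂ)} {s : ℂ} (h : ∀ n, fc φ (-n) = s * fc φ n)
    (f : L2) : reflL (mulC φ f) = s • mulC φ (reflL f) := by
  have key : reflL.comp ((mulC φ).comp reflL) = s • mulC φ := by
    apply clm_ext_exp
    intro m
    apply ext_coeff
    intro n
    have h1 : reflL (expL2 m) = expL2 (-m) := by
      apply ext_coeff
      intro j
      rw [coeff_reflL, coeff_expL2, coeff_expL2]
      congr 1
      simp [neg_eq_iff_eq_neg]
    rw [ContinuousLinearMap.comp_apply, ContinuousLinearMap.comp_apply, h1, coeff_reflL,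
      coeff_mulC_exp, show -n - -m = -(n - m) by ring, h, smul_apply, map_smul,
      coeff_mulC_exp, smul_eq_mul]
  have := congrArg (fun A : L2 →L[ℂ] L2 => A (reflL f)) key
  simpa [reflL_reflL] using this

/-! ### The linearised operator as a bounded pencil in `f = ∂_z V` -/

theorem norm_symbol_le {k : ℝ} (hk : 0 < k) {t : ℂ} {n : ℤ} (ht : ‖t‖ ≤ (n : ℝ) ^ 2) :
    ‖t / (1 + (k : ℂ) ^ 2 * (n : ℂ) ^ 2)‖ ≤ 1 / k ^ 2 := by
  have h : (1 + (k : ℂ) ^ 2 * (n : ℂ) ^ 2) = ((1 + k ^ 2 * (n : ℝ) ^ 2 : ℝ) : ℂ) := by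
    push_cast; ring
  have hp : (0 : ℝ) < 1 + k ^ 2 * (n : ℝ) ^ 2 := by positivity
  rw [h, norm_div, Complex.norm_real, Real.norm_of_nonneg hp.le, div_le_div_iff₀ hp (by positivity)]
  nlinarith [mul_le_mul_of_nonneg_right ht (sq_nonneg k)]

/-- `∂_z (1 - k² ∂_z²)⁻¹` as a bounded operator. -/
def opJL {k : ℝ} (hk : 0 < k) : L2 →L[ℂ] L2 :=
  mult (fun n => (Complex.I * n) / (1 + (k : ℂ) ^ 2 * (n : ℂ) ^ 2)) (1 / k ^ 2) fun n =>
    norm_symbol_le hk (by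
      rw [norm_mul, Complex.norm_I, one_mul, Complex.norm_intCast]
      have h : |n| ≤ n ^ 2 := by
        rw [← sq_abs]
        nlinarith [abs_nonneg n, Int.le_self_sq |n|]
      exact_mod_cast h)

/-- `∂_z (1 - k² ∂_z²)⁻¹ ∂_z` as a bounded operator. -/
def opJdL {k : ℝ} (hk : 0 < k) : L2 →L[ℂ] L2 :=
  mult (fun n => (Complex.I * n) ^ 2 / (1 + (k : ℂ) ^ 2 * (n : ℂ) ^ 2)) (1 / k ^ 2) fun n =>
    norm_symbol_le hk (by
      rw [norm_pow, norm_mul, Complex.norm_I, one_mul, Complex.norm_intCast, sq_abs])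

section

variable {k : ℝ} (hk : 0 < k)

theorem coeff_opJL (f : L2) (n : ℤ) : coeff n (opJL hk f)
    = (Complex.I * n) / (1 + (k : ℂ) ^ 2 * (n : ℂ) ^ 2) * coeff n f := coeff_mult _ _ _ _ _

theorem coeff_opJdL (f : L2) (n : ℤ) : coeff n (opJdL hk f)
    = (Complex.I * n) ^ 2 / (1 + (k : ℂ) ^ 2 * (n : ℂ) ^ 2) * coeff n f := coeff_mult _ _ _ _ _

theorem norm_opJL_le (f : L2) : ‖opJL hk f‖ ≤ 1 / k ^ 2 * ‖f‖ := norm_mult_le _ _ _ _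

theorem norm_opJdL_le (f : L2) : ‖opJdL hk f‖ ≤ 1 / k ^ 2 * ‖f‖ := norm_mult_le _ _ _ _

theorem one_add_sq_ne_zero (k : ℝ) (n : ℤ) : (1 + (k : ℂ) ^ 2 * (n : ℂ) ^ 2) ≠ 0 := by
  have hp : (0 : ℝ) < 1 + k ^ 2 * (n : ℝ) ^ 2 := by positivity
  exact_mod_cast hp.ne'

/-- The part of the pencil that is linear in the profile `(u₀, u₁, u₂) = (w, w_z, w_zz)`. -/
def opLL (b : ℝ) (u₀ u₁ u₂ : C(Torus, ℂ)) : L2 →L[ℂ] L2 :=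
  -(opJL hk ∘L (((b + 1 : ℝ) : ℂ) • mulC u₀ - ((k ^ 2 : ℝ) : ℂ) • mulC u₂) ∘L opS)
    + ((k ^ 2 * (b - 2) : ℝ) : ℂ) • (opJL hk ∘L mulC u₁) + ((k ^ 2 : ℝ) : ℂ) • (opJdL hk ∘L mulC u₀)

theorem opLL_apply (b : ℝ) (u₀ u₁ u₂ : C(Torus, ℂ)) (f : L2) : opLL hk b u₀ u₁ u₂ f
    = -opJL hk (((b + 1 : ℝ) : ℂ) • mulC u₀ (opS f) - ((k ^ 2 : ℝ) : ℂ) • mulC u₂ (opS f))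
      + ((k ^ 2 * (b - 2) : ℝ) : ℂ) • opJL hk (mulC u₁ f)
      + ((k ^ 2 : ℝ) : ℂ) • opJdL hk (mulC u₀ f) := rfl

/-- `- ∂_z (1 - k² ∂_z²)⁻¹ ∂_z⁻³`. -/
def opN : L2 →L[ℂ] L2 := -(opJL hk ∘L opS ∘L opS ∘L opS)

theorem opN_apply (f : L2) : opN hk f = -opJL hk (opS (opS (opS f))) := rfl

/-- The operator `𝒜(ℓ)` in the variable `f = ∂_z V`, with `lam = ℓ²`. -/
def opHat (b κ lam c : ℝ) (u₀ u₁ u₂ : C(Torus, ℂ)) : L2 →L[ℂ] L2 :=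
  (c : ℂ) • ContinuousLinearMap.id ℂ L2 - (κ : ℂ) • (opJL hk ∘L opS) + (lam : ℂ) • opN hk
    + opLL hk b u₀ u₁ u₂

theorem opHat_apply (b κ lam c : ℝ) (u₀ u₁ u₂ : C(Torus, ℂ)) (f : L2) :
    opHat hk b κ lam c u₀ u₁ u₂ f = (c : ℂ) • f - (κ : ℂ) • opJL hk (opS f) + (lam : ℂ) • opN hk f
      + opLL hk b u₀ u₁ u₂ f := rfl

theorem coeff_zero_opHat (b κ lam c : ℝ) (u₀ u₁ u₂ : C(Torus, ℂ)) (f : L2) :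
    coeff 0 (opHat hk b κ lam c u₀ u₁ u₂ f) = c * coeff 0 f := by
  simp [opHat_apply, opLL_apply, opN_apply, coeff_opJL, coeff_opJdL]

/-- On mean-zero V one has V = `opS` (∂_z V), so each term of 𝒜 becomes a bounded operator acting on
∂_z V. The value σ = −1 makes the transverse term +ℓ² `opN`, whose symbol is nonnegative. -/
theorem opFun_eq_opHat (b κ ℓ c : ℝ) (w : Profile) (V : H1) (hV : coeff 0 V.1 = 0) :
    opFun hk b κ (-1) ℓ c w V
      = opHat hk b κ (ℓ ^ 2) c w.onTorus w.dz.onTorus w.dz.dz.onTorus (weakDeriv V) := by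
  have hS : opS (weakDeriv V) = V.1 := by
    apply ext_coeff
    intro n
    rw [coeff_opS, coeff_weakDeriv]
    rcases eq_or_ne n 0 with rfl | hn
    · simp [hV]
    · have : (n : ℂ) ≠ 0 := by exact_mod_cast hn
      field_simp
  have hJ : ∀ g, opJ hk g = opJL hk g := fun g => ext_coeff fun n => by
    rw [opJ, coeff_multiplier, coeff_opJL]
  have hJd : ∀ g, opJd hk g = opJdL hk g := fun g => ext_coeff fun n => by
    rw [opJd, coeff_multiplier, coeff_opJdL]
  have hI : opInvD2 V.1 = opS (opS V.1) := ext_coeff fun n => by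
    rw [opInvD2, coeff_multiplier, coeff_opS, coeff_opS, sq, mul_inv, mul_assoc]
  rw [opHat_apply, opLL_apply, opN_apply, hS]
  simp only [opFun, LinearMap.add_apply, LinearMap.sub_apply, LinearMap.smul_apply,
    LinearMap.comp_apply, Submodule.subtype_apply, hJ, hJd, hI, ← mulC_apply, map_add, map_sub,
    map_smul]
  push_cast
  module

theorem opS_mem_H1 (f : L2) : opS f ∈ H1 := by
  have h2 : (0 : ℝ) < (2 : ENNReal).toReal := by norm_num
  have h := (memℓp_gen_iff h2).1 (memlp_coeff f)
  refine (memℓp_gen_iff h2).2 (Summable.of_nonneg_of_le (fun n => by positivity) (fun n => ?_) h)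
  have : ‖Complex.I * n * coeff n (opS f)‖ ≤ ‖coeff n f‖ := by
    rw [coeff_opS]
    rcases eq_or_ne n 0 with rfl | hn
    · simp
    · have : (n : ℂ) ≠ 0 := by exact_mod_cast hn
      apply le_of_eq
      congr 1
      field_simp
  exact Real.rpow_le_rpow (norm_nonneg _) this (by positivity)

theorem opS_mem_L20 (f : L2) : opS f ∈ L20 := by
  rw [mem_L20_iff, coeff_opS]
  simp

/-- The element `V = ∂_z⁻¹ f` of the domain of `𝒜(ℓ)`. -/
def antideriv (b κ ℓ c : ℝ) (w : Profile) (f : L2) : (opA hk b κ (-1) ℓ c w).domain :=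
  ⟨⟨opS f, opS_mem_L20 f⟩, opS_mem_H1 f⟩

theorem opA_antideriv (b κ ℓ c : ℝ) (w : Profile) {f : L2} (hf : coeff 0 f = 0) :
    (opA hk b κ (-1) ℓ c w (antideriv hk b κ ℓ c w f) : L2)
      = opHat hk b κ (ℓ ^ 2) c w.onTorus w.dz.onTorus w.dz.dz.onTorus f := by
  change opFun hk b κ (-1) ℓ c w ⟨opS f, opS_mem_H1 f⟩ = _
  rw [opFun_eq_opHat hk b κ ℓ c w _ ((mem_L20_iff _).1 (opS_mem_L20 f))]
  congr 1
  apply ext_coeff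
  intro n
  rw [coeff_weakDeriv]
  exact I_mul_coeff_opS hf n

theorem exists_antideriv (b κ ℓ c : ℝ) (w : Profile) (u : (opA hk b κ (-1) ℓ c w).domain) :
    ∃ f : L2, coeff 0 f = 0 ∧ u = antideriv hk b κ ℓ c w f := by
  have h0 : coeff 0 u.1.1 = 0 := (mem_L20_iff _).1 u.1.2
  refine ⟨weakDeriv ⟨u.1.1, u.2⟩, ?_, ?_⟩
  · rw [coeff_weakDeriv]; simp
  · apply Subtype.ext
    apply Subtype.ext
    apply ext_coeff
    intro n
    change coeff n u.1.1 = coeff n (opS _)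
    rw [coeff_opS, coeff_weakDeriv]
    rcases eq_or_ne n 0 with rfl | hn
    · simp [h0]
    · have : (n : ℂ) ≠ 0 := by exact_mod_cast hn
      field_simp

theorem isCompactOperator_opJL : IsCompactOperator (opJL hk) := by
  have h : opJL hk = opS ∘L opJdL hk := by
    ext1 f
    apply ext_coeff
    intro n
    rw [ContinuousLinearMap.comp_apply, coeff_opS, coeff_opJdL, coeff_opJL]
    rcases eq_or_ne n 0 with rfl | hn
    · simp
    · have : (n : ℂ) ≠ 0 := by exact_mod_cast hn
      field_simp
  rw [h]
  exact isCompactOperator_opS.comp_clm _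

/-- The symbol −k²n²/(1+k²n²) equals −1 + 1/(1+k²n²). The composition of `opJL` and `opS` supplies
the last fraction except at n = 0, which the rank-one term repairs. This isolates the non-compact
part of the pencil. -/
theorem sq_smul_opJdL (g : L2) : ((k ^ 2 : ℝ) : ℂ) • opJdL hk g
    = -g + opJL hk (opS g) + (coeffL 0).smulRight (expL2 0) g := by
  apply ext_coeff
  intro n
  simp only [map_add, map_neg, map_smul, coeff_opJL, coeff_opJdL, coeff_opS,
    ContinuousLinearMap.smulRight_apply, coeffL_apply, coeff_expL2, smul_eq_mul]
  have hne := one_add_sq_ne_zero k n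
  rcases eq_or_ne n 0 with rfl | hn
  · simp
  · have : (n : ℂ) ≠ 0 := by exact_mod_cast hn
    rw [if_neg hn, mul_pow, Complex.I_sq]
    push_cast
    field_simp
    ring

/-- Apart from c f − w f, every term contains one of the compact factors `opJL`, `opS` or a rank-one
operator. -/
theorem opHat_eq_mulC_add_compact (b κ lam c : ℝ) (u₀ u₁ u₂ : C(Torus, ℂ)) (z : ℂ) :
    ∃ K : L2 →L[ℂ] L2, IsCompactOperator K ∧ ∀ f,
      opHat hk b κ lam c u₀ u₁ u₂ f - z • opS f = (c : ℂ) • f - mulC u₀ f + K f := by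
  let K : L2 →L[ℂ] L2 := -((κ : ℂ) • (opJL hk ∘L opS)) + (lam : ℂ) • opN hk
    - (opJL hk ∘L (((b + 1 : ℝ) : ℂ) • mulC u₀ - ((k ^ 2 : ℝ) : ℂ) • mulC u₂) ∘L opS)
    + ((k ^ 2 * (b - 2) : ℝ) : ℂ) • (opJL hk ∘L mulC u₁)
    + opJL hk ∘L opS ∘L mulC u₀ + (coeffL 0).smulRight (expL2 0) ∘L mulC u₀ - z • opS
  have hJ := isCompactOperator_opJL hk
  refine ⟨K, ?_, fun f => ?_⟩
  · have h1 : IsCompactOperator (opJL hk ∘L opS) := hJ.comp_clm _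
    have h2 : IsCompactOperator (opN hk) :=
      (show IsCompactOperator (opJL hk ∘L opS ∘L opS ∘L opS) from hJ.comp_clm _).neg
    have h3 : IsCompactOperator
        (opJL hk ∘L (((b + 1 : ℝ) : ℂ) • mulC u₀ - ((k ^ 2 : ℝ) : ℂ) • mulC u₂) ∘L opS) :=
      hJ.comp_clm _
    have h4 : IsCompactOperator (opJL hk ∘L mulC u₁) := hJ.comp_clm _
    have h5 : IsCompactOperator (opJL hk ∘L opS ∘L mulC u₀) := hJ.comp_clm _
    have h6 : IsCompactOperator ((coeffL 0).smulRight (expL2 0) ∘L mulC u₀) :=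
      (isCompactOperator_rankOne 0 (expL2 0)).comp_clm _
    exact ((((((h1.smul (κ : ℂ)).neg.add (h2.smul (lam : ℂ))).sub h3).add
      (h4.smul ((k ^ 2 * (b - 2) : ℝ) : ℂ))).add h5).add h6).sub (isCompactOperator_opS.smul z)
  · rw [opHat_apply, opLL_apply, sq_smul_opJdL]
    simp only [K, sub_apply, add_apply, neg_apply, smul_apply, ContinuousLinearMap.comp_apply,
      map_sub, map_smul]
    abel

/-- Fredholm alternative for the linearised operator. -/
theorem inResolventSet_of_injective (b κ ℓ c : ℝ) (w : Profile) (z : ℂ)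
    (hc : c ≠ 0) (hw : ∀ x : Torus, (c : ℂ) - w.onTorus x ≠ 0)
    (hinj : ∀ f : L2, coeff 0 f = 0 →
      opHat hk b κ (ℓ ^ 2) c w.onTorus w.dz.onTorus w.dz.dz.onTorus f = z • opS f → f = 0) :
    InResolventSet (opA hk b κ (-1) ℓ c w) z := by
  set A := opHat hk b κ (ℓ ^ 2) c w.onTorus w.dz.onTorus w.dz.dz.onTorus with hA
  have hc' : (c : ℂ) ≠ 0 := by exact_mod_cast hc
  -- On mode 0 the pencil is multiplication by c ≠ 0. The Fredholm argument can therefore run on all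
  -- of L², and the inverse preserves mean zero.
  have h0 : ∀ f, coeff 0 (A f - z • opS f) = c * coeff 0 f := fun f => by
    rw [map_sub, map_smul, hA, coeff_zero_opHat, coeff_opS]
    simp
  have hinj' : ∀ f, A f - z • opS f = 0 → f = 0 := fun f hf => by
    have h1 := h0 f
    rw [hf, map_zero] at h1
    have h2 : coeff 0 f = 0 := by
      rcases mul_eq_zero.1 h1.symm with h | h
      · exact absurd h hc'
      · exact h
    exact hinj f h2 (sub_eq_zero.1 hf)
  obtain ⟨K, hK, hKf⟩ := opHat_eq_mulC_add_compact hk b κ (ℓ ^ 2) c w.onTorus w.dz.onTorus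
    w.dz.dz.onTorus z
  let φ : C(Torus, ℂ) := ContinuousMap.const _ (c : ℂ) - w.onTorus
  have hφf : ∀ f, (c : ℂ) • f - mulC w.onTorus f = mulC φ f := fun f => by
    have : (ContinuousMap.const Torus (c : ℂ)) = (c : ℂ) • (1 : C(Torus, ℂ)) := by ext x; simp
    rw [show φ = (c : ℂ) • (1 : C(Torus, ℂ)) - w.onTorus by rw [← this], mulC_sub, mulC_smul,
      mulC_one]
  let φi : C(Torus, ℂ) := ⟨fun x => (φ x)⁻¹, φ.continuous.inv₀ fun x => hw x⟩
  have hφ : φi * φ = 1 := by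
    ext x
    exact inv_mul_cancel₀ (hw x)
  have hφ' : φ * φi = 1 := (mul_comm φ φi).trans hφ
  let K' : L2 →L[ℂ] L2 := mulC φi ∘L K
  have hK' : IsCompactOperator K' := hK.clm_comp (mulC φi)
  have hTK : ∀ f, A f - z • opS f = mulC φ (f + K' f) := fun f => by
    rw [hKf, hφf, map_add, show K' f = mulC φi (K f) from rfl, ← mulC_mul, hφ', mulC_one]
  -- Riesz–Schauder for the compact K' = (c − w)⁻¹K: if −1 were an eigenvalue, its eigenvector would
  -- lie in the kernel of the pencil.
  have hres : (-1 : ℂ) ∈ resolventSet ℂ K' := by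
    refine (hK'.hasEigenvalue_or_mem_resolventSet (by norm_num)).resolve_left fun hev => ?_
    obtain ⟨f, hf⟩ := hev.exists_hasEigenvector
    refine hf.2 (hinj' f ?_)
    have h1 : K' f = (-1 : ℂ) • f := hf.apply_eq_smul
    rw [hTK, h1]
    simp
  rw [spectrum.mem_resolventSet_iff] at hres
  obtain ⟨u, hu⟩ := hres
  let e : L2 ≃L[ℂ] L2 := ContinuousLinearEquiv.unitsEquiv ℂ L2 u
  have he' : ∀ f, e f = -(f + K' f) := fun f => by
    rw [show e f = (u : L2 →L[ℂ] L2) f from rfl, hu]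
    simp [Algebra.algebraMap_eq_smul_one]
    abel
  let B : L2 →L[ℂ] L2 := -((e.symm : L2 →L[ℂ] L2) ∘L mulC φi)
  have hBT : ∀ f, B (A f - z • opS f) = f := fun f => by
    rw [hTK, show B (mulC φ (f + K' f)) = -e.symm (mulC φi (mulC φ (f + K' f))) from rfl,
      ← mulC_mul, hφ, mulC_one, ← map_neg, ← he', ContinuousLinearEquiv.symm_apply_apply]
  have hTB : ∀ f, A (B f) - z • opS (B f) = f := fun f => by
    have h1 : B f + K' (B f) = mulC φi f := by
      rw [← neg_neg (B f + K' (B f)), ← he',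
        show B f = -e.symm (mulC φi f) from rfl, map_neg, neg_neg,
        ContinuousLinearEquiv.apply_symm_apply]
    rw [hTK, h1, ← mulC_mul, hφ', mulC_one]
  -- If B inverts the pencil, then V = `opS` (B g) solves (𝒜 − z)V = g.
  let R : L20 →L[ℂ] L20 := ((opS ∘L B) ∘L L20.subtypeL).codRestrict L20 fun f => opS_mem_L20 _
  refine ⟨R, fun f => ?_, fun u => ?_⟩
  · have hf0 : coeff 0 (B f.1) = 0 := by
      have h1 := h0 (B f.1)
      rw [hTB, (mem_L20_iff _).1 f.2] at h1
      rcases mul_eq_zero.1 h1.symm with h | h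
      · exact absurd h hc'
      · exact h
    refine ⟨antideriv hk b κ ℓ c w (B f.1), rfl, ?_⟩
    apply Subtype.ext
    change (opA hk b κ (-1) ℓ c w (antideriv hk b κ ℓ c w (B f.1)) : L2) - z • opS (B f.1) = f.1
    rw [opA_antideriv hk b κ ℓ c w hf0]
    exact hTB f.1
  · obtain ⟨f, hf, rfl⟩ := exists_antideriv hk b κ ℓ c w u
    apply Subtype.ext
    change opS (B ((opA hk b κ (-1) ℓ c w (antideriv hk b κ ℓ c w f) : L2) - z • opS f)) = opS f
    rw [opA_antideriv hk b κ ℓ c w hf]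
    exact congrArg opS (hBT f)

/-- `opS` is injective on mean-zero functions and maps them onto the domain of 𝒜. Eigenvectors and
Jordan chains therefore correspond, the chain equation having `opS f` on its right side. -/
theorem isSimpleEigenvalue_of_pencil (b κ ℓ c : ℝ) (w : Profile) (z : ℂ) {f : L2}
    (hf0 : coeff 0 f = 0) (hf : f ≠ 0)
    (hfz : opHat hk b κ (ℓ ^ 2) c w.onTorus w.dz.onTorus w.dz.dz.onTorus f = z • opS f)
    (hgeo : ∀ g : L2, coeff 0 g = 0 →
      opHat hk b κ (ℓ ^ 2) c w.onTorus w.dz.onTorus w.dz.dz.onTorus g = z • opS g →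
        ∃ t : ℂ, g = t • f)
    (halg : ∀ g : L2, coeff 0 g = 0 →
      opHat hk b κ (ℓ ^ 2) c w.onTorus w.dz.onTorus w.dz.dz.onTorus g - z • opS g ≠ opS f) :
    IsSimpleEigenvalue (opA hk b κ (-1) ℓ c w) z := by
  have hval : ∀ g : L2, coeff 0 g = 0 →
      ((opA hk b κ (-1) ℓ c w (antideriv hk b κ ℓ c w g) : L20) : L2)
        = opHat hk b κ (ℓ ^ 2) c w.onTorus w.dz.onTorus w.dz.dz.onTorus g :=
    fun g hg => opA_antideriv hk b κ ℓ c w hg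
  refine ⟨antideriv hk b κ ℓ c w f, fun h => hf ?_, fun u => ?_, fun u => ?_⟩
  · have h1 : opS f = 0 := congrArg (fun v => (v.1.1 : L2)) h
    apply ext_coeff
    intro n
    rw [← I_mul_coeff_opS hf0, h1]
    simp
  · obtain ⟨g, hg, rfl⟩ := exists_antideriv hk b κ ℓ c w u
    constructor
    · intro h
      have h1 : opHat hk b κ (ℓ ^ 2) c w.onTorus w.dz.onTorus w.dz.dz.onTorus g = z • opS g := by
        rw [← hval g hg]
        exact congrArg Subtype.val h
      obtain ⟨t, rfl⟩ := hgeo g hg h1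
      refine ⟨t, Subtype.ext (Subtype.ext ?_)⟩
      exact map_smul opS t f
    · rintro ⟨t, ht⟩
      have h2 : opS g = t • opS f := congrArg (fun v => (v.1.1 : L2)) ht
      have h3 : g = t • f := by
        apply ext_coeff
        intro n
        rw [← I_mul_coeff_opS hg, h2, map_smul, map_smul, ← I_mul_coeff_opS hf0 n]
        simp only [smul_eq_mul]
        ring
      apply Subtype.ext
      rw [hval g hg]
      change _ = z • opS g
      rw [h3, map_smul, map_smul, hfz, smul_comm]
  · obtain ⟨g, hg, rfl⟩ := exists_antideriv hk b κ ℓ c w u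
    intro h
    refine halg g hg ?_
    rw [← hval g hg]
    exact congrArg Subtype.val h

end

/-! ### A priori estimates for small waves -/

theorem Profile.hasDerivAt (w : Profile) (x : ℝ) : HasDerivAt w (w.dz x) x :=
  (w.smooth.differentiable (by norm_num) x).hasDerivAt

theorem Profile.continuous (w : Profile) : Continuous w := w.smooth.continuous

theorem Profile.dz_zero_of_even {w : Profile} (hw : Function.Even w) : w.dz 0 = 0 := by
  have h1 := w.hasDerivAt 0
  have h2 : HasDerivAt (fun x => w (-x)) (-w.dz 0) 0 := by
    have h3 : HasDerivAt w (w.dz 0) (-0) := by simpa using h1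
    have h4 := h3.scomp (0 : ℝ) (hasDerivAt_neg (0 : ℝ))
    simpa [Function.comp_def] using h4
  have h5 : (fun x => w (-x)) = w := funext hw
  rw [h5] at h2
  have := h1.unique h2
  linarith

/-- The profile `cos z`. -/
def cosProfile : Profile where
  toFun := Real.cos
  smooth := Real.contDiff_cos
  periodic := Real.cos_periodic

theorem cosProfile_apply (x : ℝ) : cosProfile x = Real.cos x := rfl

theorem cosProfile_dz (x : ℝ) : cosProfile.dz x = -Real.sin x := by
  change deriv Real.cos x = _
  rw [Real.deriv_cos]

theorem cosProfile_dz_dz (x : ℝ) : cosProfile.dz.dz x = -Real.cos x := by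
  change deriv (deriv Real.cos) x = _
  rw [Real.deriv_cos', deriv.fun_neg, Real.deriv_sin]

theorem abs_sub_le_of_deriv {f f' : ℝ → ℝ} (hf : ∀ x, HasDerivAt f (f' x) x) {r : ℝ}
    (hr : ∀ x, |f' x| ≤ r) {x : ℝ} (hx : x ∈ Set.Icc 0 (2 * Real.pi)) :
    |f x - f 0| ≤ 2 * Real.pi * r := by
  have h := Convex.norm_image_sub_le_of_norm_hasDerivWithin_le (s := Set.univ) (C := r)
    (fun y _ => (hf y).hasDerivWithinAt) (fun y _ => by simpa using hr y) convex_univ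
    (Set.mem_univ 0) (Set.mem_univ x)
  have hr0 : 0 ≤ r := (abs_nonneg _).trans (hr 0)
  rw [Real.norm_eq_abs, Real.norm_eq_abs, sub_zero, abs_of_nonneg hx.1] at h
  nlinarith [hx.2]

theorem integral_cos_sq_period : ∫ z in (0 : ℝ)..(2 * Real.pi), Real.cos z * Real.cos z = Real.pi := by
  have := integral_cos_sq (a := 0) (b := 2 * Real.pi)
  simp only [sq] at this
  rw [this]
  simp

theorem abs_integral_period_le {f : ℝ → ℝ} {r : ℝ} (hr : ∀ x, |f x| ≤ r) :
    |∫ z in (0 : ℝ)..(2 * Real.pi), f z| ≤ 2 * Real.pi * r := by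
  have h := intervalIntegral.norm_integral_le_of_norm_le_const (a := 0) (b := 2 * Real.pi) (f := f)
    (C := r) (fun x _ => hr x)
  rw [Real.norm_eq_abs, sub_zero, abs_of_nonneg Real.two_pi_pos.le] at h
  linarith

/-- Bounds for the resonant oscillator `v'' + v = R` without component along `cos`. -/
theorem oscillator_bound {v v' v'' : ℝ → ℝ} (hv : ∀ x, HasDerivAt v (v' x) x)
    (hv' : ∀ x, HasDerivAt v' (v'' x) x) (hp : Function.Periodic v (2 * Real.pi))
    (hp' : Function.Periodic v' (2 * Real.pi)) (h0 : v' 0 = 0)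
    (hcos : ∫ z in (0 : ℝ)..(2 * Real.pi), v z * Real.cos z = 0) {r : ℝ}
    (hr : ∀ x, |v x + v'' x| ≤ r) (x : ℝ) :
    |v x| ≤ 39 * r ∧ |v' x| ≤ 39 * r ∧ |v'' x| ≤ 40 * r := by
  have hr0 : 0 ≤ r := (abs_nonneg _).trans (hr 0)
  have hvc : Continuous v := continuous_iff_continuousAt.2 fun x => (hv x).continuousAt
  -- Variation of constants: rotating (v, v') by the angle x leaves quantities driven only by v +
  -- v''.
  have hP : ∀ x, HasDerivAt (fun x => v x * Real.cos x - v' x * Real.sin x)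
      (-((v x + v'' x) * Real.sin x)) x := fun x =>
    (((hv x).mul (Real.hasDerivAt_cos x)).sub ((hv' x).mul (Real.hasDerivAt_sin x))).congr_deriv
      (by ring)
  have hQ : ∀ x, HasDerivAt (fun x => v x * Real.sin x + v' x * Real.cos x)
      ((v x + v'' x) * Real.cos x) x := fun x =>
    (((hv x).mul (Real.hasDerivAt_sin x)).add ((hv' x).mul (Real.hasDerivAt_cos x))).congr_deriv
      (by ring)
  have hle : ∀ t s : ℝ, |t| ≤ r → |s| ≤ 1 → |t * s| ≤ r := fun t s ht hs => by
    rw [abs_mul]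
    calc |t| * |s| ≤ r * 1 := mul_le_mul ht hs (abs_nonneg _) hr0
      _ = r := mul_one r
  have key : ∀ x ∈ Set.Icc 0 (2 * Real.pi),
      |v x - v 0 * Real.cos x| ≤ 4 * Real.pi * r ∧ |v' x + v 0 * Real.sin x| ≤ 4 * Real.pi * r := by
    intro x hx
    have h1 := abs_sub_le_of_deriv hP (r := r) (fun y => by
      rw [abs_neg]; exact hle _ _ (hr y) (Real.abs_sin_le_one y)) hx
    have h2 := abs_sub_le_of_deriv hQ (r := r) (fun y => hle _ _ (hr y) (Real.abs_cos_le_one y)) hx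
    simp only [Real.cos_zero, Real.sin_zero, h0, mul_one, mul_zero, sub_zero, add_zero] at h1 h2
    set p := v x * Real.cos x - v' x * Real.sin x - v 0 with hp_def
    set q := v x * Real.sin x + v' x * Real.cos x with hq_def
    have hc := Real.abs_cos_le_one x
    have hs := Real.abs_sin_le_one x
    have hsc := Real.sin_sq_add_cos_sq x
    have e1 : v x - v 0 * Real.cos x = p * Real.cos x + q * Real.sin x := by
      rw [hp_def, hq_def]; linear_combination -(v x) * hsc
    have e2 : v' x + v 0 * Real.sin x = -(p * Real.sin x) + q * Real.cos x := by
      rw [hp_def, hq_def]; linear_combination -(v' x) * hsc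
    have b1 : ∀ t s : ℝ, |t| ≤ 2 * Real.pi * r → |s| ≤ 1 → |t * s| ≤ 2 * Real.pi * r :=
      fun t s ht hs => by
        rw [abs_mul]
        calc |t| * |s| ≤ (2 * Real.pi * r) * 1 := mul_le_mul ht hs (abs_nonneg _) (by positivity)
          _ = _ := mul_one _
    have hpc := abs_le.1 (b1 _ _ h1 hc)
    have hps := abs_le.1 (b1 _ _ h1 hs)
    have hqc := abs_le.1 (b1 _ _ h2 hc)
    have hqs := abs_le.1 (b1 _ _ h2 hs)
    rw [e1, e2]
    exact ⟨abs_le.2 ⟨by linarith, by linarith⟩, abs_le.2 ⟨by linarith, by linarith⟩⟩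
  -- Up to an error 4πr the function v is v(0) cos x. Its cosine integral would be π v(0) but is
  -- zero, which gives |v(0)| ≤ 2π · 4πr / π.
  have hv0 : |v 0| ≤ 8 * Real.pi * r := by
    have h1 : ∫ z in (0 : ℝ)..(2 * Real.pi), (v z - v 0 * Real.cos z) * Real.cos z
        = -(v 0 * Real.pi) := by
      have : ∀ z, (v z - v 0 * Real.cos z) * Real.cos z
          = v z * Real.cos z - v 0 * (Real.cos z * Real.cos z) := fun z => by ring
      simp only [this]
      rw [intervalIntegral.integral_sub (by apply Continuous.intervalIntegrable; fun_prop)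
        (by apply Continuous.intervalIntegrable; fun_prop), hcos,
        intervalIntegral.integral_const_mul, integral_cos_sq_period]
      ring
    have h2 := intervalIntegral.norm_integral_le_of_norm_le_const (a := 0) (b := 2 * Real.pi)
      (f := fun z => (v z - v 0 * Real.cos z) * Real.cos z) (C := 4 * Real.pi * r) (fun z hz => by
        rw [Set.uIoc_of_le Real.two_pi_pos.le] at hz
        rw [Real.norm_eq_abs, abs_mul]
        calc _ ≤ (4 * Real.pi * r) * 1 := mul_le_mul (key z ⟨hz.1.le, hz.2⟩).1
              (Real.abs_cos_le_one z) (abs_nonneg _) (by positivity)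
          _ = _ := mul_one _)
    rw [h1, Real.norm_eq_abs, abs_neg, abs_mul, abs_of_pos Real.pi_pos, sub_zero,
      abs_of_pos Real.two_pi_pos] at h2
    have hpi := Real.pi_pos
    have : |v 0| * Real.pi ≤ (8 * Real.pi * r) * Real.pi := by linarith
    exact le_of_mul_le_mul_right this hpi
  -- The errors add up to 4πr + 8πr = 12πr, and 12π < 39.
  have fin : ∀ x ∈ Set.Icc 0 (2 * Real.pi), |v x| ≤ 39 * r ∧ |v' x| ≤ 39 * r := by
    intro x hx
    obtain ⟨h1, h2⟩ := key x hx
    have hb : ∀ s : ℝ, |s| ≤ 1 → |v 0 * s| ≤ 8 * Real.pi * r := fun s hs => by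
      rw [abs_mul]
      calc |v 0| * |s| ≤ (8 * Real.pi * r) * 1 := mul_le_mul hv0 hs (abs_nonneg _) (by positivity)
        _ = _ := mul_one _
    have hc := abs_le.1 (hb _ (Real.abs_cos_le_one x))
    have hs := abs_le.1 (hb _ (Real.abs_sin_le_one x))
    have hpi : Real.pi * r ≤ 3.15 * r := mul_le_mul_of_nonneg_right Real.pi_lt_d2.le hr0
    rw [abs_le] at h1 h2
    exact ⟨abs_le.2 ⟨by linarith, by linarith⟩, abs_le.2 ⟨by linarith, by linarith⟩⟩
  have fin' : |v x| ≤ 39 * r ∧ |v' x| ≤ 39 * r := by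
    have hpp : Function.Periodic (fun x => (v x, v' x)) (2 * Real.pi) := fun y => by
      simp only [hp y, hp' y]
    obtain ⟨y, hy, hxy⟩ := hpp.exists_mem_Ico₀ Real.two_pi_pos x
    obtain ⟨e1, e2⟩ := Prod.mk.inj hxy
    rw [e1, e2]
    exact fin y ⟨hy.1, hy.2.le⟩
  refine ⟨fin'.1, fin'.2, ?_⟩
  have h1 := abs_le.1 (hr x)
  have h2 := abs_le.1 fin'.1
  exact abs_le.2 ⟨by linarith, by linarith⟩

/-- A common bound for `w`, `w_z`, `w_zz`. -/
def C2Bound (w : Profile) (m : ℝ) : Prop := ∀ x, |w x| ≤ m ∧ |w.dz x| ≤ m ∧ |w.dz.dz x| ≤ m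

/-- A common bound for `w - a cos` and its first two derivatives. -/
def C2Near (w : Profile) (a m : ℝ) : Prop := ∀ x, |w x - a * Real.cos x| ≤ m ∧
  |w.dz x + a * Real.sin x| ≤ m ∧ |w.dz.dz x + a * Real.cos x| ≤ m

/-- The quadratic terms of the profile equation. -/
def quadTerm (b k p₀ p₁ p₂ : ℝ) : ℝ :=
  (b + 1) / 2 * p₀ ^ 2 - k ^ 2 * p₀ * p₂ - (b - 1) / 2 * k ^ 2 * p₁ ^ 2

/-- The size of the coefficients in `quadTerm`. -/
def quadBound (b k : ℝ) : ℝ := |(b + 1) / 2| + k ^ 2 + |(b - 1) / 2 * k ^ 2|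

theorem quadBound_nonneg (b k : ℝ) : 0 ≤ quadBound b k := by unfold quadBound; positivity

theorem abs_quadTerm_sub_le (b k : ℝ) {p₀ p₁ p₂ q₀ q₁ q₂ m d : ℝ} (hp₀ : |p₀| ≤ m) (hp₁ : |p₁| ≤ m)
    (hp₂ : |p₂| ≤ m) (hq₀ : |q₀| ≤ m) (hq₁ : |q₁| ≤ m) (h₀ : |p₀ - q₀| ≤ d)
    (h₁ : |p₁ - q₁| ≤ d) (h₂ : |p₂ - q₂| ≤ d) :
    |quadTerm b k p₀ p₁ p₂ - quadTerm b k q₀ q₁ q₂| ≤ quadBound b k * (2 * m * d) := by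
  have hm : 0 ≤ m := (abs_nonneg _).trans hp₀
  have hd : 0 ≤ d := (abs_nonneg _).trans h₀
  have bil : ∀ s t s' t' : ℝ, |s| ≤ m → |t| ≤ m → |s'| ≤ d → |t'| ≤ d →
      |s * t' + t * s'| ≤ 2 * m * d := fun s t s' t' hs ht hs' ht' => by
    calc |s * t' + t * s'| ≤ |s| * |t'| + |t| * |s'| := by
          rw [← abs_mul, ← abs_mul]; exact abs_add_le _ _
      _ ≤ m * d + m * d := by gcongr
      _ = 2 * m * d := by ring
  have e : quadTerm b k p₀ p₁ p₂ - quadTerm b k q₀ q₁ q₂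
      = (b + 1) / 2 * (p₀ * (p₀ - q₀) + q₀ * (p₀ - q₀))
        - k ^ 2 * (q₀ * (p₂ - q₂) + p₂ * (p₀ - q₀))
        - (b - 1) / 2 * k ^ 2 * (p₁ * (p₁ - q₁) + q₁ * (p₁ - q₁)) := by
    unfold quadTerm; ring
  rw [e]
  have h1 := bil _ _ _ _ hp₀ hq₀ h₀ h₀
  have h2 := bil _ _ _ _ hq₀ hp₂ h₀ h₂
  have h3 := bil _ _ _ _ hp₁ hq₁ h₁ h₁
  calc _ ≤ |(b + 1) / 2 * (p₀ * (p₀ - q₀) + q₀ * (p₀ - q₀))|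
        + |k ^ 2 * (q₀ * (p₂ - q₂) + p₂ * (p₀ - q₀))|
        + |(b - 1) / 2 * k ^ 2 * (p₁ * (p₁ - q₁) + q₁ * (p₁ - q₁))| :=
        (abs_sub _ _).trans (add_le_add (abs_sub _ _) le_rfl)
    _ ≤ |(b + 1) / 2| * (2 * m * d) + k ^ 2 * (2 * m * d)
        + |(b - 1) / 2 * k ^ 2| * (2 * m * d) := by
        rw [abs_mul, abs_mul, abs_mul (_ * k ^ 2), abs_of_nonneg (sq_nonneg k)]
        gcongr
    _ = quadBound b k * (2 * m * d) := by unfold quadBound; ring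

theorem abs_quadTerm_le (b k : ℝ) {p₀ p₁ p₂ m : ℝ} (hp₀ : |p₀| ≤ m) (hp₁ : |p₁| ≤ m)
    (hp₂ : |p₂| ≤ m) : |quadTerm b k p₀ p₁ p₂| ≤ quadBound b k * (2 * m * m) := by
  have hm : 0 ≤ m := (abs_nonneg _).trans hp₀
  have h := abs_quadTerm_sub_le b k (q₀ := 0) (q₁ := 0) (q₂ := 0) hp₀ hp₁ hp₂ (by simpa) (by simpa)
    (d := m) (by simpa) (by simpa) (by simpa)
  simpa [quadTerm] using h

section

variable {b κ k c a : ℝ} {w : Profile}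

/-- At c = c₀ the linear part of the profile equation is a multiple of w + w''. The rest is a speed
correction and quadratic terms, hence small. -/
theorem IsWave.resonant_eq (hk : 0 < k) (h : IsWave b κ k c w) (z : ℝ) :
    κ / (1 + k ^ 2) * k ^ 2 * (w z + w.dz.dz z)
      = (c - κ / (1 + k ^ 2)) * (w z - k ^ 2 * w.dz.dz z)
        - quadTerm b k (w z) (w.dz z) (w.dz.dz z) := by
  have h1 := h.profile_eq z
  have h2 : κ = κ / (1 + k ^ 2) * (1 + k ^ 2) := by field_simp
  unfold quadTerm
  set c₀ := κ / (1 + k ^ 2)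
  rw [h2] at h1
  linear_combination h1

theorem integral_mul_cos (hamp : w.amplitude = a) :
    ∫ z in (0 : ℝ)..(2 * Real.pi), w z * Real.cos z = Real.pi * a := by
  rw [← hamp, Profile.amplitude]
  field_simp

/-- The operator 1 + ∂_z² is symmetric and annihilates the cosine. -/
theorem integral_resonant_mul_cos (w : Profile) :
    ∫ z in (0 : ℝ)..(2 * Real.pi), (w z + w.dz.dz z) * Real.cos z = 0 := by
  have h : ∀ x ∈ Set.uIcc 0 (2 * Real.pi), HasDerivAt
      (fun x => w.dz x * Real.cos x + w x * Real.sin x) ((w x + w.dz.dz x) * Real.cos x) x :=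
    fun x _ => (((w.dz.hasDerivAt x).mul (Real.hasDerivAt_cos x)).add
      ((w.hasDerivAt x).mul (Real.hasDerivAt_sin x))).congr_deriv (by ring)
  rw [intervalIntegral.integral_eq_sub_of_hasDerivAt h
    (((w.continuous.add w.dz.dz.continuous).mul Real.continuous_cos).intervalIntegrable _ _)]
  have hp := w.dz.periodic 0
  simp only [zero_add] at hp
  simp [hp]

/-- One step of a bootstrap. With w of size m, the resonant oscillator has forcing of size (|c − c₀|
+ m)m, and subtracting a cos z removes its resonant component. -/
theorem IsWave.near_of_bound (hκ : 0 < κ) (hk : 0 < k) (h : IsWave b κ k c w)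
    (hamp : w.amplitude = a) {m : ℝ} (hm : C2Bound w m) :
    C2Near w a (40 * ((|c - κ / (1 + k ^ 2)| * ((1 + k ^ 2) * m) + quadBound b k * (2 * m * m))
      / (κ / (1 + k ^ 2) * k ^ 2))) := by
  set c₀ := κ / (1 + k ^ 2) with hc₀
  have hc₀p : 0 < c₀ := by positivity
  set r := (|c - c₀| * ((1 + k ^ 2) * m) + quadBound b k * (2 * m * m)) / (c₀ * k ^ 2) with hr_def
  have hm0 : 0 ≤ m := (abs_nonneg _).trans (hm 0).1
  have hr : ∀ x, |w x + w.dz.dz x| ≤ r := fun x => by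
    obtain ⟨h1, h2, h3⟩ := hm x
    rw [hr_def, le_div_iff₀ (by positivity)]
    have h4 := h.resonant_eq hk x
    rw [← hc₀] at h4
    have h5 : |w x + w.dz.dz x| * (c₀ * k ^ 2) = |c₀ * k ^ 2 * (w x + w.dz.dz x)| := by
      rw [abs_mul _ (w x + w.dz.dz x), abs_of_pos (by positivity : 0 < c₀ * k ^ 2)]; ring
    rw [h5, h4]
    refine (abs_sub _ _).trans (add_le_add ?_ (abs_quadTerm_le b k h1 h2 h3))
    rw [abs_mul]
    gcongr
    calc |w x - k ^ 2 * w.dz.dz x| ≤ |w x| + |k ^ 2 * w.dz.dz x| := abs_sub _ _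
      _ ≤ m + k ^ 2 * m := by
        rw [abs_mul, abs_of_nonneg (sq_nonneg k)]
        gcongr
      _ = (1 + k ^ 2) * m := by ring
  have hosc := oscillator_bound (v := fun x => w x - a * Real.cos x)
    (v' := fun x => w.dz x + a * Real.sin x) (v'' := fun x => w.dz.dz x + a * Real.cos x)
    (fun x => ((w.hasDerivAt x).sub ((Real.hasDerivAt_cos x).const_mul a)).congr_deriv (by ring))
    (fun x => ((w.dz.hasDerivAt x).add ((Real.hasDerivAt_sin x).const_mul a)).congr_deriv (by ring))
    (fun x => by simp only [w.periodic x, Real.cos_add_two_pi])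
    (fun x => by simp only [w.dz.periodic x, Real.sin_add_two_pi])
    (by simp [Profile.dz_zero_of_even h.even]) (by
      have : ∀ z, (w z - a * Real.cos z) * Real.cos z
          = w z * Real.cos z - a * (Real.cos z * Real.cos z) := fun z => by ring
      simp only [this]
      have hw := w.continuous
      rw [intervalIntegral.integral_sub (by apply Continuous.intervalIntegrable; fun_prop)
        (by apply Continuous.intervalIntegrable; fun_prop), integral_mul_cos hamp,
        intervalIntegral.integral_const_mul, integral_cos_sq_period]
      ring)
    (r := r) (fun x => by
      have : w x - a * Real.cos x + (w.dz.dz x + a * Real.cos x) = w x + w.dz.dz x := by ring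
      rw [this]; exact hr x)
  have hr0 : 0 ≤ r := (abs_nonneg _).trans (hr 0)
  intro x
  obtain ⟨h1, h2, h3⟩ := hosc x
  exact ⟨by linarith, by linarith, h3⟩

theorem C2Near.bound {m : ℝ} (h : C2Near w a m) : C2Bound w (|a| + m) := fun x => by
  obtain ⟨h1, h2, h3⟩ := h x
  have hb : ∀ s : ℝ, |s| ≤ 1 → |a * s| ≤ |a| := fun s hs => by
    rw [abs_mul]
    calc |a| * |s| ≤ |a| * 1 := by gcongr
      _ = |a| := mul_one _
  have hc := abs_le.1 (hb _ (Real.abs_cos_le_one x))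
  have hs := abs_le.1 (hb _ (Real.abs_sin_le_one x))
  rw [abs_le] at h1 h2 h3
  exact ⟨abs_le.2 ⟨by linarith, by linarith⟩, abs_le.2 ⟨by linarith, by linarith⟩,
    abs_le.2 ⟨by linarith, by linarith⟩⟩

/-- Iterating m ↦ |a| + m/2 converges to its fixed point 2|a|. The iterates never exceed max(m,
2|a|), so the improvement is needed only below that level. -/
theorem C2Bound.of_halving {m : ℝ} (hm : C2Bound w m)
    (h : ∀ m' ≤ max m (2 * |a|), C2Bound w m' → C2Bound w (|a| + m' / 2)) :
    C2Bound w (2 * |a|) := by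
  have hind : ∀ n : ℕ, C2Bound w (2 * |a| + (max m (2 * |a|) - 2 * |a|) * (1 / 2) ^ n) := by
    intro n
    have h0 : 0 ≤ max m (2 * |a|) - 2 * |a| := sub_nonneg.2 (le_max_right _ _)
    induction n with
    | zero =>
      intro x
      obtain ⟨h1, h2, h3⟩ := hm x
      have := le_max_left m (2 * |a|)
      rw [pow_zero]
      exact ⟨by linarith, by linarith, by linarith⟩
    | succ n ih =>
      have hle : (1 / 2 : ℝ) ^ n ≤ 1 := pow_le_one₀ (by norm_num) (by norm_num)
      have := h _ (by nlinarith) ih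
      convert this using 1
      rw [pow_succ]; ring
  intro x
  have hlim : Filter.Tendsto
      (fun n : ℕ => 2 * |a| + (max m (2 * |a|) - 2 * |a|) * (1 / 2 : ℝ) ^ n) Filter.atTop
      (nhds (2 * |a|)) := by
    have := ((tendsto_pow_atTop_nhds_zero_of_lt_one (r := (1 / 2 : ℝ)) (by norm_num)
      (by norm_num)).const_mul (max m (2 * |a|) - 2 * |a|)).const_add (2 * |a|)
    simpa using this
  exact ⟨ge_of_tendsto' hlim fun n => (hind n x).1, ge_of_tendsto' hlim fun n => (hind n x).2.1,
    ge_of_tendsto' hlim fun n => (hind n x).2.2⟩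

/-- The resonant form of the equation is tested against cos z: w + w'' drops out, and w − k²w''
contributes (1+k²)πa. -/
theorem IsWave.speed_identity (hk : 0 < k) (h : IsWave b κ k c w)
    (hamp : w.amplitude = a) : (c - κ / (1 + k ^ 2)) * ((1 + k ^ 2) * (Real.pi * a))
      = ∫ z in (0 : ℝ)..(2 * Real.pi), quadTerm b k (w z) (w.dz z) (w.dz.dz z) * Real.cos z := by
  have hw := w.continuous
  have hw1 := w.dz.continuous
  have hw2 := w.dz.dz.continuous
  have e : ∀ z, quadTerm b k (w z) (w.dz z) (w.dz.dz z) * Real.cos z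
      = (c - κ / (1 + k ^ 2)) * (1 + k ^ 2) * (w z * Real.cos z)
        - ((c - κ / (1 + k ^ 2)) * k ^ 2 + κ / (1 + k ^ 2) * k ^ 2)
          * ((w z + w.dz.dz z) * Real.cos z) := fun z => by
    linear_combination Real.cos z * h.resonant_eq hk z
  simp only [e]
  rw [intervalIntegral.integral_sub (by apply Continuous.intervalIntegrable; fun_prop)
    (by apply Continuous.intervalIntegrable; fun_prop), intervalIntegral.integral_const_mul,
    intervalIntegral.integral_const_mul, integral_resonant_mul_cos, integral_mul_cos hamp]
  ring

/-- A quadratic expression in first harmonics contains only harmonics 0 and 2. This cancellation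
improves the speed estimate from order a to order a². -/
theorem integral_quadTerm_cos (b k a : ℝ) : ∫ z in (0 : ℝ)..(2 * Real.pi),
    quadTerm b k (a * Real.cos z) (-(a * Real.sin z)) (-(a * Real.cos z)) * Real.cos z = 0 := by
  have h : ∀ x ∈ Set.uIcc 0 (2 * Real.pi), HasDerivAt
      (fun x => ((b + 1) / 2 + k ^ 2) * a ^ 2 * (Real.sin x - Real.sin x ^ 3 / 3)
        - (b - 1) / 2 * k ^ 2 * a ^ 2 * (Real.sin x ^ 3 / 3))
      (quadTerm b k (a * Real.cos x) (-(a * Real.sin x)) (-(a * Real.cos x)) * Real.cos x) x :=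
    fun x _ => by
      have h1 := Real.hasDerivAt_sin x
      have h3 := (h1.pow 3).div_const 3
      refine (((h1.sub h3).const_mul (((b + 1) / 2 + k ^ 2) * a ^ 2)).sub
        (h3.const_mul ((b - 1) / 2 * k ^ 2 * a ^ 2))).congr_deriv ?_
      have hsc := Real.sin_sq_add_cos_sq x
      unfold quadTerm
      push_cast
      linear_combination ((b + 1) / 2 + k ^ 2) * a ^ 2 * Real.cos x * (-1 : ℝ) * hsc
  rw [intervalIntegral.integral_eq_sub_of_hasDerivAt h
    (by apply Continuous.intervalIntegrable; unfold quadTerm; fun_prop)]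
  simp

/-- Small waves are governed by their amplitude. -/
theorem wave_estimates (b : ℝ) {κ k : ℝ} (hκ : 0 < κ) (hk : 0 < k) :
    ∃ ε > 0, ∃ C > 0, ∀ (a c : ℝ) (w : Profile), IsWave b κ k c w → w.amplitude = a → a ≠ 0 →
      |a| < ε → NearBifurcation ε κ k c w →
      C2Bound w (2 * |a|) ∧ C2Near w a (C * a ^ 2) ∧ |c - κ / (1 + k ^ 2)| ≤ C * a ^ 2 := by
  set c₀ := κ / (1 + k ^ 2) with hc₀
  have hc₀p : 0 < c₀ := by positivity
  have hqn := quadBound_nonneg b k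
  set q := quadBound b k with hq
  have hA : 0 < c₀ * k ^ 2 := by positivity
  set C₁ := 40 * ((1 + k ^ 2) + 4 * q) / (c₀ * k ^ 2) with hC₁
  have hC₁p : 0 < C₁ := by positivity
  set C₂ := 40 * (32 * q + 8 * q) / (c₀ * k ^ 2) with hC₂
  have hC₂n : 0 ≤ C₂ := by positivity
  refine ⟨1 / (2 * C₁), by positivity, C₂ + 8 * q * C₂ + 1, by positivity, ?_⟩
  intro a c w hwave hamp ha hε hnear
  rw [NearBifurcation, ← hc₀] at hnear
  obtain ⟨hcε, hwε⟩ := hnear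
  rw [lt_div_iff₀ (by positivity)] at hcε hε
  have hb : C2Bound w (2 * |a|) := by
    have h0 : C2Bound w (1 / (2 * C₁)) := fun x =>
      ⟨(hwε x).1.le, (hwε x).2.1.le, (hwε x).2.2.le⟩
    refine h0.of_halving fun m hm hmb => ?_
    have hm0 : 0 ≤ m := (abs_nonneg _).trans (hmb 0).1
    have hm1 : m * C₁ ≤ 1 := by
      rcases le_max_iff.1 hm with h | h
      · rw [le_div_iff₀ (by positivity)] at h; linarith
      · nlinarith
    have hn := (hwave.near_of_bound hκ hk hamp hmb).bound
    refine fun x => ?_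
    -- `C₁` is chosen for this step: |c − c₀| ≤ 1/(2C₁) and m ≤ 1/C₁ bring the error below m/2.
    have hle : 40 * ((|c - c₀| * ((1 + k ^ 2) * m) + q * (2 * m * m)) / (c₀ * k ^ 2)) ≤ m / 2 := by
      rw [← mul_div_assoc, div_le_iff₀ hA]
      have e1 : C₁ * (c₀ * k ^ 2) = 40 * ((1 + k ^ 2) + 4 * q) := by rw [hC₁]; field_simp
      have h1 : C₁ * (|c - c₀| * (1 + k ^ 2) + 2 * q * m)
          ≤ 1 / 2 * (1 + k ^ 2) + 2 * q := by nlinarith [sq_nonneg k]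
      have h2 : C₁ * (40 * (|c - c₀| * (1 + k ^ 2) + 2 * q * m)) ≤ C₁ * (c₀ * k ^ 2 / 2) := by
        nlinarith [sq_nonneg k]
      have h3 := le_of_mul_le_mul_left h2 hC₁p
      nlinarith
    obtain ⟨h1, h2, h3⟩ := hn x
    exact ⟨by linarith, by linarith, by linarith⟩
  have hapos : 0 < |a| := abs_pos.2 ha
  have hpi := Real.pi_pos
  have hid := hwave.speed_identity hk hamp
  rw [← hc₀] at hid
  have hcosle : ∀ t s r : ℝ, |t| ≤ r → |s| ≤ 1 → |t * s| ≤ r := fun t s r ht hs => by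
    rw [abs_mul]
    calc |t| * |s| ≤ r * 1 := mul_le_mul ht hs (abs_nonneg _) ((abs_nonneg _).trans ht)
      _ = r := mul_one r
  have hspeed : ∀ B : ℝ, 0 ≤ B → |(c - c₀) * ((1 + k ^ 2) * (Real.pi * a))| ≤ 2 * Real.pi * (B * |a|) →
      |c - c₀| ≤ 2 * B := by
    intro B hB h
    rw [abs_mul, abs_mul, abs_mul, abs_of_pos hpi, abs_of_pos (by positivity : 0 < 1 + k ^ 2)] at h
    have h1 : |c - c₀| * (1 + k ^ 2) ≤ 2 * B := by
      have : (|c - c₀| * (1 + k ^ 2)) * (Real.pi * |a|) ≤ 2 * B * (Real.pi * |a|) := by linarith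
      exact le_of_mul_le_mul_right this (by positivity)
    nlinarith [abs_nonneg (c - c₀), sq_nonneg k, mul_nonneg (abs_nonneg (c - c₀)) (sq_nonneg k)]
  have hnr : C2Near w a (C₂ * a ^ 2) := by
    have hn := hwave.near_of_bound hκ hk hamp hb
    have hle : 40 * ((|c - c₀| * ((1 + k ^ 2) * (2 * |a|)) + q * (2 * (2 * |a|) * (2 * |a|)))
        / (c₀ * k ^ 2)) ≤ C₂ * a ^ 2 := by
      -- A crude speed bound of order a already makes the distance of w to a cos z quadratic in a.
      have hc1' : |c - c₀| * (1 + k ^ 2) ≤ 2 * (8 * q * |a|) := by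
        have h1 : |(c - c₀) * ((1 + k ^ 2) * (Real.pi * a))| ≤ 2 * Real.pi * (8 * q * |a| * |a|) := by
          rw [hid]
          refine (abs_integral_period_le (r := q * (2 * (2 * |a|) * (2 * |a|))) fun x =>
            hcosle _ _ _ (abs_quadTerm_le b k (hb x).1 (hb x).2.1 (hb x).2.2)
              (Real.abs_cos_le_one x)).trans ?_
          apply le_of_eq; ring
        rw [abs_mul, abs_mul, abs_mul, abs_of_pos hpi,
          abs_of_pos (by positivity : 0 < 1 + k ^ 2)] at h1
        have : (|c - c₀| * (1 + k ^ 2)) * (Real.pi * |a|) ≤ 2 * (8 * q * |a|) * (Real.pi * |a|) := by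
          linarith
        exact le_of_mul_le_mul_right this (by positivity)
      have hX : 40 * (|c - c₀| * ((1 + k ^ 2) * (2 * |a|)) + q * (2 * (2 * |a|) * (2 * |a|)))
          ≤ 40 * (32 * q + 8 * q) * a ^ 2 := by
        rw [← sq_abs a]
        nlinarith
      calc _ = 40 * (|c - c₀| * ((1 + k ^ 2) * (2 * |a|)) + q * (2 * (2 * |a|) * (2 * |a|)))
            / (c₀ * k ^ 2) := mul_div_assoc' _ _ _
        _ ≤ 40 * (32 * q + 8 * q) * a ^ 2 / (c₀ * k ^ 2) := div_le_div_of_nonneg_right hX hA.le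
        _ = C₂ * a ^ 2 := by rw [hC₂, mul_div_right_comm]
    intro x
    obtain ⟨h1, h2, h3⟩ := hn x
    exact ⟨h1.trans hle, h2.trans hle, h3.trans hle⟩
  have ha2 : |a| * |a| = a ^ 2 := by rw [← sq, sq_abs]
  -- The quadratic terms at a cos z do not contribute to the speed identity. Their difference from
  -- those at w is of size |a| · a², and division by |a| leaves a².
  have hc2 : |c - c₀| ≤ 2 * (4 * q * C₂ * a ^ 2) := by
    apply hspeed _ (by positivity)
    have hw := w.continuous
    have hw1 := w.dz.continuous
    have hw2 := w.dz.dz.continuous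
    have e : (c - c₀) * ((1 + k ^ 2) * (Real.pi * a)) = ∫ z in (0 : ℝ)..(2 * Real.pi),
        (quadTerm b k (w z) (w.dz z) (w.dz.dz z)
          - quadTerm b k (a * Real.cos z) (-(a * Real.sin z)) (-(a * Real.cos z))) * Real.cos z := by
      have e' : ∀ z, (quadTerm b k (w z) (w.dz z) (w.dz.dz z)
          - quadTerm b k (a * Real.cos z) (-(a * Real.sin z)) (-(a * Real.cos z))) * Real.cos z
          = quadTerm b k (w z) (w.dz z) (w.dz.dz z) * Real.cos z
          - quadTerm b k (a * Real.cos z) (-(a * Real.sin z)) (-(a * Real.cos z)) * Real.cos z :=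
        fun z => sub_mul _ _ _
      simp only [e']
      rw [intervalIntegral.integral_sub
        (by apply Continuous.intervalIntegrable; unfold quadTerm; fun_prop)
        (by apply Continuous.intervalIntegrable; unfold quadTerm; fun_prop),
        integral_quadTerm_cos, hid, sub_zero]
    rw [e]
    refine (abs_integral_period_le (r := q * (2 * (2 * |a|) * (C₂ * a ^ 2))) fun x =>
      hcosle _ _ _ ?_ (Real.abs_cos_le_one x)).trans ?_
    · obtain ⟨h1, h2, h3⟩ := hnr x
      have hab : ∀ s : ℝ, |s| ≤ 1 → |a * s| ≤ 2 * |a| := fun s hs => by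
        rw [abs_mul]; nlinarith
      refine abs_quadTerm_sub_le b k (hb x).1 (hb x).2.1 (hb x).2.2
        (hab _ (Real.abs_cos_le_one x)) (by rw [abs_neg]; exact hab _ (Real.abs_sin_le_one x))
        h1 (by rwa [sub_neg_eq_add]) (by rwa [sub_neg_eq_add])
    · apply le_of_eq; ring
  refine ⟨hb, fun x => ?_, ?_⟩
  · obtain ⟨h1, h2, h3⟩ := hnr x
    have hle : C₂ * a ^ 2 ≤ (C₂ + 8 * q * C₂ + 1) * a ^ 2 := by
      apply mul_le_mul_of_nonneg_right _ (sq_nonneg a)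
      have : 0 ≤ 8 * q * C₂ := by positivity
      linarith
    exact ⟨h1.trans hle, h2.trans hle, h3.trans hle⟩
  · refine hc2.trans ?_
    have h1 : 0 ≤ C₂ * a ^ 2 := by positivity
    nlinarith [sq_nonneg a]

end

/-! ### Profiles on the circle -/

theorem Profile.onTorus_coe (w : Profile) (x : ℝ) : w.onTorus (x : Torus) = (w x : ℂ) := rfl

theorem Profile.hasTorusDeriv (w : Profile) : HasTorusDeriv w.onTorus w.dz.onTorus :=
  fun x => (w.hasDerivAt x).ofReal_comp

theorem Profile.norm_onTorus_le (w : Profile) {m : ℝ} (h : ∀ x, |w x| ≤ m) : ‖w.onTorus‖ ≤ m := by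
  rw [ContinuousMap.norm_le _ ((abs_nonneg _).trans (h 0))]
  intro x
  induction x using QuotientAddGroup.induction_on with
  | H x => exact (Complex.norm_real (w x)).trans_le (h x)

theorem fc_conj (φ : C(Torus, ℂ)) (hφ : ∀ x, (starRingEnd ℂ) (φ x) = φ x) (n : ℤ) :
    (starRingEnd ℂ) (fc φ n) = fc φ (-n) := by
  rw [fc, fc, fourierCoeff, fourierCoeff, ← integral_conj]
  congr 1
  ext x
  simp only [smul_eq_mul, map_mul, hφ, neg_neg]
  rw [fourier_neg, Complex.conj_conj]

theorem fc_even (φ : C(Torus, ℂ)) (hφ : ∀ x, φ (-x) = φ x) (n : ℤ) : fc φ (-n) = fc φ n := by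
  rw [fc, fc, fourierCoeff, fourierCoeff, ← integral_neg_eq_self]
  congr 1
  ext x
  rw [hφ, neg_neg]
  congr 1
  rw [fourier_apply, fourier_apply]
  simp

theorem Profile.conj_onTorus (w : Profile) (x : Torus) :
    (starRingEnd ℂ) (w.onTorus x) = w.onTorus x := by
  induction x using QuotientAddGroup.induction_on with
  | H x => exact Complex.conj_ofReal _

theorem Profile.onTorus_neg {w : Profile} (hw : Function.Even w) (x : Torus) :
    w.onTorus (-x) = w.onTorus x := by
  induction x using QuotientAddGroup.induction_on with
  | H x =>
    change ((w (-x) : ℝ) : ℂ) = ((w x : ℝ) : ℂ)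
    rw [hw x]

theorem Profile.fc_neg {w : Profile} (hw : Function.Even w) (n : ℤ) : fc w.onTorus (-n) = fc w.onTorus n :=
  fc_even _ (Profile.onTorus_neg hw) n

theorem Profile.conj_fc {w : Profile} (hw : Function.Even w) (n : ℤ) : (starRingEnd ℂ) (fc w.onTorus n) = fc w.onTorus n := by
  rw [fc_conj _ w.conj_onTorus, Profile.fc_neg hw]

theorem Profile.fc_dz_neg {w : Profile} (hw : Function.Even w) (n : ℤ) : fc w.dz.onTorus (-n) = -fc w.dz.onTorus n := by
  rw [w.hasTorusDeriv.fc_eq, w.hasTorusDeriv.fc_eq, Profile.fc_neg hw]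
  push_cast
  ring

theorem Profile.conj_fc_dz {w : Profile} (hw : Function.Even w) (n : ℤ) :
    (starRingEnd ℂ) (fc w.dz.onTorus n) = -fc w.dz.onTorus n := by
  rw [fc_conj _ w.dz.conj_onTorus, Profile.fc_dz_neg hw]

theorem Profile.fc_dz_dz_neg {w : Profile} (hw : Function.Even w) (n : ℤ) : fc w.dz.dz.onTorus (-n) = fc w.dz.dz.onTorus n := by
  rw [w.dz.hasTorusDeriv.fc_eq, w.dz.hasTorusDeriv.fc_eq, Profile.fc_dz_neg hw]
  push_cast
  ring

theorem Profile.conj_fc_dz_dz {w : Profile} (hw : Function.Even w) (n : ℤ) :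
    (starRingEnd ℂ) (fc w.dz.dz.onTorus n) = fc w.dz.dz.onTorus n := by
  rw [fc_conj _ w.dz.dz.conj_onTorus, Profile.fc_dz_dz_neg hw]

theorem Profile.fc_dz_dz (w : Profile) (n : ℤ) :
    fc w.dz.dz.onTorus n = -(n : ℂ) ^ 2 * fc w.onTorus n := by
  rw [w.dz.hasTorusDeriv.fc_eq, w.hasTorusDeriv.fc_eq]
  linear_combination (n : ℂ) ^ 2 * fc w.onTorus n * Complex.I_sq

theorem Profile.fc_one {w : Profile} (hw : Function.Even w) :
    fc w.onTorus 1 = ((w.amplitude / 2 : ℝ) : ℂ) := by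
  have key : ∀ n : ℤ, fc w.onTorus n = 1 / (2 * Real.pi) *
      ∫ x in (0 : ℝ)..(2 * Real.pi), fourier (-n) (x : Torus) * ((w x : ℝ) : ℂ) := by
    intro n
    rw [fc, fourierCoeff_eq_intervalIntegral _ _ 0, zero_add]
    simp [Complex.real_smul, Profile.onTorus_coe]
  have hcont : ∀ n : ℤ, IntervalIntegrable
      (fun x : ℝ => fourier (-n) (x : Torus) * ((w x : ℝ) : ℂ)) volume 0 (2 * Real.pi) := by
    intro n
    apply Continuous.intervalIntegrable
    exact ((fourier (-n)).continuous.comp (AddCircle.continuous_mk' _)).mul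
      (Complex.continuous_ofReal.comp w.continuous)
  have h2 : fc w.onTorus 1 + fc w.onTorus (-1) = ((w.amplitude : ℝ) : ℂ) := by
    rw [key, key, ← mul_add, ← intervalIntegral.integral_add (hcont 1) (hcont (-1)),
      Profile.amplitude]
    have : ∀ x : ℝ, fourier (-1) (x : Torus) * ((w x : ℝ) : ℂ)
        + fourier (- -1) (x : Torus) * ((w x : ℝ) : ℂ) = ((2 * (w x * Real.cos x) : ℝ) : ℂ) := by
      intro x
      have hpi : (Real.pi : ℂ) ≠ 0 := by exact_mod_cast Real.pi_ne_zero
      rw [fourier_coe_apply, fourier_coe_apply]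
      push_cast
      rw [Complex.cos]
      have e1 : 2 * (Real.pi : ℂ) * Complex.I * -1 * x / (2 * Real.pi) = -(x : ℂ) * Complex.I := by
        field_simp
      have e2 : 2 * (Real.pi : ℂ) * Complex.I * 1 * x / (2 * Real.pi) = (x : ℂ) * Complex.I := by
        field_simp
      rw [e1, e2]
      ring
    simp only [this]
    rw [intervalIntegral.integral_ofReal, intervalIntegral.integral_const_mul]
    push_cast
    ring
  rw [Profile.fc_neg hw] at h2
  push_cast
  linear_combination h2 / 2

/-! ### The unperturbed operator and the perturbation -/

/-- The diagonal part of the pencil. -/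
def opTheta {k : ℝ} (hk : 0 < k) (κ : ℝ) : L2 →L[ℂ] L2 :=
  ((κ / (1 + k ^ 2) : ℝ) : ℂ) • ContinuousLinearMap.id ℂ L2 - (κ : ℂ) • (opJL hk ∘L opS)

/-- The symbol of `opTheta` on functions of mean zero. -/
def theta (κ k : ℝ) (n : ℤ) : ℝ := κ / (1 + k ^ 2) - κ / (1 + k ^ 2 * n ^ 2)

/-- The symbol of `opN`. -/
def symN (k : ℝ) (n : ℤ) : ℝ := 1 / (n ^ 2 * (1 + k ^ 2 * n ^ 2))

/-- The perturbation of `opTheta` in the pencil. -/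
def opB {k : ℝ} (hk : 0 < k) (b κ lam c : ℝ) (w : Profile) : L2 →L[ℂ] L2 :=
  ((c - κ / (1 + k ^ 2) : ℝ) : ℂ) • ContinuousLinearMap.id ℂ L2 + (lam : ℂ) • opN hk
    + opLL hk b w.onTorus w.dz.onTorus w.dz.dz.onTorus

/-- A small perturbation with the symmetries of the problem. -/
structure IsPert (B : L2 →L[ℂ] L2) (η : ℝ) : Prop where
  bound : ∀ f, ‖B f‖ ≤ η * ‖f‖
  zero : ∀ f, coeff 0 f = 0 → coeff 0 (B f) = 0
  conj : ∀ f, conjL (B f) = B (conjL f)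
  refl : ∀ f, reflL (B f) = B (reflL f)

section

variable {k : ℝ} (hk : 0 < k)

theorem opHat_eq (b κ lam c : ℝ) (w : Profile) (f : L2) :
    opHat hk b κ lam c w.onTorus w.dz.onTorus w.dz.dz.onTorus f
      = opTheta hk κ f + opB hk b κ lam c w f := by
  simp only [opHat_apply, opTheta, opB, add_apply, sub_apply, smul_apply,
    ContinuousLinearMap.comp_apply, ContinuousLinearMap.id_apply]
  push_cast
  module

theorem opB_apply (b κ lam c : ℝ) (w : Profile) (f : L2) : opB hk b κ lam c w f
    = ((c - κ / (1 + k ^ 2) : ℝ) : ℂ) • f + (lam : ℂ) • opN hk f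
      + opLL hk b w.onTorus w.dz.onTorus w.dz.dz.onTorus f := rfl

theorem opB_eq_add_opN (b κ lam c : ℝ) (w : Profile) (f : L2) :
    opB hk b κ lam c w f = opB hk b κ 0 c w f + (lam : ℂ) • opN hk f := by
  rw [opB_apply, opB_apply]
  simp only [Complex.ofReal_zero, zero_smul]
  abel

theorem coeff_opTheta (κ : ℝ) {f : L2} (hf : coeff 0 f = 0) (n : ℤ) :
    coeff n (opTheta hk κ f) = theta κ k n * coeff n f := by
  simp only [opTheta, sub_apply, smul_apply, ContinuousLinearMap.comp_apply,
    ContinuousLinearMap.id_apply, map_sub, map_smul, coeff_opJL, coeff_opS, smul_eq_mul, theta]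
  rcases eq_or_ne n 0 with rfl | hn
  · simp [hf]
  · have h1 : (n : ℂ) ≠ 0 := by exact_mod_cast hn
    have h2 := one_add_sq_ne_zero k n
    have h3 := one_add_sq_ne_zero k 1
    push_cast at h3 ⊢
    field_simp

theorem coeff_opN (f : L2) (n : ℤ) : coeff n (opN hk f) = symN k n * coeff n f := by
  rw [opN_apply, map_neg, coeff_opJL, coeff_opS, coeff_opS, coeff_opS, symN]
  rcases eq_or_ne n 0 with rfl | hn
  · simp
  · have h1 : (n : ℂ) ≠ 0 := by exact_mod_cast hn
    have h2 := one_add_sq_ne_zero k n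
    push_cast
    field_simp
    rw [Complex.I_sq]
    ring

theorem symN_nonneg (n : ℤ) : 0 ≤ symN k n := by unfold symN; positivity

theorem symN_le_one (n : ℤ) : symN k n ≤ 1 := by
  unfold symN
  rcases eq_or_ne n 0 with rfl | hn
  · simp
  · have h : (1 : ℝ) ≤ (n : ℝ) ^ 2 := by
      exact_mod_cast Int.add_one_le_iff.2 (sq_pos_of_ne_zero hn)
    rw [div_le_one (by positivity)]
    nlinarith [mul_nonneg (sq_nonneg k) (sq_nonneg (n : ℝ))]

theorem norm_opN_le (f : L2) : ‖opN hk f‖ ≤ ‖f‖ := by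
  refine (norm_le_of_coeff (f := f) zero_le_one fun n => ?_).trans_eq (one_mul _)
  rw [coeff_opN, norm_mul, Complex.norm_real, Real.norm_of_nonneg (symN_nonneg n)]
  exact mul_le_mul_of_nonneg_right (symN_le_one n) (norm_nonneg _)

theorem conj_symbol (n : ℤ) : (starRingEnd ℂ) ((Complex.I * n) / (1 + (k : ℂ) ^ 2 * (n : ℂ) ^ 2))
    = -((Complex.I * n) / (1 + (k : ℂ) ^ 2 * (n : ℂ) ^ 2)) := by
  simp [neg_div]

theorem conjL_opJL (f : L2) : conjL (opJL hk f) = -opJL hk (conjL f) := ext_coeff fun n => by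
  rw [coeff_conjL, coeff_opJL, map_neg, coeff_opJL, coeff_conjL, map_mul, conj_symbol, neg_mul]

theorem reflL_opJL (f : L2) : reflL (opJL hk f) = -opJL hk (reflL f) := ext_coeff fun n => by
  rw [coeff_reflL, coeff_opJL, map_neg, coeff_opJL, coeff_reflL]
  push_cast
  rw [neg_sq]
  ring

theorem conjL_opJdL (f : L2) : conjL (opJdL hk f) = opJdL hk (conjL f) := ext_coeff fun n => by
  rw [coeff_conjL, coeff_opJdL, coeff_opJdL, coeff_conjL]
  simp [mul_pow]

theorem reflL_opJdL (f : L2) : reflL (opJdL hk f) = opJdL hk (reflL f) := ext_coeff fun n => by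
  rw [coeff_reflL, coeff_opJdL, coeff_opJdL, coeff_reflL]
  push_cast
  ring

theorem conjL_opN (f : L2) : conjL (opN hk f) = opN hk (conjL f) := ext_coeff fun n => by
  rw [coeff_conjL, coeff_opN, coeff_opN, coeff_conjL, map_mul, Complex.conj_ofReal]

theorem reflL_opN (f : L2) : reflL (opN hk f) = opN hk (reflL f) := ext_coeff fun n => by
  rw [coeff_reflL, coeff_opN, coeff_opN, coeff_reflL]
  simp [symN]

/-- The constant in the bound of `opLL`. -/
def boundLL (b k : ℝ) : ℝ := (|b + 1| + k ^ 2) / k ^ 2 + |b - 2| + 1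

theorem boundLL_pos (b k : ℝ) : 0 < boundLL b k := by unfold boundLL; positivity

theorem norm_opLL_le (b : ℝ) {u₀ u₁ u₂ : C(Torus, ℂ)} {m : ℝ} (h₀ : ‖u₀‖ ≤ m) (h₁ : ‖u₁‖ ≤ m)
    (h₂ : ‖u₂‖ ≤ m) (f : L2) : ‖opLL hk b u₀ u₁ u₂ f‖ ≤ boundLL b k * m * ‖f‖ := by
  have hm : 0 ≤ m := (norm_nonneg _).trans h₀
  have hmul : ∀ (u : C(Torus, ℂ)) (g : L2), ‖u‖ ≤ m → ‖g‖ ≤ ‖f‖ → ‖mulC u g‖ ≤ m * ‖f‖ :=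
    fun u g hu hg => (norm_mulC_le u g).trans (mul_le_mul hu hg (norm_nonneg _) hm)
  have hJ : ∀ (g : L2) (s : ℝ), ‖g‖ ≤ s → ‖opJL hk g‖ ≤ s / k ^ 2 := fun g s hg =>
    (norm_opJL_le hk g).trans (by rw [one_div, inv_mul_eq_div]; gcongr)
  have hJd : ∀ (g : L2) (s : ℝ), ‖g‖ ≤ s → ‖opJdL hk g‖ ≤ s / k ^ 2 := fun g s hg =>
    (norm_opJdL_le hk g).trans (by rw [one_div, inv_mul_eq_div]; gcongr)
  have hk2 : 0 < k ^ 2 := by positivity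
  have e1 : ‖opJL hk (((b + 1 : ℝ) : ℂ) • mulC u₀ (opS f) - ((k ^ 2 : ℝ) : ℂ) • mulC u₂ (opS f))‖
      ≤ (|b + 1| * (m * ‖f‖) + k ^ 2 * (m * ‖f‖)) / k ^ 2 := by
    apply hJ
    refine (norm_sub_le _ _).trans (add_le_add ?_ ?_)
    · rw [norm_smul, Complex.norm_real, Real.norm_eq_abs]
      gcongr
      exact hmul _ _ h₀ (norm_opS_le f)
    · rw [norm_smul, Complex.norm_real, Real.norm_of_nonneg hk2.le]
      gcongr
      exact hmul _ _ h₂ (norm_opS_le f)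
  have e2 : ‖((k ^ 2 * (b - 2) : ℝ) : ℂ) • opJL hk (mulC u₁ f)‖ ≤ |b - 2| * (m * ‖f‖) := by
    rw [norm_smul, Complex.norm_real, Real.norm_eq_abs, abs_mul, abs_of_pos hk2]
    have := hJ _ _ (hmul _ _ h₁ le_rfl)
    rw [le_div_iff₀ hk2] at this
    calc _ = |b - 2| * (‖opJL hk (mulC u₁ f)‖ * k ^ 2) := by ring
      _ ≤ _ := by gcongr
  have e3 : ‖((k ^ 2 : ℝ) : ℂ) • opJdL hk (mulC u₀ f)‖ ≤ m * ‖f‖ := by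
    rw [norm_smul, Complex.norm_real, Real.norm_of_nonneg hk2.le]
    have := hJd _ _ (hmul _ _ h₀ le_rfl)
    rw [le_div_iff₀ hk2] at this
    linarith
  rw [opLL_apply]
  calc _ ≤ _ + _ + _ := norm_add₃_le
    _ ≤ (|b + 1| * (m * ‖f‖) + k ^ 2 * (m * ‖f‖)) / k ^ 2 + |b - 2| * (m * ‖f‖) + m * ‖f‖ := by
      rw [norm_neg]
      gcongr
    _ = boundLL b k * m * ‖f‖ := by unfold boundLL; ring

/-- `opJL`, `opS` and multiplication by w_z each change sign under both symmetries, while w, w_zz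
and `opJdL` do not. In every term the sign-changing factors occur an even number of times. -/
theorem isPert_opB (b κ lam c : ℝ) {w : Profile} (hw : Function.Even w) {m η : ℝ}
    (hm : C2Bound w m) (hη : |c - κ / (1 + k ^ 2)| + |lam| + boundLL b k * m ≤ η) :
    IsPert (opB hk b κ lam c w) η where
  bound f := by
    have h1 := norm_opLL_le hk b (w.norm_onTorus_le fun x => (hm x).1)
      (w.dz.norm_onTorus_le fun x => (hm x).2.1) (w.dz.dz.norm_onTorus_le fun x => (hm x).2.2) f
    have h2 : ‖(lam : ℂ) • opN hk f‖ ≤ |lam| * ‖f‖ := by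
      rw [norm_smul, Complex.norm_real, Real.norm_eq_abs]
      gcongr
      exact norm_opN_le hk f
    have h3 : ‖((c - κ / (1 + k ^ 2) : ℝ) : ℂ) • f‖ ≤ |c - κ / (1 + k ^ 2)| * ‖f‖ := by
      rw [norm_smul, Complex.norm_real, Real.norm_eq_abs]
    rw [opB_apply]
    calc _ ≤ _ + _ + _ := norm_add₃_le
      _ ≤ |c - κ / (1 + k ^ 2)| * ‖f‖ + |lam| * ‖f‖ + boundLL b k * m * ‖f‖ := by gcongr
      _ = (|c - κ / (1 + k ^ 2)| + |lam| + boundLL b k * m) * ‖f‖ := by ring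
      _ ≤ η * ‖f‖ := by gcongr
  zero f hf := by
    simp [opB_apply, opLL_apply, coeff_opN, coeff_opJL, coeff_opJdL, hf]
  conj f := by
    have e0 := conjL_mulC (φ := w.onTorus) (s := 1) (fun n => by rw [Profile.conj_fc hw, one_mul])
    have e1 := conjL_mulC (φ := w.dz.onTorus) (s := -1) (fun n => by
      rw [Profile.conj_fc_dz hw, neg_one_mul])
    have e2 := conjL_mulC (φ := w.dz.dz.onTorus) (s := 1) (fun n => by
      rw [Profile.conj_fc_dz_dz hw, one_mul])
    rw [opB_apply, opB_apply, opLL_apply, opLL_apply]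
    simp only [map_add, map_sub, map_neg, ContinuousLinearMap.map_smulₛₗ, Complex.conj_ofReal, conjL_opN,
      conjL_opJL, conjL_opJdL, e0, e1, e2, conjL_opS, map_smul, one_smul]
    module
  refl f := by
    have e0 := reflL_mulC (φ := w.onTorus) (s := 1) (fun n => by rw [Profile.fc_neg hw, one_mul])
    have e1 := reflL_mulC (φ := w.dz.onTorus) (s := -1) (fun n => by
      rw [Profile.fc_dz_neg hw, neg_one_mul])
    have e2 := reflL_mulC (φ := w.dz.dz.onTorus) (s := 1) (fun n => by
      rw [Profile.fc_dz_dz_neg hw, one_mul])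
    rw [opB_apply, opB_apply, opLL_apply, opLL_apply]
    simp only [map_add, map_sub, map_neg, map_smul, reflL_opN,
      reflL_opJL, reflL_opJdL, e0, e1, e2, reflL_opS, one_smul]
    module

/-! ### The kernel generated by translations -/

/-- The vector `cos z`. -/
def cosV : L2 := (1 / 2 : ℂ) • (expL2 1 + expL2 (-1))

/-- The vector `- sin z`. -/
def sinV : L2 := (Complex.I / 2) • (expL2 1 - expL2 (-1))

theorem coeff_cosV (n : ℤ) :
    coeff n cosV = if n = 1 then 1 / 2 else if n = -1 then 1 / 2 else 0 := by
  rw [cosV, map_smul, map_add, coeff_expL2, coeff_expL2, smul_eq_mul]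
  by_cases h1 : n = 1
  · simp [h1]
  · by_cases h2 : n = -1 <;> simp [h1, h2]

theorem coeff_sinV (n : ℤ) :
    coeff n sinV = if n = 1 then Complex.I / 2 else if n = -1 then -(Complex.I / 2) else 0 := by
  rw [sinV, map_smul, map_sub, coeff_expL2, coeff_expL2, smul_eq_mul]
  by_cases h1 : n = 1
  · simp [h1]
  · by_cases h2 : n = -1 <;> simp [h1, h2]

theorem norm_cosV_le : ‖cosV‖ ≤ 1 := by
  rw [cosV, norm_smul]
  have := norm_add_le (expL2 1) (expL2 (-1))
  rw [norm_expL2, norm_expL2] at this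
  norm_num
  linarith

theorem norm_sinV_le : ‖sinV‖ ≤ 1 := by
  rw [sinV, norm_smul]
  have := norm_sub_le (expL2 1) (expL2 (-1))
  rw [norm_expL2, norm_expL2] at this
  norm_num
  linarith

/-- The kernel element `ψ = - w_zz / a` of the pencil at `ℓ = 0`. -/
def kerV (a : ℝ) (w : Profile) : L2 := (-(a : ℂ)⁻¹) • toL2 w.dz.dz.onTorus

/-- Translation invariance: differentiating the profile equation shows that w_z is in the kernel of
𝒜 at ℓ = 0, and in the variable f = ∂_z V this vector is w_zz. -/
theorem opTheta_add_opB_kerV {b κ c : ℝ} {w : Profile} (h : IsWave b κ k c w) (a : ℝ) :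
    opTheta hk κ (kerV a w) + opB hk b κ 0 c w (kerV a w) = 0 := by
  rw [← opHat_eq, kerV, map_smul]
  have key : opHat hk b κ 0 c w.onTorus w.dz.onTorus w.dz.dz.onTorus (toL2 w.dz.dz.onTorus) = 0 := by
    have hS : opS (toL2 w.dz.dz.onTorus) = toL2 w.dz.onTorus := ext_coeff fun n => by
      rw [coeff_opS, coeff_toL2, coeff_toL2, w.dz.hasTorusDeriv.fc_eq]
      rcases eq_or_ne n 0 with rfl | hn
      · rw [w.hasTorusDeriv.fc_eq]; simp
      · have h1 : (n : ℂ) ≠ 0 := by exact_mod_cast hn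
        field_simp
    have hE : ((κ - c : ℝ) : ℂ) • w.onTorus + ((c * k ^ 2 : ℝ) : ℂ) • w.dz.dz.onTorus
        + (((b + 1) / 2 : ℝ) : ℂ) • (w.onTorus * w.onTorus)
        - ((k ^ 2 : ℝ) : ℂ) • (w.onTorus * w.dz.dz.onTorus)
        - (((b - 1) / 2 * k ^ 2 : ℝ) : ℂ) • (w.dz.onTorus * w.dz.onTorus) = 0 := by
      ext x
      induction x using QuotientAddGroup.induction_on with
      | H x =>
        have := congrArg (fun t : ℝ => (t : ℂ)) (h.profile_eq x)
        push_cast at this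
        change ((κ - c : ℝ) : ℂ) * ((w x : ℝ) : ℂ) + ((c * k ^ 2 : ℝ) : ℂ) * ((w.dz.dz x : ℝ) : ℂ)
          + (((b + 1) / 2 : ℝ) : ℂ) * (((w x : ℝ) : ℂ) * ((w x : ℝ) : ℂ))
          - ((k ^ 2 : ℝ) : ℂ) * (((w x : ℝ) : ℂ) * ((w.dz.dz x : ℝ) : ℂ))
          - (((b - 1) / 2 * k ^ 2 : ℝ) : ℂ) * (((w.dz x : ℝ) : ℂ) * ((w.dz x : ℝ) : ℂ)) = 0
        push_cast
        linear_combination this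
    apply ext_coeff
    intro n
    have hEn := congrArg (fun φ => fc φ n) hE
    have h0 : fc (0 : C(Torus, ℂ)) n = 0 := by
      have := fc_smul 0 (0 : C(Torus, ℂ)) n
      simpa using this
    simp only [fc_add, fc_sub, fc_smul, h0] at hEn
    have d1 := (w.hasTorusDeriv.mul w.hasTorusDeriv).fc_eq n
    have d2 := (w.dz.hasTorusDeriv.mul w.dz.hasTorusDeriv).fc_eq n
    have d3 := w.hasTorusDeriv.fc_eq n
    have d4 := w.dz.hasTorusDeriv.fc_eq n
    rw [fc_add, mul_comm w.dz.onTorus w.onTorus] at d1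
    rw [fc_add, mul_comm w.dz.dz.onTorus w.dz.onTorus] at d2
    have hne := one_add_sq_ne_zero k n
    rw [opHat_apply, opLL_apply, hS]
    simp only [mulC_toL2, map_add, map_sub, map_neg, map_smul, coeff_opJL, coeff_opJdL, coeff_toL2,
      smul_eq_mul, Complex.ofReal_zero, zero_smul, map_zero, mul_comm w.dz.dz.onTorus w.dz.onTorus]
    set W := fc w.onTorus n
    set W1 := fc w.dz.onTorus n
    set W2 := fc w.dz.dz.onTorus n
    set P := fc (w.onTorus * w.onTorus) n
    set P1 := fc (w.onTorus * w.dz.onTorus) n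
    set P2 := fc (w.onTorus * w.dz.dz.onTorus) n
    set Q := fc (w.dz.onTorus * w.dz.onTorus) n
    set Q1 := fc (w.dz.onTorus * w.dz.dz.onTorus) n
    have hI := Complex.I_sq
    have hj : Complex.I * n / (1 + (k : ℂ) ^ 2 * (n : ℂ) ^ 2) * (1 + (k : ℂ) ^ 2 * (n : ℂ) ^ 2)
        = Complex.I * n := div_mul_cancel₀ _ hne
    rw [show (Complex.I * n) ^ 2 / (1 + (k : ℂ) ^ 2 * (n : ℂ) ^ 2)
      = Complex.I * n * (Complex.I * n / (1 + (k : ℂ) ^ 2 * (n : ℂ) ^ 2)) by ring]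
    set j := Complex.I * n / (1 + (k : ℂ) ^ 2 * (n : ℂ) ^ 2)
    push_cast at hEn ⊢
    -- The profile equation acted on by ∂_z(1 − k²∂_z²)⁻¹∂_z; `d1` to `d4` express the derivatives
    -- of w and of the products.
    linear_combination (-(j * Complex.I * n)) * hEn - j * (κ - c) * d3
      + (c + j * c * k ^ 2 * Complex.I * n) * d4 - j * (b + 1) / 2 * d1
      + j * (b - 1) * k ^ 2 / 2 * d2 - c * W1 * hj + c * j * k ^ 2 * n ^ 2 * W1 * hI
  rw [key, smul_zero]

end

/-! ### The unperturbed symbol -/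

section

variable {κ k : ℝ}

theorem theta_neg (n : ℤ) : theta κ k (-n) = theta κ k n := by simp [theta]

theorem theta_one : theta κ k 1 = 0 := by simp [theta]

theorem theta_neg_one : theta κ k (-1) = 0 := by rw [theta_neg, theta_one]

theorem theta_mono (hκ : 0 < κ) {m n : ℤ} (h : |m| ≤ |n|) : theta κ k m ≤ theta κ k n := by
  unfold theta
  have h1 : (m : ℝ) ^ 2 ≤ (n : ℝ) ^ 2 := by exact_mod_cast sq_le_sq.2 h
  have h2 : (0 : ℝ) < 1 + k ^ 2 * m ^ 2 := by positivity
  gcongr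

/-- The spectral gap of the unperturbed operator. -/
def gap (κ k : ℝ) : ℝ := theta κ k 2

theorem gap_pos (hκ : 0 < κ) (hk : 0 < k) : 0 < gap κ k := by
  unfold gap theta
  rw [sub_pos]
  apply div_lt_div_of_pos_left hκ (by positivity)
  have : 0 < k ^ 2 := by positivity
  push_cast
  linarith

theorem gap_le_theta (hκ : 0 < κ) {n : ℤ} (hn : 2 ≤ |n|) : gap κ k ≤ theta κ k n :=
  theta_mono hκ (by simpa using hn)

theorem theta_nonneg (hκ : 0 < κ) {n : ℤ} (hn : n ≠ 0) : 0 ≤ theta κ k n := by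
  rw [← theta_one (κ := κ) (k := k)]
  exact theta_mono hκ (by simpa using Int.one_le_abs hn)

/-- nθ_n − mθ_m = (n − m)θ_n + m(θ_n − θ_m), where θ is nonnegative and increasing in |n|, and n ≥
2. -/
theorem freq_gap_of_pos (hκ : 0 < κ) {m n : ℤ} (hm : 1 ≤ m) (hmn : m < n) :
    gap κ k ≤ n * theta κ k n - m * theta κ k m := by
  have h1 : theta κ k m ≤ theta κ k n := theta_mono hκ (by
    rw [abs_of_nonneg (by omega), abs_of_nonneg (by omega)]; omega)
  have h2 : gap κ k ≤ theta κ k n := gap_le_theta hκ (by rw [abs_of_nonneg (by omega)]; omega)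
  have h3 := theta_nonneg (κ := κ) (k := k) hκ (n := n) (by omega)
  have h4 : (m : ℝ) + 1 ≤ n := by exact_mod_cast hmn
  have h5 : (1 : ℝ) ≤ m := by exact_mod_cast hm
  nlinarith

/-- Both summands are nonnegative, and the one whose index is at least 2 exceeds the gap. -/
theorem freq_gap_of_opposite (hκ : 0 < κ) {m n : ℤ} (hm : 1 ≤ m) (hn : 1 ≤ n)
    (h : ¬ (m = 1 ∧ n = 1)) : gap κ k ≤ n * theta κ k n + m * theta κ k m := by
  have key : ∀ m n : ℤ, 1 ≤ m → 2 ≤ n → gap κ k ≤ n * theta κ k n + m * theta κ k m := by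
    intro m n hm hn
    have h2 : gap κ k ≤ theta κ k n := gap_le_theta hκ (by rw [abs_of_nonneg (by omega)]; omega)
    have h3 := theta_nonneg (κ := κ) (k := k) hκ (n := n) (by omega)
    have h4 := theta_nonneg (κ := κ) (k := k) hκ (n := m) (by omega)
    have h5 : (1 : ℝ) ≤ m := by exact_mod_cast hm
    have h6 : (2 : ℝ) ≤ n := by exact_mod_cast hn
    nlinarith
  by_cases hn2 : 2 ≤ n
  · exact key m n hm hn2
  · have := key n m hn (by omega)
    linarith

/-- Distinct unperturbed frequencies are separated, except for the pair `±1`. -/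
theorem freq_gap (hκ : 0 < κ) {m n : ℤ} (hm : m ≠ 0) (hn : n ≠ 0) (hmn : m ≠ n)
    (h : ¬ (|m| = 1 ∧ |n| = 1)) : gap κ k ≤ |n * theta κ k n - m * theta κ k m| := by
  have odd : ∀ j : ℤ, ((-j : ℤ) : ℝ) * theta κ k (-j) = -(j * theta κ k j) := fun j => by
    rw [theta_neg]; push_cast; ring
  rcases lt_or_gt_of_ne hm with hm' | hm' <;> rcases lt_or_gt_of_ne hn with hn' | hn'
  · rcases lt_or_gt_of_ne hmn with h1 | h1
    · have := freq_gap_of_pos (κ := κ) (k := k) hκ (m := -n) (n := -m) (by omega) (by omega)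
      rw [odd, odd] at this
      exact this.trans (le_abs.2 (Or.inl (by linarith)))
    · have := freq_gap_of_pos (κ := κ) (k := k) hκ (m := -m) (n := -n) (by omega) (by omega)
      rw [odd, odd] at this
      exact this.trans (le_abs.2 (Or.inr (by linarith)))
  · have := freq_gap_of_opposite (κ := κ) (k := k) hκ (m := -m) (n := n) (by omega) (by omega)
      (by rintro ⟨h1, h2⟩; exact h ⟨by rw [abs_of_neg hm', h1], by rw [h2]; rfl⟩)
    rw [odd] at this
    exact this.trans (le_abs.2 (Or.inl (by linarith)))
  · have := freq_gap_of_opposite (κ := κ) (k := k) hκ (m := m) (n := -n) (by omega) (by omega)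
      (by rintro ⟨h1, h2⟩; exact h ⟨by rw [h1]; rfl, by rw [abs_of_neg hn', h2]⟩)
    rw [odd] at this
    exact this.trans (le_abs.2 (Or.inr (by linarith)))
  · rcases lt_or_gt_of_ne hmn with h1 | h1
    · have := freq_gap_of_pos (κ := κ) (k := k) hκ (m := m) (n := n) (by omega) (by omega)
      exact this.trans (le_abs.2 (Or.inl (by linarith)))
    · have := freq_gap_of_pos (κ := κ) (k := k) hκ (m := n) (n := m) (by omega) (by omega)
      exact this.trans (le_abs.2 (Or.inr (by linarith)))

/-- The symbol of the unperturbed pencil. -/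
def symD (κ k : ℝ) (z : ℂ) (n : ℤ) : ℂ := theta κ k n - z * (Complex.I * n)⁻¹

/-- After multiplication by n the spectral parameter enters through a term independent of n, so it
cancels when two modes are compared. -/
theorem int_mul_symD (z : ℂ) {n : ℤ} (hn : n ≠ 0) :
    n * symD κ k z n = ((n * theta κ k n : ℝ) : ℂ) + Complex.I * z := by
  have h1 : (n : ℂ) ≠ 0 := by exact_mod_cast hn
  rw [symD, mul_inv, Complex.inv_I]
  push_cast
  field_simp
  ring

/-- For large |n| the part z/(in) is below half the gap, whereas θ_n is at least the gap. Hence near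
resonance confines n. -/
theorem abs_le_of_symD_lt (hκ : 0 < κ) (hk : 0 < k) {z : ℂ} {M : ℝ} (hz : ‖z‖ ≤ M) {n : ℤ} (hn : n ≠ 0)
    (h : ‖symD κ k z n‖ < gap κ k / 2) : (|n| : ℝ) ≤ 1 + 2 * M / gap κ k := by
  have hg := gap_pos hκ hk
  have hM : 0 ≤ M := (norm_nonneg _).trans hz
  by_contra! hcon
  have hn2 : 2 ≤ |n| := by
    have h0 : 0 ≤ 2 * M / gap κ k := by positivity
    have h1 : (1 : ℝ) < |(n : ℝ)| := by linarith
    have h2 : (1 : ℤ) < |n| := by exact_mod_cast h1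
    omega
  have h1 : (n : ℂ) * symD κ k z n - Complex.I * z = ((n * theta κ k n : ℝ) : ℂ) := by
    rw [int_mul_symD z hn]; ring
  have h2 : |n * theta κ k n| ≤ |(n : ℝ)| * ‖symD κ k z n‖ + M := by
    rw [← Real.norm_eq_abs, ← Complex.norm_real, ← h1]
    refine (norm_sub_le _ _).trans (add_le_add ?_ ?_)
    · rw [norm_mul, Complex.norm_intCast]
    · rwa [norm_mul, Complex.norm_I, one_mul]
  have h3 := gap_le_theta (κ := κ) (k := k) hκ hn2
  rw [abs_mul, abs_of_nonneg (hg.le.trans h3)] at h2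
  have h4 : 2 * M < |(n : ℝ)| * gap κ k := by
    have : 2 * M / gap κ k < |(n : ℝ)| := by linarith
    rwa [div_lt_iff₀ hg] at this
  have h5 : 0 < |(n : ℝ)| := abs_pos.2 (by exact_mod_cast hn)
  nlinarith

/-- At most one frequency, up to the pair `±1`, is nearly resonant. -/
theorem symD_unique (hκ : 0 < κ) (hk : 0 < k) {z : ℂ} {M : ℝ} (hz : ‖z‖ ≤ M) {m n : ℤ} (hm : m ≠ 0) (hn : n ≠ 0)
    (h1 : ‖symD κ k z m‖ < gap κ k / (4 * (1 + 2 * M / gap κ k)))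
    (h2 : ‖symD κ k z n‖ < gap κ k / (4 * (1 + 2 * M / gap κ k))) :
    m = n ∨ (|m| = 1 ∧ |n| = 1) := by
  have hg := gap_pos hκ hk
  have hM : 0 ≤ M := (norm_nonneg _).trans hz
  by_contra! hcon
  have hN : 1 ≤ 1 + 2 * M / gap κ k := by
    have : 0 ≤ 2 * M / gap κ k := by positivity
    linarith
  set N := 1 + 2 * M / gap κ k
  have hle : gap κ k / (4 * N) ≤ gap κ k / 2 :=
    div_le_div_of_nonneg_left hg.le (by norm_num) (by linarith)
  have hm' := abs_le_of_symD_lt hκ hk hz hm (h1.trans_le hle)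
  have hn' := abs_le_of_symD_lt hκ hk hz hn (h2.trans_le hle)
  have hsep := freq_gap (κ := κ) (k := k) hκ hm hn hcon.1 (fun h => hcon.2 h.1 h.2)
  have e : ((n * theta κ k n - m * theta κ k m : ℝ) : ℂ) = n * symD κ k z n - m * symD κ k z m := by
    rw [int_mul_symD z hn, int_mul_symD z hm]; push_cast; ring
  rw [← Real.norm_eq_abs, ← Complex.norm_real, e] at hsep
  have h3 := hsep.trans (norm_sub_le _ _)
  rw [norm_mul, norm_mul, Complex.norm_intCast, Complex.norm_intCast] at h3
  -- Each weighted symbol is at most a quarter of the gap. The two together cannot bridge a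
  -- frequency difference of a full gap.
  have hb : ∀ s t : ℝ, 0 ≤ s → s ≤ N → 0 ≤ t → t < gap κ k / (4 * N) → s * t ≤ gap κ k / 4 := by
    intro s t hs hsN ht htN
    calc s * t ≤ N * (gap κ k / (4 * N)) := mul_le_mul hsN htN.le ht (by linarith)
      _ = gap κ k / 4 := by field_simp
  have h4 := hb _ _ (abs_nonneg _) hn' (norm_nonneg _) h2
  have h5 := hb _ _ (abs_nonneg _) hm' (norm_nonneg _) h1
  linarith

end

/-! ### Simple non-zero frequencies stay on the imaginary axis -/

section

variable {κ k : ℝ} (hk : 0 < k)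

theorem conjL_opTheta (f : L2) : conjL (opTheta hk κ f) = opTheta hk κ (conjL f) := by
  simp only [opTheta, sub_apply, smul_apply, ContinuousLinearMap.comp_apply,
    ContinuousLinearMap.id_apply, map_sub, ContinuousLinearMap.map_smulₛₗ, Complex.conj_ofReal,
    conjL_opJL, conjL_opS, map_neg, neg_neg]

theorem reflL_opTheta (f : L2) : reflL (opTheta hk κ f) = opTheta hk κ (reflL f) := by
  simp only [opTheta, sub_apply, smul_apply, ContinuousLinearMap.comp_apply,
    ContinuousLinearMap.id_apply, map_sub, map_smul, reflL_opJL, reflL_opS, map_neg, neg_neg]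

theorem coeff_pencil (z : ℂ) {f : L2} (hf : coeff 0 f = 0) (n : ℤ) :
    coeff n (opTheta hk κ f - z • opS f) = symD κ k z n * coeff n f := by
  rw [map_sub, map_smul, coeff_opTheta hk κ hf, coeff_opS, symD, smul_eq_mul]
  ring

/-- If the non-resonant modes of `f` are those of `f'`, the pencil controls `f'`. -/
theorem norm_le_of_symD {z : ℂ} {f f' : L2} (hf : coeff 0 f = 0) {δ : ℝ} (hδ : 0 < δ)
    (h : ∀ n, coeff n f' = 0 ∨ (coeff n f' = coeff n f ∧ δ ≤ ‖symD κ k z n‖)) :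
    δ * ‖f'‖ ≤ ‖opTheta hk κ f - z • opS f‖ := by
  have h1 : ‖f'‖ ≤ δ⁻¹ * ‖opTheta hk κ f - z • opS f‖ := by
    refine norm_le_of_coeff (by positivity) fun n => ?_
    rw [coeff_pencil hk z hf, norm_mul]
    rcases h n with h | ⟨h, hn⟩
    · rw [h, norm_zero]; positivity
    · rw [h, ← mul_assoc]
      refine le_mul_of_one_le_left (norm_nonneg _) ?_
      rw [inv_mul_eq_div, le_div_iff₀ hδ, one_mul]
      exact hn
  rw [inv_mul_eq_div, le_div_iff₀ hδ] at h1
  linarith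

/-- Away from `0`, the eigenvalues in a bounded region are imaginary. -/
theorem re_eq_zero_of_bounded (hκ : 0 < κ) {M δ : ℝ} (hM : 0 ≤ M)
    (hδ : 0 < δ) (hδM : δ ≤ gap κ k / (4 * (1 + 2 * M / gap κ k))) :
    ∃ η₀ > 0, ∀ (B : L2 →L[ℂ] L2) (η : ℝ), η ≤ η₀ → IsPert B η → ∀ (z : ℂ) (f : L2),
      δ ≤ ‖z‖ → ‖z‖ ≤ M → coeff 0 f = 0 → f ≠ 0 → opTheta hk κ f + B f = z • opS f → z.re = 0 := by
  have hg := gap_pos hκ hk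
  set N := 1 + 2 * M / gap κ k with hN_def
  have hN : 1 ≤ N := by
    have : 0 ≤ 2 * M / gap κ k := by positivity
    linarith
  refine ⟨δ / (16 * N), by positivity, ?_⟩
  intro B η hη hB z f hδz hzM hf0 hf hfz
  have hηN : η * (16 * N) ≤ δ := by rwa [le_div_iff₀ (by positivity)] at hη
  have hfpos : 0 < ‖f‖ := norm_pos_iff.2 hf
  have hη0 : 0 ≤ η := by
    by_contra! h
    have := (norm_nonneg _).trans (hB.bound f)
    nlinarith
  have hη8 : 16 * η ≤ δ := by nlinarith
  have hpen : ∀ f, opTheta hk κ f + B f = z • opS f →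
      ‖opTheta hk κ f - z • opS f‖ ≤ η * ‖f‖ := fun f hf => by
    have : opTheta hk κ f - z • opS f = -B f := by rw [← hf]; abel
    rw [this, norm_neg]
    exact hB.bound f
  by_cases hall : ∀ n, n ≠ 0 → δ ≤ ‖symD κ k z n‖
  · have h1 := norm_le_of_symD hk (κ := κ) (z := z) (f' := f) hf0 hδ fun n => by
      rcases eq_or_ne n 0 with rfl | hn
      · exact Or.inl hf0
      · exact Or.inr ⟨rfl, hall n hn⟩
    have := h1.trans (hpen f hfz)
    nlinarith
  · push Not at hall
    obtain ⟨n, hn0, hn⟩ := hall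
    -- At n = ±1 one has θ_n = 0, so the symbol has modulus |z| ≥ δ and is not resonant.
    have hn1 : ¬ |n| = 1 := by
      intro h
      have h1 := int_mul_symD (κ := κ) (k := k) z hn0
      have h2 : theta κ k n = 0 := by
        rcases (abs_eq (by norm_num)).1 h with rfl | rfl
        · exact theta_one
        · exact theta_neg_one
      have h3 := congrArg norm h1
      rw [h2, norm_mul, Complex.norm_intCast, mul_zero, Complex.ofReal_zero, zero_add, norm_mul,
        Complex.norm_I, one_mul] at h3
      have h4 : |(n : ℝ)| = 1 := by exact_mod_cast h
      rw [h4, one_mul] at h3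
      linarith
    have hothers : ∀ m, m ≠ 0 → m ≠ n → δ ≤ ‖symD κ k z m‖ := fun m hm hmn => by
      by_contra! hcon
      rcases symD_unique hκ hk hzM hm hn0 (hcon.trans_le hδM) (hn.trans_le hδM) with h | h
      · exact hmn h
      · exact hn1 h.2
    have hnN : (|n| : ℝ) ≤ N := abs_le_of_symD_lt hκ hk hzM hn0
      ((hn.trans_le hδM).trans_le (div_le_div_of_nonneg_left hg.le (by norm_num) (by linarith)))
    have hfn : coeff n f ≠ 0 := by
      intro h0
      have h1 := norm_le_of_symD hk (κ := κ) (z := z) (f' := f) hf0 hδ fun m => by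
        rcases eq_or_ne m 0 with rfl | hm
        · exact Or.inl hf0
        · rcases eq_or_ne m n with rfl | hmn
          · exact Or.inl h0
          · exact Or.inr ⟨rfl, hothers m hm hmn⟩
      have := h1.trans (hpen f hfz)
      nlinarith
    set e := (coeff n f)⁻¹ • f with he
    have hen : coeff n e = 1 := by rw [he, map_smul, smul_eq_mul, inv_mul_cancel₀ hfn]
    have he0 : coeff 0 e = 0 := by rw [he, map_smul, hf0, smul_zero]
    have hez : opTheta hk κ e + B e = z • opS e := by
      rw [he, map_smul, map_smul, map_smul, ← smul_add, hfz, smul_comm]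
    have henorm : ‖e‖ ≤ 2 := by
      have h1 := norm_le_of_symD hk (κ := κ) (z := z) (f' := e - expL2 n) he0 hδ fun m => by
        rw [map_sub, coeff_expL2]
        rcases eq_or_ne m n with rfl | hmn
        · left; rw [hen]; simp
        · rcases eq_or_ne m 0 with rfl | hm
          · left; rw [he0]; simp [hmn]
          · right; exact ⟨by simp [hmn], hothers m hm hmn⟩
      have h2 := h1.trans (hpen e hez)
      have h3 : ‖e‖ ≤ ‖e - expL2 n‖ + 1 := by
        rw [← norm_expL2 n]
        simpa using norm_add_le (e - expL2 n) (expL2 n)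
      nlinarith [norm_nonneg e, norm_nonneg (e - expL2 n)]
    -- The conjugate s belongs to −z̄, and q = e − s has no component in the resonant mode. The
    -- other modes bound q by t = z + z̄, while the resonant mode bounds t by a small multiple of q;
    -- hence t = 0.
    set s := conjL e with hs
    have hsn : coeff n s = 1 := by rw [hs, coeff_conjL, hen, map_one]
    have hs0 : coeff 0 s = 0 := by rw [hs, coeff_conjL, he0, map_zero]
    have hsnorm : ‖s‖ ≤ 2 := (norm_conjL_le e).trans henorm
    have hsz : opTheta hk κ s + B s = -((starRingEnd ℂ) z) • opS s := by
      rw [hs, ← conjL_opTheta, ← hB.conj, ← map_add, hez, ContinuousLinearMap.map_smulₛₗ, conjL_opS]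
      simp
    set t := z + (starRingEnd ℂ) z with ht
    set q := e - s with hq
    have hq0 : coeff 0 q = 0 := by rw [hq, map_sub, he0, hs0, sub_zero]
    have hqn : coeff n q = 0 := by rw [hq, map_sub, hen, hsn, sub_self]
    have hqz : opTheta hk κ q - z • opS q = -B q + t • opS s := by
      have h1 : opTheta hk κ e = z • opS e - B e := by rw [← hez]; abel
      have h2 : opTheta hk κ s = -((starRingEnd ℂ) z) • opS s - B s := by rw [← hsz]; abel
      rw [hq, map_sub, map_sub, map_sub, h1, h2, ht]
      module
    have hqt : δ * ‖q‖ ≤ η * ‖q‖ + ‖t‖ * 2 := by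
      refine (norm_le_of_symD hk (κ := κ) (z := z) (f' := q) hq0 hδ fun m => ?_).trans ?_
      · rcases eq_or_ne m 0 with rfl | hm
        · exact Or.inl hq0
        · rcases eq_or_ne m n with rfl | hmn
          · exact Or.inl hqn
          · exact Or.inr ⟨rfl, hothers m hm hmn⟩
      · rw [hqz]
        refine (norm_add_le _ _).trans (add_le_add ?_ ?_)
        · rw [norm_neg]; exact hB.bound q
        · rw [norm_smul]
          gcongr
          exact (norm_opS_le s).trans hsnorm
    have htn : ‖t‖ ≤ N * (η * ‖q‖) := by
      have h1 := congrArg (coeff n) hqz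
      rw [coeff_pencil hk z hq0, hqn, mul_zero, map_add, map_neg, map_smul, coeff_opS, hsn,
        smul_eq_mul, mul_one] at h1
      have hnc : (n : ℂ) ≠ 0 := by exact_mod_cast hn0
      have h2 : t = Complex.I * n * coeff n (B q) := by
        have h3 : t * (Complex.I * n)⁻¹ = coeff n (B q) := by linear_combination -h1
        rw [← h3]
        field_simp
      rw [h2, norm_mul, norm_mul, Complex.norm_I, one_mul, Complex.norm_intCast]
      gcongr
      exact (norm_coeff_le n _).trans (hB.bound q)
    have ht0 : ‖t‖ = 0 := by
      have hq8 : δ * ‖q‖ ≤ 4 * ‖t‖ := by nlinarith [norm_nonneg q]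
      have h1 : N * η * (δ * ‖q‖) ≤ N * η * (4 * ‖t‖) := by gcongr
      have h2 : δ * ‖t‖ ≤ δ * (N * (η * ‖q‖)) := by gcongr
      have h3 : (16 * (N * η)) * ‖t‖ ≤ δ * ‖t‖ := by
        apply mul_le_mul_of_nonneg_right _ (norm_nonneg t)
        linarith
      by_contra hne
      have htp : 0 < ‖t‖ := lt_of_le_of_ne (norm_nonneg _) (Ne.symm hne)
      have h4 : 0 < δ * ‖t‖ := by positivity
      nlinarith
    have ht1 := congrArg Complex.re (norm_eq_zero.1 ht0)
    rw [ht] at ht1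
    simp at ht1
    linarith

end

/-! ### The double eigenvalue `0` -/

/-- `f` has no Fourier modes `0, ±1`. -/
def NoLow (f : L2) : Prop := ∀ n : ℤ, |n| ≤ 1 → coeff n f = 0

theorem NoLow.zero {f : L2} (h : NoLow f) : coeff 0 f = 0 := h 0 (by norm_num)
theorem NoLow.one {f : L2} (h : NoLow f) : coeff 1 f = 0 := h 1 (by norm_num)

theorem NoLow.of_coeff {f : L2} (h0 : coeff 0 f = 0) (h1 : coeff 1 f = 0) (h2 : coeff (-1) f = 0) :
    NoLow f := fun n hn => by
  have : n = 0 ∨ n = 1 ∨ n = -1 := by rw [abs_le] at hn; omega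
  rcases this with rfl | rfl | rfl <;> assumption

theorem NoLow.sub {f g : L2} (hf : NoLow f) (hg : NoLow g) : NoLow (f - g) := fun n hn => by
  rw [map_sub, hf n hn, hg n hn, sub_zero]

theorem NoLow.smul {f : L2} (hf : NoLow f) (t : ℂ) : NoLow (t • f) := fun n hn => by
  rw [map_smul, hf n hn, smul_zero]

theorem coeff_cosV_of_two_le {n : ℤ} (hn : 2 ≤ |n|) : coeff n cosV = 0 := by
  rw [coeff_cosV, if_neg (by rintro rfl; norm_num at hn), if_neg (by rintro rfl; norm_num at hn)]

theorem coeff_sinV_of_two_le {n : ℤ} (hn : 2 ≤ |n|) : coeff n sinV = 0 := by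
  rw [coeff_sinV, if_neg (by rintro rfl; norm_num at hn), if_neg (by rintro rfl; norm_num at hn)]

theorem coeff_one_cosV : coeff 1 cosV = 1 / 2 := by simp [coeff_cosV]
theorem coeff_neg_one_cosV : coeff (-1) cosV = 1 / 2 := by simp [coeff_cosV]
theorem coeff_zero_cosV : coeff 0 cosV = 0 := by simp [coeff_cosV]
theorem coeff_one_sinV : coeff 1 sinV = Complex.I / 2 := by simp [coeff_sinV]
theorem coeff_neg_one_sinV : coeff (-1) sinV = -(Complex.I / 2) := by simp [coeff_sinV]
theorem coeff_zero_sinV : coeff 0 sinV = 0 := by simp [coeff_sinV]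

theorem coeff_one_opS (f : L2) : coeff 1 (opS f) = -Complex.I * coeff 1 f := by
  rw [coeff_opS]; simp

theorem reflL_sinV : reflL sinV = -sinV := ext_coeff fun n => by
  rw [coeff_reflL, map_neg, coeff_sinV, coeff_sinV]
  by_cases h1 : n = 1
  · simp [h1]
  · by_cases h2 : n = -1
    · simp [h2]
    · rw [if_neg (by omega), if_neg (by omega), if_neg h1, if_neg h2, neg_zero]

theorem conjL_sinV : conjL sinV = -sinV := ext_coeff fun n => by
  rw [coeff_conjL, map_neg, coeff_sinV]
  by_cases h1 : n = 1
  · simp [h1, neg_div, Complex.conj_ofNat]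
  · by_cases h2 : n = -1
    · simp [h2, neg_div, Complex.conj_ofNat]
    · simp [h1, h2]

/-- The even part. -/
def evenPart (f : L2) : L2 := (1 / 2 : ℂ) • (f + reflL f)

/-- The odd part. -/
def oddPart (f : L2) : L2 := (1 / 2 : ℂ) • (f - reflL f)

theorem evenPart_add_oddPart (f : L2) : evenPart f + oddPart f = f := by
  unfold evenPart oddPart; module

theorem reflL_evenPart (f : L2) : reflL (evenPart f) = evenPart f := by
  unfold evenPart; rw [map_smul, map_add, reflL_reflL, add_comm]

theorem reflL_oddPart (f : L2) : reflL (oddPart f) = -oddPart f := by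
  unfold oddPart; rw [map_smul, map_sub, reflL_reflL]; module

theorem coeff_evenPart (f : L2) (n : ℤ) :
    coeff n (evenPart f) = 1 / 2 * (coeff n f + coeff (-n) f) := by
  rw [evenPart, map_smul, map_add, coeff_reflL, smul_eq_mul]

theorem coeff_oddPart (f : L2) (n : ℤ) :
    coeff n (oddPart f) = 1 / 2 * (coeff n f - coeff (-n) f) := by
  rw [oddPart, map_smul, map_sub, coeff_reflL, smul_eq_mul]

theorem coeff_neg_of_refl {f : L2} (h : reflL f = f) (n : ℤ) : coeff (-n) f = coeff n f := by
  conv_rhs => rw [← h]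
  rw [coeff_reflL]

theorem coeff_neg_of_refl_neg {f : L2} (h : reflL f = -f) (n : ℤ) : coeff (-n) f = -coeff n f := by
  have := congrArg (coeff n) h
  rwa [coeff_reflL, map_neg] at this

/-- An odd function of mean zero is a multiple of `sinV` up to high modes. -/
theorem NoLow.of_odd {f : L2} (h0 : coeff 0 f = 0) (h : reflL f = -f) :
    NoLow (f - (-(2 * Complex.I) * coeff 1 f) • sinV) := by
  have hI : Complex.I * Complex.I = -1 := Complex.I_mul_I
  refine NoLow.of_coeff ?_ ?_ ?_
  · rw [map_sub, map_smul, h0, coeff_zero_sinV, smul_zero, sub_zero]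
  · rw [map_sub, map_smul, coeff_one_sinV, smul_eq_mul]
    linear_combination coeff 1 f * hI
  · rw [map_sub, map_smul, coeff_neg_one_sinV, smul_eq_mul, coeff_neg_of_refl_neg h 1]
    linear_combination -coeff 1 f * hI

/-- The data of the kernel of the pencil at `ℓ = 0`. -/
structure IsKer {k : ℝ} (hk : 0 < k) (κ : ℝ) (B₀ : L2 →L[ℂ] L2) (η : ℝ) (ψ : L2) : Prop where
  zero : coeff 0 ψ = 0
  one : coeff 1 ψ = 1 / 2
  conj : conjL ψ = ψ
  refl : reflL ψ = ψ
  ker : opTheta hk κ ψ + B₀ ψ = 0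
  near : ‖ψ - cosV‖ ≤ η

/-- The perturbation at transverse wave number `ℓ`, `lam = ℓ²`. -/
def pertAt {k : ℝ} (hk : 0 < k) (B₀ : L2 →L[ℂ] L2) (lam : ℝ) : L2 →L[ℂ] L2 :=
  B₀ + (lam : ℂ) • opN hk

/-- A solution of the rescaled eigenvalue problem near `0`. -/
structure ScaledSol {k : ℝ} (hk : 0 < k) (κ : ℝ) (B₀ : L2 →L[ℂ] L2) (ψ : L2) (lam : ℝ) (ν : ℂ)
    (F ρ : L2) : Prop where
  F_zero : coeff 0 F = 0
  F_odd : reflL F = -F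
  ρ_zero : coeff 0 ρ = 0
  ρ_one : coeff 1 ρ = 0
  ρ_even : reflL ρ = ρ
  eq_even : opN hk ψ + opTheta hk κ ρ + pertAt hk B₀ lam ρ = opS F
  eq_odd : opTheta hk κ F + pertAt hk B₀ lam F = ν • opS (ψ + (lam : ℂ) • ρ)

section

variable {κ k : ℝ} (hk : 0 < k)

theorem pertAt_apply (B₀ : L2 →L[ℂ] L2) (lam : ℝ) (f : L2) :
    pertAt hk B₀ lam f = B₀ f + (lam : ℂ) • opN hk f := rfl

/-- `K` bounds the inverse of the unperturbed operator on high modes. -/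
theorem norm_le_of_theta (hk : 0 < k) (hκ : 0 < κ) {K : ℝ} (hK0 : 0 < K) (hK : 1 ≤ K * gap κ k) {r h : L2}
    (hr : NoLow r) (hh : ∀ n : ℤ, 2 ≤ |n| → theta κ k n * coeff n r = coeff n h) :
    ‖r‖ ≤ K * ‖h‖ := by
  refine norm_le_of_coeff hK0.le fun n => ?_
  by_cases hn : |n| ≤ 1
  · rw [hr n hn, norm_zero]; positivity
  · have hn2 : 2 ≤ |n| := by omega
    have h1 := gap_le_theta (κ := κ) (k := k) hκ hn2
    rw [← hh n hn2, norm_mul, Complex.norm_real, Real.norm_of_nonneg ((gap_pos hκ hk).le.trans h1),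
      ← mul_assoc]
    refine le_mul_of_one_le_left (norm_nonneg _) (hK.trans ?_)
    gcongr

theorem coeff_opTheta_sinV (n : ℤ) : coeff n (opTheta hk κ sinV) = 0 := by
  rw [coeff_opTheta hk κ coeff_zero_sinV, coeff_sinV]
  by_cases h1 : n = 1
  · simp [h1, theta_one]
  · by_cases h2 : n = -1
    · simp [h2, theta_neg_one]
    · simp [h1, h2]

theorem opTheta_sinV : opTheta hk κ sinV = 0 := ext_coeff fun n => by
  rw [coeff_opTheta_sinV, map_zero]

/-- All terms carrying η are absorbed into the left sides, because ηK² ≤ 1/64. -/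
theorem linear_estimate_arith {K η r p x G₁ G₂ G : ℝ} (hK1 : 1 ≤ K) (hη : η * (64 * K ^ 2) ≤ 1)
    (hη0 : 0 ≤ η) (r0 : 0 ≤ r) (p0 : 0 ≤ p) (x0 : 0 ≤ x) (hG10 : 0 ≤ G₁)
    (hg1 : G₁ ≤ G) (hg2 : G₂ ≤ G) (hx : x ≤ 2 * (η * p + G₁)) (hp : p ≤ K * (r + G₁ + η * p))
    (hrr : r ≤ K * (η * p + G₂ + η * x + η * r)) :
    r ≤ 2 * (K ^ 2 * G) ∧ p ≤ 6 * (K ^ 2 * G) ∧ x ≤ 4 * (K ^ 2 * G) := by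
  have hK0 : 0 < K := by linarith
  have hG0 : 0 ≤ G := hG10.trans hg1
  have hηK0 : 0 ≤ η * K := by positivity
  have hηKK : η * K * K ≤ 1 / 64 := by linarith
  have hηK : η * K ≤ 1 / 64 := (le_mul_of_one_le_right hηK0 hK1).trans hηKK
  have hKp1 : K * (η * p) ≤ 1 / 64 * p := by
    have := mul_le_mul_of_nonneg_right hηK p0
    linarith
  have hKG1 : K * G₁ ≤ K * G := by gcongr
  have hKG2 : K * G₂ ≤ K * G := by gcongr
  have hp2 : p ≤ 2 * K * (r + G) := by
    have : 0 ≤ K * (r + G) := by positivity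
    linarith
  have hKp : K * (η * p) ≤ 1 / 32 * (r + G) := by
    have h1 : K * (η * p) ≤ K * (η * (2 * K * (r + G))) := by gcongr
    have h2 : (η * K * K) * (r + G) ≤ 1 / 64 * (r + G) := by gcongr
    linarith
  have hηp : η * p ≤ 1 / 32 * (r + G) := (le_mul_of_one_le_left (by positivity) hK1).trans hKp
  have hKx : K * (η * x) ≤ 1 / 64 * x := by
    have := mul_le_mul_of_nonneg_right hηK x0
    linarith
  have hKr : K * (η * r) ≤ 1 / 64 * r := by
    have := mul_le_mul_of_nonneg_right hηK r0
    linarith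
  have hGK : G ≤ K * G := le_mul_of_one_le_left hG0 hK1
  have hr2 : r ≤ 2 * (K * G) := by linarith
  have hKG : K * G ≤ K ^ 2 * G := by
    have := le_mul_of_one_le_left (by positivity : 0 ≤ K * G) hK1
    linarith
  have hKr2 : K * r ≤ K * (2 * (K * G)) := by gcongr
  refine ⟨by linarith, by linarith, by linarith⟩

/-- The basic linear estimate near the double eigenvalue. -/
theorem linear_estimate (hκ : 0 < κ) {K η : ℝ} (hK1 : 1 ≤ K) (hK : 1 ≤ K * gap κ k)
    (hη : η * (64 * K ^ 2) ≤ 1) (hη0 : 0 ≤ η) {B : L2 →L[ℂ] L2} (hB : ∀ f, ‖B f‖ ≤ η * ‖f‖)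
    {m x : ℂ} {r ρ g₁ g₂ : L2} (hm : ‖m‖ ≤ η) (hr : NoLow r) (hρ : NoLow ρ)
    (h₁ : opTheta hk κ ρ + B ρ = opS (x • sinV + r) + g₁)
    (h₂ : opTheta hk κ (x • sinV + r) + B (x • sinV + r) = m • opS ρ + g₂) :
    ‖x‖ + ‖r‖ + ‖ρ‖ ≤ 20 * K ^ 2 * (‖g₁‖ + ‖g₂‖) ∧
      ‖coeff 1 g₂‖ ≤ 20 * K ^ 2 * η * (‖g₁‖ + ‖g₂‖) := by
  set G := ‖g₁‖ + ‖g₂‖ with hG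
  have hK0 : 0 < K := by linarith
  have hG0 : 0 ≤ G := by positivity
  -- Mode 1 of the first equation: θ_1 = 0 and r has no mode 1, so x is determined there.
  have hx : ‖x‖ ≤ 2 * (η * ‖ρ‖ + ‖g₁‖) := by
    have h := congrArg (coeff 1) h₁
    simp only [map_add, map_smul, coeff_opTheta hk κ hρ.zero, theta_one, coeff_one_opS, coeff_one_sinV,
      hr.one, smul_eq_mul, mul_zero, add_zero, Complex.ofReal_zero, zero_mul, zero_add] at h
    have e : x = 2 * (coeff 1 (B ρ) - coeff 1 g₁) := by
      rw [h]; linear_combination x * Complex.I_mul_I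
    rw [e, norm_mul, Complex.norm_two]
    gcongr
    exact (norm_sub_le _ _).trans (add_le_add ((norm_coeff_le _ _).trans (hB ρ)) (norm_coeff_le _ _))
  have hp : ‖ρ‖ ≤ K * (‖r‖ + ‖g₁‖ + η * ‖ρ‖) := by
    refine (norm_le_of_theta hk hκ hK0 hK (h := opS r + g₁ - B ρ) hρ fun n hn => ?_).trans ?_
    · have h := congrArg (coeff n) h₁
      simp only [map_add, map_smul, coeff_opTheta hk κ hρ.zero, coeff_opS, coeff_sinV_of_two_le hn,
        smul_eq_mul, mul_zero, zero_add] at h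
      rw [map_sub, map_add, coeff_opS]
      linear_combination h
    · gcongr
      refine (norm_sub_le _ _).trans (add_le_add ((norm_add_le _ _).trans ?_) (hB ρ))
      gcongr
      exact norm_opS_le r
  have hrr : ‖r‖ ≤ K * (η * ‖ρ‖ + ‖g₂‖ + η * ‖x‖ + η * ‖r‖) := by
    refine (norm_le_of_theta hk hκ hK0 hK (h := m • opS ρ + g₂ - B (x • sinV) - B r) hr
      fun n hn => ?_).trans ?_
    · have h := congrArg (coeff n) h₂
      rw [map_add (opTheta hk κ), map_smul, opTheta_sinV, smul_zero, zero_add, map_add B] at h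
      simp only [map_add, coeff_opTheta hk κ hr.zero] at h
      simp only [map_sub, map_add]
      linear_combination h
    · gcongr
      refine (norm_sub_le _ _).trans (add_le_add ((norm_sub_le _ _).trans (add_le_add
        ((norm_add_le _ _).trans (add_le_add ?_ le_rfl)) ?_)) (hB r))
      · rw [norm_smul]
        exact mul_le_mul hm (norm_opS_le ρ) (norm_nonneg _) hη0
      · refine (hB _).trans ?_
        rw [norm_smul]
        gcongr
        exact mul_le_of_le_one_right (norm_nonneg _) norm_sinV_le
  -- Mode 1 of the second equation contains the unknowns only through B. It is a solvability
  -- condition on g₂.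
  have hx1 : ‖coeff 1 g₂‖ ≤ η * (‖x‖ + ‖r‖) := by
    have h := congrArg (coeff 1) h₂
    rw [map_add (opTheta hk κ), map_smul, opTheta_sinV, smul_zero, zero_add] at h
    simp only [map_add, map_smul, coeff_opTheta hk κ hr.zero, theta_one, coeff_one_opS,
      hρ.one, smul_eq_mul, mul_zero, Complex.ofReal_zero, zero_mul, zero_add] at h
    have e : coeff 1 g₂ = coeff 1 (B (x • sinV + r)) := by
      rw [map_add, map_smul, map_add, map_smul, smul_eq_mul]
      exact h.symm
    rw [e]
    refine (norm_coeff_le _ _).trans ((hB _).trans ?_)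
    gcongr
    refine (norm_add_le _ _).trans (add_le_add_left ?_ _)
    rw [norm_smul]
    exact mul_le_of_le_one_right (norm_nonneg _) norm_sinV_le
  have hg1 : ‖g₁‖ ≤ G := by rw [hG]; linarith [norm_nonneg g₂]
  have hg2 : ‖g₂‖ ≤ G := by rw [hG]; linarith [norm_nonneg g₁]
  obtain ⟨hr2, hp3, hx3⟩ := linear_estimate_arith hK1 hη hη0 (norm_nonneg r) (norm_nonneg ρ)
    (norm_nonneg x) (norm_nonneg g₁) hg1 hg2 hx hp hrr
  have hKG : 0 ≤ K ^ 2 * G := by positivity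
  refine ⟨by linarith, hx1.trans ?_⟩
  calc η * (‖x‖ + ‖r‖) ≤ η * (20 * K ^ 2 * G) := by
        gcongr
        linarith
    _ = _ := by ring

end

/-! ### The rescaled problem: bounds, uniqueness, reality and sign of ν -/

section

variable {κ k : ℝ} (hk : 0 < k)

theorem symN_one : symN k 1 = 1 / (1 + k ^ 2) := by simp [symN]

theorem coeff_one_opN (f : L2) : coeff 1 (opN hk f) = symN k 1 * coeff 1 f := coeff_opN hk f 1

section sol

variable {K η : ℝ} {B₀ : L2 →L[ℂ] L2} {ψ : L2} {lam : ℝ}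

theorem IsKer.norm_le {hk : 0 < k} (hψ : IsKer hk κ B₀ η ψ) (hη : η ≤ 1) : ‖ψ‖ ≤ 2 := by
  have h1 : ‖ψ‖ ≤ ‖ψ - cosV‖ + ‖cosV‖ := by simpa using norm_add_le (ψ - cosV) cosV
  linarith [hψ.near, norm_cosV_le]

/-- The coefficient of `F` along `sinV`. -/
def sinCoeff (F : L2) : ℂ := -(2 * Complex.I) * coeff 1 F

theorem ScaledSol.noLow_F {hk : 0 < k} {ν : ℂ} {F ρ : L2} (h : ScaledSol hk κ B₀ ψ lam ν F ρ) :
    NoLow (F - sinCoeff F • sinV) := NoLow.of_odd h.F_zero h.F_odd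

theorem ScaledSol.noLow_ρ {hk : 0 < k} {ν : ℂ} {F ρ : L2} (h : ScaledSol hk κ B₀ ψ lam ν F ρ) :
    NoLow ρ := NoLow.of_coeff h.ρ_zero h.ρ_one (by rw [coeff_neg_of_refl h.ρ_even, h.ρ_one])

/-- A rescaled solution solves the system of `linear_estimate` with m = νλ and data −`opN` ψ and ν
`opS` ψ. -/
theorem ScaledSol.bound {hk : 0 < k} (hκ : 0 < κ) (hK1 : 1 ≤ K) (hK : 1 ≤ K * gap κ k)
    (hη : η * (1024 * K ^ 2) ≤ 1) (hη0 : 0 ≤ η) (hψ : IsKer hk κ B₀ η ψ)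
    (hB : IsPert (pertAt hk B₀ lam) η) (hlam : |lam| ≤ η) {ν : ℂ} (hν : ‖ν‖ ≤ 1) {F ρ : L2}
    (h : ScaledSol hk κ B₀ ψ lam ν F ρ) :
    ‖sinCoeff F‖ + ‖F - sinCoeff F • sinV‖ + ‖ρ‖ ≤ 80 * K ^ 2 := by
  have hK2 : 1 ≤ K ^ 2 := one_le_pow₀ hK1
  have hη1 : η ≤ 1 := by nlinarith
  have hψ2 := hψ.norm_le hη1
  have hF : sinCoeff F • sinV + (F - sinCoeff F • sinV) = F := by abel
  have hl := linear_estimate hk hκ hK1 hK (m := ν * lam) (x := sinCoeff F)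
    (r := F - sinCoeff F • sinV) (ρ := ρ) (g₁ := -opN hk ψ) (g₂ := ν • opS ψ)
    (by nlinarith) hη0 hB.bound (by
      rw [norm_mul, Complex.norm_real, Real.norm_eq_abs]
      nlinarith [abs_nonneg lam, norm_nonneg ν]) h.noLow_F h.noLow_ρ
    (by rw [hF, ← h.eq_even]; abel) (by rw [hF, h.eq_odd, map_add, map_smul]; module)
  refine hl.1.trans ?_
  have h1 : ‖-opN hk ψ‖ ≤ 2 := by rw [norm_neg]; exact (norm_opN_le hk ψ).trans hψ2
  have h2 : ‖ν • opS ψ‖ ≤ 2 := by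
    rw [norm_smul]
    have := (norm_opS_le ψ).trans hψ2
    nlinarith [norm_nonneg ν, norm_nonneg (opS ψ)]
  nlinarith

theorem ScaledSol.norm_even_le {hk : 0 < k} (hκ : 0 < κ) (hK1 : 1 ≤ K) (hK : 1 ≤ K * gap κ k)
    (hη : η * (1024 * K ^ 2) ≤ 1) (hη0 : 0 ≤ η) (hψ : IsKer hk κ B₀ η ψ)
    (hB : IsPert (pertAt hk B₀ lam) η) (hlam : |lam| ≤ η) {ν : ℂ} (hν : ‖ν‖ ≤ 1) {F ρ : L2}
    (h : ScaledSol hk κ B₀ ψ lam ν F ρ) : ‖opS (ψ + (lam : ℂ) • ρ)‖ ≤ 3 := by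
  have hb := h.bound hκ hK1 hK hη hη0 hψ hB hlam hν
  have hK2 : 1 ≤ K ^ 2 := one_le_pow₀ hK1
  have hψ2 := hψ.norm_le (by nlinarith : η ≤ 1)
  refine (norm_opS_le _).trans ((norm_add_le _ _).trans ?_)
  rw [norm_smul, Complex.norm_real, Real.norm_eq_abs]
  have h1 : ‖ρ‖ ≤ 80 * K ^ 2 := by
    linarith [norm_nonneg (sinCoeff F), norm_nonneg (F - sinCoeff F • sinV)]
  have h2 : |lam| * ‖ρ‖ ≤ η * (80 * K ^ 2) := by gcongr
  linarith

/-- This nonzero value makes the solvability condition in mode 1 determine ν. -/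
theorem coeff_one_even {hk : 0 < k} (hψ : IsKer hk κ B₀ η ψ) {ρ : L2} (hρ : coeff 1 ρ = 0) :
    coeff 1 (opS (ψ + (lam : ℂ) • ρ)) = -(Complex.I / 2) := by
  rw [coeff_one_opS, map_add, map_smul, hψ.one, hρ]
  simp
  ring

/-- The rescaled problem has at most one solution. -/
theorem ScaledSol.unique {hk : 0 < k} (hκ : 0 < κ) (hK1 : 1 ≤ K) (hK : 1 ≤ K * gap κ k)
    (hη : η * (1024 * K ^ 2) ≤ 1) (hη0 : 0 ≤ η) (hψ : IsKer hk κ B₀ η ψ)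
    (hB : IsPert (pertAt hk B₀ lam) η) (hlam : |lam| ≤ η) {ν₁ ν₂ : ℂ} (hν₁ : ‖ν₁‖ ≤ 1)
    (hν₂ : ‖ν₂‖ ≤ 1) {F₁ ρ₁ F₂ ρ₂ : L2} (h₁ : ScaledSol hk κ B₀ ψ lam ν₁ F₁ ρ₁)
    (h₂ : ScaledSol hk κ B₀ ψ lam ν₂ F₂ ρ₂) : ν₁ = ν₂ ∧ F₁ = F₂ ∧ ρ₁ = ρ₂ := by
  have hK2 : 1 ≤ K ^ 2 := one_le_pow₀ hK1
  have hU := h₂.norm_even_le hκ hK1 hK hη hη0 hψ hB hlam hν₂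
  set U := opS (ψ + (lam : ℂ) • ρ₂)
  set t := ν₁ - ν₂ with ht
  set x := sinCoeff F₁ - sinCoeff F₂
  set r := F₁ - sinCoeff F₁ • sinV - (F₂ - sinCoeff F₂ • sinV)
  have hF : x • sinV + r = F₁ - F₂ := by simp only [x, r]; module
  have hl := linear_estimate hk hκ hK1 hK (m := ν₁ * lam) (x := x) (r := r) (ρ := ρ₁ - ρ₂)
    (g₁ := 0) (g₂ := t • U) (by nlinarith) hη0 hB.bound (by
      rw [norm_mul, Complex.norm_real, Real.norm_eq_abs]
      nlinarith [abs_nonneg lam, norm_nonneg ν₁]) (h₁.noLow_F.sub h₂.noLow_F)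
    (h₁.noLow_ρ.sub h₂.noLow_ρ)
    (by
      rw [hF, map_sub opS, ← h₁.eq_even, ← h₂.eq_even, map_sub, map_sub]; abel)
    (by
      have e : opTheta hk κ (F₁ - F₂) + pertAt hk B₀ lam (F₁ - F₂)
          = (opTheta hk κ F₁ + pertAt hk B₀ lam F₁) - (opTheta hk κ F₂ + pertAt hk B₀ lam F₂) := by
        rw [map_sub, map_sub]; abel
      rw [hF, e, h₁.eq_odd, h₂.eq_odd]
      simp only [U, t, map_add, map_smul, map_sub]
      module)
  have hg : ‖(0 : L2)‖ + ‖t • U‖ ≤ 3 * ‖t‖ := by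
    rw [norm_zero, zero_add, norm_smul]
    nlinarith [norm_nonneg t]
  -- The solvability condition reads |t|/2 ≤ 60K²η|t|, which leaves only t = 0 as ηK² ≤ 1/1024.
  have ht0 : ‖t‖ = 0 := by
    have h1 := hl.2
    rw [map_smul, smul_eq_mul, norm_mul, coeff_one_even hψ h₂.ρ_one] at h1
    have h2 : ‖-(Complex.I / 2)‖ = 1 / 2 := by simp
    rw [h2] at h1
    have h3 : 20 * K ^ 2 * η * (‖(0 : L2)‖ + ‖t • U‖) ≤ 20 * K ^ 2 * η * (3 * ‖t‖) := by gcongr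
    have h4 : (η * (1024 * K ^ 2)) * ‖t‖ ≤ 1 * ‖t‖ := by gcongr
    nlinarith [norm_nonneg t]
  have htt : t = 0 := norm_eq_zero.1 ht0
  have h0 := hl.1
  rw [htt, zero_smul, norm_zero, add_zero, mul_zero] at h0
  have hx0 : x = 0 := norm_le_zero_iff.1 (by linarith [norm_nonneg r, norm_nonneg (ρ₁ - ρ₂)])
  have hr0 : r = 0 := norm_le_zero_iff.1 (by linarith [norm_nonneg x, norm_nonneg (ρ₁ - ρ₂)])
  have hρ0 : ρ₁ - ρ₂ = 0 := norm_le_zero_iff.1 (by linarith [norm_nonneg x, norm_nonneg r])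
  refine ⟨sub_eq_zero.1 htt, sub_eq_zero.1 ?_, sub_eq_zero.1 hρ0⟩
  rw [← hF, hx0, hr0, zero_smul, add_zero]

/-- The minus sign in front of F* compensates the sign produced by `opS` under conjugation. -/
theorem ScaledSol.conj {hk : 0 < k} (hψ : IsKer hk κ B₀ η ψ)
    (hB : IsPert (pertAt hk B₀ lam) η) {ν : ℂ} {F ρ : L2} (h : ScaledSol hk κ B₀ ψ lam ν F ρ) :
    ScaledSol hk κ B₀ ψ lam ((starRingEnd ℂ) ν) (-conjL F) (conjL ρ) where
  F_zero := by rw [map_neg, coeff_conjL, h.F_zero, map_zero, neg_zero]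
  F_odd := by
    apply ext_coeff
    intro n
    rw [coeff_reflL, map_neg, map_neg, map_neg, coeff_conjL, coeff_conjL,
      coeff_neg_of_refl_neg h.F_odd, map_neg]
  ρ_zero := by rw [coeff_conjL, h.ρ_zero, map_zero]
  ρ_one := by rw [coeff_conjL, h.ρ_one, map_zero]
  ρ_even := by
    apply ext_coeff
    intro n
    rw [coeff_reflL, coeff_conjL, coeff_conjL, coeff_neg_of_refl h.ρ_even]
  eq_even := by
    have h1 := congrArg conjL h.eq_even
    rw [map_add, map_add, conjL_opN, conjL_opTheta, hB.conj, hψ.conj, conjL_opS] at h1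
    rw [h1, map_neg]
  eq_odd := by
    have h1 := congrArg conjL h.eq_odd
    rw [map_add, conjL_opTheta, hB.conj, ContinuousLinearMap.map_smulₛₗ, conjL_opS, map_add,
      ContinuousLinearMap.map_smulₛₗ, hψ.conj, Complex.conj_ofReal] at h1
    rw [map_neg, map_neg, ← neg_add, h1, smul_neg, neg_neg]

/-- ν and its conjugate both solve the rescaled problem, so uniqueness makes ν real. -/
theorem ScaledSol.conj_eq {hk : 0 < k} (hκ : 0 < κ) (hK1 : 1 ≤ K) (hK : 1 ≤ K * gap κ k)
    (hη : η * (1024 * K ^ 2) ≤ 1) (hη0 : 0 ≤ η) (hψ : IsKer hk κ B₀ η ψ)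
    (hB : IsPert (pertAt hk B₀ lam) η) (hlam : |lam| ≤ η) {ν : ℂ} (hν : ‖ν‖ ≤ 1) {F ρ : L2}
    (h : ScaledSol hk κ B₀ ψ lam ν F ρ) : ν = (ν.re : ℂ) := by
  have := (h.unique hκ hK1 hK hη hη0 hψ hB hlam hν (by simpa using hν) (h.conj hψ hB)).1
  exact (Complex.conj_eq_iff_re.1 this.symm).symm

/-- The comparison of `ν` with the threshold `lamS`, at which the pencil has an odd kernel. -/
theorem ScaledSol.compare {hk : 0 < k} (hκ : 0 < κ) (hK1 : 1 ≤ K) (hK : 1 ≤ K * gap κ k)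
    (hη : η * (1024 * K ^ 2) ≤ 1) (hη0 : 0 ≤ η) (hψ : IsKer hk κ B₀ η ψ)
    (hB : IsPert (pertAt hk B₀ lam) η) (hlam : |lam| ≤ η) {ν : ℂ} (hν : ‖ν‖ ≤ 1) {F ρ : L2}
    (h : ScaledSol hk κ B₀ ψ lam ν F ρ) {lamS : ℝ} {rS : L2} (hrS : NoLow rS) (hrS1 : ‖rS‖ ≤ 1)
    (hS : opTheta hk κ (sinV + rS) + pertAt hk B₀ lamS (sinV + rS) = 0) :
    ‖sinCoeff F - symN k 1‖ ≤ 160 * K ^ 2 * η ∧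
    ‖ν + symN k 1 * sinCoeff F * (lam - lamS)‖ ≤ 512 * K ^ 3 * η * (‖ν‖ + |lam - lamS|) := by
  have hK2 : 1 ≤ K ^ 2 := one_le_pow₀ hK1
  have hK0 : 0 < K := by linarith
  have hb := h.bound hκ hK1 hK hη hη0 hψ hB hlam hν
  have hU := h.norm_even_le hκ hK1 hK hη hη0 hψ hB hlam hν
  have hU1 := coeff_one_even (lam := lam) hψ h.ρ_one
  set U := opS (ψ + (lam : ℂ) • ρ)
  set x := sinCoeff F with hx
  have hρb : ‖ρ‖ ≤ 80 * K ^ 2 := by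
    linarith [norm_nonneg x, norm_nonneg (F - x • sinV)]
  have hxb : ‖x‖ ≤ 80 * K ^ 2 := by
    linarith [norm_nonneg ρ, norm_nonneg (F - x • sinV)]
  have hF1 : coeff 1 F = Complex.I / 2 * x := by
    rw [hx, sinCoeff]; linear_combination coeff 1 F * Complex.I_mul_I
  refine ⟨?_, ?_⟩
  · have h1 := congrArg (coeff 1) h.eq_even
    rw [map_add, map_add, coeff_one_opN, coeff_opTheta hk κ h.ρ_zero, theta_one, coeff_one_opS,
      hψ.one, hF1] at h1
    -- Mode 1 of the even equation gives x = n₁ + O(η).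
    have e : x - symN k 1 = 2 * coeff 1 (pertAt hk B₀ lam ρ) := by
      push_cast at h1
      linear_combination -2 * h1 + x * Complex.I_mul_I
    rw [e, norm_mul, Complex.norm_two]
    have := (norm_coeff_le 1 _).trans (hB.bound ρ)
    have : η * ‖ρ‖ ≤ η * (80 * K ^ 2) := by gcongr
    linarith
  · set t : ℂ := (lam : ℂ) - lamS with ht
    -- Subtracting x times the odd kernel vector at `lamS` leaves an r driven only by ν and by x(λ −
    -- λ*).
    obtain ⟨r, hr⟩ : ∃ r, r = F - x • sinV - x • rS := ⟨_, rfl⟩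
    have hrL : NoLow r := hr ▸ h.noLow_F.sub (hrS.smul x)
    have htn : ‖t‖ = |lam - lamS| := by
      rw [ht, ← Complex.ofReal_sub, Complex.norm_real, Real.norm_eq_abs]
    have hrF : r = F - x • (sinV + rS) := by rw [hr]; module
    have hreq : opTheta hk κ r + pertAt hk B₀ lam r
        = ν • U - (x * t) • opN hk (sinV + rS) := by
      have e1 := h.eq_odd
      have e2 : opTheta hk κ (sinV + rS) + pertAt hk B₀ lam (sinV + rS)
          = t • opN hk (sinV + rS) := by
        have : pertAt hk B₀ lam (sinV + rS)
            = pertAt hk B₀ lamS (sinV + rS) + t • opN hk (sinV + rS) := by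
          rw [pertAt_apply, pertAt_apply, ht]; module
        rw [this, ← add_assoc, hS, zero_add]
      calc _ = (opTheta hk κ F + pertAt hk B₀ lam F)
            - x • (opTheta hk κ (sinV + rS) + pertAt hk B₀ lam (sinV + rS)) := by
            rw [hrF, map_sub, map_sub, map_smul, map_smul]; module
        _ = _ := by rw [e1, e2, smul_smul]
    have hrb : ‖r‖ ≤ K * (η * ‖r‖ + ‖ν‖ * 3 + ‖x‖ * ‖t‖) := by
      refine (norm_le_of_theta hk hκ hK0 hK (h := ν • U - (x * t) • opN hk rS - pertAt hk B₀ lam r)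
        hrL fun n hn => ?_).trans ?_
      · have h1 := congrArg (coeff n) hreq
        rw [map_add, coeff_opTheta hk κ hrL.zero, map_sub, map_smul, map_smul, coeff_opN,
          map_add, coeff_sinV_of_two_le hn, zero_add] at h1
        rw [map_sub, map_sub, map_smul, map_smul, coeff_opN]
        linear_combination h1
      · gcongr
        refine (norm_sub_le _ _).trans ?_
        have h1 : ‖ν • U - (x * t) • opN hk rS‖ ≤ ‖ν‖ * 3 + ‖x‖ * ‖t‖ := by
          refine (norm_sub_le _ _).trans (add_le_add ?_ ?_)
          · rw [norm_smul]; gcongr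
          · rw [norm_smul, norm_mul]
            exact mul_le_of_le_one_right (by positivity) ((norm_opN_le hk rS).trans hrS1)
        linarith [hB.bound r]
    -- Mode 1 of the equation for r: its left side has only the small perturbation, so the forcing
    -- must nearly cancel.
    have hm : ‖ν + symN k 1 * x * t‖ ≤ 2 * (η * ‖r‖) := by
      have h1 := congrArg (coeff 1) hreq
      rw [map_add, coeff_opTheta hk κ hrL.zero, theta_one, map_sub, map_smul, map_smul,
        coeff_one_opN, map_add, coeff_one_sinV, hrS.one, hU1] at h1
      have e : ν + symN k 1 * x * t = 2 * Complex.I * coeff 1 (pertAt hk B₀ lam r) := by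
        simp only [smul_eq_mul] at h1
        push_cast at h1
        linear_combination -2 * Complex.I * h1 + (ν + symN k 1 * x * t) * Complex.I_mul_I
      rw [e, norm_mul, norm_mul, Complex.norm_two, Complex.norm_I, mul_one]
      have := (norm_coeff_le 1 _).trans (hB.bound r)
      linarith
    have hrb2 : ‖r‖ ≤ 2 * K * (‖ν‖ * 3 + ‖x‖ * ‖t‖) := by
      have h1 : K * η ≤ 1 / 2 := by nlinarith
      have := mul_le_mul_of_nonneg_right h1 (norm_nonneg r)
      linarith
    rw [htn] at hrb2
    refine hm.trans ?_
    have h1 : ‖ν‖ * 3 + ‖x‖ * |lam - lamS| ≤ 80 * K ^ 2 * (‖ν‖ + |lam - lamS|) := by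
      have := mul_le_mul_of_nonneg_right hxb (abs_nonneg (lam - lamS))
      nlinarith [norm_nonneg ν]
    have h2 : 2 * K * (‖ν‖ * 3 + ‖x‖ * |lam - lamS|)
        ≤ 2 * K * (80 * K ^ 2 * (‖ν‖ + |lam - lamS|)) := by gcongr
    have h3 : η * ‖r‖ ≤ η * (2 * K * (80 * K ^ 2 * (‖ν‖ + |lam - lamS|))) := by
      gcongr
      exact hrb2.trans h2
    have h4 : 0 ≤ K ^ 3 * η * (‖ν‖ + |lam - lamS|) := by positivity
    nlinarith

/-- In ν = −n₁x(λ − λ*) + error the factor n₁ Re x is at least n₁²/2, while the error is at most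
(n₁²/8)(|ν| + |λ − λ*|), since 512K³η ≤ n₁²/8. It cannot reverse the sign. -/
theorem ScaledSol.sign {hk : 0 < k} (hκ : 0 < κ) (hK1 : 1 ≤ K) (hK : 1 ≤ K * gap κ k)
    (hη : η * (1024 * K ^ 2) ≤ 1) (hη' : 4096 * K ^ 3 * η ≤ symN k 1 ^ 2) (hη0 : 0 ≤ η)
    (hψ : IsKer hk κ B₀ η ψ)
    (hB : IsPert (pertAt hk B₀ lam) η) (hlam : |lam| ≤ η) {ν : ℂ} (hν : ‖ν‖ ≤ 1) {F ρ : L2}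
    (h : ScaledSol hk κ B₀ ψ lam ν F ρ) {lamS : ℝ} {rS : L2} (hrS : NoLow rS) (hrS1 : ‖rS‖ ≤ 1)
    (hS : opTheta hk κ (sinV + rS) + pertAt hk B₀ lamS (sinV + rS) = 0) :
    (lamS < lam → ν.re < 0) ∧ (lam < lamS → 0 < ν.re) := by
  obtain ⟨hx, hc⟩ := h.compare hκ hK1 hK hη hη0 hψ hB hlam hν hrS hrS1 hS
  have hreal := h.conj_eq hκ hK1 hK hη hη0 hψ hB hlam hν
  set v := ν.re
  have hn0 : 0 < symN k 1 := by rw [symN_one]; positivity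
  have hn1 : symN k 1 ≤ 1 := symN_le_one 1
  set n₁ := symN k 1
  set x := sinCoeff F
  have hK3 : K ^ 2 ≤ K ^ 3 := pow_le_pow_right₀ hK1 (by norm_num)
  have hxre : n₁ / 2 ≤ x.re := by
    have h1 := (Complex.abs_re_le_norm (x - n₁)).trans hx
    rw [Complex.sub_re, Complex.ofReal_re, abs_le] at h1
    have h2 : K ^ 2 * η ≤ K ^ 3 * η := by gcongr
    nlinarith
  have hre : |v + n₁ * x.re * (lam - lamS)| ≤ n₁ ^ 2 / 8 * (|v| + |lam - lamS|) := by
    have h1 := (Complex.abs_re_le_norm _).trans hc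
    have e : (ν + n₁ * x * (lam - lamS)).re = v + n₁ * x.re * (lam - lamS) := by
      rw [← Complex.ofReal_sub]
      simp [v]
    have e2 : ‖ν‖ = |v| := by rw [hreal, Complex.norm_real, Real.norm_eq_abs]
    rw [e, e2] at h1
    refine h1.trans ?_
    gcongr
    linarith
  have hsq : n₁ ^ 2 ≤ 1 := pow_le_one₀ hn0.le hn1
  have hpos : n₁ ^ 2 / 2 ≤ n₁ * x.re := by nlinarith
  rw [abs_le] at hre
  constructor
  · intro hl
    by_contra! hcon
    rw [abs_of_nonneg hcon, abs_of_pos (sub_pos.2 hl)] at hre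
    have h1 : n₁ ^ 2 / 2 * (lam - lamS) ≤ n₁ * x.re * (lam - lamS) :=
      mul_le_mul_of_nonneg_right hpos (sub_nonneg.2 hl.le)
    have h2 : 0 < n₁ ^ 2 * (lam - lamS) := by
      have := sub_pos.2 hl
      positivity
    have h3 : n₁ ^ 2 * v ≤ 1 * v := mul_le_mul_of_nonneg_right hsq hcon
    linarith
  · intro hl
    by_contra! hcon
    rw [abs_of_nonpos hcon, abs_of_neg (sub_neg.2 hl)] at hre
    have h1 : n₁ ^ 2 / 2 * (lamS - lam) ≤ n₁ * x.re * (lamS - lam) :=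
      mul_le_mul_of_nonneg_right hpos (sub_nonneg.2 hl.le)
    have h2 : 0 < n₁ ^ 2 * (lamS - lam) := by
      have := sub_pos.2 hl
      positivity
    have h3 : n₁ ^ 2 * (-v) ≤ 1 * (-v) := mul_le_mul_of_nonneg_right hsq (by linarith)
    linarith

/-- The eigenvector of the pencil attached to a rescaled solution. -/
def scaledVec (lam : ℝ) (z : ℂ) (ψ F ρ : L2) : L2 := F + (z / lam) • (ψ + (lam : ℂ) • ρ)

theorem ScaledSol.eq_even' {hk : 0 < k} (hψ : IsKer hk κ B₀ η ψ) {ν : ℂ} {F ρ : L2}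
    (h : ScaledSol hk κ B₀ ψ lam ν F ρ) :
    opTheta hk κ (ψ + (lam : ℂ) • ρ) + pertAt hk B₀ lam (ψ + (lam : ℂ) • ρ)
      = (lam : ℂ) • opS F := by
  have h1 : pertAt hk B₀ lam ψ = B₀ ψ + (lam : ℂ) • opN hk ψ := pertAt_apply hk B₀ lam ψ
  have h2 := hψ.ker
  rw [← h.eq_even, map_add, map_add, map_smul, map_smul, h1]
  calc _ = (opTheta hk κ ψ + B₀ ψ) + ((lam : ℂ) • opN hk ψ + (lam : ℂ) • opTheta hk κ ρ
        + (lam : ℂ) • pertAt hk B₀ lam ρ) := by abel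
    _ = _ := by rw [h2]; module

/-- The even part has factor z/λ. Applying A to it returns z `opS` F, and z · (z/λ) = ν matches the
odd equation. -/
theorem ScaledSol.eigen {hk : 0 < k} (hψ : IsKer hk κ B₀ η ψ) {ν z : ℂ} {F ρ : L2}
    (h : ScaledSol hk κ B₀ ψ lam ν F ρ) (hlam : lam ≠ 0) (hz : z ^ 2 = ν * lam) :
    opTheta hk κ (scaledVec lam z ψ F ρ) + pertAt hk B₀ lam (scaledVec lam z ψ F ρ)
      = z • opS (scaledVec lam z ψ F ρ) := by
  have hl : (lam : ℂ) ≠ 0 := by exact_mod_cast hlam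
  have h1 := h.eq_even' hψ
  have h2 := h.eq_odd
  unfold scaledVec
  have h3 : z * (z / lam) = ν := by rw [← mul_div_assoc, ← sq, hz, mul_div_cancel_right₀ _ hl]
  generalize ψ + (lam : ℂ) • ρ = U at h1 h2 ⊢
  calc _ = (opTheta hk κ F + pertAt hk B₀ lam F)
        + (z / lam) • (opTheta hk κ U + pertAt hk B₀ lam U) := by
        rw [map_add, map_add, map_smul, map_smul]; module
    _ = ν • opS U + z • opS F := by rw [h1, h2, smul_smul, div_mul_cancel₀ _ hl]
    _ = z • opS (F + (z / lam) • U) := by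
      rw [map_add, map_smul, smul_add, smul_smul, h3, add_comm]

theorem ScaledSol.coeff_zero_vec {hk : 0 < k} (hψ : IsKer hk κ B₀ η ψ) {ν : ℂ} (z : ℂ) {F ρ : L2}
    (h : ScaledSol hk κ B₀ ψ lam ν F ρ) : coeff 0 (scaledVec lam z ψ F ρ) = 0 := by
  simp [scaledVec, h.F_zero, hψ.zero, h.ρ_zero]

theorem ScaledSol.coeff_even_vec {hk : 0 < k} (hψ : IsKer hk κ B₀ η ψ) {ν : ℂ} (z : ℂ) {F ρ : L2}
    (h : ScaledSol hk κ B₀ ψ lam ν F ρ) :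
    coeff 1 (evenPart (scaledVec lam z ψ F ρ)) = z / lam * (1 / 2) := by
  rw [coeff_evenPart, scaledVec]
  simp only [map_add, map_smul, smul_eq_mul, coeff_neg_of_refl_neg h.F_odd,
    coeff_neg_of_refl h.ρ_even, coeff_neg_of_refl hψ.refl, hψ.one, h.ρ_one]
  ring

/-- A preserves parity and `opS` reverses it, so the even and odd parts of the equation separate
into a coupled pair. -/
theorem pencil_parity {A : L2 →L[ℂ] L2} (hA : ∀ f, reflL (A f) = A (reflL f)) {z t : ℂ}
    {p F U : L2} (hF : reflL F = -F) (hU : reflL U = U)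
    (hp : A p = z • opS p + opS (F + t • U)) :
    A (evenPart p) = z • opS (oddPart p) + opS F ∧
      A (oddPart p) = z • opS (evenPart p) + t • opS U := by
  have hr : A (reflL p) = -(z • opS (reflL p)) - opS (-F + t • U) := by
    rw [← hA, hp, map_add, map_smul, reflL_opS, reflL_opS, map_add, map_smul, hF, hU, smul_neg]
    abel
  have e1 : A (evenPart p) = (1 / 2 : ℂ) • (A p + A (reflL p)) := by
    unfold evenPart; rw [map_smul, map_add]
  have e2 : A (oddPart p) = (1 / 2 : ℂ) • (A p - A (reflL p)) := by
    unfold oddPart; rw [map_smul, map_sub]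
  have e3 : opS (evenPart p) = (1 / 2 : ℂ) • (opS p + opS (reflL p)) := by
    unfold evenPart; rw [map_smul, map_add]
  have e4 : opS (oddPart p) = (1 / 2 : ℂ) • (opS p - opS (reflL p)) := by
    unfold oddPart; rw [map_smul, map_sub]
  rw [e1, e2, e3, e4, hp, hr, map_add, map_add, map_smul, map_neg]
  constructor <;> module

/-- The chain equation takes the form of `linear_estimate`. The forcing z/λ occurs twice, from the
chain itself and from A F = ν `opS` U, so the coefficient is 2z/λ, which is nonzero for z ≠ 0. -/
theorem pencil_rescale {A : L2 →L[ℂ] L2} {z ν : ℂ} (hz0 : z ≠ 0) (hl : (lam : ℂ) ≠ 0)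
    (hz : z ^ 2 = ν * lam) {e o F U : L2} (hF : A F = ν • opS U)
    (he : A e = z • opS o + opS F) (ho : A o = z • opS e + (z / lam) • opS U) :
    A (z⁻¹ • e) = opS (o + z⁻¹ • F) ∧
      A (o + z⁻¹ • F) = (ν * lam) • opS (z⁻¹ • e) + (2 * z / lam) • opS U := by
  constructor
  · rw [map_smul, he, map_add, map_smul, smul_add, smul_smul, inv_mul_cancel₀ hz0, one_smul]
  · have hνz : z⁻¹ * ν = z / lam := by
      rw [eq_div_iff hl, mul_assoc, ← hz, sq, inv_mul_cancel_left₀ hz0]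
    have hz1 : ν * lam * z⁻¹ = z := by rw [← hz, sq, mul_inv_cancel_right₀ hz0]
    rw [map_add, map_smul, ho, hF, map_smul, smul_smul, smul_smul, hνz, hz1]
    module

/-- There is no generalised eigenvector at a rescaled solution. -/
theorem ScaledSol.not_generalised {hk : 0 < k} (hκ : 0 < κ) (hK1 : 1 ≤ K) (hK : 1 ≤ K * gap κ k)
    (hη : η * (1024 * K ^ 2) ≤ 1) (hη0 : 0 ≤ η) (hψ : IsKer hk κ B₀ η ψ)
    (hB : IsPert (pertAt hk B₀ lam) η) (hlam : |lam| ≤ η) {ν z : ℂ} (hν : ‖ν‖ ≤ 1) {F ρ : L2}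
    (h : ScaledSol hk κ B₀ ψ lam ν F ρ) (hlam0 : lam ≠ 0) (hz : z ^ 2 = ν * lam) (hz0 : z ≠ 0)
    {g : L2} (hg0 : coeff 0 g = 0) :
    opTheta hk κ g + pertAt hk B₀ lam g - z • opS g ≠ opS (scaledVec lam z ψ F ρ) := by
  intro hg
  have hl : (lam : ℂ) ≠ 0 := by exact_mod_cast hlam0
  obtain ⟨A, hA⟩ : ∃ A : L2 →L[ℂ] L2, A = opTheta hk κ + pertAt hk B₀ lam := ⟨_, rfl⟩
  have hAf : ∀ f, A f = opTheta hk κ f + pertAt hk B₀ lam f := fun f => by rw [hA]; rfl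
  have hAr : ∀ f, reflL (A f) = A (reflL f) := fun f => by
    rw [hAf, hAf, map_add, reflL_opTheta, hB.refl]
  have he := h.eigen hψ hlam0 hz
  have hv0 := h.coeff_zero_vec hψ z
  have hv1 := h.coeff_even_vec hψ z
  have hUr : reflL (ψ + (lam : ℂ) • ρ) = ψ + (lam : ℂ) • ρ := by
    rw [map_add, map_smul, hψ.refl, h.ρ_even]
  have hU3 := h.norm_even_le hκ hK1 hK hη hη0 hψ hB hlam hν
  have hU1 := coeff_one_even (lam := lam) hψ h.ρ_one
  have hAF : A F = ν • opS (ψ + (lam : ℂ) • ρ) := by rw [hAf]; exact h.eq_odd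
  rw [← hAf] at he hg
  have hvd : scaledVec lam z ψ F ρ = F + (z / lam) • (ψ + (lam : ℂ) • ρ) := rfl
  generalize ψ + (lam : ℂ) • ρ = U at hUr hU3 hU1 hAF hvd
  generalize scaledVec lam z ψ F ρ = v at he hg hv0 hv1 hvd
  -- Adding a multiple of the eigenvector to g is harmless; this multiple removes mode 1 from the
  -- even part.
  obtain ⟨s, hs⟩ : ∃ s, s = coeff 1 (evenPart g) * (2 * lam / z) := ⟨_, rfl⟩
  obtain ⟨p, hp⟩ : ∃ p, p = g - s • v := ⟨_, rfl⟩
  have hp0 : coeff 0 p = 0 := by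
    rw [hp, map_sub, map_smul, hg0, hv0, smul_zero, sub_zero]
  have hpA : A p = z • opS p + opS (F + (z / lam) • U) := by
    rw [← hvd, hp, map_sub, map_smul, he, map_sub, map_smul, ← hg]; module
  have hp1 : coeff 1 (evenPart p) = 0 := by
    have e : evenPart p = evenPart g - s • evenPart v := by
      rw [hp]; unfold evenPart; rw [map_sub, map_smul]; module
    rw [e, map_sub, map_smul, hv1, hs, smul_eq_mul]
    field_simp
    ring
  obtain ⟨hAe, hAo⟩ := pencil_parity hAr h.F_odd hUr hpA
  obtain ⟨e1, e2⟩ := pencil_rescale hz0 hl hz hAF hAe hAo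
  have hF0 : coeff 0 (oddPart p + z⁻¹ • F) = 0 := by
    rw [map_add, map_smul, h.F_zero, coeff_oddPart]
    simp
  have hFr : reflL (oddPart p + z⁻¹ • F) = -(oddPart p + z⁻¹ • F) := by
    rw [map_add, map_smul, reflL_oddPart, h.F_odd]; module
  have hρL : NoLow (z⁻¹ • evenPart p) := by
    refine NoLow.smul (NoLow.of_coeff ?_ hp1 ?_) _
    · rw [coeff_evenPart, neg_zero, hp0]; simp
    · rw [coeff_neg_of_refl (reflL_evenPart p), hp1]
  generalize oddPart p + z⁻¹ • F = F' at e1 e2 hF0 hFr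
  generalize z⁻¹ • evenPart p = ρ' at e1 e2 hρL
  have hxr : sinCoeff F' • sinV + (F' - sinCoeff F' • sinV) = F' := by abel
  have hK2 : 1 ≤ K ^ 2 := one_le_pow₀ hK1
  -- The solvability condition fails: mode 1 of the forcing has size |2z/λ|/2, whereas at most
  -- 60K²η|2z/λ| is allowed.
  have hl2 := (linear_estimate hk hκ hK1 hK (m := ν * lam) (x := sinCoeff F')
    (r := F' - sinCoeff F' • sinV) (ρ := ρ')
    (g₁ := 0) (g₂ := (2 * z / lam) • opS U) (by nlinarith) hη0 hB.bound (by
      rw [norm_mul, Complex.norm_real, Real.norm_eq_abs]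
      nlinarith [abs_nonneg lam, norm_nonneg ν]) (NoLow.of_odd hF0 hFr) hρL
    (by rw [hxr, add_zero, ← hAf]; exact e1) (by rw [hxr, ← hAf]; exact e2)).2
  rw [map_smul, smul_eq_mul, hU1, norm_mul, norm_zero, zero_add, norm_smul] at hl2
  have h2 : ‖-(Complex.I / 2)‖ = 1 / 2 := by simp
  rw [h2] at hl2
  have hpos : 0 < ‖2 * z / (lam : ℂ)‖ :=
    norm_pos_iff.2 (div_ne_zero (mul_ne_zero two_ne_zero hz0) hl)
  generalize ‖2 * z / (lam : ℂ)‖ = q at hl2 hpos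
  have h3 : 20 * K ^ 2 * η * (q * ‖opS U‖) ≤ 20 * K ^ 2 * η * (q * 3) := by gcongr
  have h4 : (η * (1024 * K ^ 2)) * q ≤ 1 * q := by gcongr
  nlinarith

end sol

end

/-! ### Small eigenvalues come from the rescaled problem -/

section

variable {κ k : ℝ}

theorem near_zero_arith {K η L Z X Y A B : ℝ} (hK1 : 1 ≤ K) (hη : η * (1024 * K ^ 2) ≤ 1)
    (hη0 : 0 ≤ η) (hL0 : 0 ≤ L) (hL : L ≤ η) (hZ0 : 0 < Z) (hZ : K * Z ≤ 1 / 4) (hX0 : 0 ≤ X)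
    (hY0 : 0 ≤ Y) (hA0 : 0 ≤ A) (hB0 : 0 ≤ B)
    (hA : A ≤ K * (Z * B + 2 * (L * Y) + η * A)) (hzx : Z * X ≤ L * Y + 2 * (η * A))
    (hB : B ≤ K * (Z * Y * η + Z * A + η * X + η * B)) (hzy : Z * Y ≤ 2 * (η * X + η * B)) :
    B ≤ X ∧ Z * Y ≤ 4 * (η * X) ∧ A ≤ K * (2 * (Z * B) + 4 * (L * Y)) ∧ Z * X ≤ 2 * (L * Y) := by
  have hK0 : 0 < K := by linarith
  have hKK : K ≤ K ^ 2 := by nlinarith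
  have hKη : K * η ≤ 1 / 1024 := by nlinarith
  have hη1 : η ≤ 1 / 1024 := by nlinarith
  have hKL : K ^ 2 * L ≤ 1 / 1024 := by nlinarith [mul_le_mul_of_nonneg_left hL (sq_nonneg K)]
  have hA1 : A ≤ K * (2 * (Z * B) + 4 * (L * Y)) := by
    have h1 := mul_le_mul_of_nonneg_right hKη hA0
    have h2 : 0 ≤ K * (Z * B) := by positivity
    have h3 : 0 ≤ K * (L * Y) := by positivity
    nlinarith
  have hKηX := mul_le_mul_of_nonneg_right hKη hX0
  have hKηB := mul_le_mul_of_nonneg_right hKη hB0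
  have hηX := mul_le_mul_of_nonneg_right hη1 hX0
  have hηB := mul_le_mul_of_nonneg_right hη1 hB0
  have hBX : B ≤ X := by
    have h1 : K * (Z * A) ≤ 2 * ((K * Z) * ((K * Z) * B)) + 4 * ((K ^ 2 * L) * (Z * Y)) := by
      have := mul_le_mul_of_nonneg_left hA1 (by positivity : 0 ≤ K * Z)
      nlinarith
    have h2 : (K * Z) * ((K * Z) * B) ≤ 1 / 4 * (1 / 4 * B) := by gcongr
    have hZY0 : 0 ≤ Z * Y := by positivity
    have h3 : (K ^ 2 * L) * (Z * Y) ≤ 1 / 1024 * (Z * Y) := by gcongr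
    have h4 : K * (Z * Y * η) ≤ 1 / 1024 * (Z * Y) := by
      have := mul_le_mul_of_nonneg_right hKη hZY0
      linarith
    nlinarith
  refine ⟨hBX, ?_, hA1, ?_⟩
  · have := mul_le_mul_of_nonneg_left hBX hη0
    linarith
  · have h1 : η * A ≤ 2 * ((K * η) * (Z * B)) + 4 * ((K * η) * (L * Y)) := by
      have := mul_le_mul_of_nonneg_left hA1 hη0
      linarith
    have h2 : (K * η) * (Z * B) ≤ 1 / 1024 * (Z * X) := by gcongr
    have h3 : (K * η) * (L * Y) ≤ 1 / 1024 * (L * Y) := by gcongr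
    have : 0 ≤ L * Y := by positivity
    linarith

variable {K η : ℝ} {B₀ : L2 →L[ℂ] L2} {ψ : L2} {lam : ℝ}

/-- An even function of mean zero is a multiple of `ψ` up to high modes. -/
theorem IsKer.noLow_even {hk : 0 < k} (hψ : IsKer hk κ B₀ η ψ) {e : L2} (he0 : coeff 0 e = 0)
    (her : reflL e = e) : NoLow (e - (2 * coeff 1 e) • ψ) := by
  refine NoLow.of_coeff ?_ ?_ ?_
  · rw [map_sub, map_smul, he0, hψ.zero, smul_zero, sub_zero]
  · rw [map_sub, map_smul, hψ.one, smul_eq_mul]; ring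
  · rw [map_sub, map_smul, coeff_neg_of_refl her, coeff_neg_of_refl hψ.refl, hψ.one, smul_eq_mul]
    ring

theorem IsKer.pencil {hk : 0 < k} (hψ : IsKer hk κ B₀ η ψ) :
    opTheta hk κ ψ + pertAt hk B₀ lam ψ = (lam : ℂ) • opN hk ψ := by
  rw [pertAt_apply, ← add_assoc, hψ.ker, zero_add]

/-- Mode 1 and the high modes of the even and odd equations give four inequalities, closed by
`near_zero_arith`. They show that none of x, y, λ can vanish for a nonzero eigenvector, and that
z²/λ is of order η; both are needed for the rescaling. -/
theorem near_zero_estimates {hk : 0 < k} (hκ : 0 < κ) (hK1 : 1 ≤ K) (hK : 1 ≤ K * gap κ k)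
    (hη : η * (1024 * K ^ 2) ≤ 1) (hη0 : 0 ≤ η) (hψ : IsKer hk κ B₀ η ψ)
    (hB : IsPert (pertAt hk B₀ lam) η) (hlam : |lam| ≤ η) {z x y : ℂ} (hz : z ≠ 0)
    (hzK : K * ‖z‖ ≤ 1 / 4) {p r : L2} (hp : NoLow p) (hr : NoLow r)
    (he : opTheta hk κ (y • ψ + p) + pertAt hk B₀ lam (y • ψ + p) = z • opS (x • sinV + r))
    (ho : opTheta hk κ (x • sinV + r) + pertAt hk B₀ lam (x • sinV + r) = z • opS (y • ψ + p)) :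
    ‖r‖ ≤ ‖x‖ ∧ ‖z‖ * ‖y‖ ≤ 4 * (η * ‖x‖) ∧
      ‖p‖ ≤ K * (2 * (‖z‖ * ‖r‖) + 4 * (|lam| * ‖y‖)) ∧ ‖z‖ * ‖x‖ ≤ 2 * (|lam| * ‖y‖) := by
  have hK2 : 1 ≤ K ^ 2 := one_le_pow₀ hK1
  have hK0 : 0 < K := by linarith
  have hψ2 := hψ.norm_le (by nlinarith : η ≤ 1)
  have hN := (norm_opN_le hk ψ).trans hψ2
  have he' : (y * lam) • opN hk ψ + opTheta hk κ p + pertAt hk B₀ lam p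
      = z • opS (x • sinV + r) := by
    rw [← he, map_add, map_add, map_smul, map_smul, mul_smul, ← hψ.pencil]; module
  have ho' : opTheta hk κ r + (x • pertAt hk B₀ lam sinV + pertAt hk B₀ lam r)
      = z • opS (y • ψ + p) := by
    rw [← ho, map_add, map_add, map_smul, map_smul, opTheta_sinV]; module
  refine near_zero_arith hK1 hη hη0 (abs_nonneg lam) hlam (norm_pos_iff.2 hz) hzK (norm_nonneg x)
    (norm_nonneg y) (norm_nonneg p) (norm_nonneg r) ?_ ?_ ?_ ?_
  · refine (norm_le_of_theta hk hκ hK0 hK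
      (h := z • opS r - (y * lam) • opN hk ψ - pertAt hk B₀ lam p) hp fun n hn => ?_).trans ?_
    · have h1 := congrArg (coeff n) he'
      rw [map_add, map_add, coeff_opTheta hk κ hp.zero, map_smul, map_smul, coeff_opS, map_add,
        map_smul, coeff_sinV_of_two_le hn, smul_zero, zero_add] at h1
      rw [map_sub, map_sub, map_smul, map_smul, coeff_opS]
      linear_combination h1
    · gcongr
      refine (norm_sub_le _ _).trans (add_le_add ((norm_sub_le _ _).trans (add_le_add ?_ ?_))
        (hB.bound p))
      · rw [norm_smul]; gcongr; exact norm_opS_le r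
      · rw [norm_smul, norm_mul, Complex.norm_real, Real.norm_eq_abs]
        have : |lam| * ‖y‖ * ‖opN hk ψ‖ ≤ |lam| * ‖y‖ * 2 := by gcongr
        linarith
  · have h1 := congrArg (coeff 1) he'
    rw [map_add, map_add, coeff_opTheta hk κ hp.zero, theta_one, map_smul, map_smul, coeff_one_opS,
      map_add, map_smul, coeff_one_sinV, hr.one, coeff_one_opN, hψ.one] at h1
    have e : z * x = y * lam * symN k 1 + 2 * coeff 1 (pertAt hk B₀ lam p) := by
      simp only [smul_eq_mul] at h1
      push_cast at h1
      linear_combination -2 * h1 + z * x * Complex.I_mul_I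
    rw [← norm_mul, e]
    refine (norm_add_le _ _).trans (add_le_add ?_ ?_)
    · rw [norm_mul, norm_mul, Complex.norm_real, Complex.norm_real, Real.norm_eq_abs,
        Real.norm_of_nonneg (symN_nonneg 1), mul_comm ‖y‖]
      exact mul_le_of_le_one_right (by positivity) (symN_le_one 1)
    · rw [norm_mul, Complex.norm_two]
      have := (norm_coeff_le 1 _).trans (hB.bound p)
      gcongr
  -- On modes |n| ≥ 2 the vector ψ agrees with ψ − `cosV`, which gains a factor η.
  · refine (norm_le_of_theta hk hκ hK0 hK (h := (z * y) • opS (ψ - cosV) + z • opS p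
      - x • pertAt hk B₀ lam sinV - pertAt hk B₀ lam r) hr fun n hn => ?_).trans ?_
    · have h1 := congrArg (coeff n) ho'
      rw [map_add, coeff_opTheta hk κ hr.zero, map_add, map_smul, map_smul, coeff_opS, map_add,
        map_smul] at h1
      rw [map_sub, map_sub, map_add, map_smul, map_smul, map_smul, coeff_opS, coeff_opS, map_sub,
        coeff_cosV_of_two_le hn]
      simp only [smul_eq_mul] at h1 ⊢
      linear_combination h1
    · gcongr
      refine (norm_sub_le _ _).trans (add_le_add ((norm_sub_le _ _).trans (add_le_add
        ((norm_add_le _ _).trans (add_le_add ?_ ?_)) ?_)) (hB.bound r))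
      · rw [norm_smul, norm_mul]; gcongr; exact (norm_opS_le _).trans hψ.near
      · rw [norm_smul]; gcongr; exact norm_opS_le p
      · rw [norm_smul, mul_comm]
        have := (hB.bound sinV).trans (mul_le_of_le_one_right hη0 norm_sinV_le)
        gcongr
  · have h1 := congrArg (coeff 1) ho'
    rw [map_add, coeff_opTheta hk κ hr.zero, theta_one, map_smul, coeff_one_opS,
      map_add _ (y • ψ), map_smul _ y, hψ.one, hp.one] at h1
    have e : z * y = 2 * Complex.I * coeff 1 (x • pertAt hk B₀ lam sinV + pertAt hk B₀ lam r) := by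
      simp only [smul_eq_mul] at h1
      push_cast at h1
      linear_combination -2 * Complex.I * h1 + z * y * Complex.I_mul_I
    rw [← norm_mul, e, norm_mul, norm_mul, Complex.norm_two, Complex.norm_I, mul_one]
    gcongr
    refine (norm_coeff_le _ _).trans ((norm_add_le _ _).trans (add_le_add ?_ (hB.bound r)))
    rw [norm_smul, mul_comm]
    have := (hB.bound sinV).trans (mul_le_of_le_one_right hη0 norm_sinV_le)
    gcongr

/-- Every eigenvector of the pencil for a small nonzero eigenvalue comes from a rescaled solution. -/
theorem exists_scaledSol_of_eigen {hk : 0 < k} (hκ : 0 < κ) (hK1 : 1 ≤ K) (hK : 1 ≤ K * gap κ k)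
    (hη : η * (1024 * K ^ 2) ≤ 1) (hη0 : 0 ≤ η) (hψ : IsKer hk κ B₀ η ψ)
    (hB : IsPert (pertAt hk B₀ lam) η) (hlam : |lam| ≤ η) {z : ℂ} (hz : z ≠ 0)
    (hzK : K * ‖z‖ ≤ 1 / 4) {f : L2} (hf0 : coeff 0 f = 0) (hf : f ≠ 0)
    (he : opTheta hk κ f + pertAt hk B₀ lam f = z • opS f) :
    lam ≠ 0 ∧ ∃ (ν : ℂ) (F ρ : L2) (t : ℂ), ScaledSol hk κ B₀ ψ lam ν F ρ ∧ ‖ν‖ ≤ 8 * η ∧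
      z ^ 2 = ν * lam ∧ f = t • scaledVec lam z ψ F ρ := by
  obtain ⟨A, hA⟩ : ∃ A : L2 →L[ℂ] L2, A = opTheta hk κ + pertAt hk B₀ lam := ⟨_, rfl⟩
  have hAf : ∀ f, A f = opTheta hk κ f + pertAt hk B₀ lam f := fun f => by rw [hA]; rfl
  have hAr : ∀ f, reflL (A f) = A (reflL f) := fun f => by
    rw [hAf, hAf, map_add, reflL_opTheta, hB.refl]
  have hpar := pencil_parity hAr (z := z) (t := 0) (p := f) (F := 0) (U := 0) (by simp) (by simp)
    (by rw [hAf, he]; simp)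
  simp only [map_zero, smul_zero, add_zero] at hpar
  obtain ⟨hAe, hAo⟩ := hpar
  have hfe := evenPart_add_oddPart f
  have he0 : coeff 0 (evenPart f) = 0 := by rw [coeff_evenPart, neg_zero, hf0]; simp
  have ho0 : coeff 0 (oddPart f) = 0 := by rw [coeff_oddPart, neg_zero, hf0]; simp
  have her := reflL_evenPart f
  have hor := reflL_oddPart f
  generalize evenPart f = e at *
  generalize oddPart f = o at *
  have hp := hψ.noLow_even he0 her
  have hr := NoLow.of_odd ho0 hor
  obtain ⟨y, hy⟩ : ∃ y, y = 2 * coeff 1 e := ⟨_, rfl⟩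
  obtain ⟨x, hx⟩ : ∃ x, x = -(2 * Complex.I) * coeff 1 o := ⟨_, rfl⟩
  obtain ⟨p, hpd⟩ : ∃ p, p = e - y • ψ := ⟨_, rfl⟩
  obtain ⟨r, hrd⟩ : ∃ r, r = o - x • sinV := ⟨_, rfl⟩
  rw [← hy, ← hpd] at hp
  rw [← hx, ← hrd] at hr
  have hep : y • ψ + p = e := by rw [hpd]; abel
  have hor' : x • sinV + r = o := by rw [hrd]; abel
  obtain ⟨h1, h2, h3, h4⟩ := near_zero_estimates hκ hK1 hK hη hη0 hψ hB hlam hz hzK hp hr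
    (by rw [hep, hor', ← hAf]; exact hAe) (by rw [hep, hor', ← hAf]; exact hAo)
  have hz' := norm_pos_iff.2 hz
  -- If x = 0, the estimates annihilate r, then y, then p, and hence f.
  have hx0 : x ≠ 0 := by
    rintro rfl
    rw [norm_zero] at h1 h2
    have hr0 : r = 0 := norm_le_zero_iff.1 h1
    have hy0 : y = 0 := by
      rw [mul_zero, mul_zero] at h2
      exact norm_le_zero_iff.1 (nonpos_of_mul_nonpos_right h2 hz')
    rw [hr0, hy0, norm_zero] at h3
    have hp0 : p = 0 := norm_le_zero_iff.1 (by simpa using h3)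
    apply hf
    rw [← hfe, ← hep, ← hor', hr0, hy0, hp0]
    simp
  have hx' := norm_pos_iff.2 hx0
  have hly : 0 < |lam| * ‖y‖ := by
    have : 0 < ‖z‖ * ‖x‖ := by positivity
    linarith
  have hlam0 : lam ≠ 0 := by rintro rfl; simp at hly
  have hy0 : y ≠ 0 := by rintro rfl; simp at hly
  have hl : (lam : ℂ) ≠ 0 := by exact_mod_cast hlam0
  -- Dividing f by λy/z turns the ψ-coefficient y of its even part into z/λ, as in `scaledVec`.
  refine ⟨hlam0, z ^ 2 / lam, (z / (lam * y)) • o, (1 / (lam * y)) • p, lam * y / z,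
    ⟨?_, ?_, ?_, ?_, ?_, ?_, ?_⟩, ?_, ?_, ?_⟩
  · rw [map_smul, ho0, smul_zero]
  · rw [map_smul, hor, smul_neg]
  · rw [map_smul, hp.zero, smul_zero]
  · rw [map_smul, hp.one, smul_zero]
  · rw [map_smul, hpd, map_sub, map_smul, her, hψ.refl]
  · have h5 : A p = z • opS o - (y * lam) • opN hk ψ := by
      rw [hpd, map_sub, map_smul, hAe, hAf, hψ.pencil, smul_smul]
    rw [add_assoc, ← hAf, map_smul, h5, map_smul, smul_sub, smul_smul, smul_smul]
    rw [show 1 / (lam * y) * (y * lam) = 1 by field_simp, show 1 / (lam * y) * z = z / (lam * y) by ring]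
    module
  · rw [← hAf, map_smul, hAo, ← hep, map_add, map_add, map_smul, map_smul, map_smul]
    simp only [smul_add, smul_smul]
    congr 2
    · field_simp
    · field_simp
  -- From |z||x| ≤ 2|λ||y| and |z||y| ≤ 4η|x| follows |z|² ≤ 8η|λ|.
  · rw [norm_div, norm_pow, Complex.norm_real, Real.norm_eq_abs, div_le_iff₀ (abs_pos.2 hlam0)]
    have h5 := mul_le_mul_of_nonneg_left h4 hz'.le
    have h6 := mul_le_mul_of_nonneg_left h2 (abs_nonneg lam)
    refine le_of_mul_le_mul_right ?_ hx'
    nlinarith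
  · rw [div_mul_cancel₀ _ hl]
  · rw [← hfe, ← hep, scaledVec]
    simp only [smul_add, smul_smul]
    rw [show lam * y / z * (z / (lam * y)) = 1 by field_simp,
      show lam * y / z * (z / lam) = y by field_simp,
      show lam * y / z * (z / lam * (lam * (1 / (lam * y)))) = 1 by field_simp]
    module

end

/-- Contraction principle on the intersection of a closed set with a ball around `0`. -/
theorem exists_fixedPoint_ball {E : Type*} [NormedAddCommGroup E] [CompleteSpace E] {s : Set E}
    (hs : IsClosed s) {R : ℝ} (hR : 0 ≤ R) (Ξ : E → E) (h0 : (0 : E) ∈ s)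
    (hmaps : ∀ u ∈ s, Ξ u ∈ s)
    (hlip : ∀ u v, ‖u‖ ≤ R → ‖v‖ ≤ R → ‖Ξ u - Ξ v‖ ≤ 1 / 2 * ‖u - v‖) (hΞ : ‖Ξ 0‖ ≤ R / 2) :
    ∃ u ∈ s, ‖u‖ ≤ R ∧ Ξ u = u := by
  have h0R : ‖(0 : E)‖ ≤ R := by rwa [norm_zero]
  have hm : Set.MapsTo Ξ (s ∩ Metric.closedBall 0 R) (s ∩ Metric.closedBall 0 R) := by
    rintro u ⟨hu, hu'⟩
    rw [mem_closedBall_zero_iff] at hu'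
    refine ⟨hmaps u hu, ?_⟩
    rw [mem_closedBall_zero_iff]
    have h1 := hlip u 0 hu' h0R
    rw [sub_zero] at h1
    have h2 : ‖Ξ u‖ ≤ ‖Ξ u - Ξ 0‖ + ‖Ξ 0‖ := by simpa using norm_add_le (Ξ u - Ξ 0) (Ξ 0)
    linarith
  have hc : ContractingWith (1 / 2) (hm.restrict Ξ _ _) := by
    refine ⟨by norm_num, LipschitzWith.of_dist_le_mul ?_⟩
    rintro ⟨u, hu, hu'⟩ ⟨v, hv, hv'⟩
    rw [mem_closedBall_zero_iff] at hu' hv'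
    rw [Subtype.dist_eq, Subtype.dist_eq, dist_eq_norm, dist_eq_norm]
    simpa using hlip u v hu' hv'
  obtain ⟨y, hy, hfy, -⟩ := hc.exists_fixedPoint' (hs.inter Metric.isClosed_closedBall).isComplete hm
    (x := 0) ⟨h0, by simpa using hR⟩ (edist_ne_top _ _)
  exact ⟨y, hy.1, by simpa using hy.2, hfy⟩

/-! ### Solving the rescaled problem by contraction -/

section

variable {κ k : ℝ}

/-- The inverse of the unperturbed operator on high modes. -/
def thetaInv (hκ : 0 < κ) (hk : 0 < k) {K : ℝ} (hK : 1 ≤ K * gap κ k) : L2 →L[ℂ] L2 :=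
  mult (fun n => if |n| ≤ 1 then 0 else ((theta κ k n : ℂ))⁻¹) K fun n => by
    have hg := gap_pos hκ hk
    have hK0 : 0 < K := pos_of_mul_pos_left (by linarith) hg.le
    by_cases hn : |n| ≤ 1
    · simp only [hn, if_true, norm_zero]; exact hK0.le
    · simp only [hn, if_false]
      have h1 := gap_le_theta (κ := κ) (k := k) hκ (by omega : 2 ≤ |n|)
      have h2 : 0 < theta κ k n := hg.trans_le h1
      rw [norm_inv, Complex.norm_real, Real.norm_of_nonneg h2.le, inv_le_iff_one_le_mul₀ h2]
      exact hK.trans (by gcongr)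

section

variable {hκ : 0 < κ} {hk : 0 < k} {K : ℝ} {hK : 1 ≤ K * gap κ k}

theorem norm_thetaInv_le (f : L2) : ‖thetaInv hκ hk hK f‖ ≤ K * ‖f‖ := norm_mult_le _ _ _ _

theorem noLow_thetaInv (f : L2) : NoLow (thetaInv hκ hk hK f) := fun n hn => by
  rw [thetaInv, coeff_mult, if_pos hn, zero_mul]

theorem theta_mul_thetaInv (f : L2) {n : ℤ} (hn : 2 ≤ |n|) :
    (theta κ k n : ℂ) * coeff n (thetaInv hκ hk hK f) = coeff n f := by
  have h2 : 0 < theta κ k n := (gap_pos hκ hk).trans_le (gap_le_theta hκ hn)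
  have h3 : (theta κ k n : ℂ) ≠ 0 := by exact_mod_cast h2.ne'
  rw [thetaInv, coeff_mult, if_neg (by omega), mul_inv_cancel_left₀ h3]

theorem reflL_thetaInv (f : L2) : reflL (thetaInv hκ hk hK f) = thetaInv hκ hk hK (reflL f) :=
  ext_coeff fun n => by
    rw [coeff_reflL, thetaInv, coeff_mult, coeff_mult, coeff_reflL, abs_neg, theta_neg]

theorem conjL_thetaInv (f : L2) : conjL (thetaInv hκ hk hK f) = thetaInv hκ hk hK (conjL f) :=
  ext_coeff fun n => by
    rw [coeff_conjL, thetaInv, coeff_mult, coeff_mult, coeff_conjL, map_mul]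
    split_ifs
    · simp
    · rw [map_inv₀, Complex.conj_ofReal]

end

theorem reflL_cosV : reflL cosV = cosV := ext_coeff fun n => by
  rw [coeff_reflL, coeff_cosV, coeff_cosV]
  by_cases h1 : n = 1
  · simp [h1]
  · by_cases h2 : n = -1
    · simp [h2]
    · rw [if_neg (by omega), if_neg (by omega), if_neg h1, if_neg h2]

theorem eq_of_even_modes {f g : L2} (hf : reflL f = f) (hg : reflL g = g) (h0 : coeff 0 f = coeff 0 g)
    (h1 : coeff 1 f = coeff 1 g) (h : ∀ n : ℤ, 2 ≤ |n| → coeff n f = coeff n g) : f = g :=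
  ext_coeff fun n => by
    by_cases hn : 2 ≤ |n|
    · exact h n hn
    · have : n = 0 ∨ n = 1 ∨ n = -1 := by rw [le_abs] at hn; omega
      rcases this with rfl | rfl | rfl
      · exact h0
      · exact h1
      · rw [coeff_neg_of_refl hf, coeff_neg_of_refl hg, h1]

theorem eq_of_odd_modes {f g : L2} (hf : reflL f = -f) (hg : reflL g = -g)
    (h0 : coeff 0 f = coeff 0 g)
    (h1 : coeff 1 f = coeff 1 g) (h : ∀ n : ℤ, 2 ≤ |n| → coeff n f = coeff n g) : f = g :=
  ext_coeff fun n => by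
    by_cases hn : 2 ≤ |n|
    · exact h n hn
    · have : n = 0 ∨ n = 1 ∨ n = -1 := by rw [le_abs] at hn; omega
      rcases this with rfl | rfl | rfl
      · exact h0
      · exact h1
      · rw [coeff_neg_of_refl_neg hf, coeff_neg_of_refl_neg hg, h1]

section fixed

variable {K η : ℝ}

/-- The unknowns `((x, ν), (r, ρ))` of the rescaled problem, `F = x sinV + r`. -/
abbrev ScaledSpace : Type := (ℂ × ℂ) × (L2 × L2)

/-- The right hand side of the high modes of the odd equation. -/
def scaledRhs (B : L2 →L[ℂ] L2) (ψ : L2) (lam : ℝ) (u : ScaledSpace) : L2 :=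
  u.1.2 • opS (ψ - cosV) + (u.1.2 * lam) • opS u.2.2 - u.1.1 • B sinV - B u.2.1

/-- The fixed point map of the rescaled problem. -/
def scaledMap (hκ : 0 < κ) (hk : 0 < k) (hK : 1 ≤ K * gap κ k) (B : L2 →L[ℂ] L2) (ψ : L2) (lam : ℝ)
    (u : ScaledSpace) : ScaledSpace :=
  ((symN k 1 + 2 * coeff 1 (B u.2.2),
    2 * Complex.I * (u.1.1 * coeff 1 (B sinV) + coeff 1 (B u.2.1))),
    (thetaInv hκ hk hK (scaledRhs B ψ lam u),
    thetaInv hκ hk hK (opS (thetaInv hκ hk hK (scaledRhs B ψ lam u)) - opN hk (ψ - cosV) - B u.2.2)))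

/-- Every term has a factor of size η; with unknowns of norm at most 2, the five differences
contribute 1 + 2 + 2 + 1 + 1 = 7. -/
theorem scaledRhs_sub (B : L2 →L[ℂ] L2) (ψ : L2) (lam : ℝ) (hη0 : 0 ≤ η)
    (hB : ∀ f, ‖B f‖ ≤ η * ‖f‖) (hψ : ‖ψ - cosV‖ ≤ η) (hlam : |lam| ≤ η) {u v : ScaledSpace}
    (hu : ‖u‖ ≤ 2) (hv : ‖v‖ ≤ 2) :
    ‖scaledRhs B ψ lam u - scaledRhs B ψ lam v‖ ≤ 7 * (η * ‖u - v‖) := by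
  have e : scaledRhs B ψ lam u - scaledRhs B ψ lam v
      = (u.1.2 - v.1.2) • opS (ψ - cosV) + (((u.1.2 - v.1.2) * lam) • opS u.2.2
        + (v.1.2 * lam) • opS (u.2.2 - v.2.2)) - (u.1.1 - v.1.1) • B sinV - B (u.2.1 - v.2.1) := by
    unfold scaledRhs
    rw [map_sub B u.2.1, map_sub opS u.2.2]
    module
  have h11 : ‖u.1.1 - v.1.1‖ ≤ ‖u - v‖ := (norm_fst_le (u - v).1).trans (norm_fst_le (u - v))
  have h12 : ‖u.1.2 - v.1.2‖ ≤ ‖u - v‖ := (norm_snd_le (u - v).1).trans (norm_fst_le (u - v))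
  have h21 : ‖u.2.1 - v.2.1‖ ≤ ‖u - v‖ := (norm_fst_le (u - v).2).trans (norm_snd_le (u - v))
  have h22 : ‖u.2.2 - v.2.2‖ ≤ ‖u - v‖ := (norm_snd_le (u - v).2).trans (norm_snd_le (u - v))
  have hu22 : ‖u.2.2‖ ≤ 2 := (norm_snd_le u.2).trans ((norm_snd_le u).trans hu)
  have hv12 : ‖v.1.2‖ ≤ 2 := (norm_snd_le v.1).trans ((norm_fst_le v).trans hv)
  have hl : ‖(lam : ℂ)‖ ≤ η := by rwa [Complex.norm_real, Real.norm_eq_abs]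
  rw [e]
  generalize ‖u - v‖ = d at *
  have hd : 0 ≤ d := (norm_nonneg _).trans h11
  have a1 : ‖(u.1.2 - v.1.2) • opS (ψ - cosV)‖ ≤ d * η := by
    rw [norm_smul]
    exact mul_le_mul h12 ((norm_opS_le _).trans hψ) (norm_nonneg _) hd
  have a2 : ‖((u.1.2 - v.1.2) * lam) • opS u.2.2‖ ≤ d * η * 2 := by
    rw [norm_smul, norm_mul]
    exact mul_le_mul (mul_le_mul h12 hl (norm_nonneg _) hd) ((norm_opS_le _).trans hu22)
      (norm_nonneg _) (by positivity)
  have a3 : ‖(v.1.2 * lam) • opS (u.2.2 - v.2.2)‖ ≤ 2 * η * d := by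
    rw [norm_smul, norm_mul]
    exact mul_le_mul (mul_le_mul hv12 hl (norm_nonneg _) (by norm_num)) ((norm_opS_le _).trans h22)
      (norm_nonneg _) (by positivity)
  have a4 : ‖(u.1.1 - v.1.1) • B sinV‖ ≤ d * η := by
    rw [norm_smul]
    exact mul_le_mul h11 ((hB _).trans (mul_le_of_le_one_right hη0 norm_sinV_le)) (norm_nonneg _) hd
  have a5 : ‖B (u.2.1 - v.2.1)‖ ≤ η * d := (hB _).trans (by gcongr)
  refine (norm_sub_le _ _).trans ?_
  refine (add_le_add_left (norm_sub_le _ _) _).trans ?_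
  have := norm_add_le ((u.1.2 - v.1.2) • opS (ψ - cosV)) (((u.1.2 - v.1.2) * lam) • opS u.2.2
        + (v.1.2 * lam) • opS (u.2.2 - v.2.2))
  have := norm_add_le (((u.1.2 - v.1.2) * (lam : ℂ)) • opS u.2.2)
    ((v.1.2 * lam) • opS (u.2.2 - v.2.2))
  linarith

theorem scaledMap_lipschitz {hκ : 0 < κ} {hk : 0 < k} (hK1 : 1 ≤ K) {hK : 1 ≤ K * gap κ k}
    (hη : η * (1024 * K ^ 2) ≤ 1) {B : L2 →L[ℂ] L2} {ψ : L2} {lam : ℝ} (hη0 : 0 ≤ η)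
    (hB : ∀ f, ‖B f‖ ≤ η * ‖f‖) (hψ : ‖ψ - cosV‖ ≤ η) (hlam : |lam| ≤ η) {u v : ScaledSpace}
    (hu : ‖u‖ ≤ 2) (hv : ‖v‖ ≤ 2) :
    ‖scaledMap hκ hk hK B ψ lam u - scaledMap hκ hk hK B ψ lam v‖ ≤ 1 / 2 * ‖u - v‖ := by
  have hG := scaledRhs_sub B ψ lam hη0 hB hψ hlam hu hv
  have h11 : ‖u.1.1 - v.1.1‖ ≤ ‖u - v‖ := (norm_fst_le (u - v).1).trans (norm_fst_le (u - v))
  have h21 : ‖u.2.1 - v.2.1‖ ≤ ‖u - v‖ := (norm_fst_le (u - v).2).trans (norm_snd_le (u - v))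
  have h22 : ‖u.2.2 - v.2.2‖ ≤ ‖u - v‖ := (norm_snd_le (u - v).2).trans (norm_snd_le (u - v))
  unfold scaledMap
  generalize scaledRhs B ψ lam u = g at hG ⊢
  generalize scaledRhs B ψ lam v = g' at hG ⊢
  generalize ‖u - v‖ = d at *
  have hd : 0 ≤ d := (norm_nonneg _).trans h11
  have hK0 : 0 < K := by linarith
  have hKK : K ≤ K ^ 2 := by nlinarith
  have hKKη : K ^ 2 * (η * d) ≤ 1 / 1024 * d := by nlinarith
  have hKη : K * (η * d) ≤ K ^ 2 * (η * d) := by gcongr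
  have hη1 : η * d ≤ K * (η * d) := le_mul_of_one_le_left (by positivity) hK1
  have b21 : ‖B (u.2.1 - v.2.1)‖ ≤ η * d := (hB _).trans (by gcongr)
  have b22 : ‖B (u.2.2 - v.2.2)‖ ≤ η * d := (hB _).trans (by gcongr)
  have hr : ‖thetaInv hκ hk hK g - thetaInv hκ hk hK g'‖ ≤ 7 * (K * (η * d)) := by
    rw [← map_sub]
    refine (norm_thetaInv_le _).trans ?_
    have := mul_le_mul_of_nonneg_left hG hK0.le
    linarith
  rw [Prod.norm_def, Prod.norm_def, Prod.norm_def]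
  simp only [Prod.fst_sub, Prod.snd_sub]
  refine max_le (max_le ?_ ?_) (max_le ?_ ?_)
  · rw [add_sub_add_left_eq_sub, ← mul_sub, ← map_sub, ← map_sub, norm_mul, Complex.norm_two]
    linarith [norm_coeff_le 1 (B (u.2.2 - v.2.2))]
  · rw [← mul_sub, add_sub_add_comm, ← sub_mul, ← map_sub, ← map_sub, norm_mul, norm_mul,
      Complex.norm_two, Complex.norm_I, mul_one]
    have h1 := norm_add_le ((u.1.1 - v.1.1) * coeff 1 (B sinV)) (coeff 1 (B (u.2.1 - v.2.1)))
    have h2 : ‖(u.1.1 - v.1.1) * coeff 1 (B sinV)‖ ≤ d * η := by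
      rw [norm_mul]
      exact mul_le_mul h11 ((norm_coeff_le _ _).trans ((hB _).trans
        (mul_le_of_le_one_right hη0 norm_sinV_le))) (norm_nonneg _) hd
    linarith [norm_coeff_le 1 (B (u.2.1 - v.2.1))]
  · linarith
  · rw [← map_sub]
    refine (norm_thetaInv_le _).trans ?_
    have e : opS (thetaInv hκ hk hK g) - opN hk (ψ - cosV) - B u.2.2
        - (opS (thetaInv hκ hk hK g') - opN hk (ψ - cosV) - B v.2.2)
        = opS (thetaInv hκ hk hK g - thetaInv hκ hk hK g') - B (u.2.2 - v.2.2) := by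
      rw [map_sub opS, map_sub B]; abel
    rw [e]
    have h1 : ‖opS (thetaInv hκ hk hK g - thetaInv hκ hk hK g') - B (u.2.2 - v.2.2)‖
        ≤ 8 * (K * (η * d)) := by
      refine (norm_sub_le _ _).trans ?_
      linarith [norm_opS_le (thetaInv hκ hk hK g - thetaInv hκ hk hK g')]
    have h2 := mul_le_mul_of_nonneg_left h1 hK0.le
    linarith

/-- The symmetry class of the unknowns. -/
def scaledSet : Set ScaledSpace := {u | reflL u.2.1 = -u.2.1 ∧ reflL u.2.2 = u.2.2}

theorem isClosed_scaledSet : IsClosed scaledSet := by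
  refine (isClosed_eq ?_ ?_).inter (isClosed_eq ?_ ?_)
  · exact reflL.continuous.comp (continuous_fst.comp continuous_snd)
  · exact (continuous_fst.comp continuous_snd).neg
  · exact reflL.continuous.comp (continuous_snd.comp continuous_snd)
  · exact continuous_snd.comp continuous_snd

variable {B₀ : L2 →L[ℂ] L2} {ψ : L2} {lam : ℝ}

theorem scaledMap_mem {hκ : 0 < κ} {hk : 0 < k} {hK : 1 ≤ K * gap κ k}
    (hψ : IsKer hk κ B₀ η ψ) {B : L2 →L[ℂ] L2} (hB : IsPert B η) {u : ScaledSpace}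
    (hu : u ∈ scaledSet) : scaledMap hκ hk hK B ψ lam u ∈ scaledSet := by
  obtain ⟨h1, h2⟩ := hu
  have hψc : reflL (ψ - cosV) = ψ - cosV := by rw [map_sub, hψ.refl, reflL_cosV]
  have hG : reflL (scaledRhs B ψ lam u) = -scaledRhs B ψ lam u := by
    unfold scaledRhs
    rw [map_sub, map_sub, map_add, map_smul, map_smul, map_smul, reflL_opS, reflL_opS, hB.refl,
      hB.refl, hψc, h1, h2, reflL_sinV, map_neg, map_neg]
    module
  have h3 : reflL (thetaInv hκ hk hK (scaledRhs B ψ lam u))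
      = -thetaInv hκ hk hK (scaledRhs B ψ lam u) := by rw [reflL_thetaInv, hG, map_neg]
  refine ⟨h3, ?_⟩
  change reflL (thetaInv hκ hk hK _) = thetaInv hκ hk hK _
  rw [reflL_thetaInv, map_sub reflL, map_sub reflL, reflL_opS, h3, reflL_opN, hψc, hB.refl, h2, map_neg, neg_neg]

/-- Lyapunov–Schmidt reduction: mode 1 of the even equation gives x, mode 1 of the odd equation
gives ν, and the high modes give ρ and r. For small η the resulting map is a contraction of the ball
of radius 2, and it preserves the parity class. -/
theorem exists_scaledSol {hk : 0 < k} (hκ : 0 < κ) (hK1 : 1 ≤ K) (hK : 1 ≤ K * gap κ k)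
    (hη : η * (1024 * K ^ 2) ≤ 1) (hη0 : 0 ≤ η) (hψ : IsKer hk κ B₀ η ψ)
    (hB : IsPert (pertAt hk B₀ lam) η) (hlam : |lam| ≤ η) :
    ∃ (ν : ℂ) (F ρ : L2), ScaledSol hk κ B₀ ψ lam ν F ρ ∧ ‖ν‖ ≤ 8 * η := by
  have hK0 : 0 < K := by linarith
  have hKη : K * η ≤ 1 := by nlinarith
  obtain ⟨u, hu, hu2, hfix⟩ := exists_fixedPoint_ball isClosed_scaledSet (R := 2) (by norm_num)
    (scaledMap hκ hk hK (pertAt hk B₀ lam) ψ lam) (by simp [scaledSet])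
    (fun u hu => scaledMap_mem hψ hB hu)
    (fun u v hu hv => scaledMap_lipschitz hK1 hη hη0 hB.bound hψ.near hlam hu hv) (by
      have h0 : scaledRhs (pertAt hk B₀ lam) ψ lam 0 = 0 := by simp [scaledRhs]
      unfold scaledMap
      rw [h0, Prod.norm_def, Prod.norm_def, Prod.norm_def]
      refine max_le (max_le ?_ ?_) (max_le ?_ ?_)
      · simpa [abs_of_nonneg (symN_nonneg 1)] using symN_le_one (k := k) 1
      · simp
      · simp
      · refine (norm_thetaInv_le _).trans ?_
        simp only [map_zero, Prod.snd_zero, zero_sub, sub_zero, norm_neg]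
        have := (norm_opN_le hk (ψ - cosV)).trans hψ.near
        have := mul_le_mul_of_nonneg_left this hK0.le
        linarith)
  obtain ⟨⟨x, ν⟩, r, ρ⟩ := u
  obtain ⟨hr, hρ⟩ := hu
  simp only [scaledMap, Prod.mk.injEq] at hfix hr hρ
  obtain ⟨⟨hx, hν⟩, hr', hρ'⟩ := hfix
  obtain ⟨G, hG⟩ : ∃ G, G = scaledRhs (pertAt hk B₀ lam) ψ lam ((x, ν), (r, ρ)) := ⟨_, rfl⟩
  rw [← hG] at hr' hρ'
  rw [hr'] at hρ'
  have hrL : NoLow r := hr' ▸ noLow_thetaInv _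
  have hρL : NoLow ρ := hρ' ▸ noLow_thetaInv _
  have hr2 : ∀ n : ℤ, 2 ≤ |n| → (theta κ k n : ℂ) * coeff n r = coeff n G := fun n hn => by
    conv_lhs => rw [← hr']
    rw [theta_mul_thetaInv _ hn]
  have hρ2 : ∀ n : ℤ, 2 ≤ |n| → (theta κ k n : ℂ) * coeff n ρ
      = coeff n (opS r - opN hk (ψ - cosV) - pertAt hk B₀ lam ρ) := fun n hn => by
    conv_lhs => rw [← hρ']
    rw [theta_mul_thetaInv _ hn]
  have hF0 : coeff 0 (x • sinV + r) = 0 := by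
    rw [map_add, map_smul, coeff_zero_sinV, hrL.zero, smul_zero, zero_add]
  have hFr : reflL (x • sinV + r) = -(x • sinV + r) := by
    rw [map_add, map_smul, reflL_sinV, hr]; module
  refine ⟨ν, x • sinV + r, ρ, ⟨hF0, hFr, hρL.zero, hρL.one, hρ, ?_, ?_⟩, ?_⟩
  -- By parity only modes 0, 1 and |n| ≥ 2 have to be compared; the fixed-point equations supply
  -- modes 1 and |n| ≥ 2.
  · refine eq_of_even_modes ?_ ?_ ?_ ?_ ?_
    · rw [map_add, map_add, reflL_opN, hψ.refl, reflL_opTheta, hB.refl, hρ]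
    · rw [reflL_opS, hFr, map_neg, neg_neg]
    · rw [map_add, map_add, coeff_opN, hψ.zero, coeff_opTheta hk κ hρL.zero, hρL.zero,
        hB.zero _ hρL.zero, coeff_opS, hF0]
      simp
    · rw [map_add, map_add, coeff_one_opN, hψ.one, coeff_opTheta hk κ hρL.zero, hρL.one,
        coeff_one_opS, map_add, map_smul, coeff_one_sinV, hrL.one, ← hx, smul_eq_mul]
      linear_combination (1 / 2 * (symN k 1 + 2 * coeff 1 (pertAt hk B₀ lam ρ))) * Complex.I_mul_I
    · intro n hn
      have h1 := hρ2 n hn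
      rw [map_sub, map_sub, map_sub (opN hk), map_sub, coeff_opN hk cosV, coeff_cosV_of_two_le hn,
        coeff_opS] at h1
      rw [map_add, map_add, coeff_opTheta hk κ hρL.zero, h1, coeff_opS, map_add, map_smul,
        coeff_sinV_of_two_le hn, smul_zero, zero_add]
      ring
  · refine eq_of_odd_modes ?_ ?_ ?_ ?_ ?_
    · rw [map_add, reflL_opTheta, hB.refl, hFr, map_neg, map_neg]; abel
    · rw [map_smul, reflL_opS, map_add, map_smul, hψ.refl, hρ, smul_neg]
    · rw [map_add, coeff_opTheta hk κ hF0, hF0, hB.zero _ hF0, map_smul, coeff_opS, map_add, map_smul,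
        hψ.zero, hρL.zero]
      simp
    · rw [map_add, coeff_opTheta hk κ hF0, theta_one, map_smul, coeff_one_even hψ hρL.one, ← hν,
        map_add (pertAt hk B₀ lam), map_smul (pertAt hk B₀ lam)]
      simp only [map_add, map_smul, smul_eq_mul]
      push_cast
      linear_combination (x * coeff 1 (pertAt hk B₀ lam sinV) + coeff 1 (pertAt hk B₀ lam r))
        * Complex.I_mul_I
    · intro n hn
      have h1 := hr2 n hn
      rw [hG, scaledRhs] at h1
      simp only [map_add, map_sub, map_smul, coeff_opS, smul_eq_mul, coeff_cosV_of_two_le hn] at h1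
      rw [map_add, coeff_opTheta hk κ hF0, map_add (pertAt hk B₀ lam), map_smul (pertAt hk B₀ lam)]
      simp only [map_add, map_smul, coeff_opS, smul_eq_mul, coeff_sinV_of_two_le hn]
      linear_combination h1
  -- The formula for ν in the fixed-point map gives 2(2η + 2η).
  · rw [← hν, norm_mul, norm_mul, Complex.norm_two, Complex.norm_I, mul_one]
    have hx2 : ‖x‖ ≤ 2 := (norm_fst_le (x, ν)).trans ((norm_fst_le _).trans hu2)
    have hr2' : ‖r‖ ≤ 2 := (norm_fst_le (r, ρ)).trans ((norm_snd_le _).trans hu2)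
    have h1 : ‖x * coeff 1 (pertAt hk B₀ lam sinV)‖ ≤ 2 * η := by
      rw [norm_mul]
      exact mul_le_mul hx2 ((norm_coeff_le _ _).trans ((hB.bound _).trans
        (mul_le_of_le_one_right hη0 norm_sinV_le))) (norm_nonneg _) (by norm_num)
    have h2 : ‖coeff 1 (pertAt hk B₀ lam r)‖ ≤ η * 2 :=
      (norm_coeff_le _ _).trans ((hB.bound _).trans (by gcongr))
    linarith [norm_add_le (x * coeff 1 (pertAt hk B₀ lam sinV)) (coeff 1 (pertAt hk B₀ lam r))]

end fixed

end

/-! ### The threshold λ* and its odd kernel vector -/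

section

variable {κ k K η : ℝ} {B : L2 →L[ℂ] L2}

/-- The fixed point map for the transverse wave number at which the pencil has an odd kernel. -/
def threshMap (hκ : 0 < κ) (hk : 0 < k) (hK : 1 ≤ K * gap κ k) (B : L2 →L[ℂ] L2) (u : L2 × ℝ) :
    L2 × ℝ :=
  (thetaInv hκ hk hK (-B (sinV + u.1) - (u.2 : ℂ) • opN hk u.1),
    (2 * Complex.I / symN k 1 * coeff 1 (B (sinV + u.1))).re)

theorem threshMap_lipschitz {hκ : 0 < κ} {hk : 0 < k} (hK1 : 1 ≤ K) {hK : 1 ≤ K * gap κ k}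
    (hη : η * (64 * K ^ 2) ≤ symN k 1) (hη0 : 0 ≤ η)
    (hB : ∀ f, ‖B f‖ ≤ η * ‖f‖) {u v : L2 × ℝ}
    (hu : ‖u‖ ≤ 4 * K * η / symN k 1) (hv : ‖v‖ ≤ 4 * K * η / symN k 1) :
    ‖threshMap hκ hk hK B u - threshMap hκ hk hK B v‖ ≤ 1 / 2 * ‖u - v‖ := by
  have hn0 : 0 < symN k 1 := by rw [symN_one]; positivity
  have hn1 : symN k 1 ≤ 1 := symN_le_one 1
  have h1 : ‖u.1 - v.1‖ ≤ ‖u - v‖ := norm_fst_le (u - v)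
  have h2 : ‖u.2 - v.2‖ ≤ ‖u - v‖ := norm_snd_le (u - v)
  have hu1 := (norm_fst_le u).trans hu
  have hv2 := (norm_snd_le v).trans hv
  have hK0 : 0 < K := by linarith
  have hR : K * (4 * K * η / symN k 1) ≤ 1 / 16 := by
    rw [← mul_div_assoc, div_le_iff₀ hn0]; linarith
  have hKη : K * η ≤ 1 / 64 := by nlinarith
  generalize 4 * K * η / symN k 1 = R at *
  unfold threshMap
  generalize ‖u - v‖ = d at *
  have hd : 0 ≤ d := (norm_nonneg _).trans h1
  have hR0 : 0 ≤ R := (norm_nonneg _).trans hv2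
  have b1 : ‖B (u.1 - v.1)‖ ≤ η * d := (hB _).trans (by gcongr)
  rw [Prod.norm_def]
  simp only [Prod.fst_sub, Prod.snd_sub]
  refine max_le ?_ ?_
  · rw [← map_sub]
    refine (norm_thetaInv_le _).trans ?_
    have e : -B (sinV + u.1) - (u.2 : ℂ) • opN hk u.1 - (-B (sinV + v.1) - (v.2 : ℂ) • opN hk v.1)
        = -B (u.1 - v.1) - (((u.2 - v.2 : ℝ) : ℂ) • opN hk u.1
          + (v.2 : ℂ) • opN hk (u.1 - v.1)) := by
      rw [map_add, map_add, map_sub B, map_sub (opN hk)]; push_cast; module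
    rw [e]
    have a2 : ‖((u.2 - v.2 : ℝ) : ℂ) • opN hk u.1‖ ≤ d * R := by
      rw [norm_smul, Complex.norm_real]
      exact mul_le_mul h2 ((norm_opN_le hk _).trans hu1) (norm_nonneg _) hd
    have a3 : ‖(v.2 : ℂ) • opN hk (u.1 - v.1)‖ ≤ R * d := by
      rw [norm_smul, Complex.norm_real]
      exact mul_le_mul hv2 ((norm_opN_le hk _).trans h1) (norm_nonneg _) hR0
    have a4 : ‖-B (u.1 - v.1) - (((u.2 - v.2 : ℝ) : ℂ) • opN hk u.1
          + (v.2 : ℂ) • opN hk (u.1 - v.1))‖ ≤ η * d + (d * R + R * d) := by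
      refine (norm_sub_le _ _).trans (add_le_add (by rwa [norm_neg])
        ((norm_add_le _ _).trans (add_le_add a2 a3)))
    have a5 := mul_le_mul_of_nonneg_left a4 hK0.le
    have a6 := mul_le_mul_of_nonneg_right hR hd
    have a7 := mul_le_mul_of_nonneg_right hKη hd
    linarith
  · rw [← Complex.sub_re, ← mul_sub, ← map_sub, ← map_sub, add_sub_add_left_eq_sub]
    refine (Complex.abs_re_le_norm _).trans ?_
    rw [norm_mul, norm_div, norm_mul, Complex.norm_two, Complex.norm_I, Complex.norm_real,
      Real.norm_of_nonneg hn0.le, mul_one, div_mul_eq_mul_div, div_le_iff₀ hn0]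
    have h3 := (norm_coeff_le 1 _).trans b1
    have h4 : η * d * 64 ≤ symN k 1 * d := by
      have : η * 64 ≤ symN k 1 := by
        have : η * (64 * 1) ≤ η * (64 * K ^ 2) := by
          gcongr
          exact one_le_pow₀ hK1
        linarith
      nlinarith
    have h5 : 0 ≤ symN k 1 * d := by positivity
    linarith

/-- The unknowns are r and λ: high modes of the kernel equation give r, and mode 1, where θ_1 = 0,
gives λ. Both are bounded by the size of B, so for a small wave they are O(a). -/
theorem exists_threshold {hk : 0 < k} (hκ : 0 < κ) (hK1 : 1 ≤ K) (hK : 1 ≤ K * gap κ k)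
    (hη : η * (64 * K ^ 2) ≤ symN k 1) (hη0 : 0 ≤ η) (hB : IsPert B η) :
    ∃ (lamS : ℝ) (rS : L2), NoLow rS ∧ reflL rS = -rS ∧ ‖rS‖ ≤ 4 * K * η / symN k 1 ∧
      |lamS| ≤ 4 * K * η / symN k 1 ∧
      opTheta hk κ (sinV + rS) + pertAt hk B lamS (sinV + rS) = 0 := by
  have hn0 : 0 < symN k 1 := by rw [symN_one]; positivity
  have hn1 : symN k 1 ≤ 1 := symN_le_one 1
  have hK0 : 0 < K := by linarith
  have hBs : ‖B sinV‖ ≤ η := (hB.bound _).trans (mul_le_of_le_one_right hη0 norm_sinV_le)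
  obtain ⟨⟨r, l⟩, ⟨hr, hc⟩, hu, hfix⟩ := exists_fixedPoint_ball
    (s := {u : L2 × ℝ | reflL u.1 = -u.1 ∧ conjL u.1 = -u.1})
    ((isClosed_eq (reflL.continuous.comp continuous_fst) continuous_fst.neg).inter
      (isClosed_eq (conjL.continuous.comp continuous_fst) continuous_fst.neg))
    (R := 4 * K * η / symN k 1) (by positivity) (threshMap hκ hk hK B) (by simp) (by
      rintro ⟨r, l⟩ ⟨h1, h2⟩
      simp only at h1 h2
      refine ⟨?_, ?_⟩
      · simp only [threshMap]
        rw [reflL_thetaInv, map_sub reflL, map_neg reflL, map_smul reflL, hB.refl, reflL_opN,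
          map_add reflL, h1, reflL_sinV, ← map_neg (thetaInv hκ hk hK), map_neg (opN hk), ← neg_add,
          map_neg B]
        congr 1
        module
      · simp only [threshMap]
        rw [conjL_thetaInv, map_sub conjL, map_neg conjL, ContinuousLinearMap.map_smulₛₗ conjL, hB.conj,
          conjL_opN, map_add conjL, h2, conjL_sinV, ← map_neg (thetaInv hκ hk hK), map_neg (opN hk),
          ← neg_add, map_neg B, Complex.conj_ofReal]
        congr 1
        module)
    (fun u v hu hv => threshMap_lipschitz hK1 hη hη0 hB.bound hu hv) (by
      have hKη : K * η ≤ K * η / symN k 1 := by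
        rw [le_div_iff₀ hn0]; exact mul_le_of_le_one_right (by positivity) hn1
      have e : 4 * K * η / symN k 1 / 2 = 2 * (K * η / symN k 1) := by ring
      rw [e, threshMap, Prod.norm_def]
      simp only [Prod.fst_zero, Prod.snd_zero, add_zero, map_zero, smul_zero, sub_zero]
      refine max_le ?_ ?_
      · refine (norm_thetaInv_le _).trans ?_
        rw [norm_neg]
        have := mul_le_mul_of_nonneg_left hBs hK0.le
        have : 0 ≤ K * η := by positivity
        linarith
      · refine (Complex.abs_re_le_norm _).trans ?_
        rw [norm_mul, norm_div, norm_mul, Complex.norm_two, Complex.norm_I, Complex.norm_real,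
          Real.norm_of_nonneg hn0.le, mul_one, div_mul_eq_mul_div, ← mul_div_assoc]
        gcongr
        exact ((norm_coeff_le 1 _).trans hBs).trans (le_mul_of_one_le_left hη0 hK1))
  simp only [threshMap, Prod.mk.injEq] at hfix hr hc
  obtain ⟨hfr, hfl⟩ := hfix
  have hrL : NoLow r := hfr ▸ noLow_thetaInv _
  have hF0 : coeff 0 (sinV + r) = 0 := by rw [map_add, coeff_zero_sinV, hrL.zero, zero_add]
  have hFr : reflL (sinV + r) = -(sinV + r) := by rw [map_add, reflL_sinV, hr]; abel
  -- The real part taken in `threshMap` loses nothing: `sinV + r` is reversed by conjugation, so its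
  -- image under B has imaginary coefficients.
  have hreal : (starRingEnd ℂ) (2 * Complex.I / symN k 1 * coeff 1 (B (sinV + r)))
      = 2 * Complex.I / symN k 1 * coeff 1 (B (sinV + r)) := by
    have h1 : (starRingEnd ℂ) (coeff 1 (B (sinV + r))) = -coeff 1 (B (sinV + r)) := by
      rw [← coeff_conjL, hB.conj, map_add conjL, conjL_sinV, hc, ← neg_add, map_neg, map_neg]
    rw [map_mul, h1, map_div₀, map_mul, Complex.conj_I, Complex.conj_ofReal, Complex.conj_ofNat]
    ring
  have hl : (l : ℂ) = 2 * Complex.I / symN k 1 * coeff 1 (B (sinV + r)) := by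
    rw [← hfl]; exact Complex.conj_eq_iff_re.1 hreal
  have hn0' : (symN k 1 : ℂ) ≠ 0 := by exact_mod_cast hn0.ne'
  have hF1 : coeff 1 (sinV + r) = Complex.I / 2 := by
    rw [map_add, coeff_one_sinV, hrL.one, add_zero]
  have hF2 : ∀ n : ℤ, 2 ≤ |n| → (theta κ k n : ℂ) * coeff n (sinV + r)
      = -coeff n (B (sinV + r)) - l * (symN k n * coeff n (sinV + r)) := fun n hn => by
    have h1 : (theta κ k n : ℂ) * coeff n r = coeff n (-B (sinV + r) - (l : ℂ) • opN hk r) := by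
      conv_lhs => rw [← hfr]
      rw [theta_mul_thetaInv _ hn]
    rw [map_sub, map_neg, map_smul (coeff n), coeff_opN, smul_eq_mul] at h1
    rw [map_add (coeff n) sinV, coeff_sinV_of_two_le hn, zero_add, h1]
  refine ⟨l, r, hrL, hr, (norm_fst_le (r, l)).trans hu, (norm_snd_le (r, l)).trans hu, ?_⟩
  clear hfr hfl hreal
  generalize sinV + r = F at hF0 hFr hl hF1 hF2 ⊢
  refine eq_of_odd_modes ?_ (by simp) ?_ ?_ ?_
  · rw [map_add, reflL_opTheta, pertAt_apply, map_add reflL, hB.refl, map_smul reflL, reflL_opN, hFr,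
      map_neg, map_neg, map_neg]
    module
  · rw [map_add, coeff_opTheta hk κ hF0, hF0, pertAt_apply, map_add (coeff 0), hB.zero _ hF0,
      map_smul (coeff 0), coeff_opN, hF0, map_zero]
    simp
  · rw [map_add, coeff_opTheta hk κ hF0, theta_one, pertAt_apply, map_add (coeff 1),
      map_smul (coeff 1), coeff_one_opN, hF1, hl, map_zero, smul_eq_mul]
    field_simp
    push_cast
    linear_combination 2 * coeff 1 (B F) * Complex.I_sq
  · intro n hn
    rw [map_add, coeff_opTheta hk κ hF0, pertAt_apply, map_add (coeff n), map_smul (coeff n),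
      coeff_opN, hF2 n hn, map_zero, smul_eq_mul]
    ring

end

/-- The perturbation of a small wave: a banded part of the size of the amplitude `a` and a remainder
of size `a²`. -/
structure WaveExpansion {k : ℝ} (hk : 0 < k) (κ : ℝ) (B₀ : L2 →L[ℂ] L2) (ψ : L2) (a M μ : ℝ) (γ : ℂ)
    (α β : ℤ → ℂ) (Lc Lv : L2 →L[ℂ] L2) : Prop where
  split : ∀ f, B₀ f = (μ : ℂ) • f + (a : ℂ) • Lc f + Lv f
  mu_le : |μ| ≤ M * a ^ 2
  cos_le : ∀ f, ‖Lc f‖ ≤ M * ‖f‖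
  band : ∀ n f, coeff n (Lc f) = α n * coeff (n - 1) f + β n * coeff (n + 1) f
  rem_le : ∀ f, ‖Lv f‖ ≤ M * a ^ 2 * ‖f‖
  near : ‖ψ - cosV‖ ≤ M * |a|
  γ_le : ‖γ‖ ≤ M
  rem_two_one : coeff 2 (Lv (expL2 1)) = 0
  rem_one_two : coeff 1 (Lv (expL2 2)) = 0
  rem_two_neg_one : ‖coeff 2 (Lv (expL2 (-1)))‖ ≤ M * |a| * ‖coeff 3 ψ‖
  rem_one_neg_two : ‖coeff 1 (Lv (expL2 (-2)))‖ ≤ M * |a| * ‖coeff 3 ψ‖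
  rem_one_neg_one : coeff 1 (Lv (expL2 (-1))) = γ * a * coeff 2 ψ

/-! ### Location of the threshold to fourth order in the amplitude -/

section

variable {κ k a M μ η : ℝ} {hk : 0 < k} {B₀ Lc Lv : L2 →L[ℂ] L2} {ψ : L2} {γ : ℂ} {α β : ℤ → ℂ}

theorem coeff_expL2_self (n : ℤ) : coeff n (expL2 n) = 1 := by rw [coeff_expL2, if_pos rfl]

theorem coeff_expL2_ne {n m : ℤ} (h : n ≠ m) : coeff n (expL2 m) = 0 := by rw [coeff_expL2, if_neg h]

theorem cosV_eq : cosV = (1 / 2 : ℂ) • (expL2 1 + expL2 (-1)) := rfl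

namespace WaveExpansion

theorem beta_le (h : WaveExpansion hk κ B₀ ψ a M μ γ α β Lc Lv) (n : ℤ) : ‖β n‖ ≤ M := by
  have h1 := h.band n (expL2 (n + 1))
  rw [coeff_expL2_ne (by omega), coeff_expL2_self, mul_zero, zero_add, mul_one] at h1
  rw [← h1]
  refine (norm_coeff_le _ _).trans ((h.cos_le _).trans ?_)
  rw [norm_expL2, mul_one]

theorem noLow (hψ : IsKer hk κ B₀ η ψ) : NoLow (ψ - cosV) := by
  refine NoLow.of_coeff ?_ ?_ ?_
  · rw [map_sub, hψ.zero, coeff_zero_cosV, sub_zero]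
  · rw [map_sub, hψ.one, coeff_one_cosV, sub_self]
  · rw [map_sub, coeff_neg_of_refl hψ.refl, hψ.one, coeff_neg_one_cosV, sub_self]

theorem coeff_high (h : WaveExpansion hk κ B₀ ψ a M μ γ α β Lc Lv) {n : ℤ} (hn : 2 ≤ |n|) :
    ‖coeff n ψ‖ ≤ M * |a| := by
  have : coeff n ψ = coeff n (ψ - cosV) := by rw [map_sub, coeff_cosV_of_two_le hn, sub_zero]
  rw [this]
  exact (norm_coeff_le _ _).trans h.near

theorem mode_eq (h : WaveExpansion hk κ B₀ ψ a M μ γ α β Lc Lv) (hψ : IsKer hk κ B₀ η ψ) (n : ℤ) :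
    (theta κ k n : ℂ) * coeff n ψ = -(μ * coeff n ψ + a * (α n * coeff (n - 1) ψ
      + β n * coeff (n + 1) ψ) + coeff n (Lv ψ)) := by
  have h1 := congrArg (coeff n) hψ.ker
  rw [map_add, coeff_opTheta hk κ hψ.zero, h.split, map_add, map_add, map_smul, map_smul, h.band,
    map_zero, smul_eq_mul, smul_eq_mul] at h1
  linear_combination h1

/-- The banded part links mode 3 only to modes 2 and 4, which are O(a) and enter with another factor
a. The remainder is O(a²). -/
theorem coeff_three_le (h : WaveExpansion hk κ B₀ ψ a M μ γ α β Lc Lv) (hψ : IsKer hk κ B₀ η ψ)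
    (hκ : 0 < κ) (hM : 1 ≤ M) (hMg : 1 ≤ M * gap κ k) (ha : M * |a| ≤ 1) :
    ‖coeff 3 ψ‖ ≤ 6 * M ^ 3 * a ^ 2 := by
  have hM0 : 0 < M := by linarith
  have hg := gap_le_theta (κ := κ) (k := k) hκ (by norm_num : (2 : ℤ) ≤ |3|)
  have hgp := gap_pos hκ hk
  have h1 := h.mode_eq hψ 3
  have e3 := h.coeff_high (n := 3) (by norm_num)
  have e2 := h.coeff_high (n := 3 - 1) (by norm_num)
  have e4 := h.coeff_high (n := 3 + 1) (by norm_num)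
  have hψ2 : ‖ψ‖ ≤ 2 := by
    have := norm_add_le (ψ - cosV) cosV
    rw [sub_add_cancel] at this
    linarith [h.near, norm_cosV_le]
  have hα : ‖α 3‖ ≤ M := by
    have h2 := h.band 3 (expL2 2)
    rw [coeff_expL2_ne (n := 3 + 1) (by omega), show (3 - 1 : ℤ) = 2 by norm_num, coeff_expL2_self,
      mul_zero, add_zero, mul_one] at h2
    rw [← h2]
    refine (norm_coeff_le _ _).trans ((h.cos_le _).trans ?_)
    rw [norm_expL2, mul_one]
  have hβ := h.beta_le 3
  have hrem : ‖coeff 3 (Lv ψ)‖ ≤ M * a ^ 2 * 2 :=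
    (norm_coeff_le _ _).trans ((h.rem_le _).trans (by gcongr))
  have hr : ‖(theta κ k 3 : ℂ) * coeff 3 ψ‖ ≤ M * a ^ 2 * 1 + |a| * (M * (M * |a|) + M * (M * |a|))
      + M * a ^ 2 * 2 := by
    rw [h1, norm_neg]
    refine (norm_add_le _ _).trans (add_le_add ((norm_add_le _ _).trans (add_le_add ?_ ?_)) hrem)
    · rw [norm_mul, Complex.norm_real, Real.norm_eq_abs]
      exact mul_le_mul h.mu_le (e3.trans ha) (norm_nonneg _) (by positivity)
    · rw [norm_mul, Complex.norm_real, Real.norm_eq_abs]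
      gcongr
      refine (norm_add_le _ _).trans (add_le_add ?_ ?_)
      · rw [norm_mul]; gcongr
      · rw [norm_mul]; gcongr
  rw [norm_mul, Complex.norm_real, Real.norm_of_nonneg (hgp.le.trans hg)] at hr
  have ha2 : |a| * |a| = a ^ 2 := by rw [← sq, sq_abs]
  have h5 : ‖coeff 3 ψ‖ ≤ M * (gap κ k * ‖coeff 3 ψ‖) := by
    rw [← mul_assoc]; exact le_mul_of_one_le_left (norm_nonneg _) hMg
  have h6 : gap κ k * ‖coeff 3 ψ‖ ≤ theta κ k 3 * ‖coeff 3 ψ‖ := by gcongr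
  have h7 : theta κ k 3 * ‖coeff 3 ψ‖ ≤ 3 * (M * a ^ 2) + 2 * (M ^ 2 * a ^ 2) := by
    have : |a| * (M * (M * |a|) + M * (M * |a|)) = 2 * (M ^ 2 * a ^ 2) := by rw [← ha2]; ring
    linarith
  have h8 : M * a ^ 2 ≤ M ^ 2 * a ^ 2 := by
    gcongr; nlinarith
  have h9 : M * (gap κ k * ‖coeff 3 ψ‖) ≤ M * (6 * (M ^ 2 * a ^ 2)) := by
    refine mul_le_mul_of_nonneg_left ?_ hM0.le
    have : 0 ≤ M ^ 2 * a ^ 2 := by positivity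
    linarith
  calc _ ≤ M * (6 * (M ^ 2 * a ^ 2)) := h5.trans h9
    _ = _ := by ring

/-- The leading source in mode 2 is α₂ a times the coefficient 1/2 of ψ in mode 1. The remainder has
no entry from 1 to 2, and its entry from −1 to 2 involves the third harmonic, so the error is O(a³).
-/
theorem coeff_two_approx (h : WaveExpansion hk κ B₀ ψ a M μ γ α β Lc Lv) (hψ : IsKer hk κ B₀ η ψ)
    (hκ : 0 < κ) (hM : 1 ≤ M) (hMg : 1 ≤ M * gap κ k) (ha : M * |a| ≤ 1) :
    ‖(gap κ k : ℂ) * coeff 2 ψ + a * α 2 / 2‖ ≤ 12 * M ^ 4 * |a| ^ 3 := by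
  have hM0 : 0 < M := by linarith
  have h3 := h.coeff_three_le hψ hκ hM hMg ha
  have h1 := h.mode_eq hψ 2
  have e2 := h.coeff_high (n := 2) (by norm_num)
  have ha2 : a ^ 2 = |a| ^ 2 := (sq_abs a).symm
  have hmu := h.mu_le
  rw [ha2] at h3 hmu
  have hrem : coeff 2 (Lv ψ) = 1 / 2 * coeff 2 (Lv (expL2 (-1))) + coeff 2 (Lv (ψ - cosV)) := by
    have e : Lv ψ = (1 / 2 : ℂ) • (Lv (expL2 1) + Lv (expL2 (-1))) + Lv (ψ - cosV) := by
      rw [map_sub, cosV_eq, map_smul, map_add]; abel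
    rw [e, map_add, map_smul, map_add, h.rem_two_one, zero_add, smul_eq_mul]
  norm_num at h1
  rw [hψ.one, hrem] at h1
  have h1' : (gap κ k : ℂ) * coeff 2 ψ + a * α 2 / 2 = -(μ * coeff 2 ψ + a * (β 2 * coeff 3 ψ)
      + 1 / 2 * coeff 2 (Lv (expL2 (-1))) + coeff 2 (Lv (ψ - cosV))) := by
    unfold gap
    linear_combination h1
  rw [h1', norm_neg]
  have a1 : ‖(μ : ℂ) * coeff 2 ψ‖ ≤ M * |a| ^ 2 * (M * |a|) := by
    rw [norm_mul, Complex.norm_real, Real.norm_eq_abs]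
    exact mul_le_mul hmu e2 (norm_nonneg _) (by positivity)
  have a2 : ‖(a : ℂ) * (β 2 * coeff 3 ψ)‖ ≤ |a| * (M * (6 * M ^ 3 * |a| ^ 2)) := by
    rw [norm_mul, norm_mul, Complex.norm_real, Real.norm_eq_abs]
    have := h.beta_le 2
    gcongr
  have a3 : ‖1 / 2 * coeff 2 (Lv (expL2 (-1)))‖ ≤ 1 / 2 * (M * |a| * (6 * M ^ 3 * |a| ^ 2)) := by
    rw [norm_mul]
    have h5 := h.rem_two_neg_one
    have h6 : M * |a| * ‖coeff 3 ψ‖ ≤ M * |a| * (6 * M ^ 3 * |a| ^ 2) := by gcongr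
    have : ‖(1 / 2 : ℂ)‖ = 1 / 2 := by simp
    rw [this]
    linarith
  have a4 : ‖coeff 2 (Lv (ψ - cosV))‖ ≤ M * |a| ^ 2 * (M * |a|) := by
    refine (norm_coeff_le _ _).trans ((h.rem_le _).trans ?_)
    rw [ha2]
    have := h.near
    gcongr
  have hp : M ^ 2 * |a| ^ 3 ≤ M ^ 4 * |a| ^ 3 := by
    gcongr
    norm_num
  have hp0 : 0 ≤ M ^ 4 * |a| ^ 3 := by positivity
  have n1 := norm_add_le ((μ : ℂ) * coeff 2 ψ + a * (β 2 * coeff 3 ψ)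
      + 1 / 2 * coeff 2 (Lv (expL2 (-1)))) (coeff 2 (Lv (ψ - cosV)))
  have n2 := norm_add_le ((μ : ℂ) * coeff 2 ψ + a * (β 2 * coeff 3 ψ))
      (1 / 2 * coeff 2 (Lv (expL2 (-1))))
  have n3 := norm_add_le ((μ : ℂ) * coeff 2 ψ) (a * (β 2 * coeff 3 ψ))
  nlinarith

/-- The equations for the combination `ψ + i (sinV + r)`, which is close to `e^{-iz}`. -/
theorem combination_eq (h : WaveExpansion hk κ B₀ ψ a M μ γ α β Lc Lv) (hψ : IsKer hk κ B₀ η ψ)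
    {lam : ℝ} {r : L2} (hr : NoLow r)
    (hS : opTheta hk κ (sinV + r) + pertAt hk B₀ lam (sinV + r) = 0) (n : ℤ) :
    (theta κ k n : ℂ) * coeff n (ψ - cosV + Complex.I • r)
      = -(μ * coeff n (expL2 (-1) + (ψ - cosV + Complex.I • r))
        + a * coeff n (Lc (expL2 (-1) + (ψ - cosV + Complex.I • r)))
        + coeff n (Lv (expL2 (-1) + (ψ - cosV + Complex.I • r)))
        + Complex.I * lam * symN k n * coeff n (sinV + r)) := by
  have hψc := noLow hψ
  have e : expL2 (-1) + (ψ - cosV + Complex.I • r) = ψ + Complex.I • (sinV + r) := by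
    have hI : Complex.I * (Complex.I / 2) = -(1 / 2) := by
      rw [← mul_div_assoc, Complex.I_mul_I, neg_div]
    rw [cosV, sinV, smul_add Complex.I, smul_smul Complex.I, hI]; module
  have h0 : coeff 0 (sinV + r) = 0 := by rw [map_add, coeff_zero_sinV, hr.zero, add_zero]
  have ht : (theta κ k n : ℂ) * coeff n (expL2 (-1)) = 0 := by
    by_cases hn : n = -1
    · rw [hn, theta_neg_one]; simp
    · rw [coeff_expL2_ne hn, mul_zero]
  have h1 := congrArg (coeff n) hψ.ker
  have h2 := congrArg (coeff n) hS
  rw [map_add, coeff_opTheta hk κ hψ.zero, map_zero] at h1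
  rw [map_add, coeff_opTheta hk κ h0, pertAt_apply, map_add (coeff n) (B₀ _), map_smul (coeff n),
    coeff_opN, map_zero, smul_eq_mul] at h2
  have h3 : coeff n (B₀ (ψ + Complex.I • (sinV + r)))
      = coeff n (B₀ ψ) + Complex.I * coeff n (B₀ (sinV + r)) := by
    rw [map_add, map_smul, map_add, map_smul, smul_eq_mul]
  have h4 : ∀ f, coeff n (B₀ f) = μ * coeff n f + a * coeff n (Lc f) + coeff n (Lv f) := fun f => by
    rw [h.split, map_add, map_add, map_smul, map_smul]; rfl
  rw [h4] at h3
  have h5 : (theta κ k n : ℂ) * coeff n (ψ - cosV + Complex.I • r)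
      = theta κ k n * coeff n ψ + Complex.I * (theta κ k n * coeff n (sinV + r)) := by
    have e2 := congrArg (coeff n) e
    rw [map_add (coeff n) (expL2 (-1)), map_add (coeff n) ψ, map_smul (coeff n), smul_eq_mul] at e2
    linear_combination (theta κ k n : ℂ) * e2 - ht
  rw [e, h5]
  linear_combination h1 + Complex.I * h2 + h3

/-- The location of the threshold. -/
theorem threshold_location (h : WaveExpansion hk κ B₀ ψ a M μ γ α β Lc Lv) (hψ : IsKer hk κ B₀ η ψ)
    (hκ : 0 < κ) (hM : 1 ≤ M) (hMg : 1 ≤ M * gap κ k) (hMn : 1 ≤ M * symN k 1) (ha : M * |a| ≤ 1)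
    {lam : ℝ} {r : L2} (hr : NoLow r) (hrM : ‖r‖ ≤ M * |a|)
    (hS : opTheta hk κ (sinV + r) + pertAt hk B₀ lam (sinV + r) = 0) :
    ‖(lam * symN k 1 * gap κ k : ℂ) + γ * α 2 * a ^ 2‖ ≤ 400 * (M ^ 7 * (1 + gap κ k)) * a ^ 4 := by
  have hM0 : 0 < M := by linarith
  have hgp := gap_pos hκ hk
  have hn0 : 0 < symN k 1 := by rw [symN_one]; positivity
  have hψc := noLow hψ
  -- In mode 1 the leading vector e^{−iz} meets neither μ nor the banded part, which reaches only
  -- modes 0 and −2. The order a² thus comes from the single remainder entry from −1 to 1. For the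
  -- same reason mode 2 of the correction g is O(a³), not O(a).
  have heq := h.combination_eq hψ hr hS
  obtain ⟨g, hg⟩ : ∃ g, g = ψ - cosV + Complex.I • r := ⟨_, rfl⟩
  rw [← hg] at heq
  have hgL : NoLow g := fun n hn => by
    rw [hg, map_add, map_smul, hψc n hn, hr n hn, smul_zero, add_zero]
  obtain ⟨d, hd⟩ : ∃ d, d = |a| := ⟨_, rfl⟩
  have hd0 : 0 ≤ d := hd ▸ abs_nonneg a
  have ha2 : a ^ 2 = d ^ 2 := by rw [hd, sq_abs]
  have ha4 : a ^ 4 = d ^ 4 := by rw [show (4 : ℕ) = 2 * 2 by norm_num, pow_mul, pow_mul, ha2]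
  have hgn : ‖g‖ ≤ 2 * (M * d) := by
    rw [hg, hd]
    refine (norm_add_le _ _).trans ?_
    rw [norm_smul, Complex.norm_I, one_mul]
    linarith [h.near]
  have h3 := h.coeff_three_le hψ hκ hM hMg ha
  have h2 := h.coeff_two_approx hψ hκ hM hMg ha
  have hψ2 := h.coeff_high (n := 2) (by norm_num)
  have hmu := h.mu_le
  have hcos := h.cos_le
  have hrem := h.rem_le
  have r21 := h.rem_two_neg_one
  have r12 := h.rem_one_neg_two
  rw [ha2] at h3 hmu
  simp only [ha2] at hrem
  rw [← hd] at h2 hψ2 ha r21 r12 hrM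
  have hac : ‖(a : ℂ)‖ = d := by rw [Complex.norm_real, Real.norm_eq_abs, hd]
  have hdM : d ≤ M * d := le_mul_of_one_le_left hd0 hM
  have hd1 : d ≤ 1 := hdM.trans ha
  have hgcos : ∀ n, ‖(a : ℂ) * coeff n (Lc g)‖ ≤ 2 * (M ^ 2 * d ^ 2) := fun n => by
    rw [norm_mul, hac]
    calc d * ‖coeff n (Lc g)‖ ≤ d * (M * (2 * (M * d))) := by
          gcongr
          exact (norm_coeff_le _ _).trans ((hcos g).trans (by gcongr))
      _ = _ := by ring
  have hgrem : ∀ n, ‖coeff n (Lv g)‖ ≤ 2 * (M ^ 2 * d ^ 3) := fun n => by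
    refine (norm_coeff_le _ _).trans ((hrem g).trans ?_)
    calc M * d ^ 2 * ‖g‖ ≤ M * d ^ 2 * (2 * (M * d)) := by gcongr
      _ = _ := by ring
  have hμg : ∀ n, ‖(μ : ℂ) * coeff n g‖ ≤ 2 * (M ^ 2 * d ^ 3) := fun n => by
    rw [norm_mul, Complex.norm_real, Real.norm_eq_abs]
    calc |μ| * ‖coeff n g‖ ≤ M * d ^ 2 * (2 * (M * d)) := by
          gcongr
          exact (norm_coeff_le _ _).trans hgn
      _ = _ := by ring
  have hd32 : M ^ 2 * d ^ 3 ≤ M ^ 2 * d ^ 2 := by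
    gcongr ?_ * ?_
    exact pow_le_pow_of_le_one hd0 hd1 (by norm_num)
  -- mode one
  have hlam1 : (lam * symN k 1 : ℂ) - 2 * (γ * a * coeff 2 ψ)
      = 2 * (a * coeff 1 (Lc g) + coeff 1 (Lv g)) := by
    have h1 := heq 1
    rw [theta_one, map_add (coeff 1) (expL2 (-1)), coeff_expL2_ne (by norm_num), hgL.one, map_add Lc,
      map_add Lv, map_add, map_add, h.rem_one_neg_one, h.band, coeff_expL2_ne (by norm_num),
      coeff_expL2_ne (by norm_num), map_add (coeff 1), coeff_one_sinV, hr.one] at h1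
    push_cast at h1
    linear_combination -2 * h1 + (lam * symN k 1) * Complex.I_mul_I
  have hγψ : ‖2 * (γ * a * coeff 2 ψ)‖ ≤ 2 * (M ^ 2 * d ^ 2) := by
    rw [norm_mul, norm_mul, norm_mul, hac, Complex.norm_two]
    have := h.γ_le
    calc 2 * (‖γ‖ * d * ‖coeff 2 ψ‖) ≤ 2 * (M * d * (M * d)) := by gcongr
      _ = _ := by ring
  have hlam : |lam| ≤ 10 * (M ^ 3 * d ^ 2) := by
    have h1 : ‖(lam * symN k 1 : ℂ)‖ ≤ 10 * (M ^ 2 * d ^ 2) := by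
      have e : (lam * symN k 1 : ℂ) = 2 * (a * coeff 1 (Lc g) + coeff 1 (Lv g))
          + 2 * (γ * a * coeff 2 ψ) := by rw [← hlam1]; ring
      rw [e]
      have n1 : ‖2 * (a * coeff 1 (Lc g) + coeff 1 (Lv g))‖
          ≤ 2 * (2 * (M ^ 2 * d ^ 2) + 2 * (M ^ 2 * d ^ 3)) := by
        rw [norm_mul, Complex.norm_two]
        gcongr
        exact (norm_add_le _ _).trans (add_le_add (hgcos 1) (hgrem 1))
      have n2 := norm_add_le (2 * (a * coeff 1 (Lc g) + coeff 1 (Lv g))) (2 * (γ * a * coeff 2 ψ))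
      linarith
    rw [norm_mul, Complex.norm_real, Complex.norm_real, Real.norm_eq_abs,
      Real.norm_of_nonneg hn0.le] at h1
    have h5 : |lam| ≤ M * (|lam| * symN k 1) := by
      have := le_mul_of_one_le_left (abs_nonneg lam) hMn
      linarith
    calc |lam| ≤ M * (10 * (M ^ 2 * d ^ 2)) := h5.trans (by gcongr)
      _ = _ := by ring
  -- high modes
  obtain ⟨g', hg'⟩ : ∃ g', g' = g - coeff 2 g • expL2 2 - coeff (-2) g • expL2 (-2) := ⟨_, rfl⟩
  have hF2 : ‖sinV + r‖ ≤ 2 := (norm_add_le _ _).trans (by linarith [norm_sinV_le])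
  have hMp : ∀ {i j : ℕ}, i ≤ j → M ^ i * d ^ 2 ≤ M ^ j * d ^ 2 := fun hij => by
    gcongr
  have hMp3 : ∀ {i j : ℕ}, i ≤ j → M ^ i * d ^ 3 ≤ M ^ j * d ^ 3 := fun hij => by
    gcongr
  -- Mode −2 of g may be O(a), being adjacent to −1. Beyond modes ±2 the banded part of e^{−iz}
  -- vanishes and all sources are O(a²).
  have hg'n : ‖g'‖ ≤ 27 * (M ^ 4 * d ^ 2) := by
    have hle : ‖g'‖ ≤ M * ‖(μ : ℂ) • g + (a : ℂ) • Lc g + (Lv (expL2 (-1)) + Lv g)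
        + (Complex.I * lam) • opN hk (sinV + r)‖ := by
      refine norm_le_of_coeff hM0.le fun n => ?_
      by_cases hn : |n| ≤ 2
      · have hz : coeff n g' = 0 := by
          rw [hg', map_sub, map_sub, map_smul, map_smul, smul_eq_mul, smul_eq_mul]
          by_cases hn1 : |n| ≤ 1
          · rw [hgL n hn1, coeff_expL2_ne (by rintro rfl; norm_num at hn1),
              coeff_expL2_ne (by rintro rfl; norm_num at hn1)]
            ring
          · have : n = 2 ∨ n = -2 := by
              rw [abs_le] at hn hn1; omega
            rcases this with rfl | rfl
            · rw [coeff_expL2_self, coeff_expL2_ne (by norm_num)]; ring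
            · rw [coeff_expL2_self, coeff_expL2_ne (by norm_num)]; ring
        rw [hz, norm_zero]
        positivity
      · have hn2 : 2 < |n| := not_le.1 hn
        have hne : ∀ m : ℤ, |m| ≤ 2 → coeff n (expL2 m) = 0 := fun m hm => by
          refine coeff_expL2_ne ?_
          rintro rfl
          omega
        have hz : coeff n g' = coeff n g := by
          rw [hg', map_sub, map_sub, map_smul, map_smul, hne 2 (by norm_num), hne (-2) (by norm_num)]
          simp
        have h1 := heq n
        rw [map_add (coeff n) (expL2 (-1)), hne (-1) (by norm_num), map_add Lc, map_add Lv,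
          map_add (coeff n) (Lc _), h.band n (expL2 (-1)),
          coeff_expL2_ne (n := n - 1) (by rintro h; rw [show n = 0 by omega] at hn2; norm_num at hn2),
          coeff_expL2_ne (n := n + 1) (by rintro h; rw [show n = -2 by omega] at hn2; norm_num at hn2)]
          at h1
        rw [hz]
        have h5 := gap_le_theta (κ := κ) (k := k) hκ hn2.le
        have h6 : ‖coeff n g‖ ≤ M * ‖(theta κ k n : ℂ) * coeff n g‖ := by
          rw [norm_mul, Complex.norm_real, Real.norm_of_nonneg (hgp.le.trans h5), ← mul_assoc]
          exact le_mul_of_one_le_left (norm_nonneg _) (hMg.trans (by gcongr))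
        refine h6.trans_eq ?_
        rw [h1, norm_neg]
        congr 2
        simp only [map_add, map_smul, coeff_opN, smul_eq_mul]
        ring
    refine hle.trans ?_
    have b1 : ‖(μ : ℂ) • g‖ ≤ 2 * (M ^ 2 * d ^ 2) := by
      rw [norm_smul, Complex.norm_real, Real.norm_eq_abs]
      calc |μ| * ‖g‖ ≤ M * d ^ 2 * (2 * (M * d)) := by gcongr
        _ = 2 * (M ^ 2 * d ^ 3) := by ring
        _ ≤ _ := by linarith
    have b2 : ‖(a : ℂ) • Lc g‖ ≤ 2 * (M ^ 2 * d ^ 2) := by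
      rw [norm_smul, hac]
      calc d * ‖Lc g‖ ≤ d * (M * (2 * (M * d))) := by
            gcongr
            exact (hcos g).trans (by gcongr)
        _ = _ := by ring
    have b3 : ‖Lv (expL2 (-1))‖ ≤ M ^ 1 * d ^ 2 := by
      have := hrem (expL2 (-1))
      rwa [norm_expL2, mul_one, ← pow_one M] at this
    have b4 : ‖Lv g‖ ≤ 2 * (M ^ 2 * d ^ 2) := by
      refine (hrem g).trans ?_
      calc M * d ^ 2 * ‖g‖ ≤ M * d ^ 2 * (2 * (M * d)) := by gcongr
        _ = 2 * (M ^ 2 * d ^ 3) := by ring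
        _ ≤ _ := by linarith
    have b5 : ‖(Complex.I * lam) • opN hk (sinV + r)‖ ≤ 20 * (M ^ 3 * d ^ 2) := by
      rw [norm_smul, norm_mul, Complex.norm_I, one_mul, Complex.norm_real, Real.norm_eq_abs]
      calc |lam| * ‖opN hk (sinV + r)‖ ≤ 10 * (M ^ 3 * d ^ 2) * 2 := by
            gcongr
            exact (norm_opN_le hk _).trans hF2
        _ = _ := by ring
    have c1 := norm_add_le ((μ : ℂ) • g + (a : ℂ) • Lc g + (Lv (expL2 (-1)) + Lv g))
      ((Complex.I * lam) • opN hk (sinV + r))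
    have c2 := norm_add_le ((μ : ℂ) • g + (a : ℂ) • Lc g) (Lv (expL2 (-1)) + Lv g)
    have c3 := norm_add_le ((μ : ℂ) • g) ((a : ℂ) • Lc g)
    have c4 := norm_add_le (Lv (expL2 (-1))) (Lv g)
    have p1 := hMp (show 1 ≤ 3 by norm_num)
    have p2 := hMp (show 2 ≤ 3 by norm_num)
    calc M * _ ≤ M * (27 * (M ^ 3 * d ^ 2)) := by
          gcongr
          linarith
      _ = _ := by ring
  -- mode two
  have hg2 : ‖coeff 2 g‖ ≤ 50 * (M ^ 6 * d ^ 3) := by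
    have h1 := heq 2
    have hg3 : coeff 3 g = coeff 3 g' := by
      rw [hg', map_sub, map_sub, map_smul, map_smul, coeff_expL2_ne (by norm_num),
        coeff_expL2_ne (by norm_num)]
      simp
    rw [map_add (coeff 2) (expL2 (-1)), coeff_expL2_ne (by norm_num), map_add Lc, map_add Lv,
      map_add (coeff 2) (Lc _), map_add (coeff 2) (Lv _), h.band 2 (expL2 (-1)), h.band 2 g,
      coeff_expL2_ne (by norm_num), coeff_expL2_ne (by norm_num), show (2 - 1 : ℤ) = 1 by norm_num,
      hgL.one, show (2 + 1 : ℤ) = 3 by norm_num, hg3, map_add (coeff 2) sinV,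
      coeff_sinV_of_two_le (by norm_num)] at h1
    have h1' : (theta κ k 2 : ℂ) * coeff 2 g = -(μ * coeff 2 g + a * (β 2 * coeff 3 g')
        + (coeff 2 (Lv (expL2 (-1))) + coeff 2 (Lv g))
        + Complex.I * lam * symN k 2 * coeff 2 r) := by
      rw [h1]; ring
    have h6 : ‖coeff 2 g‖ ≤ M * ‖(theta κ k 2 : ℂ) * coeff 2 g‖ := by
      rw [norm_mul, Complex.norm_real, Real.norm_of_nonneg (show 0 ≤ theta κ k 2 from hgp.le),
        ← mul_assoc]
      exact le_mul_of_one_le_left (norm_nonneg _) hMg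
    rw [h1', norm_neg] at h6
    refine h6.trans ?_
    have b2 : ‖(a : ℂ) * (β 2 * coeff 3 g')‖ ≤ 27 * (M ^ 5 * d ^ 3) := by
      rw [norm_mul, norm_mul, hac]
      calc d * (‖β 2‖ * ‖coeff 3 g'‖) ≤ d * (M * (27 * (M ^ 4 * d ^ 2))) := by
            have := h.beta_le 2
            have := (norm_coeff_le 3 g').trans hg'n
            gcongr
        _ = _ := by ring
    have b3 : ‖coeff 2 (Lv (expL2 (-1)))‖ ≤ 6 * (M ^ 4 * d ^ 3) := by
      refine r21.trans ?_
      calc M * d * ‖coeff 3 ψ‖ ≤ M * d * (6 * M ^ 3 * d ^ 2) := by gcongr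
        _ = _ := by ring
    have b5 : ‖Complex.I * lam * symN k 2 * coeff 2 r‖ ≤ 10 * (M ^ 4 * d ^ 3) := by
      rw [norm_mul, norm_mul, norm_mul, Complex.norm_I, one_mul, Complex.norm_real,
        Complex.norm_real, Real.norm_eq_abs, Real.norm_of_nonneg (symN_nonneg 2)]
      calc |lam| * symN k 2 * ‖coeff 2 r‖ ≤ 10 * (M ^ 3 * d ^ 2) * 1 * (M * d) := by
            have := (norm_coeff_le 2 r).trans hrM
            have := symN_le_one (k := k) 2
            have := symN_nonneg (k := k) 2
            gcongr
        _ = _ := by ring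
    have c1 := norm_add_le (μ * coeff 2 g + a * (β 2 * coeff 3 g')
        + (coeff 2 (Lv (expL2 (-1))) + coeff 2 (Lv g))) (Complex.I * lam * symN k 2 * coeff 2 r)
    have c2 := norm_add_le (μ * coeff 2 g + a * (β 2 * coeff 3 g'))
      (coeff 2 (Lv (expL2 (-1))) + coeff 2 (Lv g))
    have c3 := norm_add_le ((μ : ℂ) * coeff 2 g) (a * (β 2 * coeff 3 g'))
    have c4 := norm_add_le (coeff 2 (Lv (expL2 (-1)))) (coeff 2 (Lv g))
    have p1 := hMp3 (show 2 ≤ 5 by norm_num)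
    have p2 := hMp3 (show 4 ≤ 5 by norm_num)
    have c5 := hμg 2
    have c6 := hgrem 2
    have p0 : 0 ≤ M ^ 5 * d ^ 3 := by positivity
    calc M * _ ≤ M * (50 * (M ^ 5 * d ^ 3)) := by
          gcongr
          linarith
      _ = _ := by ring
  -- conclusion
  have hMp4 : ∀ {i j : ℕ}, i ≤ j → M ^ i * d ^ 4 ≤ M ^ j * d ^ 4 := fun hij => by
    gcongr
  have hfin : ‖(lam * symN k 1 : ℂ) - 2 * (γ * a * coeff 2 ψ)‖ ≤ 200 * (M ^ 7 * d ^ 4) := by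
    rw [hlam1, norm_mul, Complex.norm_two]
    have b1 : ‖(a : ℂ) * coeff 1 (Lc g)‖ ≤ 50 * (M ^ 7 * d ^ 4) := by
      rw [h.band, show (1 - 1 : ℤ) = 0 by norm_num, hgL.zero, mul_zero, zero_add,
        show (1 + 1 : ℤ) = 2 by norm_num, norm_mul, norm_mul, hac]
      calc d * (‖β 1‖ * ‖coeff 2 g‖) ≤ d * (M * (50 * (M ^ 6 * d ^ 3))) := by
            have := h.beta_le 1
            gcongr
        _ = _ := by ring
    have b2 : coeff 1 (Lv g) = coeff (-2) g * coeff 1 (Lv (expL2 (-2))) + coeff 1 (Lv g') := by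
      have e : Lv g = coeff 2 g • Lv (expL2 2) + coeff (-2) g • Lv (expL2 (-2)) + Lv g' := by
        rw [hg', map_sub, map_sub, map_smul, map_smul]; abel
      rw [e, map_add, map_add, map_smul, map_smul, h.rem_one_two, smul_zero, zero_add, smul_eq_mul]
    have b3 : ‖coeff (-2) g * coeff 1 (Lv (expL2 (-2)))‖ ≤ 12 * (M ^ 5 * d ^ 4) := by
      rw [norm_mul]
      calc ‖coeff (-2) g‖ * ‖coeff 1 (Lv (expL2 (-2)))‖
          ≤ 2 * (M * d) * (M * d * (6 * M ^ 3 * d ^ 2)) := by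
            have := (norm_coeff_le (-2) g).trans hgn
            have : ‖coeff 1 (Lv (expL2 (-2)))‖ ≤ M * d * (6 * M ^ 3 * d ^ 2) :=
              r12.trans (by gcongr)
            gcongr
        _ = _ := by ring
    have b4 : ‖coeff 1 (Lv g')‖ ≤ 27 * (M ^ 5 * d ^ 4) := by
      refine (norm_coeff_le _ _).trans ((hrem g').trans ?_)
      calc M * d ^ 2 * ‖g'‖ ≤ M * d ^ 2 * (27 * (M ^ 4 * d ^ 2)) := by gcongr
        _ = _ := by ring
    have c1 := norm_add_le ((a : ℂ) * coeff 1 (Lc g)) (coeff 1 (Lv g))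
    have c2 := norm_add_le (coeff (-2) g * coeff 1 (Lv (expL2 (-2)))) (coeff 1 (Lv g'))
    rw [← b2] at c2
    have p1 := hMp4 (show 5 ≤ 7 by norm_num)
    have p2 : 0 ≤ M ^ 7 * d ^ 4 := by positivity
    linarith
  -- The mode-1 relation between λ and ψ̂(2) is combined with the mode-2 approximation of ψ̂(2).
  have e : (lam * symN k 1 * gap κ k : ℂ) + γ * α 2 * a ^ 2
      = gap κ k * ((lam * symN k 1 : ℂ) - 2 * (γ * a * coeff 2 ψ))
        + 2 * γ * a * (gap κ k * coeff 2 ψ + a * α 2 / 2) := by ring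
  rw [e, ha4]
  have c1 : ‖(gap κ k : ℂ) * ((lam * symN k 1 : ℂ) - 2 * (γ * a * coeff 2 ψ))‖
      ≤ gap κ k * (200 * (M ^ 7 * d ^ 4)) := by
    rw [norm_mul, Complex.norm_real, Real.norm_of_nonneg hgp.le]
    gcongr
  have c2 : ‖2 * γ * a * (gap κ k * coeff 2 ψ + a * α 2 / 2)‖ ≤ 24 * (M ^ 5 * d ^ 4) := by
    rw [norm_mul, norm_mul, norm_mul, hac, Complex.norm_two]
    calc 2 * ‖γ‖ * d * ‖(gap κ k : ℂ) * coeff 2 ψ + a * α 2 / 2‖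
        ≤ 2 * M * d * (12 * M ^ 4 * d ^ 3) := by
          have := h.γ_le
          gcongr
      _ = _ := by ring
  have p1 := hMp4 (show 5 ≤ 7 by norm_num)
  have p2 : 0 ≤ M ^ 7 * d ^ 4 := by positivity
  have p3 : 0 ≤ gap κ k * (M ^ 7 * d ^ 4) := by positivity
  refine (norm_add_le _ _).trans ?_
  linarith

end WaveExpansion

end

/-! ### The expansion of the perturbation of a small wave -/

theorem opS_expL2 (m : ℤ) : opS (expL2 m) = (Complex.I * m)⁻¹ • expL2 m := ext_coeff fun n => by
  rw [coeff_opS, map_smul, coeff_expL2, smul_eq_mul]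
  split_ifs with h
  · rw [h]
  · rw [mul_zero, mul_zero]

/-- The matrix elements of `opLL`, without the Fourier coefficient of the profile. -/
def symG (b k : ℝ) (n m : ℤ) : ℂ :=
  -((Complex.I * n) / (1 + (k : ℂ) ^ 2 * (n : ℂ) ^ 2)
      * ((b + 1 + k ^ 2 * ((n - m : ℤ) : ℂ) ^ 2) * (Complex.I * m)⁻¹))
    + k ^ 2 * (b - 2) * ((Complex.I * n) / (1 + (k : ℂ) ^ 2 * (n : ℂ) ^ 2)
      * (Complex.I * ((n - m : ℤ) : ℂ)))
    + k ^ 2 * ((Complex.I * n) ^ 2 / (1 + (k : ℂ) ^ 2 * (n : ℂ) ^ 2))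

/-- Together with the entry from 1 to 2, this entry from −1 to 1 is all of the operator that enters
the leading coefficient. It is the source of the factor (b+1) + (7−2b)k². -/
theorem symG_one_neg_one (b k : ℝ) :
    symG b k 1 (-1) = ((((b + 1) + (7 - 2 * b) * k ^ 2) / (1 + k ^ 2) : ℝ) : ℂ) := by
  have h := one_add_sq_ne_zero k 1
  have h' : (1 + (k : ℂ) ^ 2) ≠ 0 := by simpa using h
  unfold symG
  push_cast
  norm_num
  field_simp
  linear_combination (-1 - b + 2 * b * (k : ℂ) ^ 2 - 8 * (k : ℂ) ^ 2) * Complex.I_sq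

theorem symG_two_one (b k : ℝ) :
    symG b k 2 1 = ((-(2 * (b + 1) * (1 + k ^ 2)) / (1 + 4 * k ^ 2) : ℝ) : ℂ) := by
  have h := one_add_sq_ne_zero k 2
  have h' : (1 + 4 * (k : ℂ) ^ 2) ≠ 0 := by
    intro h0
    apply h
    push_cast
    linear_combination h0
  have e : (1 + (k : ℂ) ^ 2 * 2 ^ 2) = 1 + 4 * (k : ℂ) ^ 2 := by ring
  unfold symG
  push_cast
  norm_num
  rw [show (1 + (k : ℂ) ^ 2 * 4) = 1 + 4 * (k : ℂ) ^ 2 by ring]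
  field_simp
  linear_combination (1 + b + b * (k : ℂ) ^ 2 + (k : ℂ) ^ 2) * Complex.I_sq

section

variable {k : ℝ} (hk : 0 < k)

/-- The Fourier coefficients of w_z and w_zz are multiples of those of w, so each matrix element
factors through one coefficient of the profile. -/
theorem coeff_opLL_expL2 (b : ℝ) (u : Profile) (n m : ℤ) :
    coeff n (opLL hk b u.onTorus u.dz.onTorus u.dz.dz.onTorus (expL2 m))
      = fc u.onTorus (n - m) * symG b k n m := by
  rw [opLL_apply, opS_expL2]
  simp only [map_add, map_sub, map_neg, map_smul, coeff_opJL, coeff_opJdL, smul_eq_mul,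
    coeff_mulC_exp, Profile.fc_dz_dz, u.hasTorusDeriv.fc_eq, symG]
  push_cast
  ring

theorem fourier_one_add (x : ℝ) :
    ((1 / 2 : ℂ) • (fourier 1 + fourier (-1) : C(Torus, ℂ))) (x : Torus) = (Real.cos x : ℂ) := by
  have hpi : (Real.pi : ℂ) ≠ 0 := by exact_mod_cast Real.pi_ne_zero
  rw [ContinuousMap.smul_apply, ContinuousMap.add_apply, fourier_coe_apply, fourier_coe_apply]
  push_cast
  rw [Complex.cos]
  have e1 : 2 * (Real.pi : ℂ) * Complex.I * -1 * x / (2 * Real.pi) = -(x : ℂ) * Complex.I := by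
    field_simp
  have e2 : 2 * (Real.pi : ℂ) * Complex.I * 1 * x / (2 * Real.pi) = (x : ℂ) * Complex.I := by
    field_simp
  rw [e1, e2, smul_eq_mul]
  ring

theorem toL2_cosProfile : toL2 cosProfile.onTorus = cosV := ext_coeff fun n => by
  have e : cosProfile.onTorus = (1 / 2 : ℂ) • (fourier 1 + fourier (-1) : C(Torus, ℂ)) := by
    ext x
    induction x using QuotientAddGroup.induction_on with
    | H x => exact (fourier_one_add x).symm
  have hf : ∀ m : ℤ, fc (fourier m : C(Torus, ℂ)) n = if n = m then 1 else 0 := fun m => by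
    rw [fc, fourierCoeff_fourier, Pi.single_apply]
  rw [coeff_toL2, e, fc_smul, fc_add, hf, hf, coeff_cosV]
  by_cases h1 : n = 1
  · simp [h1]
  · by_cases h2 : n = -1
    · simp [h2]
    · simp [h1, h2]

theorem fc_cosProfile (n : ℤ) : fc cosProfile.onTorus n = coeff n cosV := by
  rw [← coeff_toL2, toL2_cosProfile]

/-- The remainder `w - a cos`. -/
def remProfile (a : ℝ) (w : Profile) : Profile where
  toFun x := w x - a * Real.cos x
  smooth := w.smooth.sub (contDiff_const.mul Real.contDiff_cos)
  periodic := fun x => by simp [w.periodic x]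

theorem remProfile_dz (a : ℝ) (w : Profile) (x : ℝ) :
    (remProfile a w).dz x = w.dz x + a * Real.sin x := by
  have h : HasDerivAt (fun x => w x - a * Real.cos x) (w.dz x - a * (-Real.sin x)) x :=
    (w.hasDerivAt x).sub ((Real.hasDerivAt_cos x).const_mul a)
  change deriv (fun x => w x - a * Real.cos x) x = _
  rw [h.deriv]
  ring

theorem remProfile_dz_dz (a : ℝ) (w : Profile) (x : ℝ) :
    (remProfile a w).dz.dz x = w.dz.dz x + a * Real.cos x := by
  have h : HasDerivAt (fun x => w.dz x + a * Real.sin x) (w.dz.dz x + a * Real.cos x) x :=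
    (w.dz.hasDerivAt x).add ((Real.hasDerivAt_sin x).const_mul a)
  have e : ((remProfile a w).dz : ℝ → ℝ) = fun x => w.dz x + a * Real.sin x :=
    funext (remProfile_dz a w)
  change deriv ((remProfile a w).dz : ℝ → ℝ) x = _
  rw [e, h.deriv]

theorem onTorus_rem (a : ℝ) (w : Profile) :
    w.onTorus = (a : ℂ) • cosProfile.onTorus + (remProfile a w).onTorus := by
  ext x
  induction x using QuotientAddGroup.induction_on with
  | H x =>
    change ((w x : ℝ) : ℂ) = (a : ℂ) * ((Real.cos x : ℝ) : ℂ) + ((w x - a * Real.cos x : ℝ) : ℂ)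
    push_cast
    ring

theorem onTorus_rem_dz (a : ℝ) (w : Profile) :
    w.dz.onTorus = (a : ℂ) • cosProfile.dz.onTorus + (remProfile a w).dz.onTorus := by
  ext x
  induction x using QuotientAddGroup.induction_on with
  | H x =>
    change ((w.dz x : ℝ) : ℂ) = (a : ℂ) * ((cosProfile.dz x : ℝ) : ℂ)
      + (((remProfile a w).dz x : ℝ) : ℂ)
    rw [remProfile_dz, cosProfile_dz]
    push_cast
    ring

theorem onTorus_rem_dz_dz (a : ℝ) (w : Profile) :
    w.dz.dz.onTorus = (a : ℂ) • cosProfile.dz.dz.onTorus + (remProfile a w).dz.dz.onTorus := by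
  ext x
  induction x using QuotientAddGroup.induction_on with
  | H x =>
    change ((w.dz.dz x : ℝ) : ℂ) = (a : ℂ) * ((cosProfile.dz.dz x : ℝ) : ℂ)
      + (((remProfile a w).dz.dz x : ℝ) : ℂ)
    rw [remProfile_dz_dz, cosProfile_dz_dz]
    push_cast
    ring

theorem opLL_add_smul (b : ℝ) (t : ℂ) (u₀ u₁ u₂ v₀ v₁ v₂ : C(Torus, ℂ)) (f : L2) :
    opLL hk b (t • u₀ + v₀) (t • u₁ + v₁) (t • u₂ + v₂) f
      = t • opLL hk b u₀ u₁ u₂ f + opLL hk b v₀ v₁ v₂ f := by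
  simp only [opLL_apply, mulC_add, mulC_smul, smul_add, map_add, map_sub, map_smul]
  module

/-- `opLL` at the profile `cos` is banded. -/
theorem coeff_opLL_cos (b : ℝ) (n : ℤ) (f : L2) :
    coeff n (opLL hk b cosProfile.onTorus cosProfile.dz.onTorus cosProfile.dz.dz.onTorus f)
      = symG b k n (n - 1) / 2 * coeff (n - 1) f + symG b k n (n + 1) / 2 * coeff (n + 1) f := by
  have key : coeffL n ∘L
      opLL hk b cosProfile.onTorus cosProfile.dz.onTorus cosProfile.dz.dz.onTorus
      = (symG b k n (n - 1) / 2) • coeffL (n - 1) + (symG b k n (n + 1) / 2) • coeffL (n + 1) := by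
    apply clm_ext_exp
    intro m
    rw [ContinuousLinearMap.comp_apply, add_apply, smul_apply, smul_apply, coeffL_apply,
      coeffL_apply, coeffL_apply, coeff_opLL_expL2, fc_cosProfile, coeff_cosV, coeff_expL2,
      coeff_expL2, smul_eq_mul, smul_eq_mul]
    by_cases h1 : m = n - 1
    · rw [if_pos (by omega), if_pos h1.symm, if_neg (by omega), h1]; ring
    · by_cases h2 : m = n + 1
      · rw [if_neg (by omega), if_pos (by omega), if_neg (by omega), if_pos h2.symm, h2]; ring
      · rw [if_neg (by omega), if_neg (by omega), if_neg (by omega), if_neg (by omega)]; ring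
  exact congrArg (fun T : L2 →L[ℂ] ℂ => T f) key

theorem coeff_kerV (a : ℝ) (w : Profile) (n : ℤ) :
    coeff n (kerV a w) = n ^ 2 * fc w.onTorus n / a := by
  rw [kerV, map_smul, coeff_toL2, Profile.fc_dz_dz, smul_eq_mul, div_eq_mul_inv]
  ring

theorem kerV_sub_cosV {a : ℝ} (ha : a ≠ 0) (w : Profile) :
    kerV a w - cosV = (-(a : ℂ)⁻¹) • toL2 (remProfile a w).dz.dz.onTorus := by
  have ha' : (a : ℂ) ≠ 0 := by exact_mod_cast ha
  have h : cosProfile.dz.dz.onTorus = -cosProfile.onTorus := by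
    ext x
    induction x using QuotientAddGroup.induction_on with
    | H x =>
      change ((cosProfile.dz.dz x : ℝ) : ℂ) = -((cosProfile x : ℝ) : ℂ)
      rw [cosProfile_dz_dz, cosProfile_apply]
      push_cast
      ring
  have h2 : toL2 (-cosProfile.onTorus) = -cosV := by
    have := toL2_smul (-1) cosProfile.onTorus
    rwa [neg_one_smul, neg_one_smul, toL2_cosProfile] at this
  rw [kerV, onTorus_rem_dz_dz a w, toL2_add, toL2_smul, h, h2, smul_add, smul_smul, neg_mul,
    inv_mul_cancel₀ ha']
  module

theorem remProfile_bounds {a m : ℝ} {w : Profile} (h : C2Near w a m) :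
    ‖(remProfile a w).onTorus‖ ≤ m ∧ ‖(remProfile a w).dz.onTorus‖ ≤ m ∧
      ‖(remProfile a w).dz.dz.onTorus‖ ≤ m := by
  refine ⟨Profile.norm_onTorus_le _ fun x => (h x).1, Profile.norm_onTorus_le _ fun x => ?_,
    Profile.norm_onTorus_le _ fun x => ?_⟩
  · rw [remProfile_dz]; exact (h x).2.1
  · rw [remProfile_dz_dz]; exact (h x).2.2

theorem kerV_near {a C : ℝ} (ha : a ≠ 0) {w : Profile} (h : C2Near w a (C * a ^ 2)) :
    ‖kerV a w - cosV‖ ≤ C * |a| := by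
  have ha' : 0 < |a| := abs_pos.2 ha
  rw [kerV_sub_cosV ha, norm_smul, norm_neg, norm_inv, Complex.norm_real, Real.norm_eq_abs,
    inv_mul_le_iff₀ ha']
  refine (norm_toL2_le _).trans ((remProfile_bounds h).2.2.trans_eq ?_)
  rw [← sq_abs]
  ring

/-- The kernel at `ℓ = 0`. -/
theorem isKer_kerV {b κ c a η C : ℝ} {w : Profile} (h : IsWave b κ k c w) (hamp : w.amplitude = a)
    (ha : a ≠ 0) (hn : C2Near w a (C * a ^ 2)) (hη : C * |a| ≤ η) :
    IsKer hk κ (opB hk b κ 0 c w) η (kerV a w) where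
  zero := by rw [coeff_kerV]; simp
  one := by
    have ha' : (a : ℂ) ≠ 0 := by exact_mod_cast ha
    rw [coeff_kerV, Profile.fc_one h.even, hamp]
    push_cast
    field_simp
  conj := ext_coeff fun n => by
    rw [coeff_conjL, coeff_kerV, map_div₀, map_mul, Profile.conj_fc h.even, map_pow, Complex.conj_ofReal]
    simp
  refl := ext_coeff fun n => by
    rw [coeff_reflL, coeff_kerV, coeff_kerV, Profile.fc_neg h.even]
    simp
  ker := opTheta_add_opB_kerV hk h a
  near := (kerV_near ha hn).trans hη

theorem norm_cosProfile_le : ‖cosProfile.onTorus‖ ≤ 1 ∧ ‖cosProfile.dz.onTorus‖ ≤ 1 ∧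
    ‖cosProfile.dz.dz.onTorus‖ ≤ 1 := by
  refine ⟨Profile.norm_onTorus_le _ fun x => Real.abs_cos_le_one x,
    Profile.norm_onTorus_le _ fun x => ?_, Profile.norm_onTorus_le _ fun x => ?_⟩
  · rw [cosProfile_dz, abs_neg]; exact Real.abs_sin_le_one x
  · rw [cosProfile_dz_dz, abs_neg]; exact Real.abs_cos_le_one x

/-- The definition of the amplitude places the whole first harmonic in a cos z. The remainder
therefore cannot link modes at distance 1. -/
theorem fc_remProfile_one {b κ c a : ℝ} {w : Profile} (h : IsWave b κ k c w)
    (hamp : w.amplitude = a) : fc (remProfile a w).onTorus 1 = 0 ∧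
      fc (remProfile a w).onTorus (-1) = 0 := by
  have h1 := congrArg (fun φ => fc φ 1) (onTorus_rem a w)
  have h2 := congrArg (fun φ => fc φ (-1)) (onTorus_rem a w)
  simp only [fc_add, fc_smul, fc_cosProfile, coeff_one_cosV, coeff_neg_one_cosV,
    Profile.fc_neg h.even, Profile.fc_one h.even, hamp] at h1 h2
  push_cast at h1 h2
  exact ⟨by linear_combination -h1, by linear_combination -h2⟩

/-- The higher harmonics of w are those of ψ up to the factor a/n², so the kernel equation for ψ
replaces a separate second-order expansion of the wave. -/
theorem fc_remProfile_high {a : ℝ} (w : Profile) (ha : a ≠ 0) {n : ℤ} (hn : 2 ≤ |n|) :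
    fc (remProfile a w).onTorus n = a * coeff n (kerV a w) / n ^ 2 := by
  have ha' : (a : ℂ) ≠ 0 := by exact_mod_cast ha
  have hn0 : (n : ℂ) ≠ 0 := by
    have : n ≠ 0 := by rintro rfl; norm_num at hn
    exact_mod_cast this
  have h1 := congrArg (fun φ => fc φ n) (onTorus_rem a w)
  simp only [fc_add, fc_smul, fc_cosProfile, coeff_cosV_of_two_le hn] at h1
  rw [coeff_kerV, h1]
  field_simp
  ring

/-- The expansion of the perturbation of a small wave. -/
theorem waveExpansion {b κ c a C M : ℝ} {w : Profile} (h : IsWave b κ k c w) (hamp : w.amplitude = a)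
    (ha : a ≠ 0) (hn : C2Near w a (C * a ^ 2)) (hc : |c - κ / (1 + k ^ 2)| ≤ C * a ^ 2)
    (hCM : C ≤ M) (hbM : boundLL b k ≤ M) (hbCM : boundLL b k * C ≤ M)
    (h1 : ‖symG b k 2 (-1)‖ ≤ M) (h2 : ‖symG b k 1 (-2)‖ ≤ M) (h3 : ‖symG b k 1 (-1)‖ ≤ M) :
    WaveExpansion hk κ (opB hk b κ 0 c w) (kerV a w) a M (c - κ / (1 + k ^ 2))
      (symG b k 1 (-1) / 4) (fun n => symG b k n (n - 1) / 2) (fun n => symG b k n (n + 1) / 2)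
      (opLL hk b cosProfile.onTorus cosProfile.dz.onTorus cosProfile.dz.dz.onTorus)
      (opLL hk b (remProfile a w).onTorus (remProfile a w).dz.onTorus
        (remProfile a w).dz.dz.onTorus) where
  split f := by
    rw [opB_apply, Complex.ofReal_zero, zero_smul, add_zero, add_assoc, ← opLL_add_smul,
      ← onTorus_rem, ← onTorus_rem_dz, ← onTorus_rem_dz_dz]
  mu_le := hc.trans (by gcongr)
  cos_le f := by
    obtain ⟨n0, n1, n2⟩ := norm_cosProfile_le
    refine (norm_opLL_le hk b n0 n1 n2 f).trans ?_
    rw [mul_one]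
    gcongr
  band n f := coeff_opLL_cos hk b n f
  rem_le f := by
    obtain ⟨n0, n1, n2⟩ := remProfile_bounds hn
    refine (norm_opLL_le hk b n0 n1 n2 f).trans ?_
    rw [← mul_assoc]
    gcongr
  near := (kerV_near ha hn).trans (by gcongr)
  γ_le := by
    rw [norm_div]
    have : ‖(4 : ℂ)‖ = 4 := by simp
    rw [this]
    linarith [norm_nonneg (symG b k 1 (-1))]
  rem_two_one := by
    rw [coeff_opLL_expL2, show (2 - 1 : ℤ) = 1 by norm_num, (fc_remProfile_one h hamp).1, zero_mul]
  rem_one_two := by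
    rw [coeff_opLL_expL2, show (1 - 2 : ℤ) = -1 by norm_num, (fc_remProfile_one h hamp).2, zero_mul]
  rem_two_neg_one := by
    rw [coeff_opLL_expL2, show (2 - -1 : ℤ) = 3 by norm_num,
      fc_remProfile_high w ha (by norm_num), norm_mul, norm_div, norm_mul, Complex.norm_real,
      Real.norm_eq_abs, mul_comm, mul_assoc M]
    have e : ‖((3 : ℤ) : ℂ) ^ 2‖ = 9 := by norm_num
    rw [e]
    have : 0 ≤ |a| * ‖coeff 3 (kerV a w)‖ := by positivity
    have hM : 0 ≤ M := (norm_nonneg _).trans h1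
    gcongr
    linarith
  rem_one_neg_two := by
    rw [coeff_opLL_expL2, show (1 - -2 : ℤ) = 3 by norm_num,
      fc_remProfile_high w ha (by norm_num), norm_mul, norm_div, norm_mul, Complex.norm_real,
      Real.norm_eq_abs, mul_comm, mul_assoc M]
    have e : ‖((3 : ℤ) : ℂ) ^ 2‖ = 9 := by norm_num
    rw [e]
    have : 0 ≤ |a| * ‖coeff 3 (kerV a w)‖ := by positivity
    have hM : 0 ≤ M := (norm_nonneg _).trans h1
    gcongr
    linarith
  rem_one_neg_one := by
    rw [coeff_opLL_expL2, show (1 - -1 : ℤ) = 2 by norm_num,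
      fc_remProfile_high w ha (by norm_num)]
    push_cast
    ring

theorem gap_eq (κ k : ℝ) : gap κ k = 3 * κ * k ^ 2 / ((1 + k ^ 2) * (1 + 4 * k ^ 2)) := by
  have h1 : (1 + k ^ 2) ≠ 0 := by positivity
  have h2 : (1 + 4 * k ^ 2) ≠ 0 := by positivity
  have h3 : (1 + k ^ 2 * 2 ^ 2) ≠ 0 := by positivity
  unfold gap theta
  push_cast
  field_simp
  ring

/-- The threshold agrees with `ellASq` up to fourth order in the amplitude. -/
theorem threshold_sub_ellASq {b κ c a η C M : ℝ} (hκ : 0 < κ) {w : Profile} (h : IsWave b κ k c w)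
    (hamp : w.amplitude = a) (ha : a ≠ 0) (hn : C2Near w a (C * a ^ 2))
    (hc : |c - κ / (1 + k ^ 2)| ≤ C * a ^ 2)
    (hCM : C ≤ M) (hbM : boundLL b k ≤ M) (hbCM : boundLL b k * C ≤ M)
    (h1 : ‖symG b k 2 (-1)‖ ≤ M) (h2 : ‖symG b k 1 (-2)‖ ≤ M) (h3 : ‖symG b k 1 (-1)‖ ≤ M)
    (hM : 1 ≤ M) (hMg : 1 ≤ M * gap κ k) (hMn : 1 ≤ M * symN k 1) (haM : M * |a| ≤ 1)
    (hψ : IsKer hk κ (opB hk b κ 0 c w) η (kerV a w))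
    {lam : ℝ} {r : L2} (hr : NoLow r) (hrM : ‖r‖ ≤ M * |a|)
    (hS : opTheta hk κ (sinV + r) + pertAt hk (opB hk b κ 0 c w) lam (sinV + r) = 0) :
    |lam - ellASq b κ k a| ≤ 400 * (M ^ 9 * (1 + gap κ k)) * a ^ 4 := by
  have hloc := (waveExpansion hk h hamp ha hn hc hCM hbM hbCM h1 h2 h3).threshold_location hψ hκ hM hMg
    hMn haM hr hrM hS
  have hg := gap_pos hκ hk
  have hn0 : 0 < symN k 1 := by rw [symN_one]; positivity
  -- With the explicit entries and gap, −γα₂a²/(n₁θ_2) is exactly `ellASq`.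
  have e : (lam * symN k 1 * gap κ k : ℂ) + symG b k 1 (-1) / 4 * (symG b k 2 (2 - 1) / 2) * a ^ 2
      = ((symN k 1 * gap κ k * (lam - ellASq b κ k a) : ℝ) : ℂ) := by
    rw [show (2 - 1 : ℤ) = 1 by norm_num, symG_one_neg_one, symG_two_one, ellASq, gap_eq, symN_one]
    rw [← sub_eq_zero]
    norm_cast
    have p1 : (1 + k ^ 2) ≠ 0 := by positivity
    have p2 : (1 + 4 * k ^ 2) ≠ 0 := by positivity
    have p3 := hκ.ne'
    have p4 := hk.ne'
    field_simp
    ring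
  rw [e, Complex.norm_real, Real.norm_eq_abs, abs_mul, abs_of_pos (mul_pos hn0 hg)] at hloc
  -- Division by n₁θ_2 costs two further powers of M.
  have h5 : 1 ≤ M ^ 2 * (symN k 1 * gap κ k) := by nlinarith
  calc |lam - ellASq b κ k a| ≤ M ^ 2 * (symN k 1 * gap κ k) * |lam - ellASq b κ k a| :=
        le_mul_of_one_le_left (abs_nonneg _) h5
    _ = M ^ 2 * (symN k 1 * gap κ k * |lam - ellASq b κ k a|) := by ring
    _ ≤ M ^ 2 * (400 * (M ^ 7 * (1 + gap κ k)) * a ^ 4) := by gcongr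
    _ = _ := by ring

end

/-! ### The phase of a transport operator on the circle -/

section phase

variable (ρ : Profile)

/-- The mean speed. -/
def meanSpeed : ℝ := 2 * Real.pi / ∫ x in (0 : ℝ)..(2 * Real.pi), ρ x

/-- The phase function, normalised to have degree one. -/
def phase (x : ℝ) : ℝ := meanSpeed ρ * ∫ y in (0 : ℝ)..x, ρ y

variable {ρ}

theorem two_pi_mul_le_integral {m : ℝ} (h : ∀ x, m ≤ ρ x) :
    2 * Real.pi * m ≤ ∫ x in (0 : ℝ)..(2 * Real.pi), ρ x := by
  have h1 : ∫ _ in (0 : ℝ)..(2 * Real.pi), m ≤ ∫ x in (0 : ℝ)..(2 * Real.pi), ρ x :=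
    intervalIntegral.integral_mono_on Real.two_pi_pos.le intervalIntegrable_const
      (ρ.continuous.intervalIntegrable _ _) fun x _ => h x
  simpa using h1

theorem meanSpeed_pos {m : ℝ} (hm : 0 < m) (h : ∀ x, m ≤ ρ x) : 0 < meanSpeed ρ := by
  have h1 := two_pi_mul_le_integral h
  have h2 : 0 < 2 * Real.pi * m := by positivity
  exact div_pos Real.two_pi_pos (h2.trans_le h1)

theorem meanSpeed_le {m : ℝ} (hm : 0 < m) (h : ∀ x, m ≤ ρ x) : meanSpeed ρ ≤ 1 / m := by
  have h1 := two_pi_mul_le_integral h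
  have h2 : 0 < 2 * Real.pi * m := by positivity
  rw [meanSpeed, div_le_div_iff₀ (h2.trans_le h1) hm]
  linarith

theorem hasDerivAt_phase (x : ℝ) : HasDerivAt (phase ρ) (meanSpeed ρ * ρ x) x :=
  (intervalIntegral.integral_hasDerivAt_right (ρ.continuous.intervalIntegrable _ _)
    (ρ.continuous.stronglyMeasurableAtFilter _ _) ρ.continuous.continuousAt).const_mul _

/-- The factor `meanSpeed` normalises the winding to one, so that exp(−inφ) is periodic for every
integer n. -/
theorem phase_add {m : ℝ} (hm : 0 < m) (h : ∀ x, m ≤ ρ x) (x : ℝ) :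
    phase ρ (x + 2 * Real.pi) = phase ρ x + 2 * Real.pi := by
  have h1 := two_pi_mul_le_integral h
  have h2 : 0 < 2 * Real.pi * m := by positivity
  have h3 := h2.trans_le h1
  have h4 : ∫ y in x..(x + 2 * Real.pi), ρ y = ∫ y in (0 : ℝ)..(2 * Real.pi), ρ y := by
    simpa using ρ.periodic.intervalIntegral_add_eq x 0
  rw [phase, phase, ← intervalIntegral.integral_add_adjacent_intervals
    (ρ.continuous.intervalIntegrable 0 x) (ρ.continuous.intervalIntegrable x _), h4, mul_add,
    meanSpeed, div_mul_cancel₀ _ h3.ne']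

theorem phase_neg (he : Function.Even ρ) (x : ℝ) : phase ρ (-x) = -phase ρ x := by
  have h1 : ∫ y in (0 : ℝ)..(-x), ρ y = -∫ y in (0 : ℝ)..x, ρ y := by
    have := intervalIntegral.integral_comp_neg (a := 0) (b := x) fun y => ρ y
    simp only [he _, neg_zero] at this
    rw [intervalIntegral.integral_symm, ← this]
  rw [phase, phase, h1, mul_neg]

/-- The exponentials of the phase, as functions on the circle. -/
theorem exists_phase_exp {m : ℝ} (hm : 0 < m) (h : ∀ x, m ≤ ρ x) (n : ℤ) :
    ∃ E : C(Torus, ℂ), ∀ x : ℝ, E (x : Torus) = Complex.exp (-(Complex.I * n) * phase ρ x) := by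
  have hp : Function.Periodic (fun x : ℝ => Complex.exp (-(Complex.I * n) * phase ρ x))
      (2 * Real.pi) := fun x => by
    simp only
    rw [phase_add hm h]
    push_cast
    rw [mul_add, Complex.exp_add, show -(Complex.I * n) * (2 * (Real.pi : ℂ))
      = ((-n : ℤ) : ℂ) * (2 * Real.pi * Complex.I) by push_cast; ring,
      Complex.exp_int_mul_two_pi_mul_I, mul_one]
  have hc : Continuous (fun x : ℝ => Complex.exp (-(Complex.I * n) * phase ρ x)) := by
    have : Continuous (phase ρ) :=
      continuous_iff_continuousAt.2 fun x => (hasDerivAt_phase x).continuousAt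
    fun_prop
  exact ⟨⟨hp.lift, hc.quotient_liftOn' _⟩, fun x => rfl⟩

theorem conj_fc_of_conj_neg (φ : C(Torus, ℂ)) (hφ : ∀ x, (starRingEnd ℂ) (φ x) = φ (-x)) (n : ℤ) :
    (starRingEnd ℂ) (fc φ n) = fc φ n := by
  rw [fc, fourierCoeff, ← integral_conj, ← integral_neg_eq_self]
  congr 1
  ext x
  simp only [smul_eq_mul, map_mul, hφ, neg_neg]
  congr 1
  rw [fourier_neg, Complex.conj_conj, fourier_apply, fourier_apply]
  simp

/-- The conjugating functions of the transport operator. -/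
theorem exists_conjugating {m : ℝ} (he : Function.Even ρ) (hm : 0 < m) (h : ∀ x, m ≤ ρ x) (n : ℤ) :
    ∃ E E' : C(Torus, ℂ), ‖E‖ ≤ 1 ∧ ‖E'‖ ≤ 1 ∧ E' * E = 1 ∧
      HasTorusDeriv E ((-(Complex.I * n * meanSpeed ρ)) • (ρ.onTorus * E)) ∧
      ∀ j, (starRingEnd ℂ) (fc E j) = fc E j := by
  obtain ⟨E, hE⟩ := exists_phase_exp hm h n
  obtain ⟨E', hE'⟩ := exists_phase_exp hm h (-n)
  have hnorm : ∀ (φ : C(Torus, ℂ)) (n : ℤ),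
      (∀ x : ℝ, φ (x : Torus) = Complex.exp (-(Complex.I * n) * phase ρ x)) → ‖φ‖ ≤ 1 := by
    intro φ n hφ
    rw [ContinuousMap.norm_le _ zero_le_one]
    intro x
    induction x using QuotientAddGroup.induction_on with
    | H x =>
      have := hφ x
      change ‖φ (x : Torus)‖ ≤ 1
      rw [this, Complex.norm_exp]
      simp
  refine ⟨E, E', hnorm E n hE, hnorm E' (-n) hE', ?_, ?_, conj_fc_of_conj_neg E ?_⟩
  · ext x
    induction x using QuotientAddGroup.induction_on with
    | H x =>
      change E' (x : Torus) * E (x : Torus) = 1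
      rw [hE, hE', ← Complex.exp_add]
      push_cast
      rw [← Complex.exp_zero]
      congr 1
      ring
  · intro x
    have h1 : HasDerivAt (fun y : ℝ => Complex.exp (-(Complex.I * n) * phase ρ y))
        (Complex.exp (-(Complex.I * n) * phase ρ x)
          * (-(Complex.I * n) * ((meanSpeed ρ * ρ x : ℝ) : ℂ))) x :=
      ((hasDerivAt_phase x).ofReal_comp.const_mul _).cexp
    have h2 : (fun y : ℝ => E (y : Torus))
        = fun y : ℝ => Complex.exp (-(Complex.I * n) * phase ρ y) := funext hE
    rw [h2]
    refine h1.congr_deriv ?_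
    change _ = (-(Complex.I * n * meanSpeed ρ)) * (((ρ x : ℝ) : ℂ) * E (x : Torus))
    rw [hE]
    push_cast
    ring
  · intro x
    induction x using QuotientAddGroup.induction_on with
    | H x =>
      change (starRingEnd ℂ) (E (x : Torus)) = E ((-x : ℝ) : Torus)
      rw [hE, hE, phase_neg he, ← Complex.exp_conj]
      simp

end phase

/-- The profile `1 / (c - w)`. -/
def invProfile (c : ℝ) (w : Profile) (h : ∀ x, c - w x ≠ 0) : Profile where
  toFun x := (c - w x)⁻¹
  smooth := (contDiff_const.sub w.smooth).inv h
  periodic := fun x => by simp [w.periodic x]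

/-! ### The smoothing remainder at high frequency -/

section

variable {k : ℝ} (hk : 0 < k)

/-- `(1 - k² ∂_z²)⁻¹`. -/
def opG (k : ℝ) : L2 →L[ℂ] L2 := mult (fun n => 1 / (1 + (k : ℂ) ^ 2 * (n : ℂ) ^ 2)) 1 fun n => by
  have h : (1 + (k : ℂ) ^ 2 * (n : ℂ) ^ 2) = ((1 + k ^ 2 * (n : ℝ) ^ 2 : ℝ) : ℂ) := by
    push_cast; ring
  have hp : (0 : ℝ) ≤ k ^ 2 * (n : ℝ) ^ 2 := by positivity
  rw [h, norm_div, norm_one, Complex.norm_real, Real.norm_of_nonneg (by linarith),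
    div_le_one (by linarith)]
  linarith

theorem coeff_opG (f : L2) (n : ℤ) :
    coeff n (opG k f) = 1 / (1 + (k : ℂ) ^ 2 * (n : ℂ) ^ 2) * coeff n f := coeff_mult _ _ _ _ _

theorem norm_opG_le (f : L2) : ‖opG k f‖ ≤ ‖f‖ :=
  (norm_mult_le _ _ _ _).trans_eq (one_mul _)

theorem smul_opJdL_eq (g : L2) : ((k ^ 2 : ℝ) : ℂ) • opJdL hk g = opG k g - g := ext_coeff fun n => by
  have hne := one_add_sq_ne_zero k n
  rw [map_smul, map_sub, coeff_opJdL, coeff_opG, smul_eq_mul, mul_pow, Complex.I_sq]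
  push_cast
  field_simp
  ring

/-- With V = `opS f`, the product rule gives u f = (uV)_z − u'V. The derivative moves into the
multiplier, and the result is controlled by V instead of f. -/
theorem opJL_mulC {u u' : C(Torus, ℂ)} (h : HasTorusDeriv u u') {f : L2} (hf : coeff 0 f = 0) :
    opJL hk (mulC u f) = opJdL hk (mulC u (opS f)) - opJL hk (mulC u' (opS f)) :=
  ext_coeff fun n => by
    rw [map_sub, coeff_opJL, coeff_opJdL, coeff_opJL]
    have := coeff_deriv_mulC h hf n
    linear_combination -(Complex.I * n / (1 + (k : ℂ) ^ 2 * (n : ℂ) ^ 2)) * this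

theorem opG_mulC {u u' : C(Torus, ℂ)} (h : HasTorusDeriv u u') {f : L2} (hf : coeff 0 f = 0) :
    opG k (mulC u f) = opJL hk (mulC u (opS f)) - opG k (mulC u' (opS f)) :=
  ext_coeff fun n => by
    rw [map_sub, coeff_opG, coeff_opJL, coeff_opG]
    have := coeff_deriv_mulC h hf n
    linear_combination -(1 / (1 + (k : ℂ) ^ 2 * (n : ℂ) ^ 2)) * this

theorem norm_opJL_mulC_le {u u' : C(Torus, ℂ)} (h : HasTorusDeriv u u') {f : L2}
    (hf : coeff 0 f = 0) {m : ℝ} (hu : ‖u‖ ≤ m) (hu' : ‖u'‖ ≤ m) :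
    ‖opJL hk (mulC u f)‖ ≤ 2 * m / k ^ 2 * ‖opS f‖ := by
  have hb : ∀ φ : C(Torus, ℂ), ‖φ‖ ≤ m → ‖mulC φ (opS f)‖ ≤ m * ‖opS f‖ := fun φ hφ =>
    (norm_mulC_le _ _).trans (by gcongr)
  rw [opJL_mulC hk h hf]
  have h1 := (norm_opJdL_le hk (mulC u (opS f))).trans
    (mul_le_mul_of_nonneg_left (hb u hu) (by positivity))
  have h2 := (norm_opJL_le hk (mulC u' (opS f))).trans
    (mul_le_mul_of_nonneg_left (hb u' hu') (by positivity))
  refine (norm_sub_le _ _).trans ((add_le_add h1 h2).trans_eq ?_)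
  ring

theorem norm_opG_mulC_le (hk : 0 < k) {u u' : C(Torus, ℂ)} (h : HasTorusDeriv u u') {f : L2}
    (hf : coeff 0 f = 0) {m : ℝ} (hu : ‖u‖ ≤ m) (hu' : ‖u'‖ ≤ m) :
    ‖opG k (mulC u f)‖ ≤ (1 / k ^ 2 + 1) * m * ‖opS f‖ := by
  have hb : ∀ φ : C(Torus, ℂ), ‖φ‖ ≤ m → ‖mulC φ (opS f)‖ ≤ m * ‖opS f‖ := fun φ hφ =>
    (norm_mulC_le _ _).trans (by gcongr)
  rw [opG_mulC hk h hf]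
  have h1 := (norm_opJL_le hk (mulC u (opS f))).trans
    (mul_le_mul_of_nonneg_left (hb u hu) (by positivity))
  have h2 := (norm_opG_le (k := k) (mulC u' (opS f))).trans (hb u' hu')
  refine (norm_sub_le _ _).trans ((add_le_add h1 h2).trans_eq ?_)
  ring

/-- The smoothing part of the pencil. -/
def opRem (b κ lam : ℝ) (w : Profile) (f : L2) : L2 :=
  -((κ : ℂ) • opJL hk (opS f))
    + (-opJL hk (((b + 1 : ℝ) : ℂ) • mulC w.onTorus (opS f)
        - ((k ^ 2 : ℝ) : ℂ) • mulC w.dz.dz.onTorus (opS f))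
      + ((k ^ 2 * (b - 2) : ℝ) : ℂ) • opJL hk (mulC w.dz.onTorus f)
      + (lam : ℂ) • opN hk f + opG k (mulC w.onTorus f))

theorem opHat_eq_rem (b κ lam c : ℝ) (w : Profile) (f : L2) :
    opHat hk b κ lam c w.onTorus w.dz.onTorus w.dz.dz.onTorus f
      = (c : ℂ) • f - mulC w.onTorus f + opRem hk b κ lam w f := by
  rw [opHat_apply, opLL_apply, smul_opJdL_eq]
  simp only [opRem]
  module

/-- The constant of the smoothing part. -/
def boundRem (b k : ℝ) : ℝ := (|b + 1| + k ^ 2) / k ^ 2 + 2 * |b - 2| + 1 / k ^ 2 + 1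

theorem boundRem_pos (b : ℝ) : 0 < boundRem b k := by unfold boundRem; positivity

/-- Everything except the κ-term is bounded by V = `opS f` with the small factor m + |λ|. The κ-term
is kept apart because only a large z makes it small. -/
theorem norm_opRem_le (b κ lam : ℝ) {w : Profile} {m : ℝ} (hw : C2Bound w m) {f : L2}
    (hf : coeff 0 f = 0) :
    ‖opRem hk b κ lam w f‖ ≤ |κ| * ‖opJL hk (opS f)‖ + boundRem b k * (m + |lam|) * ‖opS f‖ := by
  have hw0 := w.norm_onTorus_le fun x => (hw x).1
  have hw1 := w.dz.norm_onTorus_le fun x => (hw x).2.1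
  have hw2 := w.dz.dz.norm_onTorus_le fun x => (hw x).2.2
  have hm : 0 ≤ m := (norm_nonneg _).trans hw0
  have hk2 : 0 < k ^ 2 := by positivity
  have hb : ∀ φ : C(Torus, ℂ), ‖φ‖ ≤ m → ‖mulC φ (opS f)‖ ≤ m * ‖opS f‖ := fun φ hφ =>
    (norm_mulC_le _ _).trans (by gcongr)
  have e0 : ‖-((κ : ℂ) • opJL hk (opS f))‖ = |κ| * ‖opJL hk (opS f)‖ := by
    rw [norm_neg, norm_smul, Complex.norm_real, Real.norm_eq_abs]
  have e1 : ‖-opJL hk (((b + 1 : ℝ) : ℂ) • mulC w.onTorus (opS f)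
        - ((k ^ 2 : ℝ) : ℂ) • mulC w.dz.dz.onTorus (opS f))‖
      ≤ 1 / k ^ 2 * (|b + 1| * (m * ‖opS f‖) + k ^ 2 * (m * ‖opS f‖)) := by
    rw [norm_neg]
    refine (norm_opJL_le hk _).trans ?_
    gcongr
    refine (norm_sub_le _ _).trans (add_le_add ?_ ?_)
    · rw [norm_smul, Complex.norm_real, Real.norm_eq_abs]; gcongr; exact hb _ hw0
    · rw [norm_smul, Complex.norm_real, Real.norm_of_nonneg hk2.le]; gcongr; exact hb _ hw2
  have e2 : ‖((k ^ 2 * (b - 2) : ℝ) : ℂ) • opJL hk (mulC w.dz.onTorus f)‖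
      ≤ k ^ 2 * |b - 2| * (2 * m / k ^ 2 * ‖opS f‖) := by
    rw [norm_smul, Complex.norm_real, Real.norm_eq_abs, abs_mul, abs_of_pos hk2]
    gcongr
    exact norm_opJL_mulC_le hk w.dz.hasTorusDeriv hf hw1 hw2
  have e3 : ‖(lam : ℂ) • opN hk f‖ ≤ |lam| * (1 / k ^ 2 * ‖opS f‖) := by
    rw [norm_smul, Complex.norm_real, Real.norm_eq_abs, opN_apply, norm_neg]
    gcongr
    refine (norm_opJL_le hk _).trans ?_
    gcongr
    exact (norm_opS_le _).trans (norm_opS_le _)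
  have e4 := norm_opG_mulC_le hk w.hasTorusDeriv hf hw0 hw1
  unfold opRem
  refine (norm_add_le _ _).trans (add_le_add e0.le ?_)
  refine (norm_add_le _ _).trans ((add_le_add_left ((norm_add_le _ _).trans (add_le_add_left
    ((norm_add_le _ _).trans (add_le_add e1 e2)) _)) _).trans ((add_le_add (add_le_add_right e3 _) e4).trans ?_))
  have hV := norm_nonneg (opS f)
  have hl := abs_nonneg lam
  have hB : boundRem b k * (m + |lam|) * ‖opS f‖
      = (1 / k ^ 2 * (|b + 1| * (m * ‖opS f‖) + k ^ 2 * (m * ‖opS f‖))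
        + k ^ 2 * |b - 2| * (2 * m / k ^ 2 * ‖opS f‖) + |lam| * (1 / k ^ 2 * ‖opS f‖)
        + (1 / k ^ 2 + 1) * m * ‖opS f‖)
        + ((|b + 1| + k ^ 2) / k ^ 2 + 2 * |b - 2| + 1) * (|lam| * ‖opS f‖) := by
    unfold boundRem
    field_simp
    ring
  rw [hB]
  have : 0 ≤ ((|b + 1| + k ^ 2) / k ^ 2 + 2 * |b - 2| + 1) * (|lam| * ‖opS f‖) := by
    positivity
  linarith

/-- The constant in the high frequency estimate. -/
def boundHigh (b κ k : ℝ) : ℝ :=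
  1 / k ^ 2 * (2 * |κ| / (1 + k ^ 2) + 4 + (|κ| / k ^ 2 + 2 * boundRem b k))

/-- Applying `opJL` to the equation expresses z `opJL` V through terms bounded by V and g. The
κ-term of the remainder therefore decays like 1/|z|. -/
theorem norm_opJL_opS_le (b κ : ℝ) {lam c : ℝ} {w : Profile} {m : ℝ} (hw : C2Bound w m)
    (hm1 : m ≤ 1) (hl1 : |lam| ≤ 1) (hc : |c| ≤ 2 * |κ| / (1 + k ^ 2)) {z : ℂ} {f g : L2}
    (hf : coeff 0 f = 0)
    (h : opHat hk b κ lam c w.onTorus w.dz.onTorus w.dz.dz.onTorus f = z • opS f + g) :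
    ‖z‖ * ‖opJL hk (opS f)‖ ≤ boundHigh b κ k * (‖opS f‖ + ‖g‖) := by
  have hw0 := w.norm_onTorus_le fun x => (hw x).1
  have hw1 := w.dz.norm_onTorus_le fun x => (hw x).2.1
  have hm : 0 ≤ m := (norm_nonneg _).trans hw0
  have hk2 : 0 < k ^ 2 := by positivity
  have hB := boundRem_pos (k := k) b
  have e1 : opJL hk f = opJdL hk (opS f) := ext_coeff fun n => by
    rw [coeff_opJL, coeff_opJdL]
    have := I_mul_coeff_opS hf n
    linear_combination -(Complex.I * n / (1 + (k : ℂ) ^ 2 * (n : ℂ) ^ 2)) * this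
  have key : z • opJL hk (opS f) = (c : ℂ) • opJdL hk (opS f) - opJL hk (mulC w.onTorus f)
      + opJL hk (opRem hk b κ lam w f) - opJL hk g := by
    have h1 := congrArg (opJL hk) h
    rw [opHat_eq_rem, map_add, map_sub, map_smul, map_add, map_smul, e1] at h1
    rw [h1]
    abel
  have hrem := norm_opRem_le hk b κ lam hw hf
  have hrem2 : ‖opRem hk b κ lam w f‖ ≤ (|κ| / k ^ 2 + 2 * boundRem b k) * ‖opS f‖ := by
    have h1 := norm_opJL_le hk (opS f)
    have h2 : |κ| * ‖opJL hk (opS f)‖ ≤ |κ| * (1 / k ^ 2 * ‖opS f‖) := by gcongr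
    have h3 : boundRem b k * (m + |lam|) * ‖opS f‖ ≤ boundRem b k * 2 * ‖opS f‖ := by
      gcongr
      linarith
    calc _ ≤ _ := hrem
      _ ≤ |κ| * (1 / k ^ 2 * ‖opS f‖) + boundRem b k * 2 * ‖opS f‖ := add_le_add h2 h3
      _ = _ := by ring
  rw [← norm_smul, key]
  have a1 : ‖(c : ℂ) • opJdL hk (opS f)‖ ≤ 2 * |κ| / (1 + k ^ 2) * (1 / k ^ 2 * ‖opS f‖) := by
    rw [norm_smul, Complex.norm_real, Real.norm_eq_abs]
    gcongr
    exact norm_opJdL_le hk _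
  have a2 : ‖opJL hk (mulC w.onTorus f)‖ ≤ 2 * 1 / k ^ 2 * ‖opS f‖ :=
    (norm_opJL_mulC_le hk w.hasTorusDeriv hf hw0 hw1).trans (by gcongr)
  have a3 : ‖opJL hk (opRem hk b κ lam w f)‖
      ≤ 1 / k ^ 2 * ((|κ| / k ^ 2 + 2 * boundRem b k) * ‖opS f‖) :=
    (norm_opJL_le hk _).trans (by gcongr)
  have a4 := norm_opJL_le hk g
  have n1 := norm_sub_le ((c : ℂ) • opJdL hk (opS f) - opJL hk (mulC w.onTorus f)
      + opJL hk (opRem hk b κ lam w f)) (opJL hk g)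
  have n2 := norm_add_le ((c : ℂ) • opJdL hk (opS f) - opJL hk (mulC w.onTorus f))
    (opJL hk (opRem hk b κ lam w f))
  have n3 := norm_sub_le ((c : ℂ) • opJdL hk (opS f)) (opJL hk (mulC w.onTorus f))
  have e : boundHigh b κ k * (‖opS f‖ + ‖g‖)
      = 2 * |κ| / (1 + k ^ 2) * (1 / k ^ 2 * ‖opS f‖) + 2 * 1 / k ^ 2 * ‖opS f‖
        + 1 / k ^ 2 * ((|κ| / k ^ 2 + 2 * boundRem b k) * ‖opS f‖) + 1 / k ^ 2 * ‖g‖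
        + (1 / k ^ 2 * (2 * ‖opS f‖) + 1 / k ^ 2 * (2 * |κ| / (1 + k ^ 2) + 3
          + (|κ| / k ^ 2 + 2 * boundRem b k)) * ‖g‖) := by
    unfold boundHigh
    field_simp
    ring
  rw [e]
  have : 0 ≤ 1 / k ^ 2 * (2 * ‖opS f‖) + 1 / k ^ 2 * (2 * |κ| / (1 + k ^ 2) + 3
          + (|κ| / k ^ 2 + 2 * boundRem b k)) * ‖g‖ := by positivity
  linarith

/-- At high frequency the smoothing part is small. -/
theorem norm_opRem_le_of_large (b κ : ℝ) {lam c : ℝ} {w : Profile} {m : ℝ} (hw : C2Bound w m)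
    (hm1 : m ≤ 1) (hl1 : |lam| ≤ 1) (hc : |c| ≤ 2 * |κ| / (1 + k ^ 2)) {z : ℂ} {f g : L2}
    (hf : coeff 0 f = 0)
    (h : opHat hk b κ lam c w.onTorus w.dz.onTorus w.dz.dz.onTorus f = z • opS f + g) {ε : ℝ}
    (hz : |κ| * boundHigh b κ k ≤ ε / 2 * ‖z‖) (hz0 : z ≠ 0)
    (hs : boundRem b k * (m + |lam|) ≤ ε / 2) :
    ‖opRem hk b κ lam w f‖ ≤ ε * (‖opS f‖ + ‖g‖) := by
  have hz' := norm_pos_iff.2 hz0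
  have h1 := norm_opJL_opS_le hk b κ hw hm1 hl1 hc hf h
  have h2 : |κ| * ‖opJL hk (opS f)‖ ≤ ε / 2 * (‖opS f‖ + ‖g‖) := by
    refine le_of_mul_le_mul_left ?_ hz'
    calc ‖z‖ * (|κ| * ‖opJL hk (opS f)‖) = |κ| * (‖z‖ * ‖opJL hk (opS f)‖) := by ring
      _ ≤ |κ| * (boundHigh b κ k * (‖opS f‖ + ‖g‖)) := by gcongr
      _ = |κ| * boundHigh b κ k * (‖opS f‖ + ‖g‖) := by ring
      _ ≤ ε / 2 * ‖z‖ * (‖opS f‖ + ‖g‖) := by gcongr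
      _ = _ := by ring
  have hw0 := w.norm_onTorus_le fun x => (hw x).1
  have hm : 0 ≤ m := (norm_nonneg _).trans hw0
  have hε : 0 ≤ ε / 2 := le_trans (by have := boundRem_pos (k := k) b; positivity) hs
  have h3 : boundRem b k * (m + |lam|) * ‖opS f‖ ≤ ε / 2 * (‖opS f‖ + ‖g‖) := by
    gcongr
    linarith [norm_nonneg g]
  linarith [norm_opRem_le hk b κ lam hw hf]

end

/-! ### Transport operators conjugated to constant mean speed -/

theorem HasTorusDeriv.transport_coeff {ρ E : C(Torus, ℂ)} {s : ℂ}
    (hE : HasTorusDeriv E ((-s) • (ρ * E))) {f G : L2} {z : ℂ} (hf : coeff 0 f = 0)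
    (h : f = mulC ρ (z • opS f + G)) (j : ℤ) :
    Complex.I * j * coeff j (mulC E (opS f))
      = coeff j (mulC ρ ((z - s) • mulC E (opS f) + mulC E G)) := by
  -- The derivative of E contributes −sρE V, which shifts the spectral parameter from z to z − s.
  rw [coeff_deriv_mulC hE hf, mulC_smul, mulC_mul]
  conv_lhs => rw [h]
  have hcomm : ∀ g, mulC E (mulC ρ g) = mulC ρ (mulC E g) := fun g => by
    rw [← mulC_mul, ← mulC_mul, mul_comm E ρ]
  rw [hcomm, ← h]
  simp only [map_add, map_smul, smul_eq_mul]
  ring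

/-- The symbol of the transport operator away from the resonant mode. -/
theorem norm_I_mul_sub_ge {d : ℂ} (hd : |d.im| ≤ 3 / 5) {j : ℤ} (hj : j ≠ 0) :
    2 / 5 ≤ ‖Complex.I * j - d‖ ∧ 2 / 5 * ‖d‖ ≤ ‖Complex.I * j - d‖ := by
  have h1 : ‖Complex.I * j - d‖ ^ 2 = d.re ^ 2 + ((j : ℝ) - d.im) ^ 2 := by
    rw [← Complex.normSq_eq_norm_sq, Complex.normSq_apply]
    simp
    ring
  have h2 : ‖d‖ ^ 2 = d.re ^ 2 + d.im ^ 2 := by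
    rw [← Complex.normSq_eq_norm_sq, Complex.normSq_apply]
    ring
  have hj1 : (1 : ℝ) ≤ |(j : ℝ)| := by exact_mod_cast Int.one_le_abs hj
  have h3 : (2 / 5 : ℝ) ≤ |(j : ℝ) - d.im| := by
    have := abs_sub_abs_le_abs_sub (j : ℝ) d.im
    linarith
  have h4 : (2 / 5 : ℝ) ^ 2 ≤ ((j : ℝ) - d.im) ^ 2 := by
    rw [← sq_abs ((j : ℝ) - d.im)]
    exact pow_le_pow_left₀ (by norm_num) h3 2
  have h5 : d.im ^ 2 ≤ (3 / 5) ^ 2 := by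
    rw [← sq_abs d.im]
    exact pow_le_pow_left₀ (abs_nonneg _) hd 2
  constructor
  · refine le_of_sq_le_sq ?_ (norm_nonneg _)
    rw [h1]
    nlinarith [sq_nonneg d.re]
  · refine le_of_sq_le_sq ?_ (norm_nonneg _)
    rw [h1, mul_pow, h2]
    nlinarith [sq_nonneg d.re]

section transport

variable {c r : ℝ} {δ : ℂ} {ρ ρ₁ : C(Torus, ℂ)} {X Y : L2}

theorem mulC_eq_of_split (hρ : ρ = ((1 / c : ℝ) : ℂ) • (1 : C(Torus, ℂ)) + ρ₁) (g : L2) :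
    mulC ρ g = ((1 / c : ℝ) : ℂ) • g + mulC ρ₁ g := by
  rw [hρ, mulC_add, mulC_smul, mulC_one]

/-- For j ≠ 0 the symbol ij − δ/c is bounded below both by a constant and by a multiple of |δ/c|.
The second bound is needed because δ itself multiplies the perturbation ρ₁ and its real part is not
controlled. -/
theorem norm_sub_coeff_zero_le (hc : 0 < c) (hδ : |δ.im| ≤ 3 / 5 * c)
    (hρ : ρ = ((1 / c : ℝ) : ℂ) • (1 : C(Torus, ℂ)) + ρ₁) 
    (h : ∀ j : ℤ, Complex.I * j * coeff j Y = coeff j (mulC ρ (δ • Y + X))) :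
    ‖Y - coeff 0 Y • expL2 0‖ ≤ 5 / 2 * (c * ‖mulC ρ₁ Y‖ + ‖mulC ρ X‖) := by
  have hcC : (c : ℂ) ≠ 0 := by exact_mod_cast hc.ne'
  set d : ℂ := δ / c with hd
  have hdim : |d.im| ≤ 3 / 5 := by
    rw [hd, Complex.div_ofReal_im, abs_div, abs_of_pos hc, div_le_iff₀ hc]
    exact hδ
  have hmode : ∀ j : ℤ, (Complex.I * j - d) * coeff j Y
      = d * (c * coeff j (mulC ρ₁ Y)) + coeff j (mulC ρ X) := by
    intro j
    have h1 := h j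
    rw [map_add, map_smul, map_add, map_smul, mulC_eq_of_split hρ Y, map_add, map_smul,
      smul_eq_mul, smul_eq_mul] at h1
    have e : δ = d * c := by rw [hd]; field_simp
    rw [sub_mul, h1, e]
    push_cast
    field_simp
    ring
  have hA : ‖Y - coeff 0 Y • expL2 0‖ ≤ 1 * ‖mult (fun j => if j = 0 then 0 else
      (Complex.I * j - d)⁻¹ * d) (5 / 2) (fun j => by
        split_ifs with hj
        · rw [norm_zero]
          norm_num
        · have h2 := norm_I_mul_sub_ge hdim hj
          rw [norm_mul, norm_inv, inv_mul_le_iff₀ (by linarith)]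
          linarith) ((c : ℂ) • mulC ρ₁ Y) + mult (fun j => if j = 0 then 0 else
      (Complex.I * j - d)⁻¹) (5 / 2) (fun j => by
        split_ifs with hj
        · rw [norm_zero]
          norm_num
        · have h2 := norm_I_mul_sub_ge hdim hj
          rw [norm_inv, inv_le_comm₀ (by linarith) (by norm_num)]
          norm_num
          linarith) (mulC ρ X)‖ := by
    refine norm_le_of_coeff zero_le_one fun j => ?_
    rw [one_mul]
    refine le_of_eq (congrArg _ ?_)
    rw [map_sub, map_smul, map_add, coeff_mult, coeff_mult, coeff_expL2, map_smul]
    split_ifs with hj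
    · subst hj
      simp
    · have h2 := norm_I_mul_sub_ge hdim hj
      have h3 : Complex.I * j - d ≠ 0 := by
        rw [← norm_pos_iff]
        linarith
      simp only [smul_eq_mul, mul_zero, sub_zero]
      refine mul_left_cancel₀ h3 ?_
      rw [hmode]
      field_simp
  refine hA.trans ?_
  rw [one_mul]
  refine (norm_add_le _ _).trans ((add_le_add (norm_mult_le _ _ _ _)
    (norm_mult_le _ _ _ _)).trans_eq ?_)
  rw [norm_smul, Complex.norm_real, Real.norm_of_nonneg hc.le]
  ring

theorem norm_le_coeff_zero_add (Y : L2) : ‖Y‖ ≤ ‖coeff 0 Y‖ + ‖Y - coeff 0 Y • expL2 0‖ := by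
  have h := norm_add_le (coeff 0 Y • expL2 0) (Y - coeff 0 Y • expL2 0)
  rwa [add_sub_cancel, norm_smul, norm_expL2, mul_one] at h

end transport

theorem norm_invProfile_sub_le {c : ℝ} (hc : 0 < c) {w : Profile} (hw : ∀ x, |w x| ≤ c / 200)
    (h : ∀ x, c - w x ≠ 0) :
    ‖(invProfile c w h).onTorus - ((1 / c : ℝ) : ℂ) • (1 : C(Torus, ℂ))‖ ≤ 1 / (100 * c) := by
  rw [ContinuousMap.norm_le _ (by positivity)]
  intro x
  induction x using QuotientAddGroup.induction_on with
  | H x =>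
    change ‖(((c - w x)⁻¹ : ℝ) : ℂ) - ((1 / c : ℝ) : ℂ) * 1‖ ≤ _
    rw [mul_one, ← Complex.ofReal_sub, Complex.norm_real, Real.norm_eq_abs]
    have h1 := abs_le.1 (hw x)
    have h2 : 0 < c - w x := by linarith
    have e : (c - w x)⁻¹ - 1 / c = w x / ((c - w x) * c) := by
      have := h x
      field_simp
      ring
    rw [e, abs_div, abs_of_pos (mul_pos h2 hc), div_le_div_iff₀ (mul_pos h2 hc) (by positivity)]
    nlinarith [hw x]

set_option maxHeartbeats 1000000 in
/-- A transport operator with a small remainder, invariant under conjugation, has only purely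
imaginary eigenvalues. -/
theorem re_eq_zero_of_transport {c ε : ℝ} (hc : 0 < c) (hε0 : 0 ≤ ε) (hεc : ε ≤ c / 1000)
    (hε1 : ε ≤ 1 / 1000) {w : Profile} (he : Function.Even w) (hw : ∀ x, |w x| ≤ c / 200)
    {T : L2 →L[ℂ] L2} {R : L2 → L2} (hT : ∀ f, T f = (c : ℂ) • f - mulC w.onTorus f + R f)
    (hconj : ∀ f, coeff 0 f = 0 → conjL (T f) = T (conjL f)) {z : ℂ}
    (hR : ∀ f g, coeff 0 f = 0 → T f = z • opS f + g → ‖R f‖ ≤ ε * (‖opS f‖ + ‖g‖))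
    {f : L2} (hf0 : coeff 0 f = 0) (hf : f ≠ 0) (hfz : T f = z • opS f) : z.re = 0 := by
  have hpos : ∀ x, 0 < c - w x := fun x => by have := abs_le.1 (hw x); linarith
  have hne : ∀ x, c - w x ≠ 0 := fun x => (hpos x).ne'
  set P := invProfile c w hne with hP
  have hPv : ∀ x, P x = (c - w x)⁻¹ := fun _ => rfl
  set ρ := P.onTorus with hρdef
  set ρ₁ := ρ - ((1 / c : ℝ) : ℂ) • (1 : C(Torus, ℂ)) with hρ₁
  have hρ : ρ = ((1 / c : ℝ) : ℂ) • (1 : C(Torus, ℂ)) + ρ₁ := by rw [hρ₁]; abel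
  have hr : ‖ρ₁‖ ≤ 1 / (100 * c) := norm_invProfile_sub_le hc hw hne
  have hb1 : ∀ g, ‖mulC ρ₁ g‖ ≤ 1 / (100 * c) * ‖g‖ := fun g =>
    (norm_mulC_le _ _).trans (by gcongr)
  have hb : ∀ g, ‖mulC ρ g‖ ≤ 2 / c * ‖g‖ := fun g => by
    rw [mulC_eq_of_split hρ]
    refine (norm_add_le _ _).trans ((add_le_add_right (hb1 g) _).trans ?_)
    rw [norm_smul, Complex.norm_real, Real.norm_of_nonneg (by positivity), ← add_mul]
    gcongr
    rw [div_add_div _ _ hc.ne' (by positivity), div_le_div_iff₀ (by positivity) hc]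
    nlinarith [mul_pos hc hc]
  have hlow : ∀ x, 200 / (201 * c) ≤ P x := fun x => by
    rw [hPv, ← one_div, div_le_div_iff₀ (by positivity) (hpos x)]
    have := abs_le.1 (hw x)
    linarith
  have hlow0 : (0 : ℝ) < 200 / (201 * c) := by positivity
  have hτ0 := meanSpeed_pos hlow0 hlow
  have hτ1 := meanSpeed_le hlow0 hlow
  set τ := meanSpeed P
  have hτ2 : τ ≤ 6 / 5 * c := hτ1.trans (by
    rw [one_div_div]
    linarith)
  have hPe : Function.Even P := fun x => by rw [hPv, hPv, he x]
  -- The integer n is the mode closest to resonance: z − inτ has imaginary part at most τ/2 ≤ 3c/5,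
  -- so after conjugation only mode 0 can be resonant.
  set n : ℤ := round (z.im / τ)
  obtain ⟨E, E', hE1, hE'1, hEE, hEd, hEr⟩ := exists_conjugating hPe hlow0 hlow n
  set s : ℂ := Complex.I * n * τ
  set δ : ℂ := z - s with hδdef
  have hδ : |δ.im| ≤ 3 / 5 * c := by
    have h1 : δ.im = (z.im / τ - n) * τ := by
      rw [hδdef]
      simp [s]
      field_simp
    rw [h1, abs_mul, abs_of_pos hτ0]
    have h2 := abs_sub_round (z.im / τ)
    nlinarith
  have hbE : ∀ g, ‖mulC E g‖ ≤ ‖g‖ := fun g =>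
    (norm_mulC_le _ _).trans ((mul_le_mul_of_nonneg_right hE1 (norm_nonneg _)).trans_eq
      (one_mul _))
  have hbE' : ∀ g, ‖g‖ ≤ ‖mulC E g‖ := fun g => by
    have h1 : mulC E' (mulC E g) = g := by rw [← mulC_mul, hEE, mulC_one]
    calc ‖g‖ = ‖mulC E' (mulC E g)‖ := by rw [h1]
      _ ≤ ‖E'‖ * ‖mulC E g‖ := norm_mulC_le _ _
      _ ≤ 1 * ‖mulC E g‖ := by gcongr
      _ = _ := one_mul _
  have hρc : ρ * ((c : ℂ) • (1 : C(Torus, ℂ)) - w.onTorus) = 1 := by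
    ext x
    induction x using QuotientAddGroup.induction_on with
    | H x =>
      change (((c - w x)⁻¹ : ℝ) : ℂ) * ((c : ℂ) * 1 - ((w x : ℝ) : ℂ)) = 1
      rw [mul_one, ← Complex.ofReal_sub, ← Complex.ofReal_mul, inv_mul_cancel₀ (hne x),
        Complex.ofReal_one]
  have hsolve : ∀ f g, T f = z • opS f + g → f = mulC ρ (z • opS f + (g - R f)) := by
    intro f g h
    have h1 : z • opS f + (g - R f) = mulC ((c : ℂ) • (1 : C(Torus, ℂ)) - w.onTorus) f := by
      rw [mulC_sub, mulC_smul, mulC_one, ← add_sub_assoc, ← h, hT]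
      abel
    rw [h1, ← mulC_mul, hρc, mulC_one]
  have hmodes : ∀ f g, coeff 0 f = 0 → T f = z • opS f + g → ∀ j : ℤ,
      Complex.I * j * coeff j (mulC E (opS f))
        = coeff j (mulC ρ (δ • mulC E (opS f) + mulC E (g - R f))) := fun f g hf h =>
    hEd.transport_coeff hf (hsolve f g h)
  -- the resonant mode dominates
  have hc5 : c * (1 / (100 * c)) = 1 / 100 := by field_simp
  have hc6 : ε * (2 / c) ≤ 1 / 500 := by
    rw [mul_div_assoc', div_le_div_iff₀ hc (by norm_num)]
    linarith
  have hdom : ∀ f, coeff 0 f = 0 → T f = z • opS f →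
      ‖mulC E (opS f)‖ ≤ 10 / 9 * ‖coeff 0 (mulC E (opS f))‖ ∧
        (‖δ‖ * ‖mulC E (opS f)‖ ≤ 4 * ε * ‖mulC E (opS f)‖) := by
    intro f hf0 hfz
    have hfz' : T f = z • opS f + 0 := by rw [hfz, add_zero]
    have hm := hmodes f 0 hf0 hfz'
    have hRf := hR f 0 hf0 hfz'
    rw [norm_zero, add_zero] at hRf
    rw [zero_sub] at hm
    set Y := mulC E (opS f)
    set X := mulC E (-R f)
    have hX : ‖X‖ ≤ ε * ‖Y‖ := by
      refine (hbE _).trans ?_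
      rw [norm_neg]
      exact hRf.trans (mul_le_mul_of_nonneg_left (hbE' _) hε0)
    have hρX : ‖mulC ρ X‖ ≤ 1 / 500 * ‖Y‖ := by
      refine (hb X).trans ?_
      calc 2 / c * ‖X‖ ≤ 2 / c * (ε * ‖Y‖) := by gcongr
        _ = ε * (2 / c) * ‖Y‖ := by ring
        _ ≤ _ := by gcongr
    have hcY : c * ‖mulC ρ₁ Y‖ ≤ 1 / 100 * ‖Y‖ := by
      calc c * ‖mulC ρ₁ Y‖ ≤ c * (1 / (100 * c) * ‖Y‖) := by gcongr; exact hb1 Y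
        _ = c * (1 / (100 * c)) * ‖Y‖ := by ring
        _ = _ := by rw [hc5]
    have h1 := norm_sub_coeff_zero_le hc hδ hρ hm
    have h2 := norm_le_coeff_zero_add Y
    have hY := norm_nonneg Y
    have hdomY : ‖Y‖ ≤ 10 / 9 * ‖coeff 0 Y‖ := by linarith
    refine ⟨hdomY, ?_⟩
    have h3 := hm 0
    rw [Int.cast_zero, mul_zero, zero_mul, map_add, map_smul, mulC_eq_of_split hρ Y, map_add,
      map_smul, map_add, map_smul, smul_eq_mul, smul_eq_mul] at h3
    have h4 : δ * coeff 0 Y = -(c * (δ * coeff 0 (mulC ρ₁ Y)) + c * coeff 0 (mulC ρ X)) := by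
      have hcC : (c : ℂ) ≠ 0 := by exact_mod_cast hc.ne'
      push_cast at h3
      field_simp at h3
      linear_combination -h3
    have h5 : ‖δ‖ * ‖coeff 0 Y‖ ≤ ‖δ‖ * (1 / 100 * ‖Y‖) + 2 * ε * ‖Y‖ := by
      rw [← norm_mul, h4, norm_neg]
      refine (norm_add_le _ _).trans (add_le_add ?_ ?_)
      · rw [norm_mul, norm_mul, Complex.norm_real, Real.norm_of_nonneg hc.le, mul_left_comm]
        refine mul_le_mul_of_nonneg_left ?_ (norm_nonneg δ)
        exact (mul_le_mul_of_nonneg_left (norm_coeff_le _ _) hc.le).trans hcY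
      · rw [norm_mul, Complex.norm_real, Real.norm_of_nonneg hc.le]
        calc c * ‖coeff 0 (mulC ρ X)‖ ≤ c * (2 / c * (ε * ‖Y‖)) := by
              gcongr
              exact (norm_coeff_le _ _).trans ((hb X).trans (by gcongr))
          _ = _ := by field_simp
    have h6 : ‖δ‖ * ‖Y‖ ≤ ‖δ‖ * (10 / 9 * ‖coeff 0 Y‖) := by gcongr
    have h7 : 0 ≤ ε * ‖Y‖ := by positivity
    have h8 : 0 ≤ ‖δ‖ * ‖Y‖ := by positivity
    linarith
  have hYne : ∀ f, coeff 0 f = 0 → f ≠ 0 → mulC E (opS f) ≠ 0 := by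
    intro f hf0 hf h
    apply hf
    apply ext_coeff
    intro j
    have h1 : opS f = 0 := by
      rw [← norm_le_zero_iff]
      exact (hbE' _).trans (by rw [h, norm_zero])
    rw [← I_mul_coeff_opS hf0, h1]
    simp
  -- normalise
  obtain ⟨hd1, hd2⟩ := hdom f hf0 hfz
  have hY0 : coeff 0 (mulC E (opS f)) ≠ 0 := by
    intro h0
    rw [h0, norm_zero, mul_zero] at hd1
    exact hYne f hf0 hf (norm_le_zero_iff.1 hd1)
  have hδε : ‖δ‖ ≤ 4 * ε := le_of_mul_le_mul_right hd2 (norm_pos_iff.2 (hYne f hf0 hf))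
  set f₁ := (coeff 0 (mulC E (opS f)))⁻¹ • f with hf₁
  have hf₁0 : coeff 0 f₁ = 0 := by rw [hf₁, map_smul, hf0, smul_zero]
  have hf₁z : T f₁ = z • opS f₁ := by rw [hf₁, map_smul, map_smul, hfz, smul_comm]
  have hY1 : coeff 0 (mulC E (opS f₁)) = 1 := by
    rw [hf₁, map_smul, map_smul, map_smul, smul_eq_mul, inv_mul_cancel₀ hY0]
  obtain ⟨hd3, -⟩ := hdom f₁ hf₁0 hf₁z
  rw [hY1, norm_one] at hd3
  clear_value f₁
  set Vs := conjL (opS f₁) with hVs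
  -- As `opS` reverses sign under conjugation, this sum for f is the difference V − V* for V = `opS
  -- f₁`. The conjugated difference has no mode 0, because the normalised mode is 1 for both.
  set q := f₁ + conjL f₁ with hq
  set D : ℂ := z + (starRingEnd ℂ) z with hD
  have hq0 : coeff 0 q = 0 := by rw [hq, map_add, coeff_conjL, hf₁0, map_zero, add_zero]
  have hSq : opS q = opS f₁ - Vs := by rw [hVs, conjL_opS, hq, map_add, sub_neg_eq_add]
  have hqz : T q = z • opS q + D • Vs := by
    rw [hSq, hq, map_add, ← hconj f₁ hf₁0, hf₁z, conjL.map_smulₛₗ z (opS f₁), ← hVs, hD]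
    module
  have hEV : mulC E Vs = conjL (mulC E (opS f₁)) := by
    rw [conjL_mulC (s := 1) (by simpa using hEr), one_smul]
  have hm := hmodes q _ hq0 hqz
  have hRq := hR q _ hq0 hqz
  have hYq0 : coeff 0 (mulC E (opS q)) = 0 := by
    rw [hSq, map_sub, map_sub, hEV, coeff_conjL, hY1, map_one, sub_self]
  have hEVn : ‖mulC E Vs‖ ≤ 10 / 9 := by
    rw [hEV]
    exact (norm_conjL_le _).trans (by linarith)
  have hVsn : ‖Vs‖ ≤ 10 / 9 := (hbE' _).trans hEVn
  have hDn := norm_nonneg D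
  rw [norm_smul] at hRq
  have hSqn := hbE' (opS q)
  set Yq := mulC E (opS q)
  have hYqn := norm_nonneg Yq
  have hRq2 : ‖mulC E (R q)‖ ≤ ε * (‖Yq‖ + 2 * ‖D‖) := by
    refine (hbE _).trans (hRq.trans ?_)
    have : ‖D‖ * ‖Vs‖ ≤ ‖D‖ * 2 := mul_le_mul_of_nonneg_left (by linarith) hDn
    exact mul_le_mul_of_nonneg_left (by linarith) hε0
  rw [map_sub, map_smul] at hm
  have h1 := norm_sub_coeff_zero_le hc hδ hρ hm
  rw [hYq0, zero_smul, sub_zero] at h1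
  have hρX : ‖mulC ρ (D • mulC E Vs - mulC E (R q))‖
      ≤ 2 / c * (2 * ‖D‖) + 1 / 500 * (‖Yq‖ + 2 * ‖D‖) := by
    refine (hb _).trans ?_
    calc 2 / c * ‖D • mulC E Vs - mulC E (R q)‖
        ≤ 2 / c * (2 * ‖D‖ + ε * (‖Yq‖ + 2 * ‖D‖)) := by
          gcongr
          refine (norm_sub_le _ _).trans (add_le_add ?_ hRq2)
          rw [norm_smul]
          nlinarith
      _ = 2 / c * (2 * ‖D‖) + ε * (2 / c) * (‖Yq‖ + 2 * ‖D‖) := by ring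
      _ ≤ _ := by gcongr
  have hcY : c * ‖mulC ρ₁ Yq‖ ≤ 1 / 100 * ‖Yq‖ := by
    calc c * ‖mulC ρ₁ Yq‖ ≤ c * (1 / (100 * c) * ‖Yq‖) := by gcongr; exact hb1 Yq
      _ = c * (1 / (100 * c)) * ‖Yq‖ := by ring
      _ = _ := by rw [hc5]
  have h2 : ‖Yq‖ ≤ (12 / c + 1 / 50) * ‖D‖ := by
    have e : 2 / c * (2 * ‖D‖) = 1 / 3 * (12 / c * ‖D‖) := by field_simp; ring
    rw [add_mul]
    have : 0 ≤ 12 / c * ‖D‖ := by positivity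
    linarith
  have h3 := hm 0
  rw [Int.cast_zero, mul_zero, zero_mul, map_add, map_smul, map_sub, map_smul,
    mulC_eq_of_split hρ (mulC E Vs), map_add, map_smul, map_sub, map_smul, map_add, map_smul,
    hEV, coeff_conjL, hY1, map_one, ← hEV, smul_eq_mul, smul_eq_mul, smul_eq_mul, mul_one] at h3
  -- Mode 0 of the equation for q expresses D = z + z̄ through terms bounded by a small multiple of
  -- |D|, hence D = 0.
  have h4 : D = -(c * (δ * coeff 0 (mulC ρ Yq)) + D * (c * coeff 0 (mulC ρ₁ (mulC E Vs)))
      - c * coeff 0 (mulC ρ (mulC E (R q)))) := by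
    have hcC : (c : ℂ) ≠ 0 := by exact_mod_cast hc.ne'
    have e : (c : ℂ) * ((1 / c : ℝ) : ℂ) = 1 := by
      push_cast
      field_simp
    linear_combination (-(c : ℂ)) * h3 - D * e
  have b1 : ‖(c : ℂ) * (δ * coeff 0 (mulC ρ Yq))‖ ≤ 8 * ε * ‖Yq‖ := by
    rw [norm_mul, norm_mul, Complex.norm_real, Real.norm_of_nonneg hc.le]
    calc c * (‖δ‖ * ‖coeff 0 (mulC ρ Yq)‖) ≤ c * (4 * ε * (2 / c * ‖Yq‖)) := by
          gcongr
          exact (norm_coeff_le _ _).trans (hb _)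
      _ = _ := by field_simp; ring
  have b2 : ‖D * (c * coeff 0 (mulC ρ₁ (mulC E Vs)))‖ ≤ ‖D‖ * (1 / 50) := by
    rw [norm_mul, norm_mul, Complex.norm_real, Real.norm_of_nonneg hc.le]
    gcongr
    calc c * ‖coeff 0 (mulC ρ₁ (mulC E Vs))‖ ≤ c * (1 / (100 * c) * (10 / 9)) := by
          gcongr
          exact (norm_coeff_le _ _).trans ((hb1 _).trans (by gcongr))
      _ = c * (1 / (100 * c)) * (10 / 9) := by ring
      _ ≤ _ := by rw [hc5]; norm_num
  have b3 : ‖(c : ℂ) * coeff 0 (mulC ρ (mulC E (R q)))‖ ≤ 2 * ε * (‖Yq‖ + 2 * ‖D‖) := by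
    rw [norm_mul, Complex.norm_real, Real.norm_of_nonneg hc.le]
    calc c * ‖coeff 0 (mulC ρ (mulC E (R q)))‖ ≤ c * (2 / c * (ε * (‖Yq‖ + 2 * ‖D‖))) := by
          gcongr
          exact (norm_coeff_le _ _).trans ((hb _).trans (by gcongr))
      _ = _ := by field_simp
  have h5 : ‖D‖ ≤ 8 * ε * ‖Yq‖ + ‖D‖ * (1 / 50) + 2 * ε * (‖Yq‖ + 2 * ‖D‖) := by
    calc ‖D‖ = ‖-(c * (δ * coeff 0 (mulC ρ Yq)) + D * (c * coeff 0 (mulC ρ₁ (mulC E Vs)))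
      - c * coeff 0 (mulC ρ (mulC E (R q))))‖ := congrArg _ h4
      _ ≤ _ := by
        rw [norm_neg]
        exact (norm_sub_le _ _).trans (add_le_add ((norm_add_le _ _).trans (add_le_add b1 b2)) b3)
  have h6 : ε * ‖Yq‖ ≤ 3 / 100 * ‖D‖ := by
    calc ε * ‖Yq‖ ≤ ε * ((12 / c + 1 / 50) * ‖D‖) := by gcongr
      _ = (6 * (ε * (2 / c)) + ε / 50) * ‖D‖ := by ring
      _ ≤ _ := by gcongr; linarith
  have h7 : ε * ‖D‖ ≤ 1 / 1000 * ‖D‖ := by gcongr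
  have h8 : ‖D‖ = 0 := by linarith
  have h9 := norm_eq_zero.1 h8
  rw [hD, Complex.add_conj] at h9
  have : 2 * z.re = 0 := by exact_mod_cast h9
  linarith

/-! ### Assembling the spectrum -/

section

variable {k : ℝ} (hk : 0 < k)

/-- Eigenvalues of large modulus are purely imaginary. -/
theorem re_eq_zero_of_large (b : ℝ) {κ : ℝ} (hκ : 0 < κ) :
    ∃ M > 0, ∃ η₀ > 0, ∀ (c lam m : ℝ) (w : Profile) (z : ℂ) (f : L2), Function.Even w →
      C2Bound w m → |c - κ / (1 + k ^ 2)| ≤ η₀ → m ≤ η₀ → |lam| ≤ η₀ → M ≤ ‖z‖ →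
      coeff 0 f = 0 → f ≠ 0 →
      opHat hk b κ lam c w.onTorus w.dz.onTorus w.dz.dz.onTorus f = z • opS f → z.re = 0 := by
  set c₀ := κ / (1 + k ^ 2) with hc₀
  have hc₀p : 0 < c₀ := by positivity
  have hBr := boundRem_pos (k := k) b
  have hBh : 0 < boundHigh b κ k := by unfold boundHigh; positivity
  set ε := min (c₀ / 2000) (1 / 1000) with hε
  have hε0 : 0 < ε := by positivity
  have hε1 : ε ≤ c₀ / 2000 := min_le_left _ _
  have hε2 : ε ≤ 1 / 1000 := min_le_right _ _
  -- Beyond this modulus the κ-term is below half of ε; the bounds on m and λ control the other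
  -- half.
  refine ⟨κ * boundHigh b κ k / (ε / 2), by positivity,
    min (min (c₀ / 400) 1) (ε / (4 * boundRem b k)), by positivity, ?_⟩
  intro c lam m w z f he hm hc hm₀ hl hz hf0 hf hfz
  rw [le_min_iff, le_min_iff] at hc hm₀ hl
  obtain ⟨⟨hc1, -⟩, -⟩ := hc
  obtain ⟨⟨hm1, hm2⟩, hm3⟩ := hm₀
  obtain ⟨⟨-, hl2⟩, hl3⟩ := hl
  obtain ⟨hc2, hc3⟩ := abs_le.1 hc1
  have hcp : 0 < c := by linarith
  have hpert := isPert_opB hk b κ lam c he hm le_rfl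
  have hzM : |κ| * boundHigh b κ k ≤ ε / 2 * ‖z‖ := by
    rw [abs_of_pos hκ, mul_comm (ε / 2)]
    exact (div_le_iff₀ (by positivity)).1 hz
  have hz0 : z ≠ 0 := by
    intro h
    rw [h, norm_zero, mul_zero, abs_of_pos hκ] at hzM
    have : 0 < κ * boundHigh b κ k := by positivity
    linarith
  have hs : boundRem b k * (m + |lam|) ≤ ε / 2 := by
    rw [le_div_iff₀ (by positivity)] at hm3 hl3
    linarith
  have hcb : |c| ≤ 2 * |κ| / (1 + k ^ 2) := by
    rw [abs_of_pos hcp, abs_of_pos hκ, mul_div_assoc, ← hc₀]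
    linarith
  refine re_eq_zero_of_transport hcp hε0.le (by linarith) hε2 he
    (fun x => (hm x).1.trans (by linarith))
    (T := opHat hk b κ lam c w.onTorus w.dz.onTorus w.dz.dz.onTorus)
    (R := opRem hk b κ lam w) (fun f => opHat_eq_rem hk b κ lam c w f) (fun f _ => ?_)
    (fun f g hf h => norm_opRem_le_of_large hk b κ hm hm2 hl2 hcb hf h hzM hz0 hs) hf0 hf hfz
  rw [opHat_eq, opHat_eq, map_add, conjL_opTheta, hpert.conj]

theorem exists_eigen_of_mem_spectrum {b κ ℓ c : ℝ} {w : Profile} {z : ℂ} (hc : c ≠ 0)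
    (hw : ∀ x, c - w x ≠ 0) (hz : z ∈ unboundedSpectrum (opA hk b κ (-1) ℓ c w)) :
    ∃ f : L2, coeff 0 f = 0 ∧ f ≠ 0 ∧
      opHat hk b κ (ℓ ^ 2) c w.onTorus w.dz.onTorus w.dz.dz.onTorus f = z • opS f := by
  by_contra! h
  refine hz (inResolventSet_of_injective hk b κ ℓ c w z hc (fun x => ?_) fun f hf0 hf => ?_)
  · induction x using QuotientAddGroup.induction_on with
    | H x =>
      change (c : ℂ) - ((w x : ℝ) : ℂ) ≠ 0
      exact_mod_cast hw x
  · by_contra hne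
    exact h f hf0 hne hf

theorem opHat_eq_pertAt (b κ ℓ c : ℝ) (w : Profile) (f : L2) :
    opHat hk b κ (ℓ ^ 2) c w.onTorus w.dz.onTorus w.dz.dz.onTorus f
      = opTheta hk κ f + pertAt hk (opB hk b κ 0 c w) (ℓ ^ 2) f := by
  rw [opHat_eq, opB_eq_add_opN, pertAt_apply]

variable {b κ ℓ c K η lamS : ℝ} {w : Profile} {ψ rS : L2}

/-- The spectrum of the linearised operator when all eigenvalues off the imaginary axis are small. -/
theorem spectrum_dichotomy (hκ : 0 < κ) (hK1 : 1 ≤ K) (hK : 1 ≤ K * gap κ k)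
    (hη : η * (1024 * K ^ 2) ≤ 1) (hη' : 4096 * K ^ 3 * η ≤ symN k 1 ^ 2) (hη0 : 0 ≤ η)
    (hη8 : 8 * η ≤ 1) (hc : c ≠ 0) (hw : ∀ x, c - w x ≠ 0)
    (hψ : IsKer hk κ (opB hk b κ 0 c w) η ψ)
    (hB : IsPert (pertAt hk (opB hk b κ 0 c w) (ℓ ^ 2)) η) (hlam : |ℓ ^ 2| ≤ η)
    (hrS : NoLow rS) (hrS1 : ‖rS‖ ≤ 1)
    (hS : opTheta hk κ (sinV + rS) + pertAt hk (opB hk b κ 0 c w) lamS (sinV + rS) = 0)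
    (hsmall : ∀ (z : ℂ) (f : L2), coeff 0 f = 0 → f ≠ 0 →
      opTheta hk κ f + pertAt hk (opB hk b κ 0 c w) (ℓ ^ 2) f = z • opS f → z.re ≠ 0 →
      K * ‖z‖ ≤ 1 / 4) :
    (lamS < ℓ ^ 2 → ∀ z ∈ unboundedSpectrum (opA hk b κ (-1) ℓ c w), z.re = 0) ∧
    (ℓ ≠ 0 → ℓ ^ 2 < lamS → ∃ μ : ℝ, 0 < μ ∧
      IsSimpleEigenvalue (opA hk b κ (-1) ℓ c w) (μ : ℂ) ∧
      IsSimpleEigenvalue (opA hk b κ (-1) ℓ c w) (-μ : ℂ) ∧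
      ∀ z ∈ unboundedSpectrum (opA hk b κ (-1) ℓ c w),
        z.re = 0 ∨ z = (μ : ℂ) ∨ z = (-μ : ℂ)) := by
  have key : ∀ (z : ℂ) (f : L2), coeff 0 f = 0 → f ≠ 0 →
      opTheta hk κ f + pertAt hk (opB hk b κ 0 c w) (ℓ ^ 2) f = z • opS f → z.re ≠ 0 →
      ℓ ^ 2 ≠ 0 ∧ ∃ (ν : ℂ) (F ρ : L2) (t : ℂ),
        ScaledSol hk κ (opB hk b κ 0 c w) ψ (ℓ ^ 2) ν F ρ ∧ ‖ν‖ ≤ 1 ∧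
        z ^ 2 = ν * ((ℓ ^ 2 : ℝ) : ℂ) ∧ f = t • scaledVec (ℓ ^ 2) z ψ F ρ := by
    intro z f hf0 hf hfz hre
    have hz : z ≠ 0 := fun h => hre (by rw [h, Complex.zero_re])
    obtain ⟨h1, ν, F, ρ, t, h2, h3, h4, h5⟩ := exists_scaledSol_of_eigen hκ hK1 hK hη hη0 hψ hB hlam
      hz (hsmall z f hf0 hf hfz hre) hf0 hf hfz
    exact ⟨h1, ν, F, ρ, t, h2, h3.trans hη8, h4, h5⟩
  constructor
  · intro hlt z hz
    by_contra hre
    obtain ⟨f, hf0, hf, hfz⟩ := exists_eigen_of_mem_spectrum hk hc hw hz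
    rw [opHat_eq_pertAt] at hfz
    obtain ⟨hl, ν, F, ρ, t, h, hν, hz2, -⟩ := key z f hf0 hf hfz hre
    have hneg := (h.sign hκ hK1 hK hη hη' hη0 hψ hB hlam hν hrS hrS1 hS).1 hlt
    -- z² = νℓ² is real and Re z ≠ 0, so z is real and z² > 0, contradicting ν < 0.
    rw [h.conj_eq hκ hK1 hK hη hη0 hψ hB hlam hν, ← Complex.ofReal_mul, sq] at hz2
    have hr := congrArg Complex.re hz2
    have hi := congrArg Complex.im hz2
    rw [Complex.mul_re, Complex.ofReal_re] at hr
    rw [Complex.mul_im, Complex.ofReal_im] at hi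
    have him : z.im = 0 := by
      have : z.re * z.im = 0 := by linarith
      exact (mul_eq_zero.1 this).resolve_left hre
    rw [him, mul_zero, sub_zero] at hr
    have h1 : ν.re * ℓ ^ 2 ≤ 0 := mul_nonpos_of_nonpos_of_nonneg hneg.le (sq_nonneg _)
    have h2 : 0 < z.re * z.re := mul_self_pos.2 hre
    linarith
  · intro hℓ hlt
    have hl : 0 < ℓ ^ 2 := by positivity
    obtain ⟨ν, F, ρ, h, hν⟩ := exists_scaledSol hκ hK1 hK hη hη0 hψ hB hlam
    have hν1 := hν.trans hη8
    have hpos := (h.sign hκ hK1 hK hη hη' hη0 hψ hB hlam hν1 hrS hrS1 hS).2 hlt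
    have hreal := h.conj_eq hκ hK1 hK hη hη0 hψ hB hlam hν1
    have hμ0 : 0 < ν.re * ℓ ^ 2 := by positivity
    -- Here ν > 0, and the square roots of νℓ² are real. Uniqueness of ν excludes other eigenvalues
    -- off the axis, and uniqueness of (F, ρ) makes each eigenspace a line.
    set μ := Real.sqrt (ν.re * ℓ ^ 2) with hμ
    have hμp : 0 < μ := Real.sqrt_pos.2 hμ0
    have hμ2 : (μ : ℂ) ^ 2 = ν * ((ℓ ^ 2 : ℝ) : ℂ) := by
      rw [hreal, ← Complex.ofReal_mul, ← Complex.ofReal_pow, hμ, Real.sq_sqrt hμ0.le]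
    have hsimple : ∀ z : ℂ, z.re ≠ 0 → z ^ 2 = ν * ((ℓ ^ 2 : ℝ) : ℂ) →
        IsSimpleEigenvalue (opA hk b κ (-1) ℓ c w) z := by
      intro z hre hz
      have hz0 : z ≠ 0 := fun h => hre (by rw [h, Complex.zero_re])
      refine isSimpleEigenvalue_of_pencil hk b κ ℓ c w z (f := scaledVec (ℓ ^ 2) z ψ F ρ)
        (h.coeff_zero_vec hψ z) (fun h0 => ?_) ?_ (fun g hg0 hgz => ?_) (fun g hg0 => ?_)
      · have h1 := h.coeff_even_vec hψ z
        rw [h0, coeff_evenPart, map_zero, map_zero] at h1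
        have hlC : ((ℓ ^ 2 : ℝ) : ℂ) ≠ 0 := by exact_mod_cast hl.ne'
        have : z / ((ℓ ^ 2 : ℝ) : ℂ) * (1 / 2) ≠ 0 :=
          mul_ne_zero (div_ne_zero hz0 hlC) (by norm_num)
        exact this (by rw [← h1]; simp)
      · rw [opHat_eq_pertAt]
        exact h.eigen hψ hl.ne' hz
      · rw [opHat_eq_pertAt] at hgz
        by_cases hg : g = 0
        · exact ⟨0, by rw [hg, zero_smul]⟩
        obtain ⟨-, ν', F', ρ', t, h', hν', -, hgt⟩ := key z g hg0 hg hgz hre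
        obtain ⟨-, hF, hρ⟩ := h.unique hκ hK1 hK hη hη0 hψ hB hlam hν1 hν' h'
        exact ⟨t, by rw [hgt, hF, hρ]⟩
      · rw [opHat_eq_pertAt]
        exact h.not_generalised hκ hK1 hK hη hη0 hψ hB hlam hν1 hl.ne' hz hz0 hg0
    refine ⟨μ, hμp, hsimple _ (by rw [Complex.ofReal_re]; exact hμp.ne') hμ2, hsimple _
      (by rw [Complex.neg_re, Complex.ofReal_re]; exact (neg_neg_of_pos hμp).ne)
      (by rw [neg_sq, hμ2]), fun z hz => ?_⟩
    by_cases hre : z.re = 0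
    · exact Or.inl hre
    obtain ⟨f, hf0, hf, hfz⟩ := exists_eigen_of_mem_spectrum hk hc hw hz
    rw [opHat_eq_pertAt] at hfz
    obtain ⟨-, ν', F', ρ', t, h', hν', hz2, -⟩ := key z f hf0 hf hfz hre
    obtain ⟨hνν, -⟩ := h.unique hκ hK1 hK hη hη0 hψ hB hlam hν1 hν' h'
    rw [← hνν, ← hμ2] at hz2
    exact Or.inr (sq_eq_sq_iff_eq_or_eq_neg.1 hz2)

end

/-- Smallness conditions are put in the form Xε < Y, so that finitely many can be met by one ε. -/
theorem eventually_mul_lt (X : ℝ) {Y : ℝ} (hY : 0 < Y) :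
    ∀ᶠ ε in nhdsWithin (0 : ℝ) (Set.Ioi 0), X * ε < Y := by
  have h : Filter.Tendsto (fun ε : ℝ => X * ε) (nhds 0) (nhds (X * 0)) :=
    (continuous_const.mul continuous_id).tendsto 0
  rw [mul_zero] at h
  exact (h.mono_left nhdsWithin_le_nhds).eventually (gt_mem_nhds hY)

/-- The threshold of the transverse instability of small waves. -/
theorem exists_spectral_threshold (b : ℝ) {κ k : ℝ} (hκ : 0 < κ) (hk : 0 < k) :
    ∃ C > 0, ∀ᶠ ε in nhdsWithin (0 : ℝ) (Set.Ioi 0), ∀ (a c : ℝ) (w : Profile),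
      IsWave b κ k c w → w.amplitude = a → a ≠ 0 → |a| < ε → NearBifurcation ε κ k c w →
      ∃ lamS : ℝ, |lamS - ellASq b κ k a| ≤ C * a ^ 4 ∧ ∀ ℓ : ℝ, |ℓ| < ε →
        (lamS < ℓ ^ 2 → ∀ z ∈ unboundedSpectrum (opA hk b κ (-1) ℓ c w), z.re = 0) ∧
        (ℓ ≠ 0 → ℓ ^ 2 < lamS → ∃ μ : ℝ, 0 < μ ∧
          IsSimpleEigenvalue (opA hk b κ (-1) ℓ c w) (μ : ℂ) ∧
          IsSimpleEigenvalue (opA hk b κ (-1) ℓ c w) (-μ : ℂ) ∧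
          ∀ z ∈ unboundedSpectrum (opA hk b κ (-1) ℓ c w),
            z.re = 0 ∨ z = (μ : ℂ) ∨ z = (-μ : ℂ)) := by
  obtain ⟨ε₁, hε₁, C₁, hC₁, hwave⟩ := wave_estimates b hκ hk
  obtain ⟨M₀, hM₀, η₂, hη₂, hlarge⟩ := re_eq_zero_of_large hk b hκ
  have hg := gap_pos hκ hk
  have hn0 : 0 < symN k 1 := by rw [symN_one]; positivity
  have hLL := boundLL_pos b k
  set L := boundLL b k
  set K := max 1 (1 / gap κ k)
  have hK1 : 1 ≤ K := le_max_left _ _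
  have hK0 : 0 < K := by linarith
  have hK : 1 ≤ K * gap κ k := (div_le_iff₀ hg).1 (le_max_right _ _)
  -- `M₀` bounds the high-frequency region; below δ₀ the near-zero analysis applies, since then K|z|
  -- ≤ 1/4, and the annulus between is handled by the gap.
  set δ₀ := min (gap κ k / (4 * (1 + 2 * M₀ / gap κ k))) (1 / (4 * K))
  have hδ₀ : 0 < δ₀ := by positivity
  obtain ⟨η₃, hη₃, hbdd⟩ := re_eq_zero_of_bounded hk hκ hM₀.le hδ₀ (min_le_left _ _)
  obtain ⟨η, hη3, hη, hη', hη8, hηpos⟩ : ∃ η : ℝ, 1 * η < η₃ ∧ 1024 * K ^ 2 * η < 1 ∧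
      4096 * K ^ 3 * η < symN k 1 ^ 2 ∧ 8 * η < 1 ∧ η ∈ Set.Ioi (0 : ℝ) :=
    ((eventually_mul_lt 1 hη₃).and ((eventually_mul_lt (1024 * K ^ 2) one_pos).and
      ((eventually_mul_lt (4096 * K ^ 3) (by positivity)).and
        ((eventually_mul_lt 8 one_pos).and self_mem_nhdsWithin)))).exists
  replace hηpos : 0 < η := hηpos
  have hs : 0 ≤ ‖symG b k 2 (-1)‖ + ‖symG b k 1 (-2)‖ + ‖symG b k 1 (-1)‖ := by positivity
  have hq : 0 ≤ 4 * K * (C₁ + 2 * L) / symN k 1 := by positivity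
  have hg' : 0 < 1 / gap κ k := by positivity
  have hn' : 0 < 1 / symN k 1 := by positivity
  have hLC : 0 < L * C₁ := by positivity
  set M := C₁ + L + L * C₁ + (‖symG b k 2 (-1)‖ + ‖symG b k 1 (-2)‖ + ‖symG b k 1 (-1)‖) + 1
    + 1 / gap κ k + 1 / symN k 1 + 4 * K * (C₁ + 2 * L) / symN k 1 with hM
  have s1 := norm_nonneg (symG b k 2 (-1))
  have s2 := norm_nonneg (symG b k 1 (-2))
  have s3 := norm_nonneg (symG b k 1 (-1))
  have hM0 : 0 < M := by linarith
  refine ⟨400 * (M ^ 9 * (1 + gap κ k)), by positivity, ?_⟩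
  have hc₀ : 0 < κ / (1 + k ^ 2) := by positivity
  filter_upwards [eventually_mul_lt 1 one_pos, eventually_mul_lt 1 hε₁,
    eventually_mul_lt (C₁ + 2 * L + 1) hηpos, eventually_mul_lt (C₁ + 2) hη₂,
    eventually_mul_lt ((C₁ + 2 * L) * (64 * K ^ 2)) hn0, eventually_mul_lt M one_pos,
    eventually_mul_lt (C₁ + 2) hc₀, self_mem_nhdsWithin] with ε e1 e2 e3 e4 e5 e6 e7 hε
  replace hε : 0 < ε := hε
  rw [one_mul] at e1 e2
  intro a c w hW hamp ha haε hnear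
  obtain ⟨hbd, hC2, hcc⟩ := hwave a c w hW hamp ha (haε.trans e2)
    ⟨hnear.1.trans e2, fun z => ⟨(hnear.2 z).1.trans e2, (hnear.2 z).2.1.trans e2,
      (hnear.2 z).2.2.trans e2⟩⟩
  have ha0 := abs_nonneg a
  have ha2 : a ^ 2 ≤ |a| := by
    rw [← sq_abs, sq]
    exact mul_le_of_le_one_left ha0 (by linarith)
  have hCa : C₁ * a ^ 2 ≤ C₁ * |a| := by gcongr
  have hCε : C₁ * |a| ≤ C₁ * ε := by gcongr
  have hLε : L * |a| ≤ L * ε := by gcongr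
  have hψ := isKer_kerV hk hW hamp ha hC2 (η := η) (by nlinarith)
  -- The bound is taken proportional to |a|, not merely by η, so that the odd kernel vector is
  -- within O(a) of `sinV`, as the fourth-order location requires.
  have hB₀ : IsPert (opB hk b κ 0 c w) ((C₁ + 2 * L) * |a|) :=
    isPert_opB hk b κ 0 c hW.even hbd (by rw [abs_zero]; linarith)
  have haM : M * |a| ≤ 1 := by
    have : M * |a| ≤ M * ε := by gcongr
    linarith
  obtain ⟨lamS, rS, hrS, -, hrSn, -, hS⟩ := exists_threshold hκ hK1 hK (by
    calc (C₁ + 2 * L) * |a| * (64 * K ^ 2) ≤ (C₁ + 2 * L) * ε * (64 * K ^ 2) := by gcongr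
      _ = (C₁ + 2 * L) * (64 * K ^ 2) * ε := by ring
      _ ≤ _ := e5.le) (by positivity) hB₀
  have hrSM : ‖rS‖ ≤ M * |a| := by
    refine hrSn.trans ?_
    calc 4 * K * ((C₁ + 2 * L) * |a|) / symN k 1 = 4 * K * (C₁ + 2 * L) / symN k 1 * |a| := by ring
      _ ≤ M * |a| := by gcongr; linarith
  refine ⟨lamS, threshold_sub_ellASq hk hκ hW hamp ha hC2 hcc (M := M) (by linarith) (by linarith)
    (by linarith) (by linarith) (by linarith) (by linarith) (by linarith)
    ((div_le_iff₀ hg).1 (by linarith)) ((div_le_iff₀ hn0).1 (by linarith)) haM hψ hrS hrSM hS, ?_⟩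
  intro ℓ hℓ
  have hℓ2 : |ℓ ^ 2| ≤ ε := by
    rw [abs_of_nonneg (sq_nonneg ℓ), ← sq_abs, sq]
    calc |ℓ| * |ℓ| ≤ 1 * |ℓ| := by gcongr; linarith
      _ ≤ ε := by linarith
  have hpert : IsPert (opB hk b κ (ℓ ^ 2) c w) η :=
    isPert_opB hk b κ (ℓ ^ 2) c hW.even hbd (by linarith)
  have hBeq : pertAt hk (opB hk b κ 0 c w) (ℓ ^ 2) = opB hk b κ (ℓ ^ 2) c w := by
    ext1 f
    rw [pertAt_apply, ← opB_eq_add_opN]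
  have hL0 : 0 ≤ L * ε := by positivity
  have hC0 : 0 ≤ C₁ * ε := by positivity
  have hcabs := abs_le.1 hcc
  refine spectrum_dichotomy hk hκ hK1 hK (by linarith) hη'.le hηpos.le hη8.le (by linarith)
    (fun x => ?_) hψ (hBeq ▸ hpert) (by linarith) hrS (hrSM.trans haM) hS
    fun z f hf0 hf hfz hre => ?_
  · have := abs_le.1 (hbd x).1
    exact ne_of_gt (by linarith)
  · by_contra hbig
    apply hre
    have hz : δ₀ ≤ ‖z‖ := by
      refine (min_le_right _ _).trans ?_
      rw [div_le_iff₀ (by positivity)]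
      linarith
    rcases le_total ‖z‖ M₀ with hzM | hzM
    · exact hbdd _ η (by linarith) (hBeq ▸ hpert) z f hz hzM hf0 hf hfz
    · refine hlarge c (ℓ ^ 2) (2 * |a|) w z f hW.even hbd (by linarith) (by linarith) (by linarith)
        hzM hf0 hf ?_
      rw [opHat_eq_pertAt, hfz]

end

end BKP

theorem theorem4p1 (b κ k : ℝ) (hκ : 0 < κ) (hk : 0 < k) :
    ∃ ε > 0, ∃ C > 0, ∀ (a c : ℝ) (w : BKP.Profile),
      BKP.IsWave b κ k c w → w.amplitude = a → |a| < ε → BKP.NearBifurcation ε κ k c w →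
      (0 < BKP.ellASq b κ k a →
        ∃ ellStarSq : ℝ, 0 < ellStarSq ∧ |ellStarSq - BKP.ellASq b κ k a| ≤ C * a ^ 4 ∧
          ∀ ℓ : ℝ, |ℓ| < ε →
            (ellStarSq < ℓ ^ 2 →
              ∀ z ∈ BKP.unboundedSpectrum (BKP.opA hk b κ (-1) ℓ c w), z.re = 0) ∧
            (ℓ ≠ 0 → ℓ ^ 2 < ellStarSq →
              ∃ μ : ℝ, 0 < μ ∧
                BKP.IsSimpleEigenvalue (BKP.opA hk b κ (-1) ℓ c w) (μ : ℂ) ∧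
                BKP.IsSimpleEigenvalue (BKP.opA hk b κ (-1) ℓ c w) (-μ : ℂ) ∧
                ∀ z ∈ BKP.unboundedSpectrum (BKP.opA hk b κ (-1) ℓ c w),
                  z.re = 0 ∨ z = (μ : ℂ) ∨ z = (-μ : ℂ))) ∧
      (BKP.ellASq b κ k a < 0 →
        ∀ ℓ : ℝ, |ℓ| < ε →
          ∀ z ∈ BKP.unboundedSpectrum (BKP.opA hk b κ (-1) ℓ c w), z.re = 0) := by
  obtain ⟨C, hC, hev⟩ := BKP.exists_spectral_threshold b hκ hk
  set A := ((b + 1) + (7 - 2 * b) * k ^ 2) * ((b + 1) * (1 + k ^ 2) ^ 2 / (12 * κ * k ^ 2)) with hA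
  have hell : ∀ a, BKP.ellASq b κ k a = A * a ^ 2 := fun a => rfl
  -- If the coefficient vanishes, `ellASq` is zero for every amplitude and neither case occurs.
  by_cases hA0 : A = 0
  · refine ⟨1, one_pos, C, hC, fun a c w _ _ _ _ => ?_⟩
    rw [hell, hA0, zero_mul]
    exact ⟨fun h => absurd h (lt_irrefl 0), fun h => absurd h (lt_irrefl 0)⟩
  obtain ⟨ε, h, h1, hCA, hε⟩ := (hev.and ((BKP.eventually_mul_lt 1 one_pos).and
    ((BKP.eventually_mul_lt C (abs_pos.2 hA0)).and self_mem_nhdsWithin))).exists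
  replace hε : 0 < ε := hε
  refine ⟨ε, hε, C, hC, fun a c w hW hamp haε hnear => ?_⟩
  rcases eq_or_ne a 0 with rfl | ha
  · rw [hell]
    simp
  obtain ⟨lamS, hclose, hspec⟩ := h a c w hW hamp ha haε hnear
  have ha2 : 0 < a ^ 2 := by positivity
  -- The error is smaller than |ℓ_a²|, so the threshold has the sign of ℓ_a². When it is negative,
  -- every real ℓ lies above it, including ℓ = 0.
  have hsmall : C * a ^ 4 < |A| * a ^ 2 := by
    have h2 : a ^ 2 ≤ ε := by
      rw [← sq_abs, sq]
      nlinarith [abs_nonneg a]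
    calc C * a ^ 4 = C * a ^ 2 * a ^ 2 := by ring
      _ ≤ C * ε * a ^ 2 := by gcongr
      _ < |A| * a ^ 2 := by gcongr
  have hab := abs_le.1 hclose
  rw [hell] at hab
  constructor
  · intro hpos
    rw [hell] at hpos
    have hAp : 0 < A := pos_of_mul_pos_left hpos ha2.le
    rw [abs_of_pos hAp] at hsmall
    exact ⟨lamS, by linarith, hclose, hspec⟩
  · intro hneg ℓ hℓ
    rw [hell] at hneg
    have hAn : A < 0 := by
      by_contra hle
      exact absurd hneg (not_lt.2 (mul_nonneg (not_lt.1 hle) ha2.le))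
    rw [abs_of_neg hAn] at hsmall
    exact (hspec ℓ hℓ).1 (by linarith [sq_nonneg ℓ])
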